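/- There are a randomized algorithm and absolute constants $c>0$, $C$, $K$ such that the following holds. Let $G=(V,E)$ be a finite simple graph with $n$ vertices, $m$ edges and maximum degree $\Delta$. Let $\chi$ be a partial $(\Delta+1)$-edge coloring of $G$, that is, a map $\chi:E\to\{1,\dots,\Delta+1\}\cup\{\bot\}$ such that two distinct edges with a common endpoint never get the same color from $\{1,\dots,\Delta+1\}$; edges with $\chi(e)=\bot$ are called uncolored. Let $U^\star\subseteq V$, and let $1\le d\le\Delta+1$ be an integer such that for every $u\in U^\star$ at least $d$ of the $\Delta+1$ colors are missing at $u$, i.e. are not used by $\chi$ on any edge at $u$ (if $U^\star\neq\emptyset$, the bound $d\le\Delta+1$ is automatic). Let $\lambda$ be the number of uncolored edges that have at least one endpoint in $U^\star$. Given $(G,\chi,U^\star)$ (but not $d$), the algorithm outputs a partial $(\Delta+1)$-edge coloring $\chi'$ of $G$ such that every edge colored by $\chi$ is also colored by $\chi'$ (possibly with a different color), and at least $c\lambda$ of the $\lambda$ edges that have an endpoint in $U^\star$ and are uncolored by $\chi$ are colored by $\chi'$. Its expected running time is $\tilde O(\lambda\Delta+\Delta m/d)$; precisely, it is at most $C\,(\log(n+2))^{K}\,(\lambda\Delta+\Delta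 m/d+1)$. Here the algorithm is a program for a randomized random access machine with logarithmic cost (each elementary operation is charged according to the bit lengths of the numbers involved; an integer can be drawn uniformly at random from $\{0,\dots,e\}$). The vertices are $0,\dots,n-1$, the input is given as an array of the edges in arbitrary order, each with its two endpoints and its color, together with the characteristic vector of $U^\star$, and unused memory is $0$; the output overwrites the colors. -/

import Mathlib

/-! ## A randomized random access machine with logarithmic cost

A program is a finite structured text over integer registers, integer arrays (random access memory)
and a source of uniformly random integers.  Every memory cell holds a natural number.  Each elementary
operation is charged according to the bit lengths (`Nat.size`) of the numbers it handles, so large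
numbers cannot be used to obtain computation for free. -/

namespace RandRAM

/-- Arithmetic operations and tests. Tests return `1` for true and `0` for false. -/
inductive Op where
  | add | sub | mul | div | mod | lt | eq

/-- The value of an operation. Subtraction is truncated, division rounds down. -/
def Op.eval : Op → ℕ → ℕ → ℕ
  | .add, a, b => a + b
  | .sub, a, b => a - b
  | .mul, a, b => a * b
  | .div, a, b => a / b
  | .mod, a, b => a % b
  | .lt, a, b => if a < b then 1 else 0
  | .eq, a, b => if a = b then 1 else 0

/-- The memory: registers `reg x`, and arrays `arr a` with cells `arr a i`. A program mentions only
finitely many register names `x` and array names `a`; the index `i` is computed at run time. -/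
structure Mem where
  reg : ℕ → ℕ
  arr : ℕ → ℕ → ℕ

/-- Write `v` into register `x`. -/
def Mem.setReg (σ : Mem) (x v : ℕ) : Mem :=
  { σ with reg := Function.update σ.reg x v }

/-- Write `v` into cell `i` of array `a`. -/
def Mem.setArr (σ : Mem) (a i v : ℕ) : Mem :=
  { σ with arr := Function.update σ.arr a (Function.update (σ.arr a) i v) }

/-- Expressions: constants, registers, array cells `a[i]`, and operations. -/
inductive Expr where
  | lit (k : ℕ)
  | reg (x : ℕ)
  | get (a : ℕ) (i : Expr)
  | bin (op : Op) (e f : Expr)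

/-- The value of an expression. -/
def Expr.eval (σ : Mem) : Expr → ℕ
  | .lit k => k
  | .reg x => σ.reg x
  | .get a i => σ.arr a (i.eval σ)
  | .bin op e f => op.eval (e.eval σ) (f.eval σ)

/-- The cost of evaluating an expression: reading a number costs one plus its bit length (the address
of an array cell has to be computed, and paid for, as well), and an operation on numbers with `s` and
`t` bits costs `(1 + s) * (1 + t)`, enough for the schoolbook algorithms. -/
def Expr.cost (σ : Mem) : Expr → ℕ
  | .lit k => 1 + k.size
  | .reg x => 1 + (σ.reg x).size
  | .get a i => i.cost σ + (1 + (σ.arr a (i.eval σ)).size)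
  | .bin _ e f => e.cost σ + f.cost σ + (1 + (e.eval σ).size) * (1 + (f.eval σ).size)

/-- Programs. A condition holds if its value is nonzero. -/
inductive Prog where
  | skip
  /-- `x := e` -/
  | assign (x : ℕ) (e : Expr)
  /-- `a[i] := e` -/
  | store (a : ℕ) (i e : Expr)
  /-- `x :=` a fresh uniformly random element of `{0, 1, …, e}` -/
  | sample (x : ℕ) (e : Expr)
  /-- `p; q` -/
  | seq (p q : Prog)
  /-- `if e then p else q` -/
  | branch (e : Expr) (p q : Prog)
  /-- `while e do p` -/
  | loop (e : Expr) (p : Prog)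

/-- A configuration: the list of the program pieces still to be executed, and the memory. -/
abbrev Config := List Prog × Mem

/-- One step of the computation, as a probability distribution on the next configuration.
A configuration with nothing left to execute has halted. -/
noncomputable def step : Config → PMF Config
  | ([], σ) => PMF.pure ([], σ)
  | (.skip :: K, σ) => PMF.pure (K, σ)
  | (.assign x e :: K, σ) => PMF.pure (K, σ.setReg x (e.eval σ))
  | (.store a i e :: K, σ) => PMF.pure (K, σ.setArr a (i.eval σ) (e.eval σ))
  | (.sample x e :: K, σ) =>
      (PMF.uniformOfFintype (Fin (e.eval σ + 1))).map
        fun r : Fin (e.eval σ + 1) => (K, σ.setReg x r.val)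
  | (.seq p q :: K, σ) => PMF.pure (p :: q :: K, σ)
  | (.branch e p q :: K, σ) => PMF.pure ((if e.eval σ ≠ 0 then p else q) :: K, σ)
  | (.loop e p :: K, σ) => PMF.pure (if e.eval σ ≠ 0 then p :: .loop e p :: K else K, σ)

/-- The cost of the next step. It is at least `1` unless the computation has halted. -/
def stepCost : Config → ℕ
  | ([], _) => 0
  | (.skip :: _, _) => 1
  | (.assign _ e :: _, σ) => 1 + e.cost σ
  | (.store _ i e :: _, σ) => 1 + i.cost σ + e.cost σ
  | (.sample _ e :: _, σ) => 1 + e.cost σ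
  | (.seq _ _ :: _, _) => 1
  | (.branch e _ _ :: _, σ) => 1 + e.cost σ
  | (.loop e _ :: _, σ) => 1 + e.cost σ

/-- The expected total cost of the first `t` steps. -/
noncomputable def expectedCost : ℕ → Config → ENNReal
  | 0, _ => 0
  | t + 1, c => stepCost c + ∑' c', step c c' * expectedCost t c'

/-- The expected running time of program `P` started on memory `σ`: the expected total cost of all
steps. As every step before halting costs at least `1`, it is finite only if `P` halts with
probability `1`. -/
noncomputable def expectedTime (P : Prog) (σ : Mem) : ENNReal :=
  ⨆ t, expectedCost t ([P], σ)

/-- `σ'` is a possible final memory of `P` started on `σ`: the halted configuration with memory `σ'`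
is reached by finitely many steps of positive probability. -/
def PossibleOutput (P : Prog) (σ σ' : Mem) : Prop :=
  Relation.ReflTransGen (fun c c' => c' ∈ (step c).support) ([P], σ) ([], σ')

end RandRAM

/-! ## Partial edge colorings -/

/-- A partial (proper) edge coloring of `G` with `k` colors: every edge gets a color or is uncolored
(`none`), and different colored edges with a common endpoint get different colors. -/
structure PartialEdgeColoring {V : Type*} (G : SimpleGraph V) (k : ℕ) where
  color : G.edgeSet → Option (Fin k)
  proper : ∀ e f : G.edgeSet, e ≠ f → (∃ v, v ∈ e.1 ∧ v ∈ f.1) →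
    color e ≠ none → color e ≠ color f

namespace PartialEdgeColoring

variable {V : Type*} {G : SimpleGraph V} {k : ℕ}

/-- The set of colors missing at `v`, i.e. not used on any edge at `v`. -/
def miss (χ : PartialEdgeColoring G k) (v : V) : Set (Fin k) :=
  {c | ∀ e : G.edgeSet, v ∈ e.1 → χ.color e ≠ some c}

/-- The uncolored edges incident on `U`, i.e. with at least one endpoint in `U`. -/
def uncoloredAt (χ : PartialEdgeColoring G k) (U : Set V) : Set G.edgeSet :=
  {e | χ.color e = none ∧ ∃ v ∈ U, v ∈ e.1}

/-- `χ'` extends `χ`: every edge colored by `χ` is also colored by `χ'`, possibly with another color. -/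
def ExtendedBy (χ χ' : PartialEdgeColoring G k) : Prop :=
  ∀ e, χ.color e ≠ none → χ'.color e ≠ none

end PartialEdgeColoring

/-! ## Input and output format -/

/-- A list of all edges of `G`, each exactly once, in an arbitrary order and with the two endpoints of
each edge in an arbitrary order. -/
structure EdgeList {n : ℕ} (G : SimpleGraph (Fin n)) [DecidableRel G.Adj] where
  dart : Fin G.edgeFinset.card → G.Dart
  bijective : Function.Bijective fun i => (⟨(dart i).edge, (dart i).edge_mem⟩ : G.edgeSet)

namespace EdgeList

variable {n k : ℕ} {G : SimpleGraph (Fin n)} [DecidableRel G.Adj]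

/-- The `i`-th edge of the list. -/
def edge (L : EdgeList G) (i : Fin G.edgeFinset.card) : G.edgeSet :=
  ⟨(L.dart i).edge, (L.dart i).edge_mem⟩

end EdgeList

/-- The number that stands for a color: `0` for uncolored, `c + 1` for the color `c`. -/
def colorCode {k : ℕ} : Option (Fin k) → ℕ
  | none => 0
  | some c => c + 1

open Classical in
/-- The input `(G, χ, U)` in memory. Registers `0` and `1` hold the numbers of vertices and of edges,
arrays `0` and `1` hold the endpoints of the edges, array `2` holds the colors of the edges, and array
`3` is the characteristic vector of `U`. All other cells are `0`. -/
noncomputable def inputMem {n k : ℕ} {G : SimpleGraph (Fin n)} [DecidableRel G.Adj]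
    (L : EdgeList G) (χ : PartialEdgeColoring G k) (U : Set (Fin n)) : RandRAM.Mem where
  reg x := if x = 0 then n else if x = 1 then G.edgeFinset.card else 0
  arr a i :=
    if a = 0 then (if h : i < G.edgeFinset.card then ((L.dart ⟨i, h⟩).fst : ℕ) else 0)
    else if a = 1 then (if h : i < G.edgeFinset.card then ((L.dart ⟨i, h⟩).snd : ℕ) else 0)
    else if a = 2 then
      (if h : i < G.edgeFinset.card then colorCode (χ.color (L.edge ⟨i, h⟩)) else 0)
    else if a = 3 then (if h : i < n then (if (⟨i, h⟩ : Fin n) ∈ U then 1 else 0) else 0)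
    else 0

/-- Memory `σ` holds the coloring `χ`: array `2` contains the color of the `i`-th edge in cell `i`. -/
def HoldsColoring {n k : ℕ} {G : SimpleGraph (Fin n)} [DecidableRel G.Adj]
    (L : EdgeList G) (σ : RandRAM.Mem) (χ : PartialEdgeColoring G k) : Prop :=
  ∀ i : Fin G.edgeFinset.card, σ.arr 2 i = colorCode (χ.color (L.edge i))

/-!
The algorithm is a randomized form of the Vizing chain argument that treats all uncolored edges with the same
center at once.

**State.** Every edge that is to be colored becomes a *token*: one end in `U` is its center, the other end is
its leaf, and a color that is missing at the leaf is reserved there for it, in such a way that no color is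
reserved twice at the same vertex, and that every vertex keeps one more free color. Both facts are expressed by a
labeling of half-edges (`Lay`, `Core`, `Inv`): a colored edge has its color on both halves, a token has its reserved
color on its leaf half only, and the labels at a vertex are distinct. As there are more colors than half-edges
at a vertex, a free color always exists.

**One iteration** chooses a random token `h` and a random color `α` missing at its center `u`. A token can walk
around its center: if its label `c` is used at `u` on an edge `e`, it takes over the color `c` from `e`, and
the uncolored edge `e` is the new position of the token (`Inv.shift`). The possibilities are as follows.

* Another token at `u` has the same label `c`. Exchanging `α` and `c` on the path from the leaf of `h` makes
  the label of one of the two tokens missing at `u` (`Flipped.fan`), and its edge can be colored (`Inv.paint`).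
* No other token at `u` has the label `c`. All tokens at `u` with labels of their own walk virtually, and mark the
  colors they visit. If one gets to a color missing at `u`, its edge can be colored. If a walk meets another one, or
  a label shared by several tokens, the tokens go to the color where they meet, so that a class of tokens with
  the same center and label joins another one.
* Otherwise all walks run into disjoint loops. Exchanging a color of the loop of `h` with `α` on the path from
  `u` opens the loop (`Flipped.loop`), and the edge of `h` can be colored.

Each possibility decreases the potential `pot`, seven times the number of tokens plus the number of their
classes (`actP_spec`), so there are at most eight iterations for each initial token. As the loop ends only when all
tokens are gone, all selected edges get colored, whatever the random choices are (`mainP_ensures`).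

**Expected time.** Apart from flipping a path, an iteration takes `O(K)` steps, where `K = Δ + 1` is the number of
colors. For fixed colors `p`, `q`, the paths that start at vertices without `q`, alternating between `p` and `q`,
share no half-edges, so the total length of all alternating paths over all pairs of colors is at most
`4 m K` (`Core.sum_plen_total`). The flipped path determines the pair `(h, α)`; with at least `φ / 8` tokens
when the potential is `φ`, and at least `d / 2` missing colors at every center, the expected length
is at most `128 m K / (φ d)` (`sum_flipLen`, `mainP_cost`). Summation over `φ` gives a logarithm.

**Selection.** While edges are being colored, the colors missing at the centers become fewer. To keep `d / 2` of
them, only some of the uncolored edges at `U` are selected: at most one half of those at each vertex of `U`,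
rounded up, but one third of all of them (`Sel`, `selectP_spec`, `Sel.live_le`).

**Logarithmic cost.** Every step of the program enlarges the numbers in memory by at most `2` (`Runs.bdd`). So all
numbers are polynomial in `n`, and every step costs `O(log² n)` (`Expr.cost_le`, `Runs.expectedCost_le`).
-/

set_option autoImplicit false

/-! ### Deterministic execution with step counts -/

namespace RandRAM

instance (k : ℕ) : OfNat Expr k := ⟨.lit k⟩
instance : Add Expr := ⟨.bin .add⟩
instance : Sub Expr := ⟨.bin .sub⟩
instance : Mul Expr := ⟨.bin .mul⟩
instance : Mod Expr := ⟨.bin .mod⟩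

section Eval
variable (σ : Mem) (e f : Expr)

@[simp] theorem eval_lit (k : ℕ) : (Expr.lit k).eval σ = k := rfl
@[simp] theorem eval_reg (x : ℕ) : (Expr.reg x).eval σ = σ.reg x := rfl
@[simp] theorem eval_get (a : ℕ) : (Expr.get a e).eval σ = σ.arr a (e.eval σ) := rfl
@[simp] theorem eval_add : (e + f).eval σ = e.eval σ + f.eval σ := rfl
@[simp] theorem eval_sub : (e - f).eval σ = e.eval σ - f.eval σ := rfl
@[simp] theorem eval_mul : (e * f).eval σ = e.eval σ * f.eval σ := rfl
@[simp] theorem eval_mod : (e % f).eval σ = e.eval σ % f.eval σ := rfl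
@[simp] theorem eval_lt :
    (Expr.bin .lt e f).eval σ = if e.eval σ < f.eval σ then 1 else 0 := rfl
@[simp] theorem eval_eq :
    (Expr.bin .eq e f).eval σ = if e.eval σ = f.eval σ then 1 else 0 := rfl

end Eval

section MemLemmas
variable (σ : Mem) (x y v a b i : ℕ)

@[simp] theorem setReg_reg : (σ.setReg x v).reg y = if y = x then v else σ.reg y := by
  simp [Mem.setReg, Function.update_apply]
@[simp] theorem setReg_arr : (σ.setReg x v).arr = σ.arr := rfl
@[simp] theorem setArr_reg : (σ.setArr a i v).reg = σ.reg := rfl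
@[simp] theorem setArr_arr : (σ.setArr a i v).arr b =
    if b = a then Function.update (σ.arr a) i v else σ.arr b := by
  unfold Mem.setArr
  by_cases h : b = a
  · subst h; simp
  · simp [h]

end MemLemmas

/-- Deterministic execution: `P`, started on `σ`, halts after exactly `t` steps with memory `σ'`, without
drawing a random number. -/
inductive Runs : Prog → Mem → ℕ → Mem → Prop
  | skip (σ : Mem) : Runs .skip σ 1 σ
  | assign (x : ℕ) (e : Expr) (σ : Mem) : Runs (.assign x e) σ 1 (σ.setReg x (e.eval σ))
  | store (a : ℕ) (i e : Expr) (σ : Mem) :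
      Runs (.store a i e) σ 1 (σ.setArr a (i.eval σ) (e.eval σ))
  | seq {p q : Prog} {σ σ' σ'' : Mem} {t t' : ℕ} :
      Runs p σ t σ' → Runs q σ' t' σ'' → Runs (.seq p q) σ (t + t' + 1) σ''
  | branch_pos {e : Expr} {p q : Prog} {σ σ' : Mem} {t : ℕ} :
      e.eval σ ≠ 0 → Runs p σ t σ' → Runs (.branch e p q) σ (t + 1) σ'
  | branch_neg {e : Expr} {p q : Prog} {σ σ' : Mem} {t : ℕ} :
      e.eval σ = 0 → Runs q σ t σ' → Runs (.branch e p q) σ (t + 1) σ'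
  | loop_pos {e : Expr} {p : Prog} {σ σ' σ'' : Mem} {t t' : ℕ} :
      e.eval σ ≠ 0 → Runs p σ t σ' → Runs (.loop e p) σ' t' σ'' →
      Runs (.loop e p) σ (t + t' + 1) σ''
  | loop_neg {e : Expr} {p : Prog} {σ : Mem} :
      e.eval σ = 0 → Runs (.loop e p) σ 1 σ

/-- Effect of a program without loops and sampling. -/
def Prog.exec : Prog → Mem → Mem
  | .skip, σ => σ
  | .assign x e, σ => σ.setReg x (e.eval σ)
  | .store a i e, σ => σ.setArr a (i.eval σ) (e.eval σ)
  | .sample _ _, σ => σ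
  | .seq p q, σ => q.exec (p.exec σ)
  | .branch e p q, σ => if e.eval σ ≠ 0 then p.exec σ else q.exec σ
  | .loop _ _, σ => σ

/-- Whether a program is free of loops and sampling. -/
def Prog.straight : Prog → Bool
  | .skip | .assign _ _ | .store _ _ _ => true
  | .sample _ _ | .loop _ _ => false
  | .seq p q | .branch _ p q => p.straight && q.straight

/-- A bound on the number of steps of a program without loops. -/
def Prog.len : Prog → ℕ
  | .seq p q | .branch _ p q => p.len + q.len + 1
  | _ => 1

theorem runs_exec : ∀ (P : Prog) (σ : Mem), P.straight = true →
    ∃ t, t ≤ P.len ∧ Runs P σ t (P.exec σ)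
  | .skip, σ, _ => ⟨1, le_rfl, .skip σ⟩
  | .assign x e, σ, _ => ⟨1, le_rfl, .assign x e σ⟩
  | .store a i e, σ, _ => ⟨1, le_rfl, .store a i e σ⟩
  | .sample _ _, _, h => by simp [Prog.straight] at h
  | .loop _ _, _, h => by simp [Prog.straight] at h
  | .seq p q, σ, h => by
      simp only [Prog.straight, Bool.and_eq_true] at h
      obtain ⟨t, ht, r⟩ := runs_exec p σ h.1
      obtain ⟨t', ht', r'⟩ := runs_exec q (p.exec σ) h.2
      exact ⟨_, by simp only [Prog.len]; omega, r.seq r'⟩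
  | .branch e p q, σ, h => by
      simp only [Prog.straight, Bool.and_eq_true] at h
      by_cases c : e.eval σ = 0
      · obtain ⟨t, ht, r⟩ := runs_exec q σ h.2
        refine ⟨t + 1, by simp only [Prog.len]; omega, ?_⟩
        simpa [Prog.exec, c] using Runs.branch_neg (p := p) c r
      · obtain ⟨t, ht, r⟩ := runs_exec p σ h.1
        refine ⟨t + 1, by simp only [Prog.len]; omega, ?_⟩
        simpa [Prog.exec, c] using Runs.branch_pos (q := q) c r

/-- Amortized rule for loops: the measure `μ` pays for all steps. -/
theorem runs_loop {e : Expr} {p : Prog} (I : Mem → Prop) (μ : Mem → ℕ)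
    (body : ∀ σ, I σ → e.eval σ ≠ 0 → ∃ t σ', Runs p σ t σ' ∧ I σ' ∧ μ σ' + t + 1 ≤ μ σ)
    (σ : Mem) (h : I σ) :
    ∃ t σ', Runs (.loop e p) σ t σ' ∧ t + μ σ' ≤ μ σ + 1 ∧ I σ' ∧ e.eval σ' = 0 := by
  generalize hn : μ σ = n
  induction n using Nat.strong_induction_on generalizing σ with
  | _ n ih =>
    by_cases c : e.eval σ = 0
    · exact ⟨1, σ, .loop_neg c, by omega, h, c⟩
    · obtain ⟨t, σ', r, h', hμ⟩ := body σ h c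
      obtain ⟨t', σ'', r', ht', h'', c'⟩ := ih (μ σ') (by omega) σ' h' rfl
      exact ⟨_, σ'', .loop_pos c r r', by omega, h'', c'⟩

/-- Whether a program may write array `a`. -/
def Prog.writesArr (a : ℕ) : Prog → Bool
  | .skip | .assign _ _ | .sample _ _ => false
  | .store b _ _ => a == b
  | .seq p q | .branch _ p q => p.writesArr a || q.writesArr a
  | .loop _ p => p.writesArr a

/-- Whether a program may write register `x`. -/
def Prog.writesReg (x : ℕ) : Prog → Bool
  | .skip | .store _ _ _ => false
  | .assign y _ | .sample y _ => x == y
  | .seq p q | .branch _ p q => p.writesReg x || q.writesReg x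
  | .loop _ p => p.writesReg x

/-- A run leaves an array unchanged if the program text does not write it. -/
theorem Runs.arr_eq {P : Prog} {σ σ' : Mem} {t : ℕ} (r : Runs P σ t σ') (a : ℕ)
    (h : P.writesArr a = false) : σ'.arr a = σ.arr a := by
  induction r with
  | skip | assign | loop_neg => simp
  | store b i e σ =>
    simp only [Prog.writesArr, beq_eq_false_iff_ne] at h
    simp [h]
  | seq _ _ ih ih' =>
    simp only [Prog.writesArr, Bool.or_eq_false_iff] at h
    rw [ih' h.2, ih h.1]
  | branch_pos _ _ ih =>
    simp only [Prog.writesArr, Bool.or_eq_false_iff] at h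
    exact ih h.1
  | branch_neg _ _ ih =>
    simp only [Prog.writesArr, Bool.or_eq_false_iff] at h
    exact ih h.2
  | loop_pos _ _ _ ih ih' =>
    rw [ih' h, ih (by simpa [Prog.writesArr] using h)]

theorem Runs.reg_eq {P : Prog} {σ σ' : Mem} {t : ℕ} (r : Runs P σ t σ') (x : ℕ)
    (h : P.writesReg x = false) : σ'.reg x = σ.reg x := by
  induction r with
  | skip | store | loop_neg => simp
  | assign y e σ =>
    simp only [Prog.writesReg, beq_eq_false_iff_ne] at h
    simp [h]
  | seq _ _ ih ih' =>
    simp only [Prog.writesReg, Bool.or_eq_false_iff] at h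
    rw [ih' h.2, ih h.1]
  | branch_pos _ _ ih =>
    simp only [Prog.writesReg, Bool.or_eq_false_iff] at h
    exact ih h.1
  | branch_neg _ _ ih =>
    simp only [Prog.writesReg, Bool.or_eq_false_iff] at h
    exact ih h.2
  | loop_pos _ _ _ ih ih' =>
    rw [ih' h, ih (by simpa [Prog.writesReg] using h)]

/-! ### Growth of the numbers in memory, and the cost of a step -/

/-- All memory cells hold numbers at most `B`. -/
def Mem.Bdd (σ : Mem) (B : ℕ) : Prop :=
  (∀ x, σ.reg x ≤ B) ∧ ∀ a i, σ.arr a i ≤ B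

theorem Mem.Bdd.mono {σ : Mem} {B B' : ℕ} (h : σ.Bdd B) (hB : B ≤ B') : σ.Bdd B' :=
  ⟨fun x => (h.1 x).trans hB, fun a i => (h.2 a i).trans hB⟩

theorem Mem.Bdd.setReg {σ : Mem} {B : ℕ} (h : σ.Bdd B) (x : ℕ) {v : ℕ} (hv : v ≤ B) :
    (σ.setReg x v).Bdd B := by
  refine ⟨fun y => ?_, h.2⟩
  rw [setReg_reg]; split_ifs
  · exact hv
  · exact h.1 y

theorem Mem.Bdd.setArr {σ : Mem} {B : ℕ} (h : σ.Bdd B) (a i : ℕ) {v : ℕ} (hv : v ≤ B) :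
    (σ.setArr a i v).Bdd B := by
  refine ⟨h.1, fun b j => ?_⟩
  rw [setArr_arr]; split_ifs with hb
  · rw [Function.update_apply]; split_ifs
    · exact hv
    · exact h.2 a j
  · exact h.2 b j

/-- A syntactic criterion for an expression to exceed the numbers in memory by at most `k`. -/
def Expr.tame : ℕ → Expr → Bool
  | _, .lit j => decide (j ≤ 4)
  | _, .reg _ | _, .get _ _ => true
  | k, .bin .add e (.lit j) => decide (j ≤ k) && e.tame (k - j)
  | k, .bin .sub e _ | k, .bin .div e _ | k, .bin .mod e _ => e.tame k
  | _, .bin .lt _ _ | _, .bin .eq _ _ => true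
  | _, .bin _ _ _ => false

theorem Expr.tame_le {σ : Mem} {B : ℕ} (hB : 4 ≤ B) (h : σ.Bdd B) :
    ∀ (e : Expr) (k : ℕ), e.tame k = true → e.eval σ ≤ B + k := by
  intro e
  induction e with
  | lit j => intro k hk; simp only [Expr.tame, decide_eq_true_eq] at hk; simp; omega
  | reg x => intro k _; exact (h.1 x).trans (Nat.le_add_right _ _)
  | get a i _ => intro k _; exact (h.2 a _).trans (Nat.le_add_right _ _)
  | bin op e f ihe _ =>
    intro k hk
    cases op with
    | add =>
      cases f with
      | lit j =>
        simp only [Expr.tame, Bool.and_eq_true, decide_eq_true_eq] at hk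
        have := ihe _ hk.2
        simp only [Expr.eval, Op.eval]; omega
      | _ => simp [Expr.tame] at hk
    | sub => exact (Nat.sub_le _ _).trans (ihe k hk)
    | div => exact (Nat.div_le_self _ _).trans (ihe k hk)
    | mod => exact (Nat.mod_le _ _).trans (ihe k hk)
    | mul => simp [Expr.tame] at hk
    | lt => simp only [Expr.eval, Op.eval]; split_ifs <;> omega
    | eq => simp only [Expr.eval, Op.eval]; split_ifs <;> omega

/-- The number of leaves of an expression, where an array access counts as a leaf. -/
def Expr.leaves : Expr → ℕ
  | .lit _ | .reg _ | .get _ _ => 1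
  | .bin _ e f => e.leaves + f.leaves

/-- A weight that bounds the cost of an expression, relative to the square of the bit length. -/
def Expr.weight : Expr → ℕ
  | .lit _ | .reg _ => 1
  | .get _ i => i.weight + 1
  | .bin _ e f => e.weight + f.weight + e.leaves * f.leaves

/-- All constants in the expression are at most `4`. -/
def Expr.small : Expr → Bool
  | .lit k => decide (k ≤ 4)
  | .reg _ => true
  | .get _ i => i.small
  | .bin _ e f => e.small && f.small

theorem Expr.leaves_pos (e : Expr) : 1 ≤ e.leaves := by
  induction e with
  | bin _ _ _ h _ => simp only [Expr.leaves]; omega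
  | _ => simp [Expr.leaves]

/-- Auxiliary values, such as the address of a table entry, may exceed the numbers in memory, but only
polynomially. -/
theorem Expr.eval_le_pow {σ : Mem} {B : ℕ} (hB : 4 ≤ B) (h : σ.Bdd B) :
    ∀ e : Expr, e.small = true → e.eval σ ≤ B ^ e.leaves := by
  intro e
  induction e with
  | lit j => intro hk; simp only [Expr.small, decide_eq_true_eq] at hk; simp [Expr.leaves]; omega
  | reg x => intro _; simpa [Expr.leaves] using h.1 x
  | get a i _ => intro _; simpa [Expr.leaves] using h.2 a _
  | bin op e f ihe ihf =>
    intro hk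
    simp only [Expr.small, Bool.and_eq_true] at hk
    have he := ihe hk.1
    have hf := ihf hk.2
    have e2 : 2 ≤ B ^ e.leaves :=
      (by omega : 2 ≤ B).trans (Nat.le_self_pow (by have := e.leaves_pos; omega) B)
    have f2 : 2 ≤ B ^ f.leaves :=
      (by omega : 2 ≤ B).trans (Nat.le_self_pow (by have := f.leaves_pos; omega) B)
    simp only [Expr.leaves, pow_add]
    have h1 : B ^ e.leaves ≤ B ^ e.leaves * B ^ f.leaves := Nat.le_mul_of_pos_right _ (by omega)
    cases op with
    | add => simp only [Expr.eval, Op.eval]; nlinarith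
    | mul => exact Nat.mul_le_mul he hf
    | sub => exact ((Nat.sub_le _ _).trans he).trans h1
    | div => exact ((Nat.div_le_self _ _).trans he).trans h1
    | mod => exact ((Nat.mod_le _ _).trans he).trans h1
    | lt => simp only [Expr.eval, Op.eval]; split_ifs <;> omega
    | eq => simp only [Expr.eval, Op.eval]; split_ifs <;> omega

theorem Expr.size_eval_le {σ : Mem} {B : ℕ} (hB : 4 ≤ B) (h : σ.Bdd B) (e : Expr)
    (he : e.small = true) : (e.eval σ).size ≤ e.leaves * B.size := by
  rw [Nat.size_le]
  calc e.eval σ ≤ B ^ e.leaves := e.eval_le_pow hB h he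
    _ < (2 ^ B.size) ^ e.leaves :=
        Nat.pow_lt_pow_left (Nat.lt_size_self B) (by have := e.leaves_pos; omega)
    _ = 2 ^ (e.leaves * B.size) := by rw [← pow_mul, Nat.mul_comm]

theorem Expr.cost_le {σ : Mem} {B : ℕ} (hB : 4 ≤ B) (h : σ.Bdd B) :
    ∀ e : Expr, e.small = true → e.cost σ ≤ e.weight * (1 + B.size) ^ 2 := by
  have hsq : 1 + B.size ≤ (1 + B.size) ^ 2 := Nat.le_self_pow (by norm_num) _
  intro e
  induction e with
  | lit j =>
    intro hk; simp only [Expr.small, decide_eq_true_eq] at hk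
    have : j.size ≤ B.size := Nat.size_le_size (by omega)
    simp only [Expr.cost, Expr.weight]; omega
  | reg x =>
    intro _
    have : (σ.reg x).size ≤ B.size := Nat.size_le_size (h.1 x)
    simp only [Expr.cost, Expr.weight]; omega
  | get a i ih =>
    intro hk
    have h1 := ih hk
    have : (σ.arr a (i.eval σ)).size ≤ B.size := Nat.size_le_size (h.2 a _)
    simp only [Expr.cost, Expr.weight]; nlinarith
  | bin op e f ihe ihf =>
    intro hk
    simp only [Expr.small, Bool.and_eq_true] at hk
    have h1 := ihe hk.1
    have h2 := ihf hk.2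
    have s1 := e.size_eval_le hB h hk.1
    have s2 := f.size_eval_le hB h hk.2
    have p1 := e.leaves_pos
    have p2 := f.leaves_pos
    have q1 : 1 + (e.eval σ).size ≤ e.leaves * (1 + B.size) := by nlinarith
    have q2 : 1 + (f.eval σ).size ≤ f.leaves * (1 + B.size) := by nlinarith
    have := Nat.mul_le_mul q1 q2
    simp only [Expr.cost, Expr.weight]
    nlinarith

/-- The sum of the weights of all expressions of a program. -/
def Prog.weight : Prog → ℕ
  | .skip => 1
  | .assign _ e | .sample _ e => 1 + e.weight
  | .store _ i e => 1 + i.weight + e.weight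
  | .seq p q => 1 + p.weight + q.weight
  | .branch e p q => 1 + e.weight + p.weight + q.weight
  | .loop e p => 1 + e.weight + p.weight

/-- Every number that the program stores exceeds the numbers in memory by at most `2`, and all of its
constants are at most `4`. -/
def Prog.tame : Prog → Bool
  | .skip => true
  | .assign _ e => e.tame 2 && e.small
  | .sample _ e => e.tame 0 && e.small
  | .store _ i e => e.tame 2 && i.small && e.small
  | .seq p q => p.tame && q.tame
  | .branch e p q => e.small && p.tame && q.tame
  | .loop e p => e.small && p.tame

/-- A tame program enlarges the bound on the numbers in memory by at most `2` per step. -/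
theorem Runs.bdd {P : Prog} {σ σ' : Mem} {t : ℕ} (r : Runs P σ t σ') (hP : P.tame = true)
    {b : ℕ} (hb : 4 ≤ b) (h : σ.Bdd b) : σ'.Bdd (b + 2 * t) := by
  induction r generalizing b with
  | skip => exact h.mono (by omega)
  | assign x e σ =>
    simp only [Prog.tame, Bool.and_eq_true] at hP
    exact (h.mono (by omega)).setReg x (by simpa using Expr.tame_le hb h e 2 hP.1)
  | store a i e σ =>
    simp only [Prog.tame, Bool.and_eq_true] at hP
    exact (h.mono (by omega)).setArr a _ (by simpa using Expr.tame_le hb h e 2 hP.1.1)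
  | seq _ _ ih ih' =>
    simp only [Prog.tame, Bool.and_eq_true] at hP
    exact (ih' hP.2 (by omega) (ih hP.1 hb h)).mono (by omega)
  | branch_pos _ _ ih =>
    simp only [Prog.tame, Bool.and_eq_true] at hP
    exact (ih hP.1.2 hb h).mono (by omega)
  | branch_neg _ _ ih =>
    simp only [Prog.tame, Bool.and_eq_true] at hP
    exact (ih hP.2 hb h).mono (by omega)
  | loop_pos _ _ _ ih ih' =>
    have hP' := hP
    simp only [Prog.tame, Bool.and_eq_true] at hP'
    exact (ih' hP (by omega) (ih hP'.2 hb h)).mono (by omega)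
  | loop_neg => exact h.mono (by omega)

/-! ### Expected cost of deterministic and of random steps -/

theorem expectedCost_pure {t : ℕ} {c c' : Config} (h : step c = PMF.pure c') :
    expectedCost (t + 1) c = stepCost c + expectedCost t c' := by
  rw [expectedCost, h]
  congr 1
  rw [tsum_eq_single c']
  · simp
  · intro b hb; simp [hb]

theorem expectedCost_halted (t : ℕ) (σ : Mem) : expectedCost t ([], σ) = 0 := by
  induction t with
  | zero => rfl
  | succ t ih => rw [expectedCost_pure (c' := ([], σ)) rfl, ih]; simp [stepCost]

theorem expectedCost_mono_succ : ∀ (t : ℕ) (c : Config), expectedCost t c ≤ expectedCost (t + 1) c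
  | 0, c => by simp [expectedCost]
  | t + 1, c => by
      rw [expectedCost, expectedCost]
      gcongr with c'
      exact expectedCost_mono_succ t c'

/-- A deterministic piece of program in front adds its number of steps times the maximal cost of
a step to the expected cost. -/
theorem Runs.expectedCost_le {P : Prog} {σ σ' : Mem} {t : ℕ} (r : Runs P σ t σ')
    (hP : P.tame = true) {b B κ : ℕ} (hb : 4 ≤ b) (h : σ.Bdd b) (hB : b + 2 * t ≤ B)
    (hκ : P.weight ≤ κ) (n : ℕ) (k : List Prog) :
    expectedCost n (P :: k, σ) ≤
      ((t * (κ * (1 + B.size) ^ 2) : ℕ) : ENNReal) + expectedCost n (k, σ') := by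
  have hs : 1 ≤ (1 + B.size) ^ 2 := Nat.one_le_pow _ _ (by omega)
  induction r generalizing b n k with
  | skip σ =>
    cases n with
    | zero => simp [expectedCost]
    | succ n =>
      rw [expectedCost_pure (c' := (k, σ)) rfl]
      refine add_le_add ?_ (expectedCost_mono_succ _ _)
      norm_cast
      simp only [stepCost, Prog.weight] at hκ ⊢
      nlinarith
  | assign x e σ =>
    cases n with
    | zero => simp [expectedCost]
    | succ n =>
      rw [expectedCost_pure (c' := (k, σ.setReg x (e.eval σ))) rfl]
      refine add_le_add ?_ (expectedCost_mono_succ _ _)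
      norm_cast
      simp only [Prog.tame, Bool.and_eq_true] at hP
      have := Expr.cost_le (by omega) (h.mono (by omega : b ≤ B)) e hP.2
      simp only [stepCost, Prog.weight] at hκ ⊢
      nlinarith
  | store a i e σ =>
    cases n with
    | zero => simp [expectedCost]
    | succ n =>
      rw [expectedCost_pure (c' := (k, σ.setArr a (i.eval σ) (e.eval σ))) rfl]
      refine add_le_add ?_ (expectedCost_mono_succ _ _)
      norm_cast
      simp only [Prog.tame, Bool.and_eq_true] at hP
      have := Expr.cost_le (by omega) (h.mono (by omega : b ≤ B)) e hP.2
      have := Expr.cost_le (by omega) (h.mono (by omega : b ≤ B)) i hP.1.2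
      simp only [stepCost, Prog.weight] at hκ ⊢
      nlinarith
  | @seq p q σ σ' σ'' t t' rp rq ih ih' =>
    cases n with
    | zero => simp [expectedCost]
    | succ n =>
      rw [expectedCost_pure (c' := (p :: q :: k, σ)) rfl]
      simp only [Prog.tame, Bool.and_eq_true] at hP
      simp only [Prog.weight] at hκ
      have h1 := ih hP.1 hb h (by omega) (by omega) n (q :: k)
      have h2 := ih' hP.2 (by omega) (rp.bdd hP.1 hb h) (by omega) (by omega) n k
      calc _ ≤ ((1 * (κ * (1 + B.size) ^ 2) : ℕ) : ENNReal) + (_ + (_ + expectedCost (n + 1) (k, σ''))) := by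
            refine add_le_add ?_ (h1.trans (add_le_add le_rfl (h2.trans
              (add_le_add le_rfl (expectedCost_mono_succ _ _)))))
            norm_cast; simp only [stepCost]; nlinarith
        _ = _ := by push_cast; ring
  | @branch_pos e p q σ σ' t he rp ih =>
    cases n with
    | zero => simp [expectedCost]
    | succ n =>
      rw [expectedCost_pure (c' := (p :: k, σ)) (by simp [step, he])]
      simp only [Prog.tame, Bool.and_eq_true] at hP
      simp only [Prog.weight] at hκ
      have h1 := ih hP.1.2 hb h (by omega) (by omega) n k
      have := Expr.cost_le (by omega) (h.mono (by omega : b ≤ B)) e hP.1.1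
      calc _ ≤ ((1 * (κ * (1 + B.size) ^ 2) : ℕ) : ENNReal) + (_ + expectedCost (n + 1) (k, σ')) := by
            refine add_le_add ?_ (h1.trans (add_le_add le_rfl (expectedCost_mono_succ _ _)))
            norm_cast; simp only [stepCost]; nlinarith
        _ = _ := by push_cast; ring
  | @branch_neg e p q σ σ' t he rp ih =>
    cases n with
    | zero => simp [expectedCost]
    | succ n =>
      rw [expectedCost_pure (c' := (q :: k, σ)) (by simp [step, he])]
      simp only [Prog.tame, Bool.and_eq_true] at hP
      simp only [Prog.weight] at hκ
      have h1 := ih hP.2 hb h (by omega) (by omega) n k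
      have := Expr.cost_le (by omega) (h.mono (by omega : b ≤ B)) e hP.1.1
      calc _ ≤ ((1 * (κ * (1 + B.size) ^ 2) : ℕ) : ENNReal) + (_ + expectedCost (n + 1) (k, σ')) := by
            refine add_le_add ?_ (h1.trans (add_le_add le_rfl (expectedCost_mono_succ _ _)))
            norm_cast; simp only [stepCost]; nlinarith
        _ = _ := by push_cast; ring
  | @loop_pos e p σ σ' σ'' t t' he rp rq ih ih' =>
    cases n with
    | zero => simp [expectedCost]
    | succ n =>
      rw [expectedCost_pure (c' := (p :: .loop e p :: k, σ)) (by simp [step, he])]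
      have hP' := hP
      have hκ' := hκ
      simp only [Prog.tame, Bool.and_eq_true] at hP'
      simp only [Prog.weight] at hκ'
      have h1 := ih hP'.2 hb h (by omega) (by omega) n (.loop e p :: k)
      have h2 := ih' hP (by omega) (rp.bdd hP'.2 hb h) (by omega) (by omega) n k
      have := Expr.cost_le (by omega) (h.mono (by omega : b ≤ B)) e hP'.1
      calc _ ≤ ((1 * (κ * (1 + B.size) ^ 2) : ℕ) : ENNReal) + (_ + (_ + expectedCost (n + 1) (k, σ''))) := by
            refine add_le_add ?_ (h1.trans (add_le_add le_rfl (h2.trans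
              (add_le_add le_rfl (expectedCost_mono_succ _ _)))))
            norm_cast; simp only [stepCost]; nlinarith
        _ = _ := by push_cast; ring
  | @loop_neg e p σ he =>
    cases n with
    | zero => simp [expectedCost]
    | succ n =>
      rw [expectedCost_pure (c' := (k, σ)) (by simp [step, he])]
      refine add_le_add ?_ (expectedCost_mono_succ _ _)
      norm_cast
      simp only [Prog.tame, Bool.and_eq_true] at hP
      have := Expr.cost_le (by omega) (h.mono (by omega : b ≤ B)) e hP.1
      simp only [stepCost, Prog.weight] at hκ ⊢
      nlinarith

theorem tsum_map_mul {α β : Type*} (p : PMF α) (f : α → β) (g : β → ENNReal) :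
    ∑' b, (p.map f) b * g b = ∑' a, p a * g (f a) := by
  classical
  simp only [PMF.map_apply, ← ENNReal.tsum_mul_right]
  rw [ENNReal.tsum_comm]
  refine tsum_congr fun a => ?_
  rw [tsum_eq_single (f a)]
  · simp
  · intro b hb; simp [hb]

/-- The expected cost after a random choice is the average over its outcomes. -/
theorem expectedCost_sample (t x : ℕ) (e : Expr) (k : List Prog) (σ : Mem) :
    expectedCost (t + 1) (.sample x e :: k, σ) = ((1 + e.cost σ : ℕ) : ENNReal) +
      ((e.eval σ + 1 : ℕ) : ENNReal)⁻¹ *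
        ∑ r ∈ Finset.range (e.eval σ + 1), expectedCost t (k, σ.setReg x r) := by
  rw [expectedCost, step, tsum_map_mul, tsum_fintype, Finset.sum_range, Finset.mul_sum]
  simp [stepCost]

/-! ### Possible outputs -/

/-- Every halted configuration that can be reached from `c` satisfies `Q`. -/
def Ensures (c : Config) (Q : Mem → Prop) : Prop :=
  ∀ σ, Relation.ReflTransGen (fun c c' => c' ∈ (step c).support) c ([], σ) → Q σ

theorem Ensures.halted {σ : Mem} {Q : Mem → Prop} (h : Q σ) : Ensures ([], σ) Q := by
  intro τ r
  have key : ∀ c, Relation.ReflTransGen (fun c c' : Config => c' ∈ (step c).support) ([], σ) c →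
      c = ([], σ) := by
    intro c r
    induction r with
    | refl => rfl
    | tail _ hs ih => subst ih; simpa [step] using hs
  have := key _ r
  simp only [Prod.mk.injEq, true_and] at this
  rwa [this]

theorem Ensures.of_step {P : Prog} {k : List Prog} {σ : Mem} {Q : Mem → Prop}
    (h : ∀ c ∈ (step (P :: k, σ)).support, Ensures c Q) : Ensures (P :: k, σ) Q := by
  intro τ r
  rcases Relation.ReflTransGen.cases_head r with h' | ⟨c, hc, r'⟩
  · simp at h'
  · exact h c hc τ r'

theorem Ensures.of_pure {P : Prog} {k : List Prog} {σ : Mem} {c : Config} {Q : Mem → Prop}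
    (h : step (P :: k, σ) = PMF.pure c) (hc : Ensures c Q) : Ensures (P :: k, σ) Q :=
  .of_step fun c' hc' => by
    rw [h] at hc'
    simp at hc'
    rwa [hc']

theorem Runs.ensures {P : Prog} {σ σ' : Mem} {t : ℕ} (r : Runs P σ t σ') {k : List Prog}
    {Q : Mem → Prop} (h : Ensures (k, σ') Q) : Ensures (P :: k, σ) Q := by
  induction r generalizing k with
  | skip | assign | store => exact .of_pure rfl h
  | seq _ _ ih ih' => exact .of_pure rfl (ih (ih' h))
  | branch_pos he _ ih => exact .of_pure (by simp [step, he]) (ih h)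
  | branch_neg he _ ih => exact .of_pure (by simp [step, he]) (ih h)
  | loop_pos he _ _ ih ih' => exact .of_pure (by simp [step, he]) (ih (ih' h))
  | loop_neg he => exact .of_pure (by simp [step, he]) h

/-- A property of all outputs has to be verified for every outcome of a random choice. -/
theorem Ensures.sample {x : ℕ} {e : Expr} {k : List Prog} {σ : Mem} {Q : Mem → Prop}
    (h : ∀ r ≤ e.eval σ, Ensures (k, σ.setReg x r) Q) : Ensures (.sample x e :: k, σ) Q :=
  .of_step fun c hc => by
    simp only [step, PMF.mem_support_map_iff] at hc
    obtain ⟨r, -, rfl⟩ := hc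
    exact h r (Nat.lt_succ_iff.mp r.2)

end RandRAM

namespace ColorExt
open RandRAM

/-! ### Half-edge labelings -/

/-- The other half of the edge that contains the dart `d`: edge `i` consists of the darts `2 * i + 2`
and `2 * i + 3`, so that `0` and `1` are no darts. -/
def tw (d : ℕ) : ℕ := d + 1 - 2 * (d % 2)

theorem tw_tw {d : ℕ} (h : 2 ≤ d) : tw (tw d) = d := by unfold tw; omega
theorem tw_ne (d : ℕ) : tw d ≠ d := by unfold tw; omega
theorem tw_zero : tw 0 = 1 := rfl

/-- A finite graph, presented by the end vertex `V d` of each of its `2 * m` darts, and the number `K`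
of available colors. -/
structure Net where
  m : ℕ
  K : ℕ
  V : ℕ → ℕ

/-- `d` is a dart. -/
def Net.dart (N : Net) (d : ℕ) : Prop := 2 ≤ d ∧ d < 2 * N.m + 2

instance (N : Net) (d : ℕ) : Decidable (N.dart d) := inferInstanceAs (Decidable (_ ∧ _))

/-- The darts of the graph. -/
def Net.darts (N : Net) : Finset ℕ := (Finset.range (2 * N.m + 2)).filter N.dart

/-- The darts at the vertex `v`. -/
def Net.dartsAt (N : Net) (v : ℕ) : Finset ℕ := N.darts.filter fun d => N.V d = v

/-- The graph is simple and has more colors than its maximum degree. -/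
structure Net.Good (N : Net) : Prop where
  ne : ∀ d, N.dart d → N.V d ≠ N.V (tw d)
  simple : ∀ d e, N.dart d → N.dart e → N.V d = N.V e → N.V (tw d) = N.V (tw e) → d = e
  deg_lt : ∀ v, (N.dartsAt v).card < N.K

theorem Net.dart_tw {N : Net} {d : ℕ} (h : N.dart d) : N.dart (tw d) := by
  unfold Net.dart tw at *; omega

theorem Net.dart.tw_tw {N : Net} {d : ℕ} (h : N.dart d) : tw (tw d) = d := ColorExt.tw_tw h.1

@[simp] theorem Net.mem_darts {N : Net} {d : ℕ} : d ∈ N.darts ↔ N.dart d := by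
  simp only [Net.darts, Finset.mem_filter, Finset.mem_range, and_iff_right_iff_imp]
  exact fun h => h.2

@[simp] theorem Net.mem_dartsAt {N : Net} {v d : ℕ} : d ∈ N.dartsAt v ↔ N.dart d ∧ N.V d = v := by
  simp [Net.dartsAt]

theorem Net.card_darts (N : Net) : N.darts.card = 2 * N.m := by
  have : N.darts = Finset.Ico 2 (2 * N.m + 2) := by ext; simp [Net.dart]
  simp [this]

/-- A labeling of the darts by colors: `H d` is the label of the dart `d` (`0` for none), `T v c` is
the dart at `v` with label `c` (`0` for none), and `M v` is a color that labels no dart at `v`.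
An edge with two equal nonzero labels has this color, and an edge whose halves are both labeled `0`
is not going to be colored. An edge with one nonzero label is called a token. It is waiting to be
colored; it is represented by its labeled dart, whose end is called its leaf, while the other end is
called its center. The label is a missing color reserved for the token at the leaf. -/
structure Lay where
  H : ℕ → ℕ
  T : ℕ → ℕ → ℕ
  M : ℕ → ℕ

/-- The dart `h` represents a token. -/
def Lay.tok (L : Lay) (N : Net) (h : ℕ) : Prop := N.dart h ∧ L.H h ≠ 0 ∧ L.H (tw h) = 0

instance (L : Lay) (N : Net) (h : ℕ) : Decidable (L.tok N h) := inferInstanceAs (Decidable (_ ∧ _))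

/-- The color `c` is used on a colored edge at `u`. -/
def Lay.col (L : Lay) (u c : ℕ) : Prop := L.H (tw (L.T u c)) ≠ 0

instance (L : Lay) (u c : ℕ) : Decidable (L.col u c) := inferInstanceAs (Decidable (_ ≠ _))

/-- The color `M w` at the far end `w` of the edge at `u` with color `c`. -/
def Lay.lk (L : Lay) (N : Net) (u c : ℕ) : ℕ := L.M (N.V (tw (L.T u c)))

/-- `M v` is a color that labels no dart at `v`. -/
def Lay.MOk (L : Lay) (N : Net) (v : ℕ) : Prop := 1 ≤ L.M v ∧ L.M v ≤ N.K ∧ L.T v (L.M v) = 0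

/-- The table is consistent with the labels, the labels at every vertex are distinct, edges carry
legal pairs of labels, `X` is the set of darts with inert edges, and all centers are in `C`. -/
structure Core (N : Net) (X C : ℕ → Prop) (L : Lay) : Prop where
  le : ∀ d, N.dart d → L.H d ≤ N.K
  T_of : ∀ d, N.dart d → L.H d ≠ 0 → L.T (N.V d) (L.H d) = d
  of_T : ∀ v c, L.T v c ≠ 0 →
    N.dart (L.T v c) ∧ N.V (L.T v c) = v ∧ L.H (L.T v c) = c ∧ c ≠ 0
  edge : ∀ d, N.dart d → L.H d = L.H (tw d) ∨ L.H d = 0 ∨ L.H (tw d) = 0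
  one : L.H 1 = 0
  inert : ∀ d, N.dart d → (L.H d = 0 ∧ L.H (tw d) = 0 ↔ X d)
  ctr : ∀ d, L.tok N d → C (N.V (tw d))

/-- The invariant of the main loop. -/
structure Inv (N : Net) (X C : ℕ → Prop) (L : Lay) : Prop extends Core N X C L where
  free : ∀ d, N.dart d → L.MOk N (N.V d)

section
variable {N : Net} {X C : ℕ → Prop} {L : Lay}

theorem Core.T_ne (I : Core N X C L) {u c : ℕ} (h : L.col u c) : L.T u c ≠ 0 := by
  intro h0
  exact h (by rw [h0, tw_zero, I.one])

theorem Core.col_dart (I : Core N X C L) {u c : ℕ} (h : L.col u c) :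
    N.dart (L.T u c) ∧ N.V (L.T u c) = u ∧ L.H (L.T u c) = c ∧ c ≠ 0 ∧ L.H (tw (L.T u c)) = c := by
  obtain ⟨h1, h2, h3, h4⟩ := I.of_T u c (I.T_ne h)
  refine ⟨h1, h2, h3, h4, ?_⟩
  rcases I.edge _ h1 with h5 | h5 | h5
  · rw [← h5, h3]
  · exact absurd (h3.symm.trans h5) h4
  · exact absurd h5 h

theorem Core.col_le (I : Core N X C L) {u c : ℕ} (h : L.col u c) : 1 ≤ c ∧ c ≤ N.K := by
  obtain ⟨h1, h2, h3, h4, h5⟩ := I.col_dart h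
  exact ⟨Nat.one_le_iff_ne_zero.mpr h4, h3 ▸ I.le _ h1⟩

/-- Darts with the same end have distinct labels. -/
theorem Core.inj (I : Core N X C L) {d e : ℕ} (hd : N.dart d) (he : N.dart e) (h : L.H d ≠ 0)
    (hV : N.V d = N.V e) (hH : L.H d = L.H e) : d = e := by
  rw [← I.T_of d hd h, ← I.T_of e he (hH ▸ h), hV, hH]

/-- The dart with color `c` at `u`, given by an edge that has color `c`. -/
theorem Core.col_of (I : Core N X C L) {d : ℕ} (hd : N.dart d) (h : L.H d ≠ 0)
    (h' : L.H (tw d) ≠ 0) : L.col (N.V d) (L.H d) ∧ L.T (N.V d) (L.H d) = d := by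
  have := I.T_of d hd h
  exact ⟨by rw [Lay.col, this]; exact h', this⟩

/-- Update of a function of two variables. -/
def upd (T : ℕ → ℕ → ℕ) (v c x : ℕ) : ℕ → ℕ → ℕ :=
  fun v' c' => if v' = v ∧ c' = c then x else T v' c'

/-- The token `h` at the center `u` gives its label `c` to its edge and moves to the edge of the dart `g`
at `u`, whose other end is `w`. -/
def Lay.move (L : Lay) (u c h g w : ℕ) : Lay where
  H := Function.update (Function.update (Function.update L.H (tw h) c) g 0) (tw g) (L.M w)
  T := upd (upd (upd L.T u c (tw h)) w c 0) w (L.M w) (tw g)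
  M := Function.update L.M w c

/-- The token `h` moves around its center to the edge whose color it has reserved. -/
def Lay.shift (L : Lay) (N : Net) (h : ℕ) : Lay :=
  L.move (N.V (tw h)) (L.H h) h (L.T (N.V (tw h)) (L.H h)) (N.V (tw (L.T (N.V (tw h)) (L.H h))))

/-- What moving a token from `h` to `h'` changes: the other tokens keep their labels. -/
structure Moved (N : Net) (L : Lay) (h : ℕ) (L' : Lay) (h' : ℕ) : Prop where
  tok' : L'.tok N h'
  ctr : N.V (tw h') = N.V (tw h)
  toks : ∀ d, L'.tok N d ↔ d = h' ∨ L.tok N d ∧ d ≠ h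
  labels : ∀ d, L.tok N d → d ≠ h → L'.H d = L.H d ∧ d ≠ h'

/-- One step of the walk of a token. The color `c` that it has reserved at its leaf is used at its
center `u` on the edge of a dart `g`. Give `c` to the edge of `h`, uncolor the edge of `g`, and let the
token continue on that edge, with the free color at its new leaf as its label. As `c` labels no dart at
the new leaf any more, it becomes the free color there. Colors at `u` other than `c` keep their
successors `lk`. -/
theorem Inv.shift (hN : N.Good) (I : Inv N X C L) {h : ℕ} (ht : L.tok N h)
    (hc : L.col (N.V (tw h)) (L.H h)) :
    Inv N X C (L.shift N h) ∧
    Moved N L h (L.shift N h) (tw (L.T (N.V (tw h)) (L.H h))) ∧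
    (L.shift N h).H (tw (L.T (N.V (tw h)) (L.H h))) = L.lk N (N.V (tw h)) (L.H h) ∧
    ∀ c, c ≠ L.H h → ((L.shift N h).col (N.V (tw h)) c ↔ L.col (N.V (tw h)) c) ∧
      ((L.col (N.V (tw h)) c → (L.shift N h).lk N (N.V (tw h)) c = L.lk N (N.V (tw h)) c)) := by
  obtain ⟨gD, gV, gH, c0, gH'⟩ := I.col_dart hc
  obtain ⟨hD, hH0, hH1⟩ := ht
  unfold Lay.lk Lay.shift
  generalize hu : N.V (tw h) = u at *
  generalize hcc : L.H h = c at *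
  generalize hg : L.T u c = g at *
  generalize hw : N.V (tw g) = w at *
  obtain ⟨k1, k2, k3⟩ := I.free (tw g) (Net.dart_tw gD)
  rw [hw] at k1 k2 k3
  generalize hk : L.M w = k at *
  have hDt := Net.dart_tw hD
  have gDt := Net.dart_tw gD
  have e1 := hD.tw_tw
  have e2 := gD.tw_tw
  have wu : w ≠ u := fun e => hN.ne g gD (by rw [gV, hw, e])
  have vu : N.V h ≠ u := fun e => hN.ne h hD (by rw [hu, e])
  have hg1 : tw h ≠ g := fun e => by rw [e, gH] at hH1; exact c0 hH1
  have hg2 : h ≠ g := fun e => vu (by rw [e, gV])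
  have hg3 : tw g ≠ h := fun e => hg1 (by rw [← e, e2])
  have hg4 : tw g ≠ tw h := fun e => hg2 (by rw [← e1, ← e2, e])
  have hg5 : tw g ≠ g := tw_ne g
  have hg6 : tw h ≠ h := tw_ne h
  have vw : N.V h ≠ w := fun e => hg1 (hN.simple _ _ hDt gD (by rw [hu, gV]) (by rw [e1, hw, e]))
  have Twc : L.T w c = tw g := by rw [← hw, ← gH']; exact I.T_of _ gDt (by rw [gH']; exact c0)
  have hgz : tw g ≠ 0 := by have := gDt.1; omega
  have kc : k ≠ c := fun e => by rw [e, Twc] at k3; exact hgz k3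
  have Tvc : L.T (N.V h) c = h := by rw [← hcc]; exact I.T_of _ hD (by rw [hcc]; exact c0)
  have twh : ∀ d, N.dart d → (tw d = h ↔ d = tw h) ∧ (tw d = tw h ↔ d = h) ∧
      (tw d = g ↔ d = tw g) ∧ (tw d = tw g ↔ d = g) := by
    intro d hd
    have := hd.tw_tw
    refine ⟨⟨?_, ?_⟩, ⟨?_, ?_⟩, ⟨?_, ?_⟩, ⟨?_, ?_⟩⟩ <;> intro e <;> grind
  have h1 : tw h ≠ 1 ∧ g ≠ 1 ∧ tw g ≠ 1 := by
    refine ⟨?_, ?_, ?_⟩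
    · have := hDt.1; omega
    · have := gD.1; omega
    · have := gDt.1; omega
  have H' : ∀ d, (L.move u c h g w).H d =
      if d = tw g then k else if d = g then 0 else if d = tw h then c else L.H d := by
    intro d; simp only [Lay.move, hk, Function.update_apply]
  have T' : ∀ v a, (L.move u c h g w).T v a =
      if v = w ∧ a = k then tw g else if v = w ∧ a = c then 0 else
      if v = u ∧ a = c then tw h else L.T v a := by intro v a; simp only [Lay.move, hk, upd]
  have M' : ∀ v, (L.move u c h g w).M v = if v = w then c else L.M v := by
    intro v; simp only [Lay.move, Function.update_apply]
  generalize L.move u c h g w = L' at *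
  have toks : ∀ d, L'.tok N d ↔ d = tw g ∨ L.tok N d ∧ d ≠ h := by
    intro d
    by_cases hd : N.dart d
    · have := twh d hd
      simp only [Lay.tok, H']
      grind
    · simp only [Lay.tok, hd, false_and, or_false, false_iff]
      exact fun e => hd (e ▸ gDt)
  refine ⟨⟨⟨?_, ?_, ?_, ?_, ?_, ?_, ?_⟩, ?_⟩, ⟨?_, ?_, toks, ?_⟩, ?_, ?_⟩
  · intro d hd
    have := I.le d hd
    have := I.le h hD
    rw [H']; split_ifs <;> omega
  · intro d hd hd0
    have := I.T_of d hd
    have := twh d hd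
    have d0 : d ≠ 0 := by have := hd.1; omega
    rw [H'] at hd0 ⊢
    rw [T']
    by_cases a1 : d = tw g
    · subst a1; simp [hw]
    by_cases a2 : d = g
    · simp [a2, hg5.symm] at hd0
    by_cases a3 : d = tw h
    · subst a3; simp [hg4.symm, hg1, hu, wu.symm]
    simp only [a1, a2, a3, if_false] at hd0 ⊢
    have e := I.T_of d hd hd0
    split_ifs with b1 b2 b3
    · rw [b1.1, b1.2, k3] at e; exact absurd e.symm d0
    · rw [b2.1, b2.2, Twc] at e; exact absurd e.symm a1
    · rw [b3.1, b3.2, hg] at e; exact absurd e.symm a2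
    · exact e
  · intro v a ha
    rw [T'] at ha ⊢
    have := I.of_T v a
    rw [H']
    grind
  · intro d hd
    have := I.edge d hd
    have := twh d hd
    rw [H', H']
    grind
  · rw [H']; simp [h1.1.symm, h1.2.1.symm, h1.2.2.symm, I.one]
  · intro d hd
    rw [← I.inert d hd, H', H']
    have := twh d hd
    grind
  · intro d hd
    rw [toks] at hd
    rcases hd with rfl | ⟨hd, -⟩
    · rw [e2, gV, ← hu]; exact I.ctr h ⟨hD, by rw [hcc]; exact c0, hH1⟩
    · exact I.ctr d hd
  · intro d hd
    obtain ⟨a1, a2, a3⟩ := I.free d hd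
    have := I.le h hD
    have g0 : g ≠ 0 := by have := gD.1; omega
    unfold Lay.MOk
    rw [M', T']
    grind
  · exact (toks _).2 (Or.inl rfl)
  · rw [e2, gV, hu]
  · intro d hd hdh
    rw [H']
    obtain ⟨hd1, hd2, hd3⟩ := hd
    have := twh d hd1
    grind
  · rw [H']; simp
  · intro a ha
    unfold Lay.col
    have Tu : L'.T u a = L.T u a := by rw [T']; simp [wu.symm, ha]
    rw [Tu, M', H']
    by_cases h0 : L.T u a = 0
    · rw [h0, tw_zero]
      simp [h1.1.symm, h1.2.1.symm, h1.2.2.symm, I.one]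
    obtain ⟨b1, b2, b3, b4⟩ := I.of_T u a h0
    generalize L.T u a = q at *
    have := twh q b1
    have nw : N.V (tw q) ≠ w := fun e => by
      have := hN.simple q g b1 gD (by rw [b2, gV]) (by rw [e, hw])
      rw [this, gH] at b3
      exact ha b3.symm
    have q1 : q ≠ h := fun e => vu (by rw [← e, b2])
    have q2 : q ≠ tw g := fun e => wu (by rw [← hw, ← e, b2])
    have q3 : q ≠ g := fun e => ha (by rw [← b3, e, gH])
    simp [this, q1, q2, q3, nw]

end

section
variable {N : Net} {X C : ℕ → Prop} {L : Lay}

/-! ### Coloring the edge of a token -/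

/-- At every vertex one of the colors `1, …, deg v + 1` labels no dart. -/
theorem exists_free (T : ℕ → ℕ → ℕ) (v : ℕ)
    (h : ∀ c, T v c ≠ 0 → T v c ∈ N.dartsAt v) (inj : ∀ c c', T v c = T v c' → T v c ≠ 0 → c = c') :
    ∃ c, 1 ≤ c ∧ c ≤ (N.dartsAt v).card + 1 ∧ T v c = 0 := by
  by_contra! hc
  have := Finset.card_le_card_of_injOn (s := Finset.Icc 1 ((N.dartsAt v).card + 1))
    (t := N.dartsAt v) (T v) (fun c hc' => by
      rw [Finset.coe_Icc, Set.mem_Icc] at hc'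
      exact h c (hc c hc'.1 hc'.2)) (fun c hc' c' _ e => by
      rw [Finset.coe_Icc, Set.mem_Icc] at hc'
      exact inj c c' e (hc c hc'.1 hc'.2))
  simp at this

theorem Core.exists_free (I : Core N X C L) (v : ℕ) :
    ∃ c, 1 ≤ c ∧ c ≤ (N.dartsAt v).card + 1 ∧ L.T v c = 0 :=
  ColorExt.exists_free L.T v (fun c hc => by
    have := I.of_T v c hc
    simp [this.1, this.2.1]) fun c c' e hc => by
    rw [← (I.of_T v c hc).2.2.1, ← (I.of_T v c' (e ▸ hc)).2.2.1, e]

/-- Color the edge of the token `h` with its label `c`. If `c` was reserved at the center `u` by another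
token `o`, then that token gets the label `M u` instead. -/
def Lay.paint (L : Lay) (u c h o : ℕ) : Lay where
  H := if o = 0 then Function.update L.H (tw h) c
    else Function.update (Function.update L.H (tw h) c) o (L.M u)
  T := if o = 0 then upd L.T u c (tw h) else upd (upd L.T u c (tw h)) u (L.M u) o
  M := L.M

/-- Coloring the edge of a token whose label is missing at its center `u` preserves everything but the
free color at `u`. If the label is reserved at `u` for another token, only this token changes its label.
-/
theorem Inv.paint (hN : N.Good) (I : Inv N X C L) {h : ℕ} (ht : L.tok N h)
    (hc : ¬ L.col (N.V (tw h)) (L.H h)) {L' : Lay}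
    (hL' : L' = L.paint (N.V (tw h)) (L.H h) h (L.T (N.V (tw h)) (L.H h))) :
    Core N X C L' ∧ (∀ d, N.dart d → N.V d ≠ N.V (tw h) → L'.MOk N (N.V d)) ∧
    (∀ d, L'.tok N d ↔ L.tok N d ∧ d ≠ h) ∧
    (∀ d, L.tok N d → d ≠ h → d ≠ L.T (N.V (tw h)) (L.H h) → L'.H d = L.H d) := by
  obtain ⟨hD, hH0, hH1⟩ := ht
  have hDt := Net.dart_tw hD
  obtain ⟨k1, k2, k3⟩ := I.free (tw h) hDt
  have hoT := I.of_T (N.V (tw h)) (L.H h)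
  have hle := I.le h hD
  have hC := I.ctr h ⟨hD, hH0, hH1⟩
  have oe : L.H (tw (L.T (N.V (tw h)) (L.H h))) = 0 := by
    simpa [Lay.col] using hc
  have tok_h : L.tok N h := ⟨hD, hH0, hH1⟩
  have vu' := hN.ne h hD
  generalize hu : N.V (tw h) = u at *
  generalize hcc : L.H h = c at *
  generalize ho : L.T u c = o at *
  generalize hk : L.M u = k at *
  have e1 := hD.tw_tw
  have o1 : o ≠ tw h := fun e => by
    have := (hoT (by have := hDt.1; omega)).2.2.1
    rw [e, hH1] at this; exact hH0 this.symm
  have o2 : o ≠ h := fun e => by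
    have := (hoT (by have := hD.1; omega)).2.1
    rw [e] at this; exact vu' this
  have hk0 : k ≠ 0 := by omega
  have kc : o ≠ 0 → k ≠ c := fun h0 e => by rw [e, ho] at k3; exact h0 k3
  have H' : ∀ d, d ≠ 0 → L'.H d = if d = o then k else if d = tw h then c else L.H d := by
    intro d h0; rw [hL']
    by_cases hz : o = 0
    · simp only [Lay.paint, hz, if_true, Function.update_apply]; simp [h0]
    · simp only [Lay.paint, hz, if_false, Function.update_apply, hk]
  have T' : ∀ v a, L'.T v a = if o ≠ 0 ∧ v = u ∧ a = k then o else
      if v = u ∧ a = c then tw h else L.T v a := by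
    intro v a; rw [hL']
    by_cases hz : o = 0
    · simp [Lay.paint, hz, upd]
    · simp [Lay.paint, hz, upd, hk]
  have M' : ∀ v, L'.M v = L.M v := by intro v; rw [hL']; rfl
  clear hL'
  have dn : ∀ d, N.dart d → d ≠ 0 ∧ tw d ≠ 0 := fun d hd =>
    ⟨by have := hd.1; omega, by have := (Net.dart_tw hd).1; omega⟩
  have twh : ∀ d, N.dart d → (tw d = h ↔ d = tw h) ∧ (tw d = tw h ↔ d = h) := by
    intro d hd
    have := hd.tw_tw
    refine ⟨⟨?_, ?_⟩, ⟨?_, ?_⟩⟩ <;> intro e <;> grind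
  have two : ∀ d, N.dart d → tw d = o → L.H d = 0 := by
    intro d hd e
    rw [← e, hd.tw_tw] at oe
    exact oe
  have two' : ∀ d, N.dart d → d = o → L.H (tw d) = 0 ∧ L.H d = c := by
    intro d hd e
    have := (hoT (by rw [← e]; exact (dn d hd).1)).2.2.1
    rw [e]; exact ⟨oe, this⟩
  have h1 : tw h ≠ 1 := by have := hDt.1; omega
  have ho1 : o ≠ 1 := fun e => by have := (hoT (by omega)).1.1; omega
  have toks : ∀ d, L'.tok N d ↔ L.tok N d ∧ d ≠ h := by
    intro d
    by_cases hd : N.dart d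
    · have := twh d hd
      have := two d hd
      have := two' d hd
      have := two' _ (Net.dart_tw hd)
      have := hd.tw_tw
      simp only [Lay.tok, H' d (dn d hd).1, H' _ (dn d hd).2]
      grind
    · simp [Lay.tok, hd]
  refine ⟨⟨?_, ?_, ?_, ?_, ?_, ?_, ?_⟩, ?_, toks, ?_⟩
  · intro d hd
    have := I.le d hd
    rw [H' d (dn d hd).1]; split_ifs <;> omega
  · intro d hd hd0
    rw [H' d (dn d hd).1] at hd0 ⊢
    rw [T']
    by_cases a1 : d = o
    · subst a1
      have := hoT (dn d hd).1
      simp [(dn d hd).1, this.2.1]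
    by_cases a2 : d = tw h
    · subst a2; simp [a1, hu]
      intro h1 h2; exact absurd h2.symm (kc h1)
    simp only [a1, a2, if_false] at hd0 ⊢
    have e := I.T_of d hd hd0
    split_ifs with b1 b2
    · rw [b1.2.1, b1.2.2, k3] at e; exact absurd e.symm (dn d hd).1
    · rw [b2.1, b2.2, ho] at e; exact absurd e.symm a1
    · exact e
  · intro v a ha
    rw [T'] at ha ⊢
    have := I.of_T v a
    split_ifs with b1 b2
    · have := hoT b1.1
      rw [H' o b1.1]; simp [this.1, this.2.1, b1.2.1, b1.2.2, hk0]
    · rw [H' _ (dn _ hDt).1]; simp [hDt, hu, b2.1, b2.2, o1.symm, hH0]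
    · simp only [b1, b2, if_false] at ha
      obtain ⟨c1, c2, c3, c4⟩ := this ha
      refine ⟨c1, c2, ?_, c4⟩
      rw [H' _ ha]
      have := I.of_T u c
      grind
  · intro d hd
    have := I.edge d hd
    have := twh d hd
    have := two d hd
    have := two' d hd
    have := two' _ (Net.dart_tw hd)
    have := hd.tw_tw
    rw [H' d (dn d hd).1, H' _ (dn d hd).2]
    grind
  · rw [H' 1 (by omega)]; simp [h1.symm, ho1.symm, I.one]
  · intro d hd
    rw [← I.inert d hd, H' d (dn d hd).1, H' _ (dn d hd).2]
    have := twh d hd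
    have := two d hd
    have := two' d hd
    have := two' _ (Net.dart_tw hd)
    have := hd.tw_tw
    grind
  · intro d hd
    exact I.ctr d ((toks d).1 hd).1
  · intro d hd hdu
    obtain ⟨a1, a2, a3⟩ := I.free d hd
    unfold Lay.MOk
    rw [M', T']
    simp [hdu, a1, a2, a3]
  · intro d hd hdh hdo
    rw [H' d (dn d hd.1).1, if_neg hdo, if_neg]
    intro e
    have := hd.2.1
    rw [e, hH1] at this
    exact this rfl

/-- Setting `M u` to a free color restores the invariant. -/
theorem Core.setM (I : Core N X C L) (u c : ℕ) (h : ∀ d, N.dart d → N.V d ≠ u → L.MOk N (N.V d))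
    (hc : 1 ≤ c ∧ c ≤ N.K ∧ L.T u c = 0) :
    Inv N X C { L with M := Function.update L.M u c } where
  le := I.le
  T_of := I.T_of
  of_T := I.of_T
  edge := I.edge
  one := I.one
  inert := I.inert
  ctr := I.ctr
  free := by
    intro d hd
    unfold Lay.MOk
    by_cases e : N.V d = u
    · simpa [e] using hc
    · simpa [e, Lay.MOk] using h d hd e

/-! ### Kempe changes -/

/-- `L'` arises from `L` by exchanging the labels `a` and `b` at all vertices in `S`. -/
structure Swapped (N : Net) (L L' : Lay) (S : Finset ℕ) (a b : ℕ) : Prop where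
  H : ∀ d, N.dart d → L'.H d = if N.V d ∈ S then Equiv.swap a b (L.H d) else L.H d
  one : L'.H 1 = L.H 1
  T : ∀ v c, L'.T v c = L.T v (if v ∈ S then Equiv.swap a b c else c)
  M : ∀ v, L'.M v = if v ∈ S then Equiv.swap a b (L.M v) else L.M v

theorem swap_eq_zero {a b c : ℕ} (ha : a ≠ 0) (hb : b ≠ 0) : Equiv.swap a b c = 0 ↔ c = 0 := by
  rw [Equiv.swap_apply_def]; split_ifs <;> omega

theorem Swapped.H_eq_zero {L' : Lay} {S : Finset ℕ} {a b : ℕ} (W : Swapped N L L' S a b)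
    (ha : a ≠ 0) (hb : b ≠ 0) {d : ℕ} (hd : N.dart d) : L'.H d = 0 ↔ L.H d = 0 := by
  rw [W.H d hd]; split_ifs
  · exact swap_eq_zero ha hb
  · rfl

theorem Swapped.tok {L' : Lay} {S : Finset ℕ} {a b : ℕ} (W : Swapped N L L' S a b)
    (ha : a ≠ 0) (hb : b ≠ 0) (d : ℕ) : L'.tok N d ↔ L.tok N d := by
  unfold Lay.tok
  by_cases hd : N.dart d
  · rw [Ne, W.H_eq_zero ha hb hd, W.H_eq_zero ha hb (Net.dart_tw hd)]
  · simp [hd]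

/-- Whether the dart found in the table belongs to a colored edge is not affected by the exchange. -/
theorem Swapped.H_tw_T {L' : Lay} {S : Finset ℕ} {a b : ℕ} (I : Core N X C L)
    (W : Swapped N L L' S a b) (ha : a ≠ 0) (hb : b ≠ 0) (v c : ℕ) :
    L'.H (tw (L.T v c)) = 0 ↔ L.H (tw (L.T v c)) = 0 := by
  by_cases h0 : L.T v c = 0
  · rw [h0, tw_zero, W.one]
  · exact W.H_eq_zero ha hb (Net.dart_tw (I.of_T v c h0).1)

theorem Swapped.col {L' : Lay} {S : Finset ℕ} {a b : ℕ} (I : Core N X C L)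
    (W : Swapped N L L' S a b) (ha : a ≠ 0) (hb : b ≠ 0) (v c : ℕ) :
    L'.col v c ↔ L.col v (if v ∈ S then Equiv.swap a b c else c) := by
  unfold Lay.col
  rw [W.T, Ne, W.H_tw_T I ha hb]

/-- Kempe changes preserve the invariant, if `S` is closed under the edges with colors `a`, `b`. -/
theorem Swapped.inv {L' : Lay} {S : Finset ℕ} {a b : ℕ} (I : Inv N X C L)
    (W : Swapped N L L' S a b) (ha : a ≠ 0) (hb : b ≠ 0) (ha' : a ≤ N.K) (hb' : b ≤ N.K)
    (closed : ∀ d, N.dart d → L.H d ≠ 0 → L.H (tw d) ≠ 0 → L.H d = a ∨ L.H d = b → N.V d ∈ S →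
      N.V (tw d) ∈ S) : Inv N X C L' where
  le d hd := by
    rw [W.H d hd]; have := I.le d hd
    rw [Equiv.swap_apply_def]; split_ifs <;> omega
  T_of d hd h := by
    have h' : L.H d ≠ 0 := by rwa [Ne, ← W.H_eq_zero ha hb hd]
    rw [W.T, W.H d hd]
    split_ifs <;> simp [I.T_of d hd h']
  of_T v c h := by
    rw [W.T] at h ⊢
    obtain ⟨h1, h2, h3, h4⟩ := I.of_T _ _ h
    refine ⟨h1, h2, ?_, ?_⟩
    · rw [W.H _ h1, h2, h3]; split_ifs <;> simp
    · rintro rfl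
      split_ifs at h4
      · exact h4 ((swap_eq_zero ha hb).2 rfl)
      · exact h4 rfl
  edge d hd := by
    have hd' := Net.dart_tw hd
    rw [W.H_eq_zero ha hb hd, W.H_eq_zero ha hb hd']
    by_cases h1 : L.H d = 0
    · exact Or.inr (Or.inl h1)
    by_cases h2 : L.H (tw d) = 0
    · exact Or.inr (Or.inr h2)
    have e : L.H d = L.H (tw d) := by
      rcases I.edge d hd with h | h | h
      · exact h
      · exact absurd h h1
      · exact absurd h h2
    left
    rw [W.H d hd, W.H _ hd', ← e]
    by_cases h3 : L.H d = a ∨ L.H d = b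
    · have k1 := closed d hd h1 h2 h3
      have k2 := closed (tw d) hd' h2 (by rwa [hd.tw_tw]) (by rwa [← e])
      rw [hd.tw_tw] at k2
      simp only [show (N.V d ∈ S) = (N.V (tw d) ∈ S) from propext ⟨k1, k2⟩]
    · push Not at h3
      rw [Equiv.swap_apply_of_ne_of_ne h3.1 h3.2]; simp
  one := by rw [W.one, I.one]
  inert d hd := by
    rw [W.H_eq_zero ha hb hd, W.H_eq_zero ha hb (Net.dart_tw hd), I.inert d hd]
  ctr d hd := I.ctr d ((W.tok ha hb d).1 hd)
  free d hd := by
    obtain ⟨h1, h2, h3⟩ := I.free d hd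
    unfold Lay.MOk
    rw [W.T, W.M]
    refine ⟨?_, ?_, ?_⟩
    · rw [Equiv.swap_apply_def]; split_ifs <;> omega
    · rw [Equiv.swap_apply_def]; split_ifs <;> omega
    · split_ifs <;> simp [h3]

end

section
variable {N : Net} {X C : ℕ → Prop} {L : Lay}

/-! ### Alternating paths -/

/-- The colors `p`, `q`, `p`, `q`, … -/
def alt (p q k : ℕ) : ℕ := if k % 2 = 0 then p else q

theorem alt_succ (p q k : ℕ) : alt p q (k + 1) = alt q p k := by
  unfold alt; split_ifs <;> omega

theorem alt_mem (p q k : ℕ) : alt p q k = p ∨ alt p q k = q := by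
  unfold alt; split_ifs <;> simp

/-- The `k`-th vertex of the path that starts in `x` and whose edges have the colors
`p`, `q`, `p`, `q`, …; only meaningful as long as these edges exist. -/
def Lay.vt (L : Lay) (N : Net) (x p q : ℕ) : ℕ → ℕ
  | 0 => x
  | k + 1 => N.V (tw (L.T (L.vt N x p q k) (alt p q k)))

/-- The path goes on after its `k`-th vertex. -/
def Lay.on (L : Lay) (N : Net) (x p q k : ℕ) : Prop := L.col (L.vt N x p q k) (alt p q k)

/-- The number of edges of the alternating path that starts in `x` with color `p`. -/
noncomputable def Lay.plen (L : Lay) (N : Net) (x p q : ℕ) : ℕ := sInf {k | ¬ L.on N x p q k}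

theorem Lay.on_of_lt {x p q k : ℕ} (h : k < L.plen N x p q) : L.on N x p q k := by
  simpa using Nat.notMem_of_lt_sInf h

/-- An edge of the path, seen from its later end, leads back. -/
theorem Core.back (I : Core N X C L) {x p q k : ℕ} (h : L.on N x p q k) :
    L.T (L.vt N x p q (k + 1)) (alt p q k) = tw (L.T (L.vt N x p q k) (alt p q k)) ∧
    L.col (L.vt N x p q (k + 1)) (alt p q k) := by
  obtain ⟨h1, h2, h3, h4, h5⟩ := I.col_dart h
  have hd := Net.dart_tw h1
  have := I.col_of hd (by rw [h5]; exact h4) (by rw [h1.tw_tw, h3]; exact h4)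
  rw [h5] at this
  exact this.symm

theorem Core.ne_of_on (_I : Core N X C L) {x p q : ℕ} (hq : ¬ L.col x q) (h : L.on N x p q 0) :
    p ≠ q := by
  rintro rfl; exact hq h

/-- Alternating paths with the same two colors that start at vertices where the second color is missing
do not share darts. -/
theorem Core.path_inj (I : Core N X C L) {p q x x' : ℕ} (hpq : p ≠ q) (hx : ¬ L.col x q)
    (hx' : ¬ L.col x' q) : ∀ k l, (∀ j ≤ k, L.on N x p q j) → (∀ j ≤ l, L.on N x' p q j) →
    L.T (L.vt N x p q k) (alt p q k) = L.T (L.vt N x' p q l) (alt p q l) → k = l ∧ x = x' := by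
  have start : ∀ {x x' : ℕ} (_ : ¬ L.col x q) (l : ℕ), (∀ j ≤ l + 1, L.on N x' p q j) →
      x = L.vt N x' p q (l + 1) → p = alt p q (l + 1) → False := by
    intro x x' hx l hl e e'
    have b := (I.back (hl l (by omega))).2
    rw [← e] at b
    unfold alt at e' b
    split_ifs at e' b <;> first | omega | exact hx b
  intro k
  induction k with
  | zero =>
    intro l hk hl e
    obtain ⟨-, a2, a3, -⟩ := I.col_dart (hk 0 le_rfl)
    obtain ⟨-, b2, b3, -⟩ := I.col_dart (hl l le_rfl)
    rw [e, b2] at a2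
    rw [e, b3] at a3
    cases l with
    | zero => exact ⟨rfl, a2.symm⟩
    | succ l => exact (start hx l hl a2.symm a3.symm).elim
  | succ k ih =>
    intro l hk hl e
    obtain ⟨a1, a2, a3, -⟩ := I.col_dart (hk (k + 1) le_rfl)
    obtain ⟨-, b2, b3, -⟩ := I.col_dart (hl l le_rfl)
    rw [e, b2] at a2
    rw [e, b3] at a3
    cases l with
    | zero => exact (start hx' k hk a2 a3).elim
    | succ l =>
      have e3 : alt p q k = alt p q l := by
        unfold alt at a3 ⊢
        split_ifs at a3 ⊢ <;> omega
      have k1 := (I.back (hk k (by omega))).1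
      have l1 := (I.back (hl l (by omega))).1
      rw [← a2, e3, l1] at k1
      have dk := (I.col_dart (hk k (by omega))).1
      have dl := (I.col_dart (hl l (by omega))).1
      have := congrArg tw k1
      rw [dl.tw_tw, ← e3, dk.tw_tw] at this
      obtain ⟨rfl, h⟩ := ih l (fun j hj => hk j (by omega)) (fun j hj => hl j (by omega))
        (by rw [← e3]; exact this.symm)
      exact ⟨rfl, h⟩

/-- An alternating path whose first vertex lacks the second color visits no vertex twice. If its vertices
`i` and `j + 1` agree, then either it leaves both by the same dart, which `Core.path_inj` excludes, or it
arrives at the second one by the edge by which it has left the first one, so that its vertices `i + 1` and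
`j` agree as well. -/
theorem Core.path_simple (I : Core N X C L) {p q x : ℕ} (hx : ¬ L.col x q) :
    ∀ r i j, j - i ≤ r → i < j → (∀ k < j, L.on N x p q k) →
      L.vt N x p q i ≠ L.vt N x p q j := by
  intro r
  induction r with
  | zero => intro i j h1 h2; omega
  | succ r ih =>
    intro i j h1 h2 hon e
    have hpq := I.ne_of_on hx (hon 0 (by omega))
    obtain ⟨j, rfl⟩ : ∃ j', j = j' + 1 := ⟨j - 1, by omega⟩
    obtain ⟨b1, b2⟩ := I.back (hon j (by omega))
    obtain ⟨d1, d2, d3, -⟩ := I.col_dart (hon i (by omega))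
    by_cases ha : alt p q i = alt p q j
    · rw [← e, ← ha] at b1
      rcases Nat.lt_or_ge i j with hij | hij
      · obtain ⟨f1, f2, -⟩ := I.col_dart (hon j (by omega))
        have b1' := congrArg tw b1
        rw [ha, f1.tw_tw] at b1'
        have e' : L.vt N x p q (i + 1) = L.vt N x p q j := by
          conv_rhs => rw [← f2, ← b1', ← ha]
          rfl
        have : i + 1 ≠ j := by
          rintro rfl
          unfold alt at ha; split_ifs at ha <;> omega
        exact ih (i + 1) j (by omega) (by omega) (fun k hk => hon k (by omega)) e'
      · obtain rfl : i = j := by omega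
        exact tw_ne _ b1.symm
    · have ha' : alt p q i = alt p q (j + 1) := by
        unfold alt at ha ⊢; split_ifs at ha ⊢ <;> omega
      have hj : L.on N x p q (j + 1) := by
        have := hon i (by omega)
        unfold Lay.on at this ⊢
        rwa [← e, ← ha']
      have := I.path_inj hpq hx hx i (j + 1) (fun k hk => hon k (by omega))
        (fun k hk => by
          rcases Nat.lt_or_ge k (j + 1) with h | h
          · exact hon k h
          · rwa [show k = j + 1 by omega]) (by rw [e, ha'])
      omega

/-- The darts that carry the color `c` of their edge. -/
def Lay.colored (L : Lay) (N : Net) (c : ℕ) : Finset ℕ :=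
  N.darts.filter fun d => L.H d = c ∧ L.H (tw d) ≠ 0

theorem Core.path_mem (I : Core N X C L) {x p q k : ℕ} (h : L.on N x p q k) :
    L.T (L.vt N x p q k) (alt p q k) ∈ L.colored N p ∪ L.colored N q := by
  obtain ⟨d1, d2, d3, d4, d5⟩ := I.col_dart h
  have hne : L.H (tw (L.T (L.vt N x p q k) (alt p q k))) ≠ 0 := by rw [d5]; exact d4
  rcases alt_mem p q k with e | e
  · refine Finset.mem_union_left _ ?_
    simp only [Lay.colored, Finset.mem_filter, Net.mem_darts]
    exact ⟨d1, d3.trans e, hne⟩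
  · refine Finset.mem_union_right _ ?_
    simp only [Lay.colored, Finset.mem_filter, Net.mem_darts]
    exact ⟨d1, d3.trans e, hne⟩

/-- Alternating paths are finite. -/
theorem Core.plen_spec (I : Core N X C L) {x p q : ℕ} (hx : ¬ L.col x q) :
    ¬ L.on N x p q (L.plen N x p q) ∧ L.plen N x p q ≤ 2 * N.m := by
  have key : ∀ n, (∀ k < n, L.on N x p q k) → n ≤ 2 * N.m := by
    intro n hn
    rw [← N.card_darts, ← Finset.card_range n]
    refine Finset.card_le_card_of_injOn (fun k => L.T (L.vt N x p q k) (alt p q k)) ?_ ?_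
    · intro k hk
      simpa using (I.col_dart (hn k (by simpa using hk))).1
    · intro k hk l hl e
      have hk : k < n := by simpa using hk
      have hl : l < n := by simpa using hl
      exact (I.path_inj (I.ne_of_on hx (hn 0 (by omega))) hx hx k l
        (fun j hj => hn j (by omega)) (fun j hj => hn j (by omega)) e).1
  have ne : {k | ¬ L.on N x p q k}.Nonempty := by
    by_contra h
    rw [Set.not_nonempty_iff_eq_empty, Set.eq_empty_iff_forall_notMem] at h
    have := key (2 * N.m + 1) fun k _ => by simpa using h k
    omega
  exact ⟨Nat.sInf_mem ne, key _ fun k hk => Lay.on_of_lt hk⟩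

/-- For one pair of colors `p`, `q`, the total length of the paths from all starting points without `q`
is bounded by the number of darts of these colors, as the paths are disjoint. -/
theorem Core.sum_plen_le (I : Core N X C L) (p q : ℕ) (A : Finset (ℕ × ℕ × ℕ))
    (hA : ∀ t ∈ A, t.2 = (p, q) ∧ ¬ L.col t.1 q) :
    ∑ t ∈ A, L.plen N t.1 t.2.1 t.2.2 ≤ (L.colored N p).card + (L.colored N q).card := by
  refine le_trans ?_ (Finset.card_union_le _ _)
  have : ∑ t ∈ A, L.plen N t.1 t.2.1 t.2.2 =
      (A.sigma fun t => Finset.range (L.plen N t.1 t.2.1 t.2.2)).card := by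
    simp [Finset.card_sigma]
  rw [this]
  refine Finset.card_le_card_of_injOn
    (fun s => L.T (L.vt N s.1.1 p q s.2) (alt p q s.2)) ?_ ?_
  · rintro ⟨⟨x, t⟩, k⟩ hs
    simp only [Finset.coe_sigma, Set.mem_sigma_iff, Finset.mem_coe, Finset.mem_range] at hs
    obtain ⟨rfl, h⟩ := hA _ hs.1
    exact I.path_mem (Lay.on_of_lt hs.2)
  · rintro ⟨⟨x, t⟩, k⟩ hs ⟨⟨x', t'⟩, l⟩ hs' e
    simp only [Finset.coe_sigma, Set.mem_sigma_iff, Finset.mem_coe, Finset.mem_range] at hs hs'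
    have h1 := hA _ hs.1
    have h2 := hA _ hs'.1
    obtain ⟨h1e, h1⟩ := h1
    obtain ⟨h2e, h2⟩ := h2
    simp only at h1e h2e h1 h2
    subst h1e h2e
    have on1 : ∀ j ≤ k, L.on N x p q j := fun j hj => Lay.on_of_lt (lt_of_le_of_lt hj hs.2)
    have on2 : ∀ j ≤ l, L.on N x' p q j := fun j hj => Lay.on_of_lt (lt_of_le_of_lt hj hs'.2)
    obtain ⟨rfl, rfl⟩ := I.path_inj (I.ne_of_on h1 (on1 0 (by omega))) h1 h2 k l on1 on2 e
    rfl

theorem Core.sum_colored_le (_I : Core N X C L) :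
    ∑ c ∈ Finset.Icc 1 N.K, (L.colored N c).card ≤ 2 * N.m := by
  rw [← N.card_darts, ← Finset.card_biUnion]
  · exact Finset.card_le_card fun d hd => by
      simp only [Finset.mem_biUnion, Lay.colored, Finset.mem_filter] at hd
      obtain ⟨_, _, h, _⟩ := hd
      exact h
  · intro c _ c' _ hne
    rw [Function.onFun, Finset.disjoint_left]
    intro d hd hd'
    simp only [Lay.colored, Finset.mem_filter] at hd hd'
    exact hne (hd.2.1.symm.trans hd'.2.1)

/-- The total length of the alternating paths, over all starting points and pairs of colors. -/
theorem Core.sum_plen_total (I : Core N X C L) (A : Finset (ℕ × ℕ × ℕ))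
    (hA : ∀ t ∈ A, t.2.1 ∈ Finset.Icc 1 N.K ∧ t.2.2 ∈ Finset.Icc 1 N.K ∧ ¬ L.col t.1 t.2.2) :
    ∑ t ∈ A, L.plen N t.1 t.2.1 t.2.2 ≤ 4 * N.m * N.K := by
  classical
  rw [← Finset.sum_fiberwise_of_maps_to
    (t := Finset.Icc 1 N.K ×ˢ Finset.Icc 1 N.K) (g := fun t => t.2)
    (fun t ht => Finset.mem_product.2 ⟨(hA t ht).1, (hA t ht).2.1⟩)]
  calc _ ≤ ∑ r ∈ Finset.Icc 1 N.K ×ˢ Finset.Icc 1 N.K,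
        ((L.colored N r.1).card + (L.colored N r.2).card) := by
        refine Finset.sum_le_sum fun r _ => I.sum_plen_le r.1 r.2 _ fun t ht => ?_
        simp only [Finset.mem_filter] at ht
        exact ⟨ht.2, ht.2 ▸ (hA t ht.1).2.2⟩
    _ ≤ _ := by
        have := I.sum_colored_le
        rw [Finset.sum_product]
        simp only [Finset.sum_add_distrib, Finset.sum_const, Nat.card_Icc, smul_eq_mul,
          ← Finset.mul_sum]
        simp only [Nat.add_sub_cancel]
        nlinarith

end

section
variable {N : Net} {X C : ℕ → Prop} {L L' : Lay}

/-- The vertices of the alternating path up to its `k`-th vertex. -/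
def Lay.pathSet (L : Lay) (N : Net) (x p q k : ℕ) : Finset ℕ :=
  (Finset.range (k + 1)).image (L.vt N x p q)

theorem Lay.mem_pathSet {x p q k v : ℕ} :
    v ∈ L.pathSet N x p q k ↔ ∃ j ≤ k, L.vt N x p q j = v := by
  simp [Lay.pathSet]

/-- `L'` arises from `L` by exchanging the colors on the alternating path from `x`. -/
def Flipped (N : Net) (L L' : Lay) (x p q : ℕ) : Prop :=
  Swapped N L L' (L.pathSet N x p q (L.plen N x p q)) p q

/-- A maximal alternating path is a connected component of the subgraph of its two colors, if its first
vertex lacks the second color. -/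
theorem Core.pathSet_closed (I : Core N X C L) {x p q : ℕ} (hx : ¬ L.col x q) (d : ℕ)
    (hd : N.dart d) (h : L.H d ≠ 0) (h' : L.H (tw d) ≠ 0) (hc : L.H d = p ∨ L.H d = q)
    (hS : N.V d ∈ L.pathSet N x p q (L.plen N x p q)) :
    N.V (tw d) ∈ L.pathSet N x p q (L.plen N x p q) := by
  rw [Lay.mem_pathSet] at hS ⊢
  obtain ⟨j, hj, e⟩ := hS
  obtain ⟨c1, c2⟩ := I.col_of hd h h'
  rw [← e] at c1 c2
  by_cases hn : L.H d = alt p q j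
  · have hj' : j < L.plen N x p q := by
      refine lt_of_le_of_ne hj fun e' => (I.plen_spec (p := p) hx).1 ?_
      rw [← e']; unfold Lay.on; rw [← hn]; exact c1
    refine ⟨j + 1, hj', ?_⟩
    show N.V (tw (L.T (L.vt N x p q j) (alt p q j))) = _
    rw [← hn, c2]
  · cases j with
    | zero =>
      have : L.H d = q := hc.resolve_left hn
      rw [this] at c1
      exact (hx c1).elim
    | succ j =>
      have on := Lay.on_of_lt (N := N) (L := L) (show j < L.plen N x p q by omega)
      have : L.H d = alt p q j := by
        rw [alt_succ] at hn
        unfold alt at hn ⊢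
        split_ifs at hn ⊢ <;> tauto
      rw [this, (I.back on).1] at c2
      obtain ⟨d1, d2, -⟩ := I.col_dart on
      refine ⟨j, by omega, ?_⟩
      rw [← c2, d1.tw_tw, d2]

/-- Inner vertices of an alternating path have both colors. -/
theorem Core.pathSet_inner (I : Core N X C L) {x p q v : ℕ}
    (hS : v ∈ L.pathSet N x p q (L.plen N x p q)) (hvx : v ≠ x)
    (hvz : v ≠ L.vt N x p q (L.plen N x p q)) : L.col v p ∧ L.col v q := by
  rw [Lay.mem_pathSet] at hS
  obtain ⟨j, hj, rfl⟩ := hS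
  cases j with
  | zero => exact (hvx rfl).elim
  | succ j =>
    have hj' : j + 1 < L.plen N x p q := lt_of_le_of_ne hj fun e => hvz (by rw [e])
    have on1 : L.col _ _ := Lay.on_of_lt (N := N) (L := L) hj'
    have on2 := (I.back (Lay.on_of_lt (N := N) (L := L) (show j < L.plen N x p q by omega))).2
    rw [alt_succ] at on1
    unfold alt at on1 on2
    split_ifs at on1 on2
    · exact ⟨on2, on1⟩
    · exact ⟨on1, on2⟩

theorem Flipped.inv {x p q : ℕ} (F : Flipped N L L' x p q) (I : Inv N X C L) (hx : ¬ L.col x q)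
    (hp : 1 ≤ p ∧ p ≤ N.K) (hq : 1 ≤ q ∧ q ≤ N.K) : Inv N X C L' :=
  Swapped.inv I F (by omega) (by omega) hp.2 hq.2 (I.pathSet_closed hx)

theorem Lay.start_mem {x p q k : ℕ} : x ∈ L.pathSet N x p q k :=
  Lay.mem_pathSet.2 ⟨0, by omega, rfl⟩

/-- A vertex on the path without one of the two colors is one of its two ends. -/
theorem Core.pathSet_end (I : Core N X C L) {x p q v : ℕ}
    (hS : v ∈ L.pathSet N x p q (L.plen N x p q)) (h : ¬ L.col v p ∨ ¬ L.col v q) :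
    v = x ∨ v = L.vt N x p q (L.plen N x p q) := by
  by_contra! hv
  have := I.pathSet_inner hS hv.1 hv.2
  tauto

/-- The label of a token is missing at its leaf. -/
theorem Lay.tok.not_col {h : ℕ} (ht : L.tok N h) (I : Core N X C L) :
    ¬ L.col (N.V h) (L.H h) ∧ L.T (N.V h) (L.H h) = h := by
  have := I.T_of h ht.1 ht.2.1
  refine ⟨?_, this⟩
  rw [Lay.col, this]
  simpa using ht.2.2

/-- Only tokens with their leaf at an end of the path change their label. -/
theorem Flipped.labels {x p q : ℕ} (F : Flipped N L L' x p q) (I : Inv N X C L) {d : ℕ}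
    (hd : L.tok N d) (hne : L'.H d ≠ L.H d) :
    d ∈ ({L.T x p, L.T x q, L.T (L.vt N x p q (L.plen N x p q)) p,
      L.T (L.vt N x p q (L.plen N x p q)) q} : Finset ℕ) := by
  obtain ⟨n1, n2⟩ := hd.not_col I.toCore
  rw [F.H d hd.1] at hne
  split_ifs at hne with hS
  · have hl : L.H d = p ∨ L.H d = q := by
      by_contra! h
      exact hne (Equiv.swap_apply_of_ne_of_ne h.1 h.2)
    have hv := I.pathSet_end hS (by rcases hl with e | e <;> rw [e] at n1 <;> tauto)
    simp only [Finset.mem_insert, Finset.mem_singleton]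
    rcases hl with e | e <;> rcases hv with e' | e' <;> rw [e, e'] at n2 <;> simp [n2]
  · exact (hne rfl).elim

/-- If the tokens `h` and `f` with the same center `u` have the same label `c`, and one exchanges `c` with a
color `α` missing at `u` on the path from the leaf of `h`, then afterwards the label of one of them is missing
at `u`: if `u` is not on the path, this is the new label `α` of `h`; otherwise the path ends in `u`, the leaf
of `f` is not on it, and `c` is now missing at `u`. -/
theorem Flipped.fan {h f α : ℕ} (hN : N.Good) (I : Inv N X C L) (hh : L.tok N h) (hf : L.tok N f)
    (hfh : f ≠ h) (hu : N.V (tw f) = N.V (tw h)) (hl : L.H f = L.H h)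
    (hα : ¬ L.col (N.V (tw h)) α) (hα0 : α ≠ 0)
    (F : Flipped N L L' (N.V h) α (L.H h)) :
    ¬ L'.col (N.V (tw h)) (L'.H h) ∨ ¬ L'.col (N.V (tw h)) (L'.H f) := by
  have hc0 := hh.2.1
  have c := fun v a => Swapped.col (v := v) (c := a) I.toCore F hα0 hc0
  have nh := (hh.not_col I.toCore).1
  have nf := (hf.not_col I.toCore).1
  rw [hl] at nf
  by_cases hS : N.V (tw h) ∈ L.pathSet N (N.V h) α (L.H h) (L.plen N (N.V h) α (L.H h))
  · right
    have hz := (I.pathSet_end hS (Or.inl hα)).resolve_left (hN.ne h hh.1).symm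
    have hfS : N.V f ∉ L.pathSet N (N.V h) α (L.H h) (L.plen N (N.V h) α (L.H h)) := by
      intro hfS
      rcases I.pathSet_end hfS (Or.inr nf) with e | e
      · have := hN.simple (tw f) (tw h) (Net.dart_tw hf.1) (Net.dart_tw hh.1) hu
          (by rw [hf.1.tw_tw, hh.1.tw_tw, e])
        exact hfh (by rw [← hf.1.tw_tw, this, hh.1.tw_tw])
      · exact hN.ne f hf.1 (by rw [e, ← hz, hu])
    rw [c, if_pos hS, F.H f hf.1, if_neg hfS, hl]
    simpa using hα
  · left
    rw [c, if_neg hS, F.H h hh.1, if_pos Lay.start_mem]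
    simpa using hα

/-! ### Walks of a token around its center -/

/-- The colors `s 0, …, s n` are distinct, and a token at `u` with label `s 0` visits them in this
order when it moves around `u`. -/
def IsWalk (N : Net) (L : Lay) (u : ℕ) (s : ℕ → ℕ) (n : ℕ) : Prop :=
  (∀ i < n, L.col u (s i) ∧ L.lk N u (s i) = s (i + 1)) ∧ ∀ i ≤ n, ∀ j ≤ n, s i = s j → i = j

/-- A walk visits distinct colors, so it has at most `K` steps. -/
theorem IsWalk.length_le {u n : ℕ} {s : ℕ → ℕ} (I : Core N X C L) (h : IsWalk N L u s n) :
    n ≤ N.K := by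
  have := Finset.card_le_card_of_injOn (s := Finset.range n) (t := Finset.Icc 1 N.K) s
    (fun i hi => by
      have := I.col_le (h.1 i (by simpa using hi)).1
      simpa using this) (fun i hi j hj e => h.2 i (by
      have : i < n := by simpa using hi
      omega) j (by
      have : j < n := by simpa using hj
      omega) e)
  simpa using this

/-- After the first step of the walk, the rest of it is still a walk. -/
theorem IsWalk.tail {u n c : ℕ} {s : ℕ → ℕ} (h : IsWalk N L u s (n + 1)) (hs : s 0 = c)
    (hL : ∀ a, a ≠ c → (L'.col u a ↔ L.col u a) ∧ (L.col u a → L'.lk N u a = L.lk N u a)) :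
    IsWalk N L' u (fun i => s (i + 1)) n := by
  refine ⟨fun i hi => ?_, fun i hi j hj e => ?_⟩
  · have hne : s (i + 1) ≠ c := fun e => by
      have := h.2 (i + 1) (by omega) 0 (by omega) (by rw [e, hs])
      omega
    have h1 := h.1 (i + 1) (by omega)
    have h2 := hL _ hne
    exact ⟨h2.1.2 h1.1, (h2.2 h1.1).trans h1.2⟩
  · have := h.2 (i + 1) (by omega) (j + 1) (by omega) e
    omega

/-- If the walk of the token `h` around its center `u` gets into a loop, which it enters at the color `c`,
and one exchanges `c` with a color `α` missing at `u` on the path from `u`, then afterwards the walk ends in the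
color `c`, which is now missing at `u`. Two leaves have `c` as their free color, or as the label of `h`: the one
from which the walk enters the loop, and the one at which the loop closes. The path has only one end apart
from `u`, so it spoils at most one of them. If this is the first one, then the walk enters the loop by `α`
instead, follows it, and gets to `c` at its end. -/
theorem Flipped.loop {h α n j : ℕ} {s : ℕ → ℕ} (hN : N.Good) (I : Inv N X C L) (hh : L.tok N h)
    (hα : ¬ L.col (N.V (tw h)) α) (hα0 : α ≠ 0)
    (hs : IsWalk N L (N.V (tw h)) s n) (h0 : s 0 = L.H h) (hn : L.col (N.V (tw h)) (s n))
    (hj : j ≤ n) (hloop : L.lk N (N.V (tw h)) (s n) = s j)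
    (F : Flipped N L L' (N.V (tw h)) (s j) α) :
    ¬ L'.col (N.V (tw h)) (s j) ∧
    ∃ s' n', IsWalk N L' (N.V (tw h)) s' n' ∧ s' 0 = L'.H h ∧ s' n' = s j := by
  have hV := hN.ne h hh.1
  generalize hu : N.V (tw h) = u at *
  have allcol : ∀ i ≤ n, L.col u (s i) := fun i hi => by
    rcases Nat.lt_or_ge i n with h | h
    · exact (hs.1 i h).1
    · rwa [show i = n by omega]
  have c0 : s j ≠ 0 := (I.col_dart (allcol j hj)).2.2.2.1
  have c := fun v a => Swapped.col (v := v) (c := a) I.toCore F c0 hα0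
  have sα : ∀ i ≤ n, s i ≠ α := fun i hi e => hα (e ▸ allcol i hi)
  have uS : u ∈ L.pathSet N u (s j) α (L.plen N u (s j) α) := Lay.start_mem
  generalize hS : L.pathSet N u (s j) α (L.plen N u (s j) α) = S at *
  generalize hz : L.vt N u (s j) α (L.plen N u (s j) α) = z at *
  have hend : ∀ v ∈ S, ¬ L.col v (s j) → v = u ∨ v = z := fun v hv hc => by
    rw [← hS] at hv; rw [← hz]; exact I.pathSet_end hv (Or.inl hc)
  have hF : Swapped N L L' S (s j) α := by rw [← hS]; exact F
  -- the leaf of a colored edge at `u`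
  have leaf : ∀ a, L.col u a → N.V (tw (L.T u a)) ≠ u ∧ N.dart (tw (L.T u a)) := fun a ha => by
    obtain ⟨d1, d2, -⟩ := I.col_dart ha
    exact ⟨fun e => hN.ne _ d1 (by rw [d2, e]), Net.dart_tw d1⟩
  have leaf_inj : ∀ a b, L.col u a → L.col u b → N.V (tw (L.T u a)) = N.V (tw (L.T u b)) →
      a = b := fun a b ha hb e => by
    obtain ⟨a1, a2, a3, -⟩ := I.col_dart ha
    obtain ⟨b1, b2, b3, -⟩ := I.col_dart hb
    have := hN.simple _ _ a1 b1 (by rw [a2, b2]) e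
    rw [← a3, ← b3, this]
  have nsw : ¬ L'.col u (s j) := by
    rw [c, if_pos uS]; simpa using hα
  refine ⟨nsw, ?_⟩
  -- the function `M` at the leaves
  have Mleaf : ∀ a, L.col u a → L.lk N u a ≠ α → (L.lk N u a = s j → N.V (tw (L.T u a)) ≠ z) →
      L'.M (N.V (tw (L.T u a))) = L.lk N u a := by
    intro a ha h1 h2
    obtain ⟨l1, l2⟩ := leaf a ha
    rw [hF.M]
    split_ifs with hw
    · rw [show L.M (N.V (tw (L.T u a))) = L.lk N u a from rfl]
      by_cases e : L.lk N u a = s j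
      · exfalso
        have hfree := (I.free _ l2).2.2
        rw [show L.M (N.V (tw (L.T u a))) = L.lk N u a from rfl, e] at hfree
        rcases hend _ hw (fun hc => I.T_ne hc hfree) with h | h
        · exact l1 h
        · exact h2 e h
      · exact Equiv.swap_apply_of_ne_of_ne e h1
    · rfl
  have Tu : ∀ a, a ≠ s j → a ≠ α → L'.T u a = L.T u a := fun a h1 h2 => by
    rw [hF.T, if_pos uS, Equiv.swap_apply_of_ne_of_ne h1 h2]
  have Tα : L'.T u α = L.T u (s j) := by rw [hF.T, if_pos uS]; simp
  have lk' : ∀ i ≤ n, i ≠ j → (L.lk N u (s i) = s j → N.V (tw (L.T u (s i))) ≠ z) →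
      L.lk N u (s i) ≠ α → L'.col u (s i) ∧ L'.lk N u (s i) = L.lk N u (s i) := by
    intro i hi hij h1 h2
    have n1 : s i ≠ s j := fun e => hij (hs.2 i hi j hj e)
    refine ⟨?_, ?_⟩
    · rw [c, if_pos uS, Equiv.swap_apply_of_ne_of_ne n1 (sα i hi)]; exact allcol i hi
    · rw [Lay.lk, Tu _ n1 (sα i hi)]
      exact Mleaf _ (allcol i hi) h2 h1
  have lkne : ∀ i ≤ n, L.lk N u (s i) ≠ α := by
    intro i hi
    rcases Nat.lt_or_ge i n with h | h
    · rw [(hs.1 i h).2]; exact sα _ h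
    · rw [show i = n by omega, hloop]; exact sα _ hj
  have colα : L'.col u α := by rw [c, if_pos uS]; simpa using allcol j hj
  have lkα : (L.lk N u (s j) = s j → N.V (tw (L.T u (s j))) ≠ z) →
      L'.lk N u α = L.lk N u (s j) := by
    intro h1
    rw [Lay.lk, Tα]
    exact Mleaf _ (allcol j hj) (lkne j hj) h1
  -- the path does not end at the leaf from which the walk enters the loop
  by_cases hcase : (j = 0 → L'.H h = s j) ∧
      (∀ i, i + 1 = j → N.V (tw (L.T u (s i))) ≠ z)
  · refine ⟨s, j, ⟨fun i hi => ?_, fun i hi k hk => hs.2 i (by omega) k (by omega)⟩, ?_, rfl⟩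
    · have hi' := (hs.1 i (by omega)).2
      have := lk' i (by omega) (by omega) (fun e => hcase.2 i (by
        rw [hi'] at e
        exact hs.2 _ (by omega) _ hj e)) (lkne i (by omega))
      rwa [hi'] at this
    · by_cases hj0 : j = 0
      · rw [hcase.1 hj0, hj0]
      · rw [h0, hF.H h hh.1]
        split_ifs
        · rw [← h0, Equiv.swap_apply_of_ne_of_ne _ (sα 0 (by omega))]
          exact fun e => hj0 (hs.2 0 (by omega) j hj e).symm
        · rfl
  · -- it does end there, hence at no other leaf that leads to `c`
    have hz' : ∀ a, L.col u a → (∀ i, i + 1 = j → a ≠ s i) → N.V (tw (L.T u a)) ≠ z := by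
      intro a ha hai e
      apply hcase
      refine ⟨fun hj0 => ?_, fun i hi e' => ?_⟩
      · rw [hF.H h hh.1]
        split_ifs with hS
        · exfalso
          have := hend _ hS (by
            have := (hh.not_col I.toCore).1
            rwa [← h0, ← hj0] at this)
          rcases this with e' | e'
          · exact hV e'
          · obtain ⟨a1, a2, a3, a4, a5⟩ := I.col_dart ha
            have := hN.simple (tw h) _ (Net.dart_tw hh.1) a1 (by rw [hu, a2])
              (by rw [hh.1.tw_tw, e', e])
            rw [← this] at a3
            exact a4 (a3.symm.trans hh.2.2)
        · rw [← h0, hj0]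
      · exact hai i hi (leaf_inj _ _ ha (allcol i (by omega)) (by rw [e, e']))
    have key : L'.lk N u (if j = n then α else s n) = s j := by
      split_ifs with hjn
      · rw [lkα, hjn, hloop, hjn]
        exact fun _ => hz' _ (allcol j hj) fun i hi e => by
          have := hs.2 j hj i (by omega) e; omega
      · rw [(lk' n le_rfl (Ne.symm hjn) (fun _ => hz' _ hn fun i hi e => by
          have := hs.2 n le_rfl i (by omega) e; omega) (lkne n le_rfl)).2, hloop]
    have nc : ∀ i, i + 1 ≠ j → i < n → s (i + 1) ≠ s j := fun i hi hin e =>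
      hi (hs.2 _ hin _ hj e)
    refine ⟨fun i => if i = j then α else if i = n + 1 then s j else s i, n + 1,
      ⟨fun i hi => ?_, fun i hi k hk e => ?_⟩, ?_, ?_⟩
    · by_cases hij : i = j
      · subst hij
        simp only [if_true, colα, true_and]
        rcases Nat.lt_or_ge i n with hin | hin
        · rw [lkα]
          · rw [(hs.1 i hin).2]
            simp [show i ≠ n by omega]
          · rw [(hs.1 i hin).2]
            exact fun e => (nc i (by omega) hin e).elim
        · obtain rfl : i = n := by omega
          simp only [if_true] at key
          simp [key]
      · simp only [hij, if_false, show i ≠ n + 1 by omega]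
        by_cases hi1 : i + 1 = j
        · -- the step into the loop, which now leads to `α`
          have hx : L'.col u (s i) := by
            rw [c, if_pos uS, Equiv.swap_apply_of_ne_of_ne _ (sα i (by omega))]
            · exact allcol i (by omega)
            · exact fun e => hij (hs.2 i (by omega) j hj e)
          have hlk : L.lk N u (s i) = s j := by rw [(hs.1 i (by omega)).2, hi1]
          have hzz : N.V (tw (L.T u (s i))) = z := by
            by_contra hne
            exact hcase ⟨fun h => by omega, fun i' hi' => by rwa [show i' = i by omega]⟩
          refine ⟨hx, ?_⟩
          simp only [hi1, if_true]
          have n1 : s i ≠ s j := fun e => hij (hs.2 i (by omega) j hj e)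
          rw [Lay.lk, Tu _ n1 (sα i (by omega)), hF.M]
          rw [show L.M (N.V (tw (L.T u (s i)))) = L.lk N u (s i) from rfl, hlk]
          rw [if_pos]
          · simp
          · rw [hzz, ← hz, ← hS]
            exact Lay.mem_pathSet.2 ⟨_, le_rfl, rfl⟩
        · rcases Nat.lt_or_ge i n with hin | hin
          · have := lk' i (by omega) hij (fun e => by
              rw [(hs.1 i hin).2] at e
              exact (nc i hi1 hin e).elim) (lkne i (by omega))
            rw [(hs.1 i hin).2] at this
            simpa [hi1, show i ≠ n by omega] using this
          · obtain rfl : i = n := by omega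
            simp only [show ¬ j = i from fun e => hij e.symm, if_false] at key
            refine ⟨?_, ?_⟩
            · rw [c, if_pos uS, Equiv.swap_apply_of_ne_of_ne _ (sα i (by omega))]
              · exact hn
              · exact fun e => hij (hs.2 i (by omega) j hj e)
            · simp [key, hi1]
    · dsimp only at e
      split_ifs at e with e1 e2 e3 e4 e5 e6 e7 e8
      · omega
      · exact (sα j hj e.symm).elim
      · exact (sα k (by omega) e.symm).elim
      · exact (sα j hj e).elim
      · omega
      · have := hs.2 j hj k (by omega) e; omega
      · exact (sα i (by omega) e).elim
      · have := hs.2 i (by omega) j hj e; omega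
      · exact hs.2 i (by omega) k (by omega) e
    · by_cases hj0 : j = 0
      · subst hj0
        simp only [if_true]
        have hh' : L'.H h ≠ s 0 := fun e => hcase ⟨fun _ => e, fun i hi => by omega⟩
        rw [hF.H h hh.1] at hh' ⊢
        split_ifs at hh' ⊢
        · rw [← h0]; simp
        · exact (hh' h0.symm).elim
      · simp only [show ¬ 0 = j from fun e => hj0 e.symm, if_false]
        rw [if_neg (by omega), h0, hF.H h hh.1]
        split_ifs
        · rw [← h0, Equiv.swap_apply_of_ne_of_ne _ (sα 0 (by omega))]
          exact fun e => hj0 (hs.2 0 (by omega) j hj e).symm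
        · rfl
    · simp [show n + 1 ≠ j by omega]

/-! ### Counting tokens and classes -/

/-- The tokens. -/
def Lay.toks (L : Lay) (N : Net) : Finset ℕ := N.darts.filter (L.tok N)

@[simp] theorem Lay.mem_toks {d : ℕ} : d ∈ L.toks N ↔ L.tok N d := by
  simp only [Lay.toks, Finset.mem_filter, Net.mem_darts, and_iff_right_iff_imp]
  exact fun h => h.1

/-- The pair of the center and the label of a token. -/
def Lay.cl (L : Lay) (N : Net) (d : ℕ) : ℕ × ℕ := (N.V (tw d), L.H d)

/-- The number of classes of tokens: tokens with the same center and the same label form a class. -/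
def Lay.ncls (L : Lay) (N : Net) : ℕ := ((L.toks N).image (L.cl N)).card

/-- If only the darts in `E` get a new label, at most `E.card` new classes appear. -/
theorem ncls_le (E : Finset ℕ)
    (h : ∀ d, L'.tok N d → d ∈ E ∨ (L.tok N d ∧ L'.H d = L.H d)) :
    L'.ncls N ≤ L.ncls N + E.card := by
  have : (L'.toks N).image (L'.cl N) ⊆ (L.toks N).image (L.cl N) ∪ E.image (L'.cl N) := by
    intro c hc
    simp only [Finset.mem_image, Lay.mem_toks, Finset.mem_union] at hc ⊢
    obtain ⟨d, hd, rfl⟩ := hc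
    rcases h d hd with h | ⟨h1, h2⟩
    · exact Or.inr ⟨d, h, rfl⟩
    · exact Or.inl ⟨d, h1, by simp [Lay.cl, h2]⟩
  calc _ ≤ _ := Finset.card_le_card this
    _ ≤ _ := Finset.card_union_le _ _
    _ ≤ _ := by unfold Lay.ncls; gcongr; exact Finset.card_image_le

/-- The only token of its class joins another class. -/
theorem Moved.ncls_lt {y y' : ℕ} (hy : L.tok N y)
    (single : ∀ d, L.tok N d → N.V (tw d) = N.V (tw y) → L.H d = L.H y → d = y)
    (m : Moved N L y L' y')
    (hjoin : ∃ d, L'.tok N d ∧ d ≠ y' ∧ L'.cl N d = L'.cl N y') : L'.ncls N + 1 ≤ L.ncls N := by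
  have h1 : (L'.toks N).image (L'.cl N) ⊆ ((L.toks N).image (L.cl N)).erase (L.cl N y) := by
    have old : ∀ d, L'.tok N d → d ≠ y' →
        L'.cl N d ∈ ((L.toks N).image (L.cl N)).erase (L.cl N y) := by
      intro d hd hdy
      have h2 := ((m.toks d).1 hd).resolve_left hdy
      have h3 : L'.cl N d = L.cl N d := by simp [Lay.cl, (m.labels d h2.1 h2.2).1]
      rw [h3]
      simp only [Finset.mem_erase, Finset.mem_image, Lay.mem_toks]
      refine ⟨fun e => h2.2 (single d h2.1 ?_ ?_), d, h2.1, rfl⟩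
      · exact (Prod.ext_iff.1 e).1
      · exact (Prod.ext_iff.1 e).2
    intro c hc
    simp only [Finset.mem_image, Lay.mem_toks] at hc
    obtain ⟨d, hd, rfl⟩ := hc
    by_cases hdy : d = y'
    · obtain ⟨e, he, hne, hcl⟩ := hjoin
      rw [hdy, ← hcl]
      exact old e he hne
    · exact old d hd hdy
  have h2 : L.cl N y ∈ (L.toks N).image (L.cl N) :=
    Finset.mem_image_of_mem _ (Lay.mem_toks.2 hy)
  have := Finset.card_le_card h1
  rw [Finset.card_erase_of_mem h2] at this
  have := Finset.card_pos.2 ⟨_, h2⟩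
  unfold Lay.ncls
  omega

/-- Moving the only token of its class does not increase the number of classes. -/
theorem Moved.ncls_le {y y' : ℕ} (hy : L.tok N y)
    (single : ∀ d, L.tok N d → N.V (tw d) = N.V (tw y) → L.H d = L.H y → d = y)
    (m : Moved N L y L' y') : L'.ncls N ≤ L.ncls N := by
  have h1 : (L'.toks N).image (L'.cl N) ⊆
      insert (L'.cl N y') (((L.toks N).image (L.cl N)).erase (L.cl N y)) := by
    intro c hc
    simp only [Finset.mem_image, Lay.mem_toks] at hc
    obtain ⟨d, hd, rfl⟩ := hc
    by_cases hdy : d = y'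
    · rw [hdy]; exact Finset.mem_insert_self _ _
    · have h2 := ((m.toks d).1 hd).resolve_left hdy
      have h3 : L'.cl N d = L.cl N d := by simp [Lay.cl, (m.labels d h2.1 h2.2).1]
      rw [h3]
      simp only [Finset.mem_insert, Finset.mem_erase, Finset.mem_image, Lay.mem_toks]
      refine Or.inr ⟨fun e => h2.2 (single d h2.1 ?_ ?_), d, h2.1, rfl⟩
      · exact (Prod.ext_iff.1 e).1
      · exact (Prod.ext_iff.1 e).2
  have h2 : L.cl N y ∈ (L.toks N).image (L.cl N) :=
    Finset.mem_image_of_mem _ (Lay.mem_toks.2 hy)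
  have := Finset.card_le_card h1
  have h3 := Finset.card_insert_le (L'.cl N y') (((L.toks N).image (L.cl N)).erase (L.cl N y))
  rw [Finset.card_erase_of_mem h2] at h3
  have := Finset.card_pos.2 ⟨_, h2⟩
  unfold Lay.ncls
  omega

theorem Moved.refl {y : ℕ} (hy : L.tok N y) : Moved N L y L y :=
  ⟨hy, rfl, fun d => by
    by_cases h : d = y
    · simp [h, hy]
    · simp [h], fun _ _ h => ⟨rfl, h⟩⟩

theorem Moved.trans {L'' : Lay} {y y' y'' : ℕ} (m : Moved N L y L' y') (m' : Moved N L' y' L'' y'') :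
    Moved N L y L'' y'' := by
  refine ⟨m'.tok', m'.ctr.trans m.ctr, fun d => ?_, fun d hd hdy => ?_⟩
  · rw [m'.toks, m.toks]
    constructor
    · rintro (h | ⟨h | h, h'⟩)
      · exact Or.inl h
      · exact (h' h).elim
      · exact Or.inr h
    · rintro (h | h)
      · exact Or.inl h
      · exact Or.inr ⟨Or.inr h, (m.labels d h.1 h.2).2⟩
  · have h1 := m.labels d hd hdy
    have h2 := m'.labels d ((m.toks d).2 (Or.inr ⟨hd, hdy⟩)) h1.2
    exact ⟨h2.1.trans h1.1, h2.2⟩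

end

/-! ### Programs

The programs use the following memory cells. The first four arrays and the first two registers are the
input.

* arrays `0`, `1`, `2`, `3`: the two ends and the color of every edge, and the characteristic vector of `U`
* arrays `4`, `5`: the end vertex and the label of every dart
* array `6`: the dart with a given label at a given vertex, in a two-dimensional table
* array `7`: the free color `M v` of every vertex `v`
* arrays `8`, `9`: the degree and the darts of every vertex
* arrays `10`, `11`: the list of tokens, and the position of every token in it
* array `12`: the marks of the colors at the center under consideration
* array `13`: the list of the colors missing at that center
* array `14`: the bits that control the selection of the edges to be colored
* registers `1`, `2`, `3`: the numbers of edges, of colors, and of tokens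
* registers `6`, `7`: the token chosen at random, and its center
* registers `8`, `9`: the number of colors missing at the center, and the one chosen at random
* register `10`: a color on the loop of the chosen token
* register `11`: another token with the same center and label, or `0`
* registers `12`, `13`: the token that moves, and the color that it moves to
* registers `14`, `15`: the outcome of the search, and whether the present walk goes on
* registers `18`, `19`, `20`, `21`: the vertex, the two colors and the next dart of a path that is flipped
* register `31`: a random number

During preprocessing and output, registers `5` and `6` hold the ends of the present edge, and register `10`
is a counter for darts. Registers `4`, `16`, `17` and `22` to `30` are auxiliary. -/

/-- Sequential composition of programs. -/
infixr:60 " ⨾ " => Prog.seq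
/-- Assignment to a register. -/
infix:61 " ≔ " => Prog.assign

@[simp] theorem eval_zero (σ : Mem) : (0 : Expr).eval σ = 0 := rfl
@[simp] theorem eval_one (σ : Mem) : (1 : Expr).eval σ = 1 := rfl

/-- The address of the entry `(v, c)` of a two-dimensional array. -/
def ix (v c : ℕ) : ℕ := (v + c) * (v + c) + v

theorem ix_inj {v c v' c' : ℕ} : ix v c = ix v' c' ↔ v = v' ∧ c = c' := by
  constructor
  · intro h
    unfold ix at h
    have : v + c = v' + c' := by
      rcases Nat.lt_trichotomy (v + c) (v' + c') with hlt | heq | hlt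
      · nlinarith
      · exact heq
      · nlinarith
    rw [this] at h
    omega
  · rintro ⟨rfl, rfl⟩; rfl

/-- The expression for `ix`. -/
def ixE (v c : Expr) : Expr := (v + c) * (v + c) + v
/-- The expression for the other dart of an edge. -/
def twE (d : Expr) : Expr := (d + 1) - 2 * (d % 2)
/-- The contents of register `x`. -/
abbrev rg (x : ℕ) : Expr := .reg x
/-- Equality test. -/
abbrev eqE (e f : Expr) : Expr := .bin .eq e f
/-- Comparison. -/
abbrev ltE (e f : Expr) : Expr := .bin .lt e f
/-- The end vertex of a dart. -/
abbrev vE (d : Expr) : Expr := .get 4 d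
/-- The label of a dart. -/
abbrev hE (d : Expr) : Expr := .get 5 d
/-- The dart with a given label at a given vertex. -/
abbrev tE (v c : Expr) : Expr := .get 6 (ixE v c)
/-- The free color at a vertex. -/
abbrev mE (v : Expr) : Expr := .get 7 v

@[simp] theorem eval_ixE (σ : Mem) (v c : Expr) : (ixE v c).eval σ = ix (v.eval σ) (c.eval σ) := rfl
@[simp] theorem eval_twE (σ : Mem) (d : Expr) : (twE d).eval σ = tw (d.eval σ) := rfl

/-- The labeling that is stored in the memory. -/
def lay (σ : Mem) : Lay where
  H := σ.arr 5
  T v c := σ.arr 6 (ix v c)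
  M := σ.arr 7

theorem upd_ix (A : ℕ → ℕ) (v c x : ℕ) : (fun v' c' => Function.update A (ix v c) x (ix v' c')) =
    upd (fun v' c' => A (ix v' c')) v c x := by
  funext v' c'
  simp only [Function.update_apply, ix_inj, upd]

@[simp] theorem lay_setReg (σ : Mem) (x v : ℕ) : lay (σ.setReg x v) = lay σ := rfl

/-- The tokens are listed, without repetition, as `L 0, …, L (a - 1)`, and `P` is the inverse. -/
structure Listed (N : Net) (Λ : Lay) (L P : ℕ → ℕ) (a : ℕ) : Prop where
  tok : ∀ t < a, Λ.tok N (L t) ∧ P (L t) = t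
  pos : ∀ d, Λ.tok N d → P d < a ∧ L (P d) = d

/-- Move the token in register `12` around its center, in register `7`. -/
def shiftP : Prog :=
  25 ≔ hE (rg 12) ⨾ 26 ≔ tE (rg 7) (rg 25) ⨾ 27 ≔ vE (twE (rg 26)) ⨾ 28 ≔ mE (rg 27) ⨾
  .store 5 (twE (rg 12)) (rg 25) ⨾ .store 6 (ixE (rg 7) (rg 25)) (twE (rg 12)) ⨾
  .store 5 (rg 26) 0 ⨾ .store 6 (ixE (rg 27) (rg 25)) 0 ⨾
  .store 6 (ixE (rg 27) (rg 28)) (twE (rg 26)) ⨾ .store 5 (twE (rg 26)) (rg 28) ⨾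
  .store 7 (rg 27) (rg 25) ⨾
  17 ≔ .get 11 (rg 12) ⨾ .store 10 (rg 17) (twE (rg 26)) ⨾ .store 11 (twE (rg 26)) (rg 17) ⨾
  12 ≔ twE (rg 26)

section
variable (σ : Mem)

/-- `shiftP` implements `Lay.shift`. -/
theorem lay_shiftP : lay (shiftP.exec σ) = (lay σ).move (σ.reg 7) (σ.arr 5 (σ.reg 12)) (σ.reg 12)
    (σ.arr 6 (ix (σ.reg 7) (σ.arr 5 (σ.reg 12))))
    (σ.arr 4 (tw (σ.arr 6 (ix (σ.reg 7) (σ.arr 5 (σ.reg 12)))))) := by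
  simp [shiftP, Prog.exec, lay, Lay.move, upd_ix]

theorem shiftP_reg12 : (shiftP.exec σ).reg 12 =
    tw (σ.arr 6 (ix (σ.reg 7) (σ.arr 5 (σ.reg 12)))) := by
  simp [shiftP, Prog.exec]

theorem shiftP_arr10 : (shiftP.exec σ).arr 10 = Function.update (σ.arr 10)
    (σ.arr 11 (σ.reg 12)) (tw (σ.arr 6 (ix (σ.reg 7) (σ.arr 5 (σ.reg 12))))) := by
  simp [shiftP, Prog.exec]

theorem shiftP_arr11 : (shiftP.exec σ).arr 11 = Function.update (σ.arr 11)
    (tw (σ.arr 6 (ix (σ.reg 7) (σ.arr 5 (σ.reg 12))))) (σ.arr 11 (σ.reg 12)) := by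
  simp [shiftP, Prog.exec]

end

section
variable {N : Net} {X C : ℕ → Prop}

theorem Moved.listed {Λ Λ' : Lay} {y y' a : ℕ} {L P : ℕ → ℕ} (m : Moved N Λ y Λ' y')
    (hy : Λ.tok N y) (l : Listed N Λ L P a) :
    Listed N Λ' (Function.update L (P y) y') (Function.update P y' (P y)) a := by
  obtain ⟨p1, p2⟩ := l.pos y hy
  refine ⟨fun t ht => ?_, fun d hd => ?_⟩
  · by_cases e : t = P y
    · subst e; simpa using m.tok'
    · obtain ⟨q1, q2⟩ := l.tok t ht
      have hne : L t ≠ y := fun h => e (by rw [← q2, h])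
      have := m.labels _ q1 hne
      simp only [Function.update_of_ne e, Function.update_of_ne this.2]
      exact ⟨(m.toks _).2 (Or.inr ⟨q1, hne⟩), q2⟩
  · rcases (m.toks d).1 hd with rfl | ⟨h1, h2⟩
    · simpa using p1
    · obtain ⟨q1, q2⟩ := l.pos d h1
      have := m.labels _ h1 h2
      have hne : P d ≠ P y := fun h => h2 (by rw [← q2, h, p2])
      simp only [Function.update_of_ne hne, Function.update_of_ne this.2]
      exact ⟨q1, q2⟩

/-- The part of the state that the main loop maintains. -/
structure Good (N : Net) (X C : ℕ → Prop) (σ : Mem) : Prop where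
  V : σ.arr 4 = N.V
  inv : Inv N X C (lay σ)
  list : Listed N (lay σ) (σ.arr 10) (σ.arr 11) (σ.reg 3)

/-- Move the token in register `12` until its label is the color in register `13`. -/
def walkP : Prog := .loop (1 - eqE (hE (rg 12)) (rg 13)) shiftP

/-- `walkP` follows a walk to its last color. It affects only the colors that it leaves. -/
theorem walkP_spec (hN : N.Good) (n : ℕ) : ∀ (σ : Mem) (s : ℕ → ℕ), Good N X C σ →
    (lay σ).tok N (σ.reg 12) → N.V (tw (σ.reg 12)) = σ.reg 7 → IsWalk N (lay σ) (σ.reg 7) s n →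
    s 0 = (lay σ).H (σ.reg 12) → s n = σ.reg 13 →
    ∃ t σ', Runs walkP σ t σ' ∧ t ≤ 40 * n + 1 ∧ Good N X C σ' ∧
      Moved N (lay σ) (σ.reg 12) (lay σ') (σ'.reg 12) ∧ (lay σ').H (σ'.reg 12) = σ.reg 13 ∧
      ∀ c, (∀ i < n, c ≠ s i) → ((lay σ').col (σ.reg 7) c ↔ (lay σ).col (σ.reg 7) c) ∧
        ((lay σ).col (σ.reg 7) c → (lay σ').lk N (σ.reg 7) c = (lay σ).lk N (σ.reg 7) c) := by
  induction n with
  | zero =>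
    intro σ s g ht hu hs h0 hn
    refine ⟨1, σ, .loop_neg ?_, by omega, g, .refl ht, h0.symm.trans hn, fun c _ => ⟨Iff.rfl, fun _ => rfl⟩⟩
    have : (lay σ).H (σ.reg 12) = σ.arr 5 (σ.reg 12) := rfl
    simp [← hn, h0, this]
  | succ n ih =>
    intro σ s g ht hu hs h0 hn
    have hc : (lay σ).col (N.V (tw (σ.reg 12))) ((lay σ).H (σ.reg 12)) := by
      rw [hu, ← h0]; exact (hs.1 0 (by omega)).1
    obtain ⟨i1, i2, i3, i4⟩ := g.inv.shift hN ht hc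
    obtain ⟨t, htl, r⟩ := runs_exec shiftP σ rfl
    have hlay : lay (shiftP.exec σ) = (lay σ).shift N (σ.reg 12) := by
      rw [lay_shiftP, Lay.shift, hu, g.V]; rfl
    have h12 : (shiftP.exec σ).reg 12 =
        tw ((lay σ).T (N.V (tw (σ.reg 12))) ((lay σ).H (σ.reg 12))) := by
      rw [shiftP_reg12, hu]; rfl
    rw [← h12, ← hlay] at i2 i3
    rw [← hlay] at i1 i4
    rw [hu] at i3 i4
    have e7 : (shiftP.exec σ).reg 7 = σ.reg 7 := r.reg_eq 7 rfl
    have e13 : (shiftP.exec σ).reg 13 = σ.reg 13 := r.reg_eq 13 rfl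
    have e3 : (shiftP.exec σ).reg 3 = σ.reg 3 := r.reg_eq 3 rfl
    have e4 : (shiftP.exec σ).arr 4 = σ.arr 4 := r.arr_eq 4 rfl
    have g' : Good N X C (shiftP.exec σ) := by
      refine ⟨e4.trans g.V, i1, ?_⟩
      have := i2.listed ht g.list
      rw [shiftP_arr10, shiftP_arr11, e3]
      rw [shiftP_reg12] at this
      exact this
    obtain ⟨t', σ', r', ht', g'', m', hl', hk'⟩ := ih (shiftP.exec σ) (fun i => s (i + 1)) g'
      i2.tok' (by rw [i2.ctr, e7, hu]) (by rw [e7]; exact hs.tail h0 i4)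
      (by rw [i3, ← h0]; exact (hs.1 0 (by omega)).2.symm) (by rw [e13, ← hn])
    rw [e7] at hk'
    refine ⟨_, σ', .loop_pos ?_ r r', ?_, g'', i2.trans m', by rw [hl', e13], fun c hc => ?_⟩
    · have hne : s 0 ≠ s (n + 1) := fun e => by
        have := hs.2 0 (by omega) (n + 1) le_rfl e; omega
      have : ¬ σ.arr 5 (σ.reg 12) = σ.reg 13 := fun e => hne (by rw [h0, hn]; exact e)
      simp [this]
    · have : shiftP.len = 29 := rfl
      omega
    · have h1 := hk' c fun i hi => hc (i + 1) (by omega)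
      have h2 := i4 c (h0 ▸ hc 0 (by omega))
      exact ⟨h1.1.trans h2.1, fun hcol => (h1.2 (h2.1.2 hcol)).trans (h2.2 hcol)⟩

/-- Let `M` of the vertex in register `29` be its first color without label. -/
def freshP : Prog :=
  30 ≔ 1 ⨾ .loop (tE (rg 29) (rg 30)) (30 ≔ rg 30 + 1) ⨾ .store 7 (rg 29) (rg 30)

/-- `freshP` finds a free color in time proportional to a bound `D` for the smallest one. -/
theorem freshP_spec (σ : Mem) (D : ℕ)
    (hex : ∃ c, 1 ≤ c ∧ c ≤ D ∧ (lay σ).T (σ.reg 29) c = 0) :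
    ∃ t σ' c, Runs freshP σ t σ' ∧ t ≤ 2 * D + 10 ∧ 1 ≤ c ∧ c ≤ D ∧
      (lay σ).T (σ.reg 29) c = 0 ∧
      lay σ' = { lay σ with M := Function.update (lay σ).M (σ.reg 29) c } := by
  obtain ⟨c0, h1, h2, h3⟩ := hex
  obtain ⟨t, σ', r, ht, ⟨⟨k1, k2⟩, k3, k4⟩, hc⟩ := runs_loop (e := tE (rg 29) (rg 30))
    (p := 30 ≔ rg 30 + 1)
    (fun τ => (1 ≤ τ.reg 30 ∧ τ.reg 30 ≤ c0) ∧ lay τ = lay σ ∧ τ.reg 29 = σ.reg 29)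
    (fun τ => 2 * (c0 - τ.reg 30))
    (by
      rintro τ ⟨⟨a1, a2⟩, a3, a4⟩ hne
      refine ⟨1, _, .assign _ _ _, ⟨⟨by simp, ?_⟩, by simpa using a3, by simpa using a4⟩, ?_⟩
      all_goals
        have : τ.reg 30 ≠ c0 := by
          rintro e
          apply hne
          have : (lay τ).T (τ.reg 29) (τ.reg 30) = 0 := by rw [e, a3, a4, h3]
          exact this
        simp; omega)
    (σ.setReg 30 1) ⟨⟨by simp, by simpa using h1⟩, by simp, by simp⟩
  refine ⟨_, _, σ'.reg 30, (Runs.assign _ _ _).seq (r.seq (.store _ _ _ _)), ?_, k1, by omega, ?_, ?_⟩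
  · simp at ht; omega
  · rw [← k3, ← k4]; exact hc
  · rw [← k4, ← k3]
    simp [lay]

/-- The part of `paintP` before the search for a new free color. -/
def paintHead : Prog :=
  25 ≔ hE (rg 12) ⨾ 26 ≔ tE (rg 7) (rg 25) ⨾
   .store 6 (ixE (rg 7) (rg 25)) (twE (rg 12)) ⨾ .store 5 (twE (rg 12)) (rg 25) ⨾
   .branch (rg 26)
     (.store 6 (ixE (rg 7) (mE (rg 7))) (rg 26) ⨾ .store 5 (rg 26) (mE (rg 7))) .skip ⨾
   3 ≔ rg 3 - 1 ⨾
   17 ≔ .get 11 (rg 12) ⨾ 28 ≔ .get 10 (rg 3) ⨾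
   .store 10 (rg 17) (rg 28) ⨾ .store 11 (rg 28) (rg 17) ⨾
   29 ≔ rg 7

/-- Color the edge of the token in register `12` with its label, and remove it from the list of
tokens. -/
def paintP : Prog := paintHead ⨾ freshP

theorem paintHead_spec (σ : Mem) :
    lay (paintHead.exec σ) = (lay σ).paint (σ.reg 7) (σ.arr 5 (σ.reg 12)) (σ.reg 12)
      (σ.arr 6 (ix (σ.reg 7) (σ.arr 5 (σ.reg 12)))) ∧
    (paintHead.exec σ).reg 3 = σ.reg 3 - 1 ∧ (paintHead.exec σ).reg 29 = σ.reg 7 ∧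
    (paintHead.exec σ).arr 10 = Function.update (σ.arr 10) (σ.arr 11 (σ.reg 12))
      (σ.arr 10 (σ.reg 3 - 1)) ∧
    (paintHead.exec σ).arr 11 = Function.update (σ.arr 11) (σ.arr 10 (σ.reg 3 - 1))
      (σ.arr 11 (σ.reg 12)) := by
  by_cases h : σ.arr 6 (ix (σ.reg 7) (σ.arr 5 (σ.reg 12))) = 0 <;>
    simp [paintHead, Prog.exec, lay, Lay.paint, upd_ix, h]

/-- A token is removed from the list by putting the last one into its place. -/
theorem Listed.remove {Λ Λ' : Lay} {y a : ℕ} {L P : ℕ → ℕ} (l : Listed N Λ L P a)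
    (hy : Λ.tok N y) (h : ∀ d, Λ'.tok N d ↔ Λ.tok N d ∧ d ≠ y) :
    Listed N Λ' (Function.update L (P y) (L (a - 1))) (Function.update P (L (a - 1)) (P y))
      (a - 1) := by
  obtain ⟨p1, p2⟩ := l.pos y hy
  refine ⟨fun t ht => ?_, fun d hd => ?_⟩
  · rw [h]
    by_cases e : t = P y
    · subst e
      obtain ⟨q1, q2⟩ := l.tok (a - 1) (by omega)
      simp only [Function.update_self, q1, true_and, and_true]
      intro e; rw [e] at q2; omega
    · obtain ⟨q1, q2⟩ := l.tok t (by omega)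
      obtain ⟨r1, r2⟩ := l.tok (a - 1) (by omega)
      rw [Function.update_of_ne e, Function.update_of_ne]
      · exact ⟨⟨q1, fun e' => e (by rw [← q2, e'])⟩, q2⟩
      · intro e'; rw [e'] at q2; omega
  · obtain ⟨h1, h2⟩ := (h d).1 hd
    obtain ⟨q1, q2⟩ := l.pos d h1
    obtain ⟨r1, r2⟩ := l.tok (a - 1) (by omega)
    have hne : P d ≠ P y := fun e => h2 (by rw [← q2, e, p2])
    by_cases e : d = L (a - 1)
    · subst e
      simp only [Function.update_self, and_true]
      omega
    · have : P d ≠ a - 1 := fun e' => e (by rw [← q2, e'])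
      rw [Function.update_of_ne e, Function.update_of_ne hne]
      exact ⟨by omega, q2⟩

/-- `paintP` colors the edge of a token in `O(K)` steps. At most one other token, `o`, gets a new label.
-/
theorem paintP_spec (hN : N.Good) (σ : Mem) (g : Good N X C σ) (ht : (lay σ).tok N (σ.reg 12))
    (hu : N.V (tw (σ.reg 12)) = σ.reg 7)
    (hc : ¬ (lay σ).col (σ.reg 7) ((lay σ).H (σ.reg 12))) :
    ∃ t σ', Runs paintP σ t σ' ∧ t ≤ 2 * N.K + 50 ∧ Good N X C σ' ∧ σ'.reg 3 + 1 = σ.reg 3 ∧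
      ∃ o, ∀ d, (lay σ').tok N d → d = o ∨ ((lay σ).tok N d ∧ (lay σ').H d = (lay σ).H d) := by
  obtain ⟨t, htl, r⟩ := runs_exec paintHead σ rfl
  obtain ⟨a1, a2, a3, a4, a5⟩ := paintHead_spec σ
  have e4 : (paintHead.exec σ).arr 4 = σ.arr 4 := r.arr_eq 4 rfl
  rw [← hu] at hc
  obtain ⟨i1, i2, i3, i4⟩ := g.inv.paint hN ht hc (L' := lay (paintHead.exec σ))
    (by rw [a1, hu]; rfl)
  obtain ⟨c, c1, c2, c3⟩ := i1.exists_free (σ.reg 7)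
  have hdeg := hN.deg_lt (σ.reg 7)
  obtain ⟨t', σ', c', r', ht', d1, d2, d3, d4⟩ := freshP_spec (paintHead.exec σ) N.K
    ⟨c, c1, by omega, by rw [a3]; exact c3⟩
  rw [a3] at d3 d4
  have lt := (g.list.pos _ ht).1
  have tk : ∀ d, (lay σ').tok N d ↔ (lay (paintHead.exec σ)).tok N d := fun d => by rw [d4]; rfl
  have s3 : σ'.reg 3 = σ.reg 3 - 1 := (r'.reg_eq 3 rfl).trans a2
  refine ⟨_, σ', r.seq r', ?_, ⟨?_, ?_, ?_⟩, by omega,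
    (lay σ).T (N.V (tw (σ.reg 12))) ((lay σ).H (σ.reg 12)), fun d hd => ?_⟩
  · have : paintHead.len = 25 := rfl
    omega
  · rw [r'.arr_eq 4 rfl, e4, g.V]
  · rw [d4]
    exact i1.setM (σ.reg 7) c' (fun d hd hne => i2 d hd (by rwa [hu])) ⟨d1, d2, d3⟩
  · have := g.list.remove (Λ' := lay σ') ht (fun d => (tk d).trans (i3 d))
    rw [r'.arr_eq 10 rfl, r'.arr_eq 11 rfl, a4, a5, s3]
    exact this
  · rw [tk, i3] at hd
    by_cases h : d = (lay σ).T (N.V (tw (σ.reg 12))) ((lay σ).H (σ.reg 12))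
    · exact Or.inl h
    · refine Or.inr ⟨hd.1, ?_⟩
      rw [show (lay σ').H = (lay (paintHead.exec σ)).H by rw [d4]]
      exact i4 d hd.1 hd.2 h

end

/-! ### Flipping an alternating path -/

section
variable {N : Net} {X C : ℕ → Prop}

/-- Exchange the labels `a` and `b` at the vertex `y`. -/
def Lay.sw (L : Lay) (y a b : ℕ) : Lay where
  H := Function.update (Function.update L.H (L.T y a) b) (L.T y b) a
  T := upd (upd L.T y a (L.T y b)) y b (L.T y a)
  M := Function.update L.M y (if L.M y = a then b else if L.M y = b then a else L.M y)

/-- Exchanging the labels at one more vertex enlarges the set of a Kempe change. -/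
theorem Swapped.sw {L L' : Lay} {S : Finset ℕ} {p q y a b : ℕ} (I : Core N X C L)
    (W : Swapped N L L' S p q) (hp : p ≠ 0) (hq : q ≠ 0) (hy : y ∉ S)
    (hab : a = p ∧ b = q ∨ a = q ∧ b = p) :
    Swapped N L (L'.sw y a b) (insert y S) p q := by
  have hT : ∀ c, L'.T y c = L.T y c := fun c => by rw [W.T, if_neg hy]
  have hM : L'.M y = L.M y := by rw [W.M, if_neg hy]
  have hsw : ∀ c, Equiv.swap p q c = if c = a then b else if c = b then a else c := by
    intro c
    rcases hab with ⟨rfl, rfl⟩ | ⟨rfl, rfl⟩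
    · exact Equiv.swap_apply_def _ _ _
    · rw [Equiv.swap_comm]; exact Equiv.swap_apply_def _ _ _
  refine ⟨fun d hd => ?_, ?_, fun v c => ?_, fun v => ?_⟩
  · have h0 := W.H d hd
    have d0 : d ≠ 0 := by have := hd.1; omega
    have ha := I.of_T y a
    have hb := I.of_T y b
    have hd' := I.T_of d hd
    simp only [Lay.sw, Function.update_apply, hT, Finset.mem_insert]
    by_cases hv : N.V d = y
    · rw [hv] at hd' h0
      simp only [hv, true_or, if_true, hsw, hy, if_false] at h0 ⊢
      rw [h0]
      grind
    · simp only [hv, false_or]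
      rw [h0, if_neg, if_neg]
      · rintro rfl; exact hv (ha d0).2.1
      · rintro rfl; exact hv (hb d0).2.1
  · have hn : ∀ c, (1 : ℕ) ≠ L.T y c := fun c e => by
      have := (I.of_T y c (by omega)).1.1
      omega
    simp only [Lay.sw, Function.update_apply, hT, hn, if_false, W.one]
  · simp only [Lay.sw, upd, hT, Finset.mem_insert, W.T, hsw]
    by_cases hv : v = y
    · subst hv; simp only [hy]; grind
    · simp [hv]
  · simp only [Lay.sw, Function.update_apply, Finset.mem_insert, hM, hsw]
    by_cases hv : v = y
    · simp [hv]
    · simp [hv, W.M, hsw]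

/-- Exchange the labels in registers `19` and `20` at the vertex in register `18`. -/
def swP : Prog :=
  23 ≔ tE (rg 18) (rg 19) ⨾ 24 ≔ tE (rg 18) (rg 20) ⨾
  .store 6 (ixE (rg 18) (rg 19)) (rg 24) ⨾ .store 6 (ixE (rg 18) (rg 20)) (rg 23) ⨾
  .store 5 (rg 23) (rg 20) ⨾ .store 5 (rg 24) (rg 19) ⨾
  .branch (eqE (mE (rg 18)) (rg 19)) (.store 7 (rg 18) (rg 20))
    (.branch (eqE (mE (rg 18)) (rg 20)) (.store 7 (rg 18) (rg 19)) .skip)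

theorem lay_swP (σ : Mem) :
    lay (swP.exec σ) = (lay σ).sw (σ.reg 18) (σ.reg 19) (σ.reg 20) := by
  by_cases h1 : σ.arr 7 (σ.reg 18) = σ.reg 19
  · simp [swP, Prog.exec, lay, Lay.sw, upd_ix, h1]
  · by_cases h2 : σ.arr 7 (σ.reg 18) = σ.reg 20
    · have h3 : σ.reg 20 ≠ σ.reg 19 := h2 ▸ h1
      simp [swP, Prog.exec, lay, Lay.sw, upd_ix, h2, h3]
    · simp [swP, Prog.exec, lay, Lay.sw, upd_ix, h1, h2]

/-- Go on to the next vertex of the path and exchange the two labels there. -/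
def flipStep : Prog :=
  18 ≔ vE (twE (rg 21)) ⨾ 22 ≔ tE (rg 18) (rg 20) ⨾ swP ⨾
  23 ≔ rg 19 ⨾ 19 ≔ rg 20 ⨾ 20 ≔ rg 23 ⨾ 21 ≔ rg 22

/-- Exchange the colors on the path that starts at the vertex in register `18` and whose edges have
alternately the color in register `19` and the color in register `20`. -/
def flipP : Prog := 21 ≔ tE (rg 18) (rg 19) ⨾ swP ⨾ .loop (hE (twE (rg 21))) flipStep

theorem flipStep_spec (σ : Mem) :
    lay (flipStep.exec σ) = (lay σ).sw (σ.arr 4 (tw (σ.reg 21))) (σ.reg 19) (σ.reg 20) ∧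
    (flipStep.exec σ).reg 19 = σ.reg 20 ∧ (flipStep.exec σ).reg 20 = σ.reg 19 ∧
    (flipStep.exec σ).reg 21 = (lay σ).T (σ.arr 4 (tw (σ.reg 21))) (σ.reg 20) := by
  have h : ∀ τ : Mem, (swP.exec τ).reg 19 = τ.reg 19 ∧ (swP.exec τ).reg 20 = τ.reg 20 ∧
      (swP.exec τ).reg 22 = τ.reg 22 := fun τ => by
    obtain ⟨t, -, r⟩ := runs_exec swP τ rfl
    exact ⟨r.reg_eq _ rfl, r.reg_eq _ rfl, r.reg_eq _ rfl⟩
  refine ⟨?_, ?_, ?_, ?_⟩ <;> simp [flipStep, Prog.exec, h, lay_swP] <;> rfl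

/-- The state of the loop of `flipP` after the labels have been exchanged at the first `k + 1` vertices
of the path: register `21` holds the next dart, which is found in the table before the exchange at its
vertex destroys the entry. -/
theorem flip_loop {L : Lay} {p q x : ℕ} (I : Core N X C L) (hx : ¬ L.col x q) (hp : p ≠ 0)
    (hq : q ≠ 0) (r : ℕ) : ∀ (k : ℕ) (σ : Mem), k + r = L.plen N x p q → σ.arr 4 = N.V →
    Swapped N L (lay σ) (L.pathSet N x p q k) p q →
    σ.reg 21 = L.T (L.vt N x p q k) (alt p q k) → σ.reg 19 = alt p q k →
    σ.reg 20 = alt p q (k + 1) →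
    ∃ t σ', Runs (.loop (hE (twE (rg 21))) flipStep) σ t σ' ∧ t ≤ 30 * r + 1 ∧
      Flipped N L (lay σ') x p q := by
  induction r with
  | zero =>
    intro k σ hk hV W h21 h19 h20
    rw [Nat.add_zero] at hk
    refine ⟨1, σ, .loop_neg ?_, by omega, by rw [Flipped, ← hk]; exact W⟩
    have := (I.plen_spec (p := p) hx).1
    rw [← hk, Lay.on, Lay.col, not_not, ← W.H_tw_T I hp hq, ← h21] at this
    exact this
  | succ r ih =>
    intro k σ hk hV W h21 h19 h20
    have on : ∀ j ≤ k, L.on N x p q j := fun j hj => Lay.on_of_lt (by omega)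
    have hc : (lay σ).H (tw (σ.reg 21)) ≠ 0 := by
      have := on k le_rfl
      rw [Lay.on, Lay.col, Ne, ← W.H_tw_T I hp hq, ← h21] at this
      exact this
    have hvt : σ.arr 4 (tw (σ.reg 21)) = L.vt N x p q (k + 1) := by rw [hV, h21]; rfl
    have hnot : L.vt N x p q (k + 1) ∉ L.pathSet N x p q k := by
      rw [Lay.mem_pathSet]
      rintro ⟨j, hj, e⟩
      exact I.path_simple hx _ j (k + 1) le_rfl (by omega) (fun i hi => on i (by omega)) e
    obtain ⟨s1, s2, s3, s4⟩ := flipStep_spec σ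
    obtain ⟨t, ht, rr⟩ := runs_exec flipStep σ rfl
    have hlen : flipStep.len = 29 := rfl
    rw [hvt] at s1 s4
    have W' := W.sw I hp hq (a := σ.reg 19) (b := σ.reg 20) hnot (by
      rw [h19, h20]; unfold alt; split_ifs <;> omega)
    rw [← s1] at W'
    have hins : insert (L.vt N x p q (k + 1)) (L.pathSet N x p q k) = L.pathSet N x p q (k + 1) := by
      ext v
      simp only [Finset.mem_insert, Lay.mem_pathSet]
      constructor
      · rintro (rfl | ⟨j, hj, rfl⟩)
        · exact ⟨k + 1, le_rfl, rfl⟩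
        · exact ⟨j, by omega, rfl⟩
      · rintro ⟨j, hj, rfl⟩
        rcases Nat.lt_or_ge k j with h | h
        · left; rw [show j = k + 1 by omega]
        · exact Or.inr ⟨j, h, rfl⟩
    rw [hins] at W'
    obtain ⟨t', σ', r', ht', F⟩ := ih (k + 1) _ (by omega) ((rr.arr_eq 4 rfl).trans hV) W'
      (by rw [s4, W.T, if_neg hnot, h20]) (by rw [s2, h20])
      (by rw [s3, h19]; unfold alt; split_ifs <;> omega)
    exact ⟨_, σ', .loop_pos hc rr r', by omega, F⟩

/-- `flipP` exchanges the colors on a maximal alternating path, in time proportional to its length. -/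
theorem flipP_spec {x p q : ℕ} (σ : Mem) (hV : σ.arr 4 = N.V) (I : Core N X C (lay σ))
    (h18 : σ.reg 18 = x) (h19 : σ.reg 19 = p) (h20 : σ.reg 20 = q)
    (hx : ¬ (lay σ).col x q) (hp : p ≠ 0) (hq : q ≠ 0) :
    ∃ t σ', Runs flipP σ t σ' ∧ t ≤ 30 * (lay σ).plen N x p q + 30 ∧
      Flipped N (lay σ) (lay σ') x p q := by
  subst h18 h19 h20
  obtain ⟨t, ht, rr⟩ := runs_exec swP (σ.setReg 21 ((lay σ).T (σ.reg 18) (σ.reg 19))) rfl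
  have hlen : swP.len = 17 := rfl
  have W : Swapped N (lay σ) (lay σ) ∅ (σ.reg 19) (σ.reg 20) := by
    constructor <;> simp
  have W' := W.sw I hp hq (y := σ.reg 18) (a := σ.reg 19) (b := σ.reg 20) (by simp) (by simp)
  obtain ⟨t', σ', r', ht', F⟩ := flip_loop I hx hp hq ((lay σ).plen N (σ.reg 18) (σ.reg 19) (σ.reg 20))
    0 _ (by omega) ((rr.arr_eq 4 rfl).trans hV) (by
      rw [lay_swP]
      have : (lay σ).pathSet N (σ.reg 18) (σ.reg 19) (σ.reg 20) 0 = insert (σ.reg 18) ∅ := by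
        simp [Lay.pathSet, Lay.vt]
      rw [this]; exact W') ((rr.reg_eq 21 rfl).trans (by simp; rfl))
      ((rr.reg_eq 19 rfl).trans (by simp; rfl)) ((rr.reg_eq 20 rfl).trans (by simp; rfl))
  refine ⟨_, σ', (Runs.assign 21 _ σ).seq (rr.seq r'), by omega, F⟩

end

/-! ### Simultaneous walks around a center -/

section
variable {N : Net} {X C : ℕ → Prop} {L : Lay} {MK : ℕ → ℕ} {u : ℕ}

/-- `y` is a token with center `u`. -/
def Lay.tokAt (L : Lay) (N : Net) (u y : ℕ) : Prop := L.tok N y ∧ N.V (tw y) = u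

/-- The token `y` with center `u` is the only one with its label. -/
def Lay.single (L : Lay) (N : Net) (u y : ℕ) : Prop :=
  L.tokAt N u y ∧ ∀ d, L.tokAt N u d → L.H d = L.H y → d = y

/-- `s 0, …, s n` is a walk that starts with the label of `y`, and these are the colors marked
with `y`. -/
structure Trail (N : Net) (L : Lay) (u : ℕ) (MK : ℕ → ℕ) (y : ℕ) (s : ℕ → ℕ) (n : ℕ) : Prop where
  walk : IsWalk N L u s n
  zero : s 0 = L.H y
  mark : ∀ j ≤ n, MK (s j) = y ∧ 1 ≤ s j ∧ s j ≤ N.K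
  only : ∀ c, 1 ≤ c → c ≤ N.K → MK c = y → ∃ j ≤ n, s j = c

/-- The walk runs into a loop. -/
def Shut (N : Net) (L : Lay) (u : ℕ) (s : ℕ → ℕ) (n : ℕ) : Prop :=
  L.col u (s n) ∧ ∃ j ≤ n, L.lk N u (s n) = s j

/-- The marks set by simultaneous walks of the tokens with center `u`: a color has the mark `y` if the
walk of the token `y` gets there, and `1` if two tokens start there. -/
structure Marks (N : Net) (L : Lay) (u : ℕ) (MK : ℕ → ℕ) : Prop where
  kind : ∀ c, 1 ≤ c → c ≤ N.K → MK c = 0 ∨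
    (MK c = 1 ∧ ∃ d d', d ≠ d' ∧ L.tokAt N u d ∧ L.tokAt N u d' ∧ L.H d = c ∧ L.H d' = c) ∨
    L.single N u (MK c)
  trail : ∀ y, L.single N u y → ∃ s n, Trail N L u MK y s n
  multi : ∀ y, L.tokAt N u y → ¬ L.single N u y → MK (L.H y) = 1

theorem Lay.tok.ge {y : ℕ} (h : L.tok N y) : 2 ≤ y := h.1.1

theorem Trail.update {y y' c : ℕ} {s : ℕ → ℕ} {n : ℕ} (t : Trail N L u MK y s n) (hc : MK c = 0)
    (hy : y ≠ 0) (hne : y ≠ y') : Trail N L u (Function.update MK c y') y s n where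
  walk := t.walk
  zero := t.zero
  mark j hj := by
    have := t.mark j hj
    rw [Function.update_of_ne]
    · exact this
    · intro e; rw [e] at this; omega
  only d h1 h2 h3 := by
    rw [Function.update_apply] at h3
    split_ifs at h3 with e
    · exact (hne h3.symm).elim
    · exact t.only d h1 h2 h3

theorem Trail.extend {y : ℕ} {s : ℕ → ℕ} {n : ℕ} (t : Trail N L u MK y s n) (hcol : L.col u (s n))
    (hc : MK (L.lk N u (s n)) = 0) (hy : y ≠ 0)
    (hk : 1 ≤ L.lk N u (s n) ∧ L.lk N u (s n) ≤ N.K) :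
    Trail N L u (Function.update MK (L.lk N u (s n)) y) y
      (Function.update s (n + 1) (L.lk N u (s n))) (n + 1) := by
  generalize hnx : L.lk N u (s n) = x at *
  have ne : ∀ j ≤ n, s j ≠ x := fun j hj e => by
    have := (t.mark j hj).1; rw [e] at this; omega
  refine ⟨⟨fun i hi => ?_, fun i hi j hj e => ?_⟩, ?_, fun j hj => ?_, fun c h1 h2 h3 => ?_⟩
  · rw [Function.update_of_ne (by omega : i ≠ n + 1)]
    rcases Nat.lt_or_ge i n with h | h
    · rw [Function.update_of_ne (by omega)]; exact t.walk.1 i h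
    · obtain rfl : i = n := by omega
      simp [hcol, hnx]
  · simp only [Function.update_apply] at e
    split_ifs at e with h1 h2 h2
    · omega
    · exact (ne j (by omega) e.symm).elim
    · exact (ne i (by omega) e).elim
    · exact t.walk.2 i (by omega) j (by omega) e
  · rw [Function.update_of_ne (by omega)]; exact t.zero
  · rcases Nat.lt_or_ge n j with h | h
    · obtain rfl : j = n + 1 := by omega
      simp [hk]
    · have e : Function.update s (n + 1) x j = s j := Function.update_of_ne (by omega) _ _
      rw [e, Function.update_of_ne (ne j h)]
      exact t.mark j h
  · by_cases e : c = x
    · exact ⟨n + 1, le_rfl, by simp [e]⟩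
    · rw [Function.update_of_ne e] at h3
      obtain ⟨j, hj, h⟩ := t.only c h1 h2 h3
      exact ⟨j, by omega, by rw [Function.update_of_ne (by omega)]; exact h⟩

theorem Core.H_pos (I : Core N X C L) {y : ℕ} (h : L.tok N y) : 1 ≤ L.H y ∧ L.H y ≤ N.K :=
  ⟨Nat.one_le_iff_ne_zero.2 h.2.1, I.le y h.1⟩

theorem Inv.lk_pos (I : Inv N X C L) {c : ℕ} (h : L.col u c) :
    1 ≤ L.lk N u c ∧ L.lk N u c ≤ N.K := by
  have := I.free _ (Net.dart_tw (I.toCore.col_dart h).1)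
  exact ⟨this.1, this.2.1⟩

/-- A walk gets to a color without mark, and marks it. -/
theorem Marks.extend (I : Inv N X C L) (m : Marks N L u MK) {y : ℕ} {s : ℕ → ℕ} {n : ℕ}
    (hy : L.single N u y)
    (t : Trail N L u MK y s n) (hcol : L.col u (s n))
    (hc : MK (L.lk N u (s n)) = 0) : Marks N L u (Function.update MK (L.lk N u (s n)) y) where
  kind c h1 h2 := by
    rw [Function.update_apply]; split_ifs
    · exact Or.inr (Or.inr hy)
    · exact m.kind c h1 h2
  trail z hz := by
    by_cases e : z = y
    · subst e
      exact ⟨_, _, t.extend hcol hc (by have := hz.1.1.ge; omega) (I.lk_pos hcol)⟩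
    · obtain ⟨s', n', t'⟩ := m.trail z hz
      exact ⟨s', n', t'.update hc (by have := hz.1.1.ge; omega) e⟩
  multi z hz h := by
    have := m.multi z hz h
    rw [Function.update_of_ne]
    · exact this
    · intro e; rw [e] at this; omega

/-- The colors that the walk of the token `y` gets to. -/
def Lay.orb (L : Lay) (N : Net) (u y c : ℕ) : Prop := ∃ i, (L.lk N u)^[i] (L.H y) = c

theorem Trail.orb {y : ℕ} {s : ℕ → ℕ} {n : ℕ} (t : Trail N L u MK y s n) :
    ∀ j ≤ n, (L.lk N u)^[j] (L.H y) = s j := by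
  intro j
  induction j with
  | zero => intro _; exact t.zero.symm
  | succ j ih =>
    intro hj
    rw [Function.iterate_succ_apply', ih (by omega)]
    exact (t.walk.1 j (by omega)).2

/-- A walk that has run into a loop never gets to a color without its own mark. -/
theorem Trail.mark_of_orb {y : ℕ} {s : ℕ → ℕ} {n : ℕ} (t : Trail N L u MK y s n)
    (h : Shut N L u s n) {c : ℕ} (hc : L.orb N u y c) : MK c = y := by
  obtain ⟨i, rfl⟩ := hc
  have : ∃ j ≤ n, (L.lk N u)^[i] (L.H y) = s j := by
    induction i with
    | zero => exact ⟨0, by omega, t.zero.symm⟩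
    | succ i ih =>
      obtain ⟨j, hj, e⟩ := ih
      rw [Function.iterate_succ_apply', e]
      rcases Nat.lt_or_ge j n with hlt | hge
      · exact ⟨j + 1, hlt, (t.walk.1 j hlt).2⟩
      · rw [show j = n by omega]; exact h.2
  obtain ⟨j, hj, e⟩ := this
  rw [e]; exact (t.mark j hj).1

/-- The walk of the single token `h` contains the color `c`, and no other single token with the same
center gets to `c`. -/
def Lay.loopAt (L : Lay) (N : Net) (u h c : ℕ) : Prop :=
  L.single N u h ∧ L.orb N u h c ∧ ∀ y, L.single N u y → L.orb N u y c → y = h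

/-- Number of colors without mark. -/
def unmarked (N : Net) (MK : ℕ → ℕ) : ℕ := ((Finset.Icc 1 N.K).filter fun c => MK c = 0).card

theorem unmarked_update {c y : ℕ} (hc : 1 ≤ c ∧ c ≤ N.K) (h : MK c = 0) (hy : y ≠ 0) :
    unmarked N (Function.update MK c y) + 1 ≤ unmarked N MK := by
  unfold unmarked
  rw [Nat.succ_le_iff]
  refine Finset.card_lt_card ?_
  rw [Finset.ssubset_iff_of_subset]
  · exact ⟨c, by simp [hc, h], by simp [hy]⟩
  · intro d hd
    simp only [Finset.mem_filter, Function.update_apply] at hd ⊢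
    split_ifs at hd with e
    · exact absurd hd.2 hy
    · exact hd

theorem unmarked_le : unmarked N MK ≤ N.K := by
  refine (Finset.card_filter_le _ _).trans ?_
  simp

/-! ### Frames -/

/-- The memory that the analysis of a center does not change. -/
structure Frame (σ τ : Mem) : Prop where
  arr : ∀ a, a ≠ 12 → a ≠ 13 → τ.arr a = σ.arr a
  reg : ∀ x, x = 0 ∨ x = 1 ∨ x = 2 ∨ x = 3 ∨ x = 6 ∨ x = 7 → τ.reg x = σ.reg x

theorem Frame.refl (σ : Mem) : Frame σ σ := ⟨fun _ _ _ => rfl, fun _ _ => rfl⟩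

theorem Frame.trans {σ τ ρ : Mem} (f : Frame σ τ) (g : Frame τ ρ) : Frame σ ρ :=
  ⟨fun a h h' => (g.arr a h h').trans (f.arr a h h'), fun x h => (g.reg x h).trans (f.reg x h)⟩

theorem Frame.lay {σ τ : Mem} (f : Frame σ τ) : lay τ = lay σ := by
  simp [ColorExt.lay, f.arr]

/-- Whether a program writes only arrays `12`, `13` and temporary registers. -/
def framed : Prog → Bool
  | .skip => true
  | .assign x _ | .sample x _ => !(x == 0 || x == 1 || x == 2 || x == 3 || x == 6 || x == 7)
  | .store a _ _ => a == 12 || a == 13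
  | .seq p q | .branch _ p q => framed p && framed q
  | .loop _ p => framed p

theorem framed_exec : ∀ (P : Prog) (σ : Mem), framed P = true → Frame σ (P.exec σ)
  | .skip, σ, _ => .refl σ
  | .sample _ _, σ, _ => .refl σ
  | .loop _ _, σ, _ => .refl σ
  | .assign x e, σ, h => by
    simp only [framed, Bool.not_eq_true', Bool.or_eq_false_iff, beq_eq_false_iff_ne] at h
    refine ⟨fun _ _ _ => rfl, fun y hy => ?_⟩
    have : y ≠ x := by rintro rfl; omega
    simp [Prog.exec, this]
  | .store a i e, σ, h => by
    simp only [framed, Bool.or_eq_true, beq_iff_eq] at h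
    refine ⟨fun b h1 h2 => ?_, fun _ _ => rfl⟩
    have : b ≠ a := by rintro rfl; omega
    simp [Prog.exec, this]
  | .seq p q, σ, h => by
    simp only [framed, Bool.and_eq_true] at h
    exact (framed_exec p σ h.1).trans (framed_exec q _ h.2)
  | .branch e p q, σ, h => by
    simp only [framed, Bool.and_eq_true] at h
    unfold Prog.exec
    split_ifs
    · exact framed_exec p σ h.1
    · exact framed_exec q σ h.2

/-- Registers `2` and arrays `4`, `8`, `9` hold the number of colors, the end vertices of the darts,
the degrees, and the lists of darts at the vertices. -/
structure Static (N : Net) (σ : Mem) : Prop where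
  V : σ.arr 4 = N.V
  K : σ.reg 2 = N.K
  mem : ∀ v, ∀ k < σ.arr 8 v, N.dart (σ.arr 9 (ix v k)) ∧ N.V (σ.arr 9 (ix v k)) = v
  inj : ∀ v, ∀ k < σ.arr 8 v, ∀ l < σ.arr 8 v, σ.arr 9 (ix v k) = σ.arr 9 (ix v l) → k = l
  surj : ∀ d, N.dart d → ∃ k < σ.arr 8 (N.V d), σ.arr 9 (ix (N.V d) k) = d

theorem Static.of_eq {σ τ : Mem} (h : Static N σ) (h4 : τ.arr 4 = σ.arr 4) (h8 : τ.arr 8 = σ.arr 8)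
    (h9 : τ.arr 9 = σ.arr 9) (h2 : τ.reg 2 = σ.reg 2) : Static N τ := by
  constructor
  · rw [h4]; exact h.V
  · rw [h2]; exact h.K
  · rw [h8, h9]; exact h.mem
  · rw [h8, h9]; exact h.inj
  · rw [h8, h9]; exact h.surj

theorem Static.deg {σ : Mem} (h : Static N σ) (v : ℕ) : σ.arr 8 v ≤ (N.dartsAt v).card := by
  rw [← Finset.card_range (σ.arr 8 v)]
  refine Finset.card_le_card_of_injOn (fun k => σ.arr 9 (ix v k)) (fun k hk => ?_) (fun k hk l hl e => ?_)
  · have := h.mem v k (by simpa using hk)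
    simpa using this
  · exact h.inj v k (by simpa using hk) l (by simpa using hl) e

end

/-! ### The missing colors at the center of a token -/

section
variable {N : Net} {X C : ℕ → Prop}

/-- Clear the mark of the color in register `4`, and append it to the list of missing colors if it is
missing at the vertex in register `7`. -/
def missStep : Prog :=
  .store 12 (rg 4) 0 ⨾
  .branch (hE (twE (tE (rg 7) (rg 4)))) .skip (.store 13 (rg 8) (rg 4) ⨾ 8 ≔ rg 8 + 1) ⨾
  4 ≔ rg 4 + 1

/-- List the missing colors at the center of the token at position `reg 31`, and clear all marks. -/
def centerP : Prog :=
  6 ≔ .get 10 (rg 31) ⨾ 7 ≔ vE (twE (rg 6)) ⨾ 8 ≔ 0 ⨾ 4 ≔ 1 ⨾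
  .loop (ltE (rg 4) (rg 2 + 1)) missStep

theorem missStep_spec (σ : Mem) : (missStep.exec σ).reg 4 = σ.reg 4 + 1 ∧
    (missStep.exec σ).arr 12 = Function.update (σ.arr 12) (σ.reg 4) 0 ∧
    ((lay σ).col (σ.reg 7) (σ.reg 4) → (missStep.exec σ).reg 8 = σ.reg 8 ∧
      (missStep.exec σ).arr 13 = σ.arr 13) ∧
    (¬ (lay σ).col (σ.reg 7) (σ.reg 4) → (missStep.exec σ).reg 8 = σ.reg 8 + 1 ∧
      (missStep.exec σ).arr 13 = Function.update (σ.arr 13) (σ.reg 8) (σ.reg 4)) := by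
  have : (lay σ).col (σ.reg 7) (σ.reg 4) ↔ σ.arr 5 (tw (σ.arr 6 (ix (σ.reg 7) (σ.reg 4)))) ≠ 0 :=
    Iff.rfl
  by_cases h : σ.arr 5 (tw (σ.arr 6 (ix (σ.reg 7) (σ.reg 4)))) = 0 <;>
    simp [this, missStep, Prog.exec, h]

/-- The first `a` entries of `M` are the colors below `k` that are missing at `u`, each once. -/
structure MissList (L : Lay) (u k : ℕ) (M : ℕ → ℕ) (a : ℕ) : Prop where
  mem : ∀ i < a, 1 ≤ M i ∧ M i < k ∧ ¬ L.col u (M i)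
  inj : ∀ i j, i < j → j < a → M i ≠ M j
  surj : ∀ c, 1 ≤ c → c < k → ¬ L.col u c → ∃ i < a, M i = c

/-- `centerP` lists the colors missing at the center in `O(K)` steps. -/
theorem centerP_spec (σ : Mem) (hK : σ.reg 2 = N.K) :
    ∃ t σ', Runs centerP σ t σ' ∧ t ≤ 12 * N.K + 20 ∧ (∀ a, a ≠ 12 → a ≠ 13 → σ'.arr a = σ.arr a) ∧
      (∀ x, x = 0 ∨ x = 1 ∨ x = 2 ∨ x = 3 → σ'.reg x = σ.reg x) ∧
      σ'.reg 6 = σ.arr 10 (σ.reg 31) ∧ σ'.reg 7 = σ.arr 4 (tw (σ'.reg 6)) ∧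
      (∀ c, 1 ≤ c → c ≤ N.K → σ'.arr 12 c = 0) ∧
      MissList (lay σ) (σ'.reg 7) (N.K + 1) (σ'.arr 13) (σ'.reg 8) := by
  let P0 : Prog := 6 ≔ .get 10 (rg 31) ⨾ 7 ≔ vE (twE (rg 6)) ⨾ 8 ≔ 0
  have hlen : missStep.len = 9 := rfl
  set σ1 := (((σ.setReg 6 (σ.arr 10 (σ.reg 31))).setReg 7
    (σ.arr 4 (tw (σ.arr 10 (σ.reg 31))))).setReg 8 0).setReg 4 1 with hσ1
  obtain ⟨t, σ', r, ht, ⟨f, b1, b2, b3, b4⟩, hc⟩ := runs_loop (e := ltE (rg 4) (rg 2 + 1))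
    (p := missStep)
    (fun τ => Frame σ1 τ ∧ 1 ≤ τ.reg 4 ∧ τ.reg 4 ≤ N.K + 1 ∧
      (∀ c, 1 ≤ c → c < τ.reg 4 → τ.arr 12 c = 0) ∧
      MissList (lay σ1) (σ1.reg 7) (τ.reg 4) (τ.arr 13) (τ.reg 8))
    (fun τ => 10 * (N.K + 1 - τ.reg 4))
    (by
      rintro τ ⟨f, a1, a2, a3, a4⟩ hne
      obtain ⟨t, ht, r⟩ := runs_exec missStep τ rfl
      obtain ⟨s1, s2, s3, s4⟩ := missStep_spec τ
      rw [f.lay, f.reg 7 (by simp)] at s3 s4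
      have hlt : τ.reg 4 < N.K + 1 := by
        by_contra h
        apply hne
        have : τ.reg 2 = N.K := by rw [f.reg 2 (by simp), hσ1]; simpa using hK
        simp [this]; omega
      refine ⟨t, _, r, ⟨f.trans (framed_exec _ _ rfl), by omega, by omega, fun c h1 h2 => ?_, ?_⟩, ?_⟩
      · rw [s2, Function.update_apply]
        split_ifs with e
        · rfl
        · exact a3 c h1 (by omega)
      · rw [s1]
        by_cases hcol : (lay σ1).col (σ1.reg 7) (τ.reg 4)
        · rw [(s3 hcol).1, (s3 hcol).2]
          refine ⟨fun i hi => ?_, a4.inj, fun c h1 h2 h3 => a4.surj c h1 ?_ h3⟩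
          · have := a4.mem i hi; exact ⟨this.1, by omega, this.2.2⟩
          · have : c ≠ τ.reg 4 := by rintro rfl; exact h3 hcol
            omega
        · rw [(s4 hcol).1, (s4 hcol).2]
          refine ⟨fun i hi => ?_, fun i j hij hj => ?_, fun c h1 h2 h3 => ?_⟩
          · rw [Function.update_apply]
            split_ifs with e
            · exact ⟨a1, by omega, hcol⟩
            · have := a4.mem i (by omega); exact ⟨this.1, by omega, this.2.2⟩
          · rw [Function.update_of_ne (by omega), Function.update_apply]
            split_ifs with e
            · have := a4.mem i (by omega); omega
            · exact a4.inj i j hij (by omega)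
          · by_cases e : c = τ.reg 4
            · exact ⟨τ.reg 8, by omega, by simp [e]⟩
            · obtain ⟨i, hi, h⟩ := a4.surj c h1 (by omega) h3
              exact ⟨i, by omega, by rw [Function.update_of_ne (by omega)]; exact h⟩
      · omega)
    σ1 ⟨.refl _, by simp [hσ1], by simp [hσ1], fun c h1 h2 => by simp [hσ1] at h2; omega,
      ⟨fun i hi => by simp [hσ1] at hi, fun i j _ hj => by simp [hσ1] at hj,
        fun c h1 h2 => by simp [hσ1] at h2; omega⟩⟩
  have hk : σ'.reg 4 = N.K + 1 := by
    have : σ'.reg 2 = N.K := by rw [f.reg 2 (by simp), hσ1]; simpa using hK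
    simp [this] at hc; omega
  have h6 : σ'.reg 6 = σ.arr 10 (σ.reg 31) := by rw [f.reg 6 (by simp)]; simp [hσ1]
  have h7 : σ'.reg 7 = σ1.reg 7 := f.reg 7 (by simp)
  refine ⟨_, σ', (Runs.assign _ _ _).seq ((Runs.assign _ _ _).seq ((Runs.assign _ _ _).seq
    ((Runs.assign _ _ _).seq (t' := t) (σ'' := σ') ?_))), ?_, fun a h1 h2 => ?_, fun x hx => ?_, h6, ?_,
    fun c h1 h2 => b3 c h1 (by omega), ?_⟩
  · convert r using 1
    simp [hσ1]
  · have : σ1.reg 4 = 1 := by simp [hσ1]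
    rw [this] at ht
    omega
  · rw [f.arr a h1 h2]; simp [hσ1]
  · rw [f.reg x (by tauto), hσ1]
    have : x ≠ 4 ∧ x ≠ 8 ∧ x ≠ 7 ∧ x ≠ 6 := by omega
    simp [this]
  · rw [h7, h6]; simp [hσ1]
  · rw [← hk, h7]
    exact b4

/-! ### Marking the labels of the tokens at the center -/

/-- Mark the label of the token at position `reg 28` in the list of darts at the center, if there is one,
and put it into register `11` if it has the same label as the token in register `6`. -/
def markStep : Prog :=
  26 ≔ twE (.get 9 (ixE (rg 7) (rg 28))) ⨾
  .branch (hE (rg 26)) (.branch (hE (twE (rg 26))) .skip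
    (25 ≔ hE (rg 26) ⨾
     .branch (.get 12 (rg 25)) (.store 12 (rg 25) 1) (.store 12 (rg 25) (rg 26)) ⨾
     .branch (eqE (rg 25) (hE (rg 6))) (.branch (eqE (rg 26) (rg 6)) .skip (11 ≔ rg 26)) .skip))
    .skip ⨾
  28 ≔ rg 28 + 1

/-- Mark the labels of all tokens at the center. -/
def markP : Prog := 11 ≔ 0 ⨾ 28 ≔ 0 ⨾ .loop (ltE (rg 28) (.get 8 (rg 7))) markStep

theorem markStep_spec (σ : Mem) (y : ℕ) (hy : tw (σ.arr 9 (ix (σ.reg 7) (σ.reg 28))) = y) :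
    (markStep.exec σ).reg 28 = σ.reg 28 + 1 ∧
    (¬ ((lay σ).H y ≠ 0 ∧ (lay σ).H (tw y) = 0) → (markStep.exec σ).arr 12 = σ.arr 12 ∧
      (markStep.exec σ).reg 11 = σ.reg 11) ∧
    ((lay σ).H y ≠ 0 ∧ (lay σ).H (tw y) = 0 →
      (markStep.exec σ).arr 12 = Function.update (σ.arr 12) ((lay σ).H y)
        (if σ.arr 12 ((lay σ).H y) = 0 then y else 1) ∧
      (markStep.exec σ).reg 11 =
        if (lay σ).H y = (lay σ).H (σ.reg 6) ∧ y ≠ σ.reg 6 then y else σ.reg 11) := by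
  have e : (lay σ).H = σ.arr 5 := rfl
  rw [e]
  by_cases h1 : σ.arr 5 y = 0
  · simp [markStep, Prog.exec, hy, h1]
  by_cases h2 : σ.arr 5 (tw y) = 0
  · by_cases h3 : σ.arr 12 (σ.arr 5 y) = 0 <;> by_cases h4 : σ.arr 5 y = σ.arr 5 (σ.reg 6) <;>
      by_cases h5 : y = σ.reg 6 <;>
      simp [markStep, Prog.exec, hy, h1, h2, h3, h4, h5] <;> simp_all
  · simp [markStep, Prog.exec, hy, h1, h2]

end

section
variable {N : Net} {X C : ℕ → Prop}

/-- `markP` marks the starting colors of the walks of all tokens at the center `u`, and finds out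
whether another token with center `u` has the label of `h`. -/
theorem markP_spec (σ : Mem) (st : Static N σ) (hN : N.Good) (I : Inv N X C (lay σ)) {u h : ℕ}
    (h7 : σ.reg 7 = u) (h6 : σ.reg 6 = h) (hMK : ∀ c, 1 ≤ c → c ≤ N.K → σ.arr 12 c = 0) :
    ∃ t σ', Runs markP σ t σ' ∧ t ≤ 30 * N.K + 10 ∧ Frame σ σ' ∧
      Marks N (lay σ) u (σ'.arr 12) ∧
      (∀ y, (lay σ).single N u y → ∀ c, 1 ≤ c → c ≤ N.K → σ'.arr 12 c = y → c = (lay σ).H y) ∧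
      (σ'.reg 11 = 0 → ∀ y, (lay σ).tokAt N u y → (lay σ).H y = (lay σ).H h → y = h) ∧
      (σ'.reg 11 ≠ 0 → (lay σ).tokAt N u (σ'.reg 11) ∧ σ'.reg 11 ≠ h ∧
        (lay σ).H (σ'.reg 11) = (lay σ).H h) := by
  subst h7 h6
  set L := lay σ with hL
  set u := σ.reg 7 with hu
  let D : ℕ → ℕ → Prop := fun k y => ∃ j < k, tw (σ.arr 9 (ix u j)) = y
  have hlen : markStep.len = 19 := rfl
  set σ1 := (σ.setReg 11 0).setReg 28 0 with hσ1
  have f1 : Frame σ σ1 := framed_exec (11 ≔ 0 ⨾ 28 ≔ 0) σ rfl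
  obtain ⟨t, σ', r, ht, ⟨f, b1, b2, b3⟩, hc⟩ := runs_loop (e := ltE (rg 28) (.get 8 (rg 7)))
    (p := markStep)
    (fun τ => Frame σ τ ∧ τ.reg 28 ≤ σ.arr 8 u ∧
      (∀ c, 1 ≤ c → c ≤ N.K →
        (τ.arr 12 c = 0 ∧ ∀ y, D (τ.reg 28) y → L.tokAt N u y → L.H y ≠ c) ∨
        (D (τ.reg 28) (τ.arr 12 c) ∧ L.tokAt N u (τ.arr 12 c) ∧ L.H (τ.arr 12 c) = c ∧
          ∀ y, D (τ.reg 28) y → L.tokAt N u y → L.H y = c → y = τ.arr 12 c) ∨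
        (τ.arr 12 c = 1 ∧ ∃ d d', d ≠ d' ∧ L.tokAt N u d ∧ L.tokAt N u d' ∧ L.H d = c ∧
          L.H d' = c)) ∧
      ((τ.reg 11 = 0 ∧ ∀ y, D (τ.reg 28) y → L.tokAt N u y → L.H y = L.H (σ.reg 6) → y = σ.reg 6) ∨
        (L.tokAt N u (τ.reg 11) ∧ τ.reg 11 ≠ σ.reg 6 ∧ L.H (τ.reg 11) = L.H (σ.reg 6))))
    (fun τ => 24 * (σ.arr 8 u - τ.reg 28))
    (by
      rintro τ ⟨f, a1, a2, a3⟩ hne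
      obtain ⟨t, ht, r⟩ := runs_exec markStep τ rfl
      have e7 : τ.reg 7 = u := f.reg 7 (by simp)
      have e6 : τ.reg 6 = σ.reg 6 := f.reg 6 (by simp)
      have e8 : τ.arr 8 = σ.arr 8 := f.arr 8 (by simp) (by simp)
      have e9 : τ.arr 9 = σ.arr 9 := f.arr 9 (by simp) (by simp)
      have hlt : τ.reg 28 < σ.arr 8 u := by
        by_contra h
        apply hne
        simp [e7, e8]; omega
      obtain ⟨g1, g2⟩ := st.mem u _ hlt
      generalize hk : τ.reg 28 = k at *
      generalize hy : tw (σ.arr 9 (ix u k)) = y at *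
      have hyy : tw y = σ.arr 9 (ix u k) := by rw [← hy, g1.tw_tw]
      have hyd : N.dart y := hy ▸ Net.dart_tw g1
      obtain ⟨s1, s2, s3⟩ := markStep_spec τ y (by rw [e9, e7, hk]; exact hy)
      rw [f.lay, e6] at s3
      rw [f.lay] at s2
      have tk : L.tokAt N u y ↔ L.H y ≠ 0 ∧ L.H (tw y) = 0 := by
        unfold Lay.tokAt Lay.tok
        rw [hyy, g2]; simp [hyd]
      have Ds : ∀ z, D (k + 1) z ↔ D k z ∨ z = y := fun z => by
        constructor
        · rintro ⟨j, hj, e⟩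
          rcases Nat.lt_or_ge j k with h | h
          · exact Or.inl ⟨j, h, e⟩
          · right; rw [← e, ← hy, show j = k by omega]
        · rintro (⟨j, hj, e⟩ | rfl)
          · exact ⟨j, by omega, e⟩
          · exact ⟨k, by omega, hy⟩
      have Dy : ¬ D k y := by
        rintro ⟨j, hj, e⟩
        have hj' := st.mem u j (by omega)
        have := congrArg tw (e.trans hy.symm)
        rw [hj'.1.tw_tw, g1.tw_tw] at this
        have := st.inj u j (by omega) k hlt this
        omega
      refine ⟨t, _, r, ⟨f.trans (framed_exec _ _ rfl), by omega, fun c h1 h2 => ?_, ?_⟩, by omega⟩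
      · rw [s1, hk]
        by_cases hT : L.tokAt N u y
        · rw [(s3 (tk.1 hT)).1]
          rw [← hL]
          by_cases hcy : c = L.H y
          · have h := a2 c h1 h2
            subst hcy
            rw [Function.update_self]
            rcases h with ⟨h, h'⟩ | ⟨h, h', h3, h4⟩ | ⟨h, h'⟩
            · rw [if_pos h]
              refine Or.inr (Or.inl ⟨(Ds _).2 (Or.inr rfl), hT, rfl, fun z hz hzt hzc => ?_⟩)
              rcases (Ds z).1 hz with hz | hz
              · exact (h' z hz hzt hzc).elim
              · exact hz
            · have : τ.arr 12 (L.H y) ≠ 0 := by have := h'.1.ge; omega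
              rw [if_neg this]
              refine Or.inr (Or.inr ⟨rfl, y, _, ?_, hT, h', rfl, h3⟩)
              intro e; rw [← e] at h; exact Dy h
            · rw [if_neg (by omega)]
              exact Or.inr (Or.inr ⟨rfl, h'⟩)
          · rw [Function.update_of_ne hcy]
            rcases a2 c h1 h2 with ⟨h, h'⟩ | ⟨h, h', h3, h4⟩ | h
            · refine Or.inl ⟨h, fun z hz hzt hzc => ?_⟩
              rcases (Ds z).1 hz with hz | rfl
              · exact (h' z hz hzt hzc).elim
              · exact hcy hzc.symm
            · refine Or.inr (Or.inl ⟨(Ds _).2 (Or.inl h), h', h3, fun z hz hzt hzc => ?_⟩)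
              rcases (Ds z).1 hz with hz | rfl
              · exact h4 z hz hzt hzc
              · exact (hcy hzc.symm).elim
            · exact Or.inr (Or.inr h)
        · rw [(s2 (fun h => hT (tk.2 h))).1]
          have hD : ∀ z, D (k + 1) z → L.tokAt N u z → D k z := fun z hz hzt =>
            ((Ds z).1 hz).resolve_right fun e => hT (e ▸ hzt)
          rcases a2 c h1 h2 with ⟨h, h'⟩ | ⟨h, h', h3, h4⟩ | h
          · exact Or.inl ⟨h, fun z hz hzt => h' z (hD z hz hzt) hzt⟩
          · exact Or.inr (Or.inl ⟨(Ds _).2 (Or.inl h), h', h3, fun z hz hzt => h4 z (hD z hz hzt) hzt⟩)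
          · exact Or.inr (Or.inr h)
      · rw [s1, hk]
        by_cases hT : L.tokAt N u y
        · rw [(s3 (tk.1 hT)).2, ← hL]
          split_ifs with hif
          · exact Or.inr ⟨hT, hif.2, hif.1⟩
          · rcases a3 with ⟨h, h'⟩ | h
            · refine Or.inl ⟨h, fun z hz hzt hzc => ?_⟩
              rcases (Ds z).1 hz with hz | rfl
              · exact h' z hz hzt hzc
              · by_contra hne; exact hif ⟨hzc, hne⟩
            · exact Or.inr h
        · rw [(s2 (fun h => hT (tk.2 h))).2]
          rcases a3 with ⟨h, h'⟩ | h
          · exact Or.inl ⟨h, fun z hz hzt => h' z (((Ds z).1 hz).resolve_right fun e => hT (e ▸ hzt)) hzt⟩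
          · exact Or.inr h)
    σ1 ⟨f1, by simp [hσ1], fun c h1 h2 => Or.inl ⟨by simpa [hσ1] using hMK c h1 h2, by
      rintro y ⟨j, hj, -⟩; simp [hσ1] at hj⟩, Or.inl ⟨by simp [hσ1], by
      rintro y ⟨j, hj, -⟩; simp [hσ1] at hj⟩⟩
  have hk : σ'.reg 28 = σ.arr 8 u := by
    have e7 : σ'.reg 7 = u := f.reg 7 (by simp)
    have e8 : σ'.arr 8 = σ.arr 8 := f.arr 8 (by simp) (by simp)
    simp [e7, e8] at hc; omega
  have hD : ∀ y, L.tokAt N u y → D (σ'.reg 28) y := fun y hy => by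
    obtain ⟨k, hk', e⟩ := st.surj (tw y) (Net.dart_tw hy.1.1)
    rw [hy.2] at hk' e
    exact ⟨k, by omega, by rw [e, hy.1.1.tw_tw]⟩
  have hdeg : σ.arr 8 u ≤ N.K := (st.deg u).trans (hN.deg_lt u).le
  have sing : ∀ c, 1 ≤ c → c ≤ N.K → ∀ y, L.single N u y → L.H y = c → σ'.arr 12 c = y := by
    intro c h1 h2 y hy hyc
    rcases b2 c h1 h2 with ⟨h, h'⟩ | ⟨h, h', h3, h4⟩ | ⟨h, d, d', hne, k1, k2, k3, k4⟩
    · exact (h' y (hD y hy.1) hy.1 hyc).elim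
    · exact (h4 y (hD y hy.1) hy.1 hyc).symm
    · exact (hne ((hy.2 d k1 (k3.trans hyc.symm)).trans (hy.2 d' k2 (k4.trans hyc.symm)).symm)).elim
  have lab : ∀ y, L.tokAt N u y → ∀ c, 1 ≤ c → c ≤ N.K → σ'.arr 12 c = y → c = L.H y := by
    intro y hy c h1 h2 e
    have := hy.1.ge
    rcases b2 c h1 h2 with ⟨h, h'⟩ | ⟨h, h', h3, h4⟩ | ⟨h, h'⟩
    · omega
    · rw [← e, h3]
    · omega
  refine ⟨_, σ', (Runs.assign _ _ _).seq ((Runs.assign _ _ _).seq (t' := t) (σ'' := σ') r), ?_, f,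
    ⟨fun c h1 h2 => ?_, fun y hy => ?_, fun y hy hn => ?_⟩, fun y hy => lab y hy.1, fun h0 y hy hyc => ?_,
    fun h0 => ?_⟩
  · have : σ1.reg 28 = 0 := by simp [hσ1]
    omega
  · rcases b2 c h1 h2 with h | ⟨h, h', h3, h4⟩ | h
    · exact Or.inl h.1
    · exact Or.inr (Or.inr ⟨h', fun d hd hdc => h4 d (hD d hd) hd (hdc.trans h3)⟩)
    · exact Or.inr (Or.inl h)
  · have hp := I.H_pos hy.1.1
    refine ⟨fun _ => L.H y, 0, ⟨fun i hi => by omega, fun i hi j hj _ => by omega⟩, rfl, fun j hj => ?_,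
      fun c h1 h2 h3 => ⟨0, le_rfl, (lab y hy.1 c h1 h2 h3).symm⟩⟩
    exact ⟨sing _ hp.1 hp.2 y hy rfl, hp⟩
  · have hp := I.H_pos hy.1
    rcases b2 _ hp.1 hp.2 with ⟨h, h'⟩ | ⟨h, h', h3, h4⟩ | h
    · exact (h' y (hD y hy) hy rfl).elim
    · exfalso
      refine hn ⟨hy, fun d hd hdc => ?_⟩
      exact (h4 d (hD d hd) hd hdc).trans (h4 y (hD y hy) hy rfl).symm
    · exact h.1
  · rcases b3 with ⟨-, h⟩ | ⟨h, -⟩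
    · exact h y (hD y hy) hy hyc
    · have := h.1.ge; omega
  · exact b3.resolve_left fun h => h0 h.1

end

/-! ### The walks of the tokens at the center -/

section
variable {N : Net} {X C : ℕ → Prop}

@[simp] theorem eval_two (σ : Mem) : (2 : Expr).eval σ = 2 := rfl

/-- One step of the walk of the token in register `12`, which has got to the color in register `13`.
Register `15` is cleared if the walk ends, register `14` is set to `1` if it ends at a missing color and
to `2` if it ends at a mark of another token. If the token in register `6` runs into a loop,
then register `10` gets a color of the loop. -/
def searchStep : Prog :=
  .branch (hE (twE (tE (rg 7) (rg 13))))
    (13 ≔ mE (vE (twE (tE (rg 7) (rg 13)))) ⨾ 27 ≔ .get 12 (rg 13) ⨾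
     .branch (rg 27)
      (15 ≔ 0 ⨾ .branch (eqE (rg 27) (rg 12))
        (.branch (eqE (rg 12) (rg 6)) (10 ≔ rg 13) .skip) (14 ≔ 2))
      (.store 12 (rg 13) (rg 12)))
    (14 ≔ 1 ⨾ 15 ≔ 0)

/-- The walk of the token at position `reg 4` in the list of darts at the center, if there is one. -/
def searchTok : Prog :=
  12 ≔ twE (.get 9 (ixE (rg 7) (rg 4))) ⨾
  .branch (hE (rg 12)) (.branch (hE (twE (rg 12))) .skip
    (.branch (eqE (.get 12 (hE (rg 12))) 1) .skip
      (13 ≔ hE (rg 12) ⨾ 15 ≔ 1 ⨾ .loop (rg 15) searchStep))) .skip ⨾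
  4 ≔ rg 4 + 1

/-- The walks of all tokens at the center, until one of them ends otherwise than with a loop. -/
def searchP : Prog := 14 ≔ 0 ⨾ 4 ≔ 0 ⨾
  .loop (ltE (rg 4) (.get 8 (rg 7)) * eqE (rg 14) 0) searchTok

theorem searchStep_col (σ : Mem) (h : (lay σ).col (σ.reg 7) (σ.reg 13)) (c : ℕ)
    (hc : c = σ.arr 7 (σ.arr 4 (tw ((lay σ).T (σ.reg 7) (σ.reg 13))))) :
    (searchStep.exec σ).reg 13 = c ∧ (searchStep.exec σ).reg 12 = σ.reg 12 ∧
    (searchStep.exec σ).reg 4 = σ.reg 4 ∧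
    (σ.arr 12 c = 0 → (searchStep.exec σ).arr 12 = Function.update (σ.arr 12) c (σ.reg 12) ∧
      (searchStep.exec σ).reg 14 = σ.reg 14 ∧ (searchStep.exec σ).reg 15 = σ.reg 15 ∧
      (searchStep.exec σ).reg 10 = σ.reg 10) ∧
    (σ.arr 12 c ≠ 0 → (searchStep.exec σ).arr 12 = σ.arr 12 ∧ (searchStep.exec σ).reg 15 = 0 ∧
      (σ.arr 12 c = σ.reg 12 → (searchStep.exec σ).reg 14 = σ.reg 14 ∧
        (σ.reg 12 = σ.reg 6 → (searchStep.exec σ).reg 10 = c) ∧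
        (σ.reg 12 ≠ σ.reg 6 → (searchStep.exec σ).reg 10 = σ.reg 10)) ∧
      (σ.arr 12 c ≠ σ.reg 12 → (searchStep.exec σ).reg 14 = 2 ∧
        (searchStep.exec σ).reg 10 = σ.reg 10)) := by
  have h' : σ.arr 5 (tw (σ.arr 6 (ix (σ.reg 7) (σ.reg 13)))) ≠ 0 := h
  have hc' : σ.arr 7 (σ.arr 4 (tw (σ.arr 6 (ix (σ.reg 7) (σ.reg 13))))) = c := hc.symm
  by_cases h1 : σ.arr 12 c = 0
  · simp [searchStep, Prog.exec, h', hc', h1]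
  · by_cases h2 : σ.arr 12 c = σ.reg 12
    · by_cases h3 : σ.reg 12 = σ.reg 6
      · have h4 : σ.reg 6 ≠ 0 := by rw [← h3, ← h2]; exact h1
        simp [searchStep, Prog.exec, h', hc', h2, h3, h4]
      · have h4 : σ.reg 12 ≠ 0 := by rw [← h2]; exact h1
        simp [searchStep, Prog.exec, h', hc', h2, h3, h4]
    · simp [searchStep, Prog.exec, h', hc', h1, h2]

theorem searchStep_miss (σ : Mem) (h : ¬ (lay σ).col (σ.reg 7) (σ.reg 13)) :
    (searchStep.exec σ).reg 13 = σ.reg 13 ∧ (searchStep.exec σ).reg 12 = σ.reg 12 ∧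
    (searchStep.exec σ).reg 4 = σ.reg 4 ∧
    (searchStep.exec σ).arr 12 = σ.arr 12 ∧ (searchStep.exec σ).reg 15 = 0 ∧
    (searchStep.exec σ).reg 14 = 1 ∧ (searchStep.exec σ).reg 10 = σ.reg 10 := by
  have h' : σ.arr 5 (tw (σ.arr 6 (ix (σ.reg 7) (σ.reg 13)))) = 0 := not_not.1 h
  simp [searchStep, Prog.exec, h']

/-- The walks of the tokens `y` with `D y` have run into loops, and only the walks of the tokens `y` with
`E y` have begun. -/
structure Searching (N : Net) (L : Lay) (u h : ℕ) (D E : ℕ → Prop) (MK : ℕ → ℕ) (cl : ℕ) : Prop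
    extends Marks N L u MK where
  fresh : ∀ y, L.single N u y → ¬ E y → ∀ c, 1 ≤ c → c ≤ N.K → MK c = y → c = L.H y
  shut : ∀ y, L.single N u y → D y → ∃ s n, Trail N L u MK y s n ∧ Shut N L u s n ∧
    (y = h → cl = L.lk N u (s n))

/-- The walk of `y` has got to the missing color `c`. -/
def Hit (N : Net) (L : Lay) (u y c : ℕ) : Prop :=
  L.single N u y ∧ ¬ L.col u c ∧ ∃ s n, IsWalk N L u s n ∧ s 0 = L.H y ∧ s n = c

/-- The walk of `y` has got to the color `c` with the mark of another token. -/
def Clash (N : Net) (L : Lay) (u y c : ℕ) (MK : ℕ → ℕ) : Prop :=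
  Marks N L u MK ∧ L.single N u y ∧ MK c ≠ 0 ∧ MK c ≠ y ∧ ∃ s n, Trail N L u MK y s n ∧
    L.col u (s n) ∧ L.lk N u (s n) = c

/-- The walk of the token `y`. Every step but the last marks a new color, so the number of unmarked
colors pays for the steps. -/
theorem search_loop {L : Lay} {u h y : ℕ} {D : ℕ → Prop} (I : Inv N X C L) (σ : Mem)
    (hL : lay σ = L) (hV : σ.arr 4 = N.V)
    (h7 : σ.reg 7 = u) (h6 : σ.reg 6 = h) (h12 : σ.reg 12 = y) (hy : L.single N u y) (hD : ¬ D y)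
    (h15 : σ.reg 15 = 1) (h14 : σ.reg 14 = 0) (h13 : σ.reg 13 = L.H y)
    (S : Searching N L u h D D (σ.arr 12) (σ.reg 10)) :
    ∃ t σ', Runs (.loop (rg 15) searchStep) σ t σ' ∧
      t + 30 * unmarked N (σ'.arr 12) ≤ 30 * unmarked N (σ.arr 12) + 31 ∧ Frame σ σ' ∧
      σ'.reg 4 = σ.reg 4 ∧ σ'.reg 12 = y ∧
      ((σ'.reg 14 = 0 ∧ Searching N L u h (fun z => D z ∨ z = y) (fun z => D z ∨ z = y) (σ'.arr 12) (σ'.reg 10)) ∨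
       (σ'.reg 14 = 1 ∧ Hit N L u y (σ'.reg 13)) ∨
       (σ'.reg 14 = 2 ∧ Clash N L u y (σ'.reg 13) (σ'.arr 12))) := by
  have hlen : searchStep.len = 17 := rfl
  have start : ∃ s n, Trail N L u (σ.arr 12) y s n ∧ s n = σ.reg 13 := by
    obtain ⟨s, n, T⟩ := S.trail y hy
    refine ⟨s, 0, ⟨⟨fun i hi => by omega, fun i hi j hj _ => by omega⟩, T.zero, fun j hj => ?_,
      fun c h1 h2 h3 => ⟨0, le_rfl, ?_⟩⟩, T.zero.trans h13.symm⟩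
    · exact T.mark j (by omega)
    · rw [T.zero, S.fresh y hy hD c h1 h2 h3]
  have hy0 := hy.1.1.ge
  obtain ⟨t, σ', r, ht, ⟨f, b4, b12, b⟩, hc⟩ := runs_loop (e := rg 15) (p := searchStep)
    (fun τ => Frame σ τ ∧ τ.reg 4 = σ.reg 4 ∧ τ.reg 12 = y ∧
      ((τ.reg 15 = 1 ∧ τ.reg 14 = 0 ∧ Searching N L u h D (fun z => D z ∨ z = y) (τ.arr 12) (τ.reg 10) ∨ τ.reg 15 = 0) ∧
       (τ.reg 15 = 1 → ∃ s n, Trail N L u (τ.arr 12) y s n ∧ s n = τ.reg 13) ∧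
       (τ.reg 15 = 0 →
       ((τ.reg 14 = 0 ∧ Searching N L u h (fun z => D z ∨ z = y) (fun z => D z ∨ z = y) (τ.arr 12) (τ.reg 10)) ∨
       (τ.reg 14 = 1 ∧ Hit N L u y (τ.reg 13)) ∨
       (τ.reg 14 = 2 ∧ Clash N L u y (τ.reg 13) (τ.arr 12))))))
    (fun τ => 30 * unmarked N (τ.arr 12) + 30 * τ.reg 15)
    (by
      rintro τ ⟨f, a4, a12, a1, a2, -⟩ hne
      have h15' : τ.reg 15 ≠ 0 := hne
      obtain ⟨a15, a14, S⟩ := a1.resolve_right h15'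
      obtain ⟨s, n, T, hs⟩ := a2 a15
      obtain ⟨t, ht, r⟩ := runs_exec searchStep τ rfl
      have fl : lay τ = L := f.lay.trans hL
      have e7 : τ.reg 7 = u := (f.reg 7 (by simp)).trans h7
      have e6 : τ.reg 6 = h := (f.reg 6 (by simp)).trans h6
      have eV : τ.arr 4 = N.V := (f.arr 4 (by simp) (by simp)).trans hV
      refine ⟨t, _, r, ?_⟩
      by_cases hcol : L.col u (τ.reg 13)
      · obtain ⟨c13, c12, c4, c0, c1⟩ := searchStep_col τ (by rw [fl, e7]; exact hcol)
          (L.lk N u (τ.reg 13)) (by rw [fl, e7, eV, ← fl]; rfl)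
        rw [← hs] at hcol c13 c0 c1
        have hp := I.lk_pos hcol
        by_cases hm : τ.arr 12 (L.lk N u (s n)) = 0
        · obtain ⟨d12, d14, d15, d10⟩ := c0 hm
          rw [a12] at d12 c12
          have hu := unmarked_update (N := N) hp hm (show y ≠ 0 by omega)
          have m' := S.toMarks.extend I hy T hcol hm
          refine ⟨⟨f.trans (framed_exec _ _ rfl), c4.trans a4, c12, Or.inl ⟨d15.trans a15, d14.trans a14, ?_⟩,
            fun _ => ⟨Function.update s (n + 1) (L.lk N u (s n)), n + 1, ?_, ?_⟩,
            fun h => by omega⟩, by rw [d12, d15]; omega⟩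
          · rw [d12, d10]
            refine ⟨m', fun z hz hDz c h1 h2 h3 => ?_, fun z hz hDz => ?_⟩
            · rw [Function.update_apply] at h3
              split_ifs at h3
              · exact (hDz (Or.inr h3.symm)).elim
              · exact S.fresh z hz hDz c h1 h2 h3
            · obtain ⟨s', n', T', k1, k2⟩ := S.shut z hz hDz
              exact ⟨s', n', T'.update hm (by have := hz.1.1.ge; omega)
                (fun e => hD (e ▸ hDz)), k1, k2⟩
          · rw [d12]; exact T.extend hcol hm (by omega) hp
          · rw [c13]; simp
        · obtain ⟨d12, d15, d1, d2⟩ := c1 hm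
          rw [a12] at d1 d2 c12
          refine ⟨⟨f.trans (framed_exec _ _ rfl), c4.trans a4, c12, Or.inr d15,
            fun h => by omega, fun _ => ?_⟩, by rw [d12, d15]; omega⟩
          by_cases hmy : τ.arr 12 (L.lk N u (s n)) = y
          · left
            obtain ⟨d14, d10, d10'⟩ := d1 hmy
            refine ⟨d14.trans a14, ?_⟩
            rw [d12]
            obtain ⟨j, hj, hsj⟩ := T.only _ hp.1 hp.2 hmy
            refine ⟨S.toMarks, S.fresh,
              fun z hz hDz => ?_⟩
            by_cases hzy : z = y
            · subst hzy
              refine ⟨s, n, T, ⟨hcol, j, hj, hsj.symm⟩, fun e => d10 (by rw [e6]; exact e)⟩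
            · obtain ⟨s', n', T', k1, k2⟩ := S.shut z hz (hDz.resolve_right hzy)
              refine ⟨s', n', T', k1, fun e => ?_⟩
              rw [d10' (by rw [e6, ← e]; exact Ne.symm hzy)]
              exact k2 e
          · right; right
            rw [d12, c13]
            exact ⟨(d2 hmy).1, S.toMarks, hy, hm, hmy, s, n, T, hcol, rfl⟩
      · obtain ⟨c13, c12, c4, d12, d15, d14, d10⟩ := searchStep_miss τ (by rw [fl, e7]; exact hcol)
        refine ⟨⟨f.trans (framed_exec _ _ rfl), c4.trans a4, c12.trans a12, Or.inr d15,
          fun h => by omega, fun _ => Or.inr (Or.inl ⟨d14, hy, ?_⟩)⟩, by rw [d12, d15]; omega⟩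
        rw [c13]
        exact ⟨hcol, s, n, T.walk, T.zero, hs⟩)
    σ ⟨.refl _, rfl, h12, Or.inl ⟨h15, h14, S.toMarks,
      fun z hz h => S.fresh z hz fun h' => h (Or.inl h'), S.shut⟩, fun _ => start, fun h => by omega⟩
  exact ⟨t, σ', r, by rw [h15] at ht; omega, f, b4, b12, b.2.2 hc⟩

theorem Searching.congr {L : Lay} {u h cl : ℕ} {D D' : ℕ → Prop} {MK : ℕ → ℕ}
    (S : Searching N L u h D D MK cl) (hD : ∀ z, L.single N u z → (D z ↔ D' z)) :
    Searching N L u h D' D' MK cl :=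
  ⟨S.toMarks, fun z hz h => S.fresh z hz fun h' => h ((hD z hz).1 h'),
    fun z hz h => S.shut z hz ((hD z hz).2 h)⟩

theorem searchTok_spec {L : Lay} {u h y : ℕ} {D : ℕ → Prop} (I : Inv N X C L) (σ : Mem)
    (hL : lay σ = L) (hV : σ.arr 4 = N.V)
    (h7 : σ.reg 7 = u) (h6 : σ.reg 6 = h) (hy : tw (σ.arr 9 (ix (σ.reg 7) (σ.reg 4))) = y)
    (hyd : N.dart y) (hyu : N.V (tw y) = u) (hD : ¬ D y) (h14 : σ.reg 14 = 0)
    (S : Searching N L u h D D (σ.arr 12) (σ.reg 10)) :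
    ∃ t σ', Runs searchTok σ t σ' ∧
      t + 30 * unmarked N (σ'.arr 12) ≤ 30 * unmarked N (σ.arr 12) + 45 ∧ Frame σ σ' ∧
      σ'.reg 4 = σ.reg 4 + 1 ∧
      ((σ'.reg 14 = 0 ∧
        Searching N L u h (fun z => D z ∨ z = y) (fun z => D z ∨ z = y) (σ'.arr 12) (σ'.reg 10)) ∨
       (σ'.reg 14 = 1 ∧ Hit N L u (σ'.reg 12) (σ'.reg 13)) ∨
       (σ'.reg 14 = 2 ∧ Clash N L u (σ'.reg 12) (σ'.reg 13) (σ'.arr 12))) := by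
  set σ1 := σ.setReg 12 y with hσ1
  have f1 : Frame σ σ1 := ⟨fun _ _ _ => rfl, fun x hx => by
    have : x ≠ 12 := by omega
    simp [hσ1, this]⟩
  have start : Runs (12 ≔ twE (.get 9 (ixE (rg 7) (rg 4)))) σ 1 σ1 := by
    convert Runs.assign 12 _ σ using 1
    simp [hσ1, hy]
  have hH : ∀ d, σ1.arr 5 d = L.H d := fun d => by rw [← hL]; rfl
  -- nothing is done unless `y` is the only token with its label
  have idle : ¬ L.single N u y → ∀ t, t ≤ 5 →
      Runs (.branch (hE (rg 12)) (.branch (hE (twE (rg 12))) .skip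
        (.branch (eqE (.get 12 (hE (rg 12))) 1) .skip
          (13 ≔ hE (rg 12) ⨾ 15 ≔ 1 ⨾ .loop (rg 15) searchStep))) .skip) σ1 t σ1 →
      ∃ t σ', Runs searchTok σ t σ' ∧
      t + 30 * unmarked N (σ'.arr 12) ≤ 30 * unmarked N (σ.arr 12) + 45 ∧ Frame σ σ' ∧
      σ'.reg 4 = σ.reg 4 + 1 ∧
      ((σ'.reg 14 = 0 ∧
        Searching N L u h (fun z => D z ∨ z = y) (fun z => D z ∨ z = y) (σ'.arr 12) (σ'.reg 10)) ∨
       (σ'.reg 14 = 1 ∧ Hit N L u (σ'.reg 12) (σ'.reg 13)) ∨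
       (σ'.reg 14 = 2 ∧ Clash N L u (σ'.reg 12) (σ'.reg 13) (σ'.arr 12))) := by
    intro hns t ht r
    refine ⟨_, _, start.seq (r.seq (.assign _ _ _)), ?_, f1.trans (framed_exec (4 ≔ rg 4 + 1) _ rfl),
      by simp [hσ1], Or.inl ⟨by simpa [hσ1] using h14, ?_⟩⟩
    · simp [hσ1]; omega
    · have : Searching N L u h (fun z => D z ∨ z = y) (fun z => D z ∨ z = y) (σ.arr 12) (σ.reg 10) :=
        S.congr fun z hz => ⟨Or.inl, fun h => h.resolve_right fun e => hns (e ▸ hz)⟩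
      simpa [hσ1] using this
  by_cases c1 : L.H y = 0
  · exact idle (fun hs => hs.1.1.2.1 c1) 2 (by omega) (.branch_neg (by simp [hσ1]; exact (hH y).trans c1)
      (.skip _))
  have p1 : (hE (rg 12)).eval σ1 ≠ 0 := by simp [hσ1]; exact fun e => c1 ((hH y).symm.trans e)
  by_cases c2 : L.H (tw y) = 0
  swap
  · exact idle (fun hs => c2 hs.1.1.2.2) 3 (by omega) (.branch_pos p1 (.branch_pos
      (by simp [hσ1]; exact fun e => c2 ((hH _).symm.trans e)) (.skip _)))
  have p2 : (hE (twE (rg 12))).eval σ1 = 0 := by simp [hσ1]; exact (hH _).trans c2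
  have hyt : L.tokAt N u y := ⟨⟨hyd, c1, c2⟩, hyu⟩
  have e12 : (Expr.get 12 (hE (rg 12))).eval σ1 = σ.arr 12 (L.H y) := by
    simp only [eval_get, eval_reg, hσ1, setReg_reg, if_true, setReg_arr]
    rw [← hH y, hσ1]; rfl
  by_cases hs : L.single N u y
  · have c3 : σ.arr 12 (L.H y) = y := by
      obtain ⟨s, n, T⟩ := S.trail y hs
      rw [← T.zero]; exact (T.mark 0 (by omega)).1
    have p3 : (eqE (.get 12 (hE (rg 12))) 1).eval σ1 = 0 := by
      have := hyd.1
      rw [eval_eq, e12, c3, if_neg]; simp; omega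
    set σ2 := (σ1.setReg 13 (L.H y)).setReg 15 1 with hσ2
    have f2 : Frame σ1 σ2 := framed_exec (13 ≔ .lit (L.H y) ⨾ 15 ≔ 1) σ1 rfl
    obtain ⟨t, σ', r, ht, f, b4, b12, b⟩ := search_loop (D := D) I σ2 ((f1.trans f2).lay.trans hL)
      (((f1.trans f2).arr 4 (by simp) (by simp)).trans hV)
      (((f1.trans f2).reg 7 (by simp)).trans h7) (((f1.trans f2).reg 6 (by simp)).trans h6)
      (by simp [hσ2, hσ1]) hs hD (by simp [hσ2]) (by simpa [hσ2, hσ1] using h14) (by simp [hσ2])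
      (by simpa [hσ2, hσ1] using S)
    have mid : Runs (13 ≔ hE (rg 12) ⨾ 15 ≔ 1 ⨾ .loop (rg 15) searchStep) σ1 (1 + (1 + t + 1) + 1) σ' := by
      refine (Runs.assign _ _ _).seq ((Runs.assign _ _ _).seq ?_)
      convert r using 1
      rw [hσ2, ← hH y]; simp [hσ1]
    refine ⟨_, _, start.seq ((Runs.branch_pos p1 (.branch_neg p2 (.branch_neg p3 mid))).seq
      (.assign _ _ _)), ?_, (f1.trans (f2.trans f)).trans (framed_exec (4 ≔ rg 4 + 1) _ rfl), ?_, ?_⟩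
    · have : σ2.arr 12 = σ.arr 12 := by simp [hσ2, hσ1]
      rw [this] at ht
      simp; omega
    · simp [b4, hσ2, hσ1]
    · simpa [b12] using b
  · have c3 := S.multi y hyt hs
    exact idle hs 4 (by omega) (.branch_pos p1 (.branch_neg p2 (.branch_pos
      (by rw [eval_eq, e12, c3]; simp) (.skip _))))

/-- `searchP` lets all tokens at `u` walk, in `O(K)` steps altogether: either all walks run into their
own loops, or one of them gets to a missing color, or one of them meets another walk. -/
theorem searchP_spec (σ : Mem) (st : Static N σ) (hN : N.Good) (I : Inv N X C (lay σ)) {u h : ℕ}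
    (h7 : σ.reg 7 = u) (h6 : σ.reg 6 = h) (m : Marks N (lay σ) u (σ.arr 12))
    (fresh : ∀ y, (lay σ).single N u y → ∀ c, 1 ≤ c → c ≤ N.K → σ.arr 12 c = y → c = (lay σ).H y) :
    ∃ t σ', Runs searchP σ t σ' ∧ t ≤ 100 * N.K + 10 ∧ Frame σ σ' ∧
      ((σ'.reg 14 = 0 ∧ ∀ y, (lay σ).single N u y → ∃ s n, Trail N (lay σ) u (σ'.arr 12) y s n ∧
          Shut N (lay σ) u s n ∧ (y = h → σ'.reg 10 = (lay σ).lk N u (s n))) ∨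
       (σ'.reg 14 = 1 ∧ Hit N (lay σ) u (σ'.reg 12) (σ'.reg 13)) ∨
       (σ'.reg 14 = 2 ∧ Clash N (lay σ) u (σ'.reg 12) (σ'.reg 13) (σ'.arr 12))) := by
  let D : ℕ → ℕ → Prop := fun k y => ∃ j < k, tw (σ.arr 9 (ix u j)) = y
  set σ1 := (σ.setReg 14 0).setReg 4 0 with hσ1
  have f1 : Frame σ σ1 := framed_exec (14 ≔ 0 ⨾ 4 ≔ 0) σ rfl
  have hdeg : σ.arr 8 u ≤ N.K := (st.deg u).trans (hN.deg_lt u).le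
  obtain ⟨t, σ', r, ht, ⟨f, b1, b2⟩, hc⟩ := runs_loop
    (e := ltE (rg 4) (.get 8 (rg 7)) * eqE (rg 14) 0) (p := searchTok)
    (fun τ => Frame σ τ ∧ τ.reg 4 ≤ σ.arr 8 u ∧
      ((τ.reg 14 = 0 ∧ Searching N (lay σ) u h (D (τ.reg 4)) (D (τ.reg 4)) (τ.arr 12) (τ.reg 10)) ∨
       (τ.reg 14 = 1 ∧ Hit N (lay σ) u (τ.reg 12) (τ.reg 13)) ∨
       (τ.reg 14 = 2 ∧ Clash N (lay σ) u (τ.reg 12) (τ.reg 13) (τ.arr 12))))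
    (fun τ => 30 * unmarked N (τ.arr 12) + 50 * (σ.arr 8 u - τ.reg 4))
    (by
      rintro τ ⟨f, a1, a2⟩ hne
      have e7 : τ.reg 7 = u := (f.reg 7 (by simp)).trans h7
      have e8 : τ.arr 8 = σ.arr 8 := f.arr 8 (by simp) (by simp)
      have e9 : τ.arr 9 = σ.arr 9 := f.arr 9 (by simp) (by simp)
      have hlt : τ.reg 4 < σ.arr 8 u ∧ τ.reg 14 = 0 := by
        constructor
        · by_contra h
          apply hne
          simp [e7, e8, h]
        · by_contra h
          apply hne
          simp [h]
      obtain ⟨-, S⟩ := a2.resolve_right (by rw [hlt.2]; simp)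
      obtain ⟨g1, g2⟩ := st.mem u _ hlt.1
      obtain ⟨t, τ', r, ht, f', b4, b⟩ := searchTok_spec (D := D (τ.reg 4)) I τ f.lay
        ((f.arr 4 (by simp) (by simp)).trans st.V) e7 ((f.reg 6 (by simp)).trans h6)
        (by rw [e9, e7]) (Net.dart_tw g1) (by rw [g1.tw_tw, g2])
        (by
          rintro ⟨j, hj, e⟩
          have hj' := st.mem u j (by omega)
          have := congrArg tw e
          rw [hj'.1.tw_tw, g1.tw_tw] at this
          have := st.inj u j (by omega) _ hlt.1 this
          omega) hlt.2 S
      refine ⟨t, τ', r, ⟨f.trans f', by omega, ?_⟩, by omega⟩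
      refine b.imp_left fun h => ⟨h.1, h.2.congr fun z _ => ?_⟩
      rw [b4]
      constructor
      · rintro (⟨j, hj, e⟩ | rfl)
        · exact ⟨j, by omega, e⟩
        · exact ⟨τ.reg 4, by omega, rfl⟩
      · rintro ⟨j, hj, e⟩
        rcases Nat.lt_or_ge j (τ.reg 4) with h | h
        · exact Or.inl ⟨j, h, e⟩
        · right; rw [← e, show j = τ.reg 4 by omega])
    σ1 ⟨f1, by simp [hσ1], Or.inl ⟨by simp [hσ1], by
      refine ⟨by simpa [hσ1] using m, fun y hy _ => by simpa [hσ1] using fresh y hy, ?_⟩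
      rintro y - ⟨j, hj, -⟩
      simp [hσ1] at hj⟩⟩
  refine ⟨_, σ', (Runs.assign _ _ _).seq ((Runs.assign _ _ _).seq (t' := t) (σ'' := σ') r), ?_, f, ?_⟩
  · have h1 : σ1.arr 12 = σ.arr 12 := by simp [hσ1]
    have h2 : unmarked N (σ.arr 12) ≤ N.K := unmarked_le
    rw [h1] at ht
    omega
  · refine b2.imp_left fun h => ⟨h.1, fun y hy => h.2.shut y hy ?_⟩
    have e7 : σ'.reg 7 = u := (f.reg 7 (by simp)).trans h7
    have e8 : σ'.arr 8 = σ.arr 8 := f.arr 8 (by simp) (by simp)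
    simp [e7, e8, h.1] at hc
    obtain ⟨k, hk, e⟩ := st.surj (tw y) (Net.dart_tw hy.1.1.1)
    rw [hy.1.2] at hk e
    exact ⟨k, by omega, by rw [e, hy.1.1.1.tw_tw]⟩

end

/-! ### One iteration of the main loop -/

section
variable {N : Net} {X C : ℕ → Prop}

/-- Walk, then color the edge. -/
def finishP : Prog := walkP ⨾ paintP

/-- Two tokens at the center have the label of the token in register `6`: one flip of a path makes this
label usable for one of them. -/
def fanP : Prog :=
  18 ≔ vE (rg 6) ⨾ 19 ≔ rg 9 ⨾ 20 ≔ hE (rg 6) ⨾ flipP ⨾ 12 ≔ rg 6 ⨾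
  .branch (hE (twE (tE (rg 7) (hE (rg 6))))) (12 ≔ rg 11) .skip ⨾ paintP

/-- Two walks have met: both tokens walk to the color where they met. -/
def clashP : Prog :=
  16 ≔ rg 12 ⨾ 12 ≔ .get 12 (rg 13) ⨾ .branch (eqE (rg 12) 1) .skip walkP ⨾ 12 ≔ rg 16 ⨾ walkP

/-- The walk of the token in register `6` runs into a loop: one flip of a path opens it. -/
def openP : Prog :=
  18 ≔ rg 7 ⨾ 19 ≔ rg 10 ⨾ 20 ≔ rg 9 ⨾ flipP ⨾ 12 ≔ rg 6 ⨾ 13 ≔ rg 10 ⨾ finishP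

/-- The part of an iteration after the random choices. -/
def actP : Prog :=
  9 ≔ .get 13 (rg 31) ⨾ markP ⨾ .branch (rg 11) fanP
    (searchP ⨾ .branch (rg 14) (.branch (eqE (rg 14) 1) finishP clashP) openP)

/-- An iteration of the main loop. -/
def iterP : Prog :=
  .sample 31 (rg 3 - 1) ⨾ centerP ⨾ .sample 31 (rg 8 - 1) ⨾ actP

theorem Listed.congr {Λ Λ' : Lay} {L P : ℕ → ℕ} {a : ℕ} (l : Listed N Λ L P a)
    (h : ∀ d, Λ'.tok N d ↔ Λ.tok N d) : Listed N Λ' L P a :=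
  ⟨fun t ht => ⟨(h _).2 (l.tok t ht).1, (l.tok t ht).2⟩, fun d hd => l.pos d ((h d).1 hd)⟩

theorem Listed.card {Λ : Lay} {L P : ℕ → ℕ} {a : ℕ} (l : Listed N Λ L P a) :
    (Λ.toks N).card = a := by
  have : Λ.toks N = (Finset.range a).image L := by
    ext d
    simp only [Lay.mem_toks, Finset.mem_image, Finset.mem_range]
    constructor
    · intro h; exact ⟨P d, l.pos d h⟩
    · rintro ⟨t, ht, rfl⟩; exact (l.tok t ht).1
  rw [this, Finset.card_image_of_injOn, Finset.card_range]
  intro t ht t' ht' e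
  have ht : t < a := by simpa using ht
  have ht' : t' < a := by simpa using ht'
  rw [← (l.tok t ht).2, ← (l.tok t' ht').2, e]

/-- A token whose walk ends in a missing color gets its edge colored. Its own label and the label of one
other token change. -/
theorem finishP_spec (hN : N.Good) (σ : Mem) (g : Good N X C σ) {u y c n : ℕ} {s : ℕ → ℕ}
    (h7 : σ.reg 7 = u) (h12 : σ.reg 12 = y) (h13 : σ.reg 13 = c) (hy : (lay σ).tokAt N u y)
    (hc : ¬ (lay σ).col u c) (hs : IsWalk N (lay σ) u s n) (h0 : s 0 = (lay σ).H y) (hn : s n = c) :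
    ∃ t σ', Runs finishP σ t σ' ∧ t ≤ 42 * N.K + 60 ∧ Good N X C σ' ∧ σ'.reg 3 + 1 = σ.reg 3 ∧
      (lay σ').ncls N ≤ (lay σ).ncls N + 2 := by
  subst h7 h12 h13
  obtain ⟨t, τ, r, ht, g', m, hl, hk⟩ := walkP_spec hN n σ s g hy.1 hy.2 hs h0 hn
  have hnK := hs.length_le g.inv.toCore
  have e7 : τ.reg 7 = σ.reg 7 := r.reg_eq 7 rfl
  have hcol : ¬ (lay τ).col (τ.reg 7) ((lay τ).H (τ.reg 12)) := by
    rw [e7, hl, (hk _ fun i hi e => ?_).1]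
    · exact hc
    · have := hs.2 n le_rfl i hi.le (hn.trans e); omega
  obtain ⟨t', σ', r', ht', g'', h3, o, ho⟩ := paintP_spec hN τ g' m.tok' (by rw [m.ctr, e7, hy.2]) hcol
  have e3 : τ.reg 3 = σ.reg 3 := r.reg_eq 3 rfl
  refine ⟨_, σ', r.seq r', by omega, g'', by omega, ?_⟩
  refine (ncls_le {τ.reg 12, o} fun d hd => ?_).trans (by gcongr; exact Finset.card_le_two)
  simp only [Finset.mem_insert, Finset.mem_singleton]
  rcases ho d hd with h | ⟨h1, h2⟩
  · exact Or.inl (Or.inr h)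
  · rcases (m.toks d).1 h1 with h | ⟨h, h'⟩
    · exact Or.inl (Or.inl h)
    · exact Or.inr ⟨h, h2.trans (m.labels d h h').1⟩

/-- Flipping a path changes the labels of at most four tokens: those at the two ends of the path with
one of the two colors as label. -/
theorem Good.flip {σ σ' : Mem} (g : Good N X C σ) {t x p q : ℕ} (r : Runs flipP σ t σ')
    (F : Flipped N (lay σ) (lay σ') x p q) (hx : ¬ (lay σ).col x q) (hp : 1 ≤ p ∧ p ≤ N.K)
    (hq : 1 ≤ q ∧ q ≤ N.K) :
    Good N X C σ' ∧ (∀ d, (lay σ').tok N d ↔ (lay σ).tok N d) ∧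
      ∃ E : Finset ℕ, E.card ≤ 4 ∧ ∀ d, (lay σ).tok N d → d ∉ E → (lay σ').H d = (lay σ).H d := by
  have tk : ∀ d, (lay σ').tok N d ↔ (lay σ).tok N d := Swapped.tok F (by omega) (by omega)
  refine ⟨⟨(r.arr_eq 4 rfl).trans g.V, F.inv g.inv hx hp hq, ?_⟩, tk, _, Finset.card_le_four,
    fun d hd => not_imp_comm.1 (F.labels g.inv hd)⟩
  rw [r.arr_eq 10 rfl, r.arr_eq 11 rfl, r.reg_eq 3 rfl]
  exact g.list.congr tk

/-- Coloring an edge of one of two tokens with the same center and the same label, by `Flipped.fan`. -/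
theorem fanP_spec (hN : N.Good) (σ : Mem) (g : Good N X C σ) {u h f α : ℕ}
    (h7 : σ.reg 7 = u) (h6 : σ.reg 6 = h) (h9 : σ.reg 9 = α) (h11 : σ.reg 11 = f)
    (hh : (lay σ).tokAt N u h) (hf : (lay σ).tokAt N u f) (hne : f ≠ h)
    (hl : (lay σ).H f = (lay σ).H h) (hα : ¬ (lay σ).col u α) (hα' : 1 ≤ α ∧ α ≤ N.K) :
    ∃ t σ', Runs fanP σ t σ' ∧ t ≤ 2 * N.K + 100 + 30 * (lay σ).plen N (N.V h) α ((lay σ).H h) ∧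
      Good N X C σ' ∧ σ'.reg 3 + 1 = σ.reg 3 ∧ (lay σ').ncls N ≤ (lay σ).ncls N + 5 := by
  have hx := (hh.1.not_col g.inv.toCore).1
  have hp := g.inv.toCore.H_pos hh.1
  set σ1 := ((σ.setReg 18 (N.V h)).setReg 19 α).setReg 20 ((lay σ).H h) with hσ1
  have l1 : lay σ1 = lay σ := rfl
  obtain ⟨t, τ, r, ht, F⟩ := flipP_spec (x := N.V h) (p := α) (q := (lay σ).H h) σ1 g.V g.inv.toCore
    (by simp [hσ1]) (by simp [hσ1]) (by simp [hσ1]) hx (by omega) (by omega)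
  have gσ1 : Good N X C σ1 := ⟨g.V, g.inv, g.list⟩
  obtain ⟨g', tk, E, hcE, hE'⟩ := gσ1.flip r F hx hα' hp
  rw [l1] at tk hE' F ht
  have e7 : τ.reg 7 = u := (r.reg_eq 7 rfl).trans (by simpa [hσ1] using h7)
  have e6 : τ.reg 6 = h := (r.reg_eq 6 rfl).trans (by simpa [hσ1] using h6)
  have e11 : τ.reg 11 = f := (r.reg_eq 11 rfl).trans (by simpa [hσ1] using h11)
  have e3 : τ.reg 3 = σ.reg 3 := (r.reg_eq 3 rfl).trans (by simp [hσ1])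
  have start : ∀ t' σ', Runs (12 ≔ rg 6 ⨾
      .branch (hE (twE (tE (rg 7) (hE (rg 6))))) (12 ≔ rg 11) .skip ⨾ paintP) τ t' σ' →
      Runs fanP σ (1 + (1 + (1 + (t + t' + 1) + 1) + 1) + 1) σ' := fun t' σ' h => by
    refine (Runs.assign _ _ _).seq ((Runs.assign _ _ _).seq ((Runs.assign _ _ _).seq (Runs.seq ?_ h)))
    convert r using 1
    simp [hσ1, h6, g.V, h9, lay]
  have fan := F.fan hN g.inv hh.1 hf.1 hne (hf.2.trans hh.2.symm) hl (by rwa [hh.2]) (by omega)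
  rw [hh.2] at fan
  -- the token whose edge is colored
  obtain ⟨y, t1, ρ, hr, ht1, hρ, hρ12, hy, hcol⟩ : ∃ y t1 ρ, Runs (.branch
      (hE (twE (tE (rg 7) (hE (rg 6))))) (12 ≔ rg 11) .skip) (τ.setReg 12 h) t1 ρ ∧ t1 ≤ 2 ∧
      (∀ x, x ≠ 12 → ρ.reg x = τ.reg x) ∧ (ρ.reg 12 = y ∧ ρ.arr = τ.arr) ∧ (lay σ).tokAt N u y ∧
      ¬ (lay τ).col u ((lay τ).H y) := by
    by_cases hc : (lay τ).col u ((lay τ).H h)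
    · refine ⟨f, 2, (τ.setReg 12 h).setReg 12 f, .branch_pos ?_ ?_, le_rfl, fun x hx => by simp [hx],
        by simp, hf, fan.resolve_left (not_not.2 hc)⟩
      · simp [e7, e6]; exact hc
      · convert Runs.assign _ _ _ using 1; simp [e11]
    · refine ⟨h, 2, (τ.setReg 12 h), .branch_neg ?_ (.skip _), le_rfl, fun x hx => by simp [hx],
        by simp, hh, hc⟩
      simp [e7, e6]; exact not_not.1 hc
  have lρ : lay ρ = lay τ := by simp [lay, hρ12.2]
  have gρ : Good N X C ρ := by
    refine ⟨by rw [hρ12.2]; exact g'.V, lρ ▸ g'.inv, ?_⟩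
    rw [lρ, hρ12.2, hρ 3 (by simp)]; exact g'.list
  obtain ⟨t2, σ', r2, ht2, g2, h3, o, ho⟩ := paintP_spec hN ρ gρ
    (by rw [lρ, hρ12.1]; exact (tk y).2 hy.1) (by rw [hρ12.1, hρ 7 (by simp), e7]; exact hy.2)
    (by rw [lρ, hρ12.1, hρ 7 (by simp), e7]; exact hcol)
  rw [hρ 3 (by simp), e3] at h3
  refine ⟨_, σ', start _ _ (Runs.seq (t := 1) (σ' := τ.setReg 12 h) ?_ (hr.seq r2)), by omega, g2, h3,
    ?_⟩
  · convert Runs.assign _ _ _ using 1; simp [e6]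
  · refine (ncls_le (insert o E) fun d hd => ?_).trans
      (by gcongr; exact (Finset.card_insert_le _ _).trans (by omega))
    simp only [Finset.mem_insert]
    rcases ho d hd with h | ⟨h1, h2⟩
    · exact Or.inl (Or.inl h)
    · rw [lρ] at h1 h2
      by_cases hd : d ∈ E
      · exact Or.inl (Or.inr hd)
      · have := (tk d).1 h1
        exact Or.inr ⟨this, h2.trans (hE' d this hd)⟩

/-- Coloring the edge of a token whose walk runs into a loop, by `Flipped.loop`. -/
theorem openP_spec (hN : N.Good) (σ : Mem) (g : Good N X C σ) {u h α c n j : ℕ} {s : ℕ → ℕ}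
    (h7 : σ.reg 7 = u) (h6 : σ.reg 6 = h) (h9 : σ.reg 9 = α) (h10 : σ.reg 10 = c)
    (hh : (lay σ).tokAt N u h) (hα : ¬ (lay σ).col u α) (hα' : 1 ≤ α ∧ α ≤ N.K)
    (hs : IsWalk N (lay σ) u s n) (h0 : s 0 = (lay σ).H h) (hn : (lay σ).col u (s n)) (hj : j ≤ n)
    (hloop : (lay σ).lk N u (s n) = s j) (hc : s j = c) :
    ∃ t σ', Runs openP σ t σ' ∧ t ≤ 42 * N.K + 110 + 30 * (lay σ).plen N u c α ∧
      Good N X C σ' ∧ σ'.reg 3 + 1 = σ.reg 3 ∧ (lay σ').ncls N ≤ (lay σ).ncls N + 6 := by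
  have hp : 1 ≤ c ∧ c ≤ N.K := by
    rw [← hc, ← hloop]; exact g.inv.lk_pos hn
  set σ1 := ((σ.setReg 18 u).setReg 19 c).setReg 20 α with hσ1
  have l1 : lay σ1 = lay σ := rfl
  obtain ⟨t, τ, r, ht, F⟩ := flipP_spec (x := u) (p := c) (q := α) σ1 g.V g.inv.toCore
    (by simp [hσ1]) (by simp [hσ1]) (by simp [hσ1]) hα (by omega) (by omega)
  have gσ1 : Good N X C σ1 := ⟨g.V, g.inv, g.list⟩
  obtain ⟨g', tk, E, hcE, hE'⟩ := gσ1.flip r F hα hp hα'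
  rw [l1] at tk hE' F ht
  have e7 : τ.reg 7 = u := (r.reg_eq 7 rfl).trans (by simpa [hσ1] using h7)
  have e6 : τ.reg 6 = h := (r.reg_eq 6 rfl).trans (by simpa [hσ1] using h6)
  have e10 : τ.reg 10 = c := (r.reg_eq 10 rfl).trans (by simpa [hσ1] using h10)
  have e3 : τ.reg 3 = σ.reg 3 := (r.reg_eq 3 rfl).trans (by simp [hσ1])
  have start : ∀ t' σ', Runs (12 ≔ rg 6 ⨾ 13 ≔ rg 10 ⨾ finishP) τ t' σ' →
      Runs openP σ (1 + (1 + (1 + (t + t' + 1) + 1) + 1) + 1) σ' := fun t' σ' h => by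
    refine (Runs.assign _ _ _).seq ((Runs.assign _ _ _).seq ((Runs.assign _ _ _).seq (Runs.seq ?_ h)))
    convert r using 1
    simp [hσ1, h7, h10, h9]
  subst hc
  have lp := Flipped.loop (α := α) (j := j) (n := n) (s := s) hN g.inv hh.1 (by rwa [hh.2]) (by omega)
    (by rwa [hh.2]) h0 (by rwa [hh.2]) hj (by rwa [hh.2]) (by rwa [hh.2])
  rw [hh.2] at lp
  obtain ⟨nc, s', n', w1, w2, w3⟩ := lp
  set ρ := (τ.setReg 12 h).setReg 13 (s j) with hρ
  have gρ : Good N X C ρ := ⟨g'.V, g'.inv, g'.list⟩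
  obtain ⟨t2, σ', r2, ht2, g2, h3, hncl⟩ := finishP_spec hN ρ gρ (u := u) (y := h) (c := s j)
    (by simpa [hρ] using e7) (by simp [hρ]) (by simp [hρ]) ⟨(tk h).2 hh.1, hh.2⟩ nc w1 w2 w3
  have lρ : lay ρ = lay τ := rfl
  rw [lρ] at hncl
  refine ⟨_, σ', start _ _ ((Runs.assign _ _ _).seq ((Runs.assign _ _ _).seq (t' := t2) ?_)), by omega, g2,
    by simp [hρ] at h3; omega, ?_⟩
  · convert r2 using 1; simp [hρ, e6, e10]
  · have := ncls_le (N := N) (L' := lay τ) (L := lay σ) E fun d hd => by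
      have := (tk d).1 hd
      by_cases h : d ∈ E
      · exact Or.inl h
      · exact Or.inr ⟨this, hE' d this h⟩
    omega

/-- What remains of a marked walk after another token has walked elsewhere. -/
theorem Trail.walk_of_eq {L L' : Lay} {u y : ℕ} {MK : ℕ → ℕ} {s : ℕ → ℕ} {n : ℕ}
    (T : Trail N L u MK y s n) (hcol : L.col u (s n)) (hc : MK (L.lk N u (s n)) ≠ y)
    (h : ∀ c, MK c = y → (L'.col u c ↔ L.col u c) ∧ (L.col u c → L'.lk N u c = L.lk N u c)) :
    IsWalk N L' u (Function.update s (n + 1) (L.lk N u (s n))) (n + 1) := by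
  have hcol' : ∀ i ≤ n, L.col u (s i) := fun i hi => by
    rcases Nat.lt_or_ge i n with h | h
    · exact (T.walk.1 i h).1
    · rwa [show i = n by omega]
  have ne : ∀ j ≤ n, s j ≠ L.lk N u (s n) := fun j hj e => hc (by rw [← e]; exact (T.mark j hj).1)
  refine ⟨fun i hi => ?_, fun i hi j hj e => ?_⟩
  · have h1 := h (s i) (T.mark i (by omega)).1
    have h2 := hcol' i (by omega)
    rw [Function.update_of_ne (by omega : i ≠ n + 1)]
    refine ⟨h1.1.2 h2, (h1.2 h2).trans ?_⟩
    rcases Nat.lt_or_ge i n with h | h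
    · rw [Function.update_of_ne (by omega)]; exact (T.walk.1 i h).2
    · obtain rfl : i = n := by omega
      simp
  · simp only [Function.update_apply] at e
    split_ifs at e with h1 h2 h2
    · omega
    · exact (ne j (by omega) e.symm).elim
    · exact (ne i (by omega) e).elim
    · exact T.walk.2 i (by omega) j (by omega) e

/-- The last step of `clashP`: the only token of its class joins another class. -/
theorem walkP_join (hN : N.Good) (σ : Mem) (g : Good N X C σ) {u y c n : ℕ} {s : ℕ → ℕ}
    (h7 : σ.reg 7 = u) (h12 : σ.reg 12 = y) (h13 : σ.reg 13 = c) (hy : (lay σ).single N u y)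
    (hs : IsWalk N (lay σ) u s n) (h0 : s 0 = (lay σ).H y) (hn : s n = c)
    (hd : ∃ d, (lay σ).tokAt N u d ∧ d ≠ y ∧ (lay σ).H d = c) :
    ∃ t σ', Runs walkP σ t σ' ∧ t ≤ 40 * N.K + 1 ∧ Good N X C σ' ∧ σ'.reg 3 = σ.reg 3 ∧
      (lay σ').ncls N + 1 ≤ (lay σ).ncls N := by
  subst h7 h12 h13
  obtain ⟨t, τ, r, ht, g', m, hl, hk⟩ := walkP_spec hN n σ s g hy.1.1 hy.1.2 hs h0 hn
  have hnK := hs.length_le g.inv.toCore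
  refine ⟨t, τ, r, by omega, g', r.reg_eq 3 rfl, ?_⟩
  obtain ⟨d, d1, d2, d3⟩ := hd
  have hm := m.labels d d1.1 d2
  refine m.ncls_lt hy.1.1 (fun d hd hdc hH => hy.2 d ⟨hd, hdc.trans hy.1.2⟩ hH)
    ⟨d, (m.toks d).2 (Or.inr ⟨d1.1, d2⟩), hm.2, ?_⟩
  simp only [Lay.cl, Prod.mk.injEq]
  exact ⟨d1.2.trans (m.ctr.trans hy.1.2).symm, by rw [hm.1, d3, hl]⟩

/-- If two walks meet, the number of classes decreases: the token whose walk owned the color walks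
there, if it is not one of several tokens that start there, and then the other token joins it. -/
theorem clashP_spec (hN : N.Good) (σ : Mem) (g : Good N X C σ) {u y c : ℕ}
    (h7 : σ.reg 7 = u) (h12 : σ.reg 12 = y) (h13 : σ.reg 13 = c)
    (h : Clash N (lay σ) u y c (σ.arr 12)) :
    ∃ t σ', Runs clashP σ t σ' ∧ t ≤ 80 * N.K + 20 ∧ Good N X C σ' ∧ σ'.reg 3 = σ.reg 3 ∧
      (lay σ').ncls N + 1 ≤ (lay σ).ncls N := by
  obtain ⟨m, hy, c0, cy, s, n, T, hcol, hlk⟩ := h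
  have hc := g.inv.lk_pos hcol
  rw [hlk] at hc
  have hyc : (lay σ).H y ≠ c := by
    rintro rfl
    apply cy
    rw [← T.zero]; exact (T.mark 0 (by omega)).1
  set σ1 := (σ.setReg 16 y).setReg 12 (σ.arr 12 c) with hσ1
  have l1 : lay σ1 = lay σ := rfl
  have g1 : Good N X C σ1 := ⟨g.V, g.inv, g.list⟩
  have start : ∀ t τ t' σ', Runs (.branch (eqE (rg 12) 1) .skip walkP) σ1 t τ →
      Runs walkP (τ.setReg 12 (τ.reg 16)) t' σ' →
      Runs clashP σ (1 + (1 + (t + (1 + t' + 1) + 1) + 1) + 1) σ' := fun t τ t' σ' r r' => by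
    refine (Runs.assign _ _ _).seq ((Runs.assign _ _ _).seq (Runs.seq ?_ ((Runs.assign _ _ _).seq r')))
    convert r using 1
    simp [hσ1, h12, h13]
  have hself : (∀ d, σ.arr 12 d = y → ((lay σ).col u d ↔ (lay σ).col u d) ∧
      ((lay σ).col u d → (lay σ).lk N u d = (lay σ).lk N u d)) := fun _ _ => ⟨Iff.rfl, fun _ => rfl⟩
  by_cases hz : σ.arr 12 c = 1
  · rcases m.kind c hc.1 hc.2 with h | ⟨-, d, -, -, d1, -, d2, -⟩ | h
    · exact (c0 h).elim
    · set ρ := σ1.setReg 12 (σ1.reg 16) with hρ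
      obtain ⟨t, σ', r, ht, gg, h3, hn⟩ := walkP_join hN ρ (X := X) (C := C) ⟨g.V, g.inv, g.list⟩
        (u := u) (y := y) (c := c) (by simp [hρ, hσ1, h7]) (by simp [hρ, hσ1]) (by simp [hρ, hσ1, h13])
        hy (T.walk_of_eq hcol (by rwa [hlk]) hself)
        (by rw [Function.update_of_ne (by omega)]; exact T.zero) (by simpa using hlk)
        ⟨d, d1, fun e => hyc (e ▸ d2), d2⟩
      refine ⟨_, σ', start _ _ _ _ (.branch_pos ?_ (.skip _)) r, by omega, gg, ?_, hn⟩
      · simp [hσ1, hz]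
      · rw [h3]; simp [hρ, hσ1]
    · have := h.1.1.ge; omega
  · have hzs : (lay σ).single N u (σ.arr 12 c) := by
      rcases m.kind c hc.1 hc.2 with h | h | h
      · exact (c0 h).elim
      · exact (hz h.1).elim
      · exact h
    generalize hzz : σ.arr 12 c = z at *
    obtain ⟨sz, nz, Tz⟩ := m.trail z hzs
    obtain ⟨j, hj, hsj⟩ := Tz.only c hc.1 hc.2 hzz
    have wz : IsWalk N (lay σ1) (σ1.reg 7) sz j := by
      have : σ1.reg 7 = u := by simp [hσ1, h7]
      rw [this]
      exact ⟨fun i hi => Tz.walk.1 i (by omega), fun i hi k hk => Tz.walk.2 i (by omega) k (by omega)⟩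
    have e7 : σ1.reg 7 = u := by simp [hσ1, h7]
    have e12 : σ1.reg 12 = z := by simp [hσ1]
    have e13 : σ1.reg 13 = c := by simp [hσ1, h13]
    obtain ⟨t, τ, r, ht, g', mv, hl, hk⟩ := walkP_spec hN j σ1 sz g1 (by rw [e12]; exact hzs.1.1)
      (by rw [e12, e7]; exact hzs.1.2) wz (by rw [e12]; exact Tz.zero) (by rw [e13]; exact hsj)
    have hnK := wz.length_le g1.inv.toCore
    rw [l1, e12] at mv
    rw [l1, e7] at hk
    rw [e13] at hl
    have q7 : τ.reg 7 = u := (r.reg_eq 7 rfl).trans e7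
    have q13 : τ.reg 13 = c := (r.reg_eq 13 rfl).trans e13
    have q16 : τ.reg 16 = y := (r.reg_eq 16 rfl).trans (by simp [hσ1])
    have q3 : τ.reg 3 = σ.reg 3 := (r.reg_eq 3 rfl).trans (by simp [hσ1])
    have hmy := mv.labels y hy.1.1 (Ne.symm cy)
    have ncl := mv.ncls_le hzs.1.1 (fun d hd hdc hH => hzs.2 d ⟨hd, hdc.trans hzs.1.2⟩ hH)
    have hys : (lay τ).single N u y := by
      refine ⟨⟨(mv.toks y).2 (Or.inr ⟨hy.1.1, Ne.symm cy⟩), hy.1.2⟩, fun d hd hdH => ?_⟩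
      rw [hmy.1] at hdH
      rcases (mv.toks d).1 hd.1 with rfl | ⟨h1, h2⟩
      · exact (hyc (hdH.symm.trans hl)).elim
      · rw [(mv.labels d h1 h2).1] at hdH
        exact hy.2 d ⟨h1, hd.2⟩ hdH
    have hk' : ∀ d, σ.arr 12 d = y → ((lay τ).col u d ↔ (lay σ).col u d) ∧
        ((lay σ).col u d → (lay τ).lk N u d = (lay σ).lk N u d) := fun d hd =>
      hk d fun i hi e => cy (by rw [← hd, e]; exact ((Tz.mark i (by omega)).1).symm)
    set ρ := τ.setReg 12 (τ.reg 16) with hρ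
    obtain ⟨t', σ', r', ht', gg, h3, hn⟩ := walkP_join hN ρ (X := X) (C := C)
      ⟨g'.V, g'.inv, g'.list⟩
      (u := u) (y := y) (c := c) (by simp [hρ, q7]) (by simp [hρ, q16]) (by simp [hρ, q13])
      hys (T.walk_of_eq hcol (by rw [hlk, hzz]; exact cy) hk')
      (by rw [Function.update_of_ne (by omega)]; exact T.zero.trans hmy.1.symm) (by simpa using hlk)
      ⟨_, ⟨mv.tok', mv.ctr.trans hzs.1.2⟩, fun e => hmy.2 e.symm, hl⟩
    have : lay ρ = lay τ := rfl
    rw [this] at hn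
    refine ⟨_, σ', start _ _ _ _ (.branch_neg ?_ r) r', by omega, gg, ?_, by omega⟩
    · simp [hσ1, hz]
    · rw [h3]; simp [hρ, q3]

/-- The potential function that decreases in every iteration. Coloring the edge of a token creates at most
six new classes, which the weight `7` of the token pays for. -/
noncomputable def pot (N : Net) (σ : Mem) : ℕ := 7 * σ.reg 3 + (lay σ).ncls N

/-- `l` is a possible length of the path that is flipped if the token `h` with center `u` and the missing
color `α` of `u` are chosen. -/
def FlipLen (N : Net) (L : Lay) (u h α l : ℕ) : Prop :=
  l = 0 ∨ l = L.plen N (N.V h) α (L.H h) ∨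
    ∃ c, L.loopAt N u h c ∧ 1 ≤ c ∧ c ≤ N.K ∧ l = L.plen N u c α

/-- For every random choice, an iteration decreases the potential, in `O(K)` steps and the steps for
flipping at most one path. -/
theorem actP_spec (hN : N.Good) (σ : Mem) (g : Good N X C σ) (st : Static N σ) {u h α : ℕ}
    (h7 : σ.reg 7 = u) (h6 : σ.reg 6 = h) (hh : (lay σ).tokAt N u h)
    (hMK : ∀ c, 1 ≤ c → c ≤ N.K → σ.arr 12 c = 0) (hαr : σ.arr 13 (σ.reg 31) = α)
    (hα : ¬ (lay σ).col u α) (hα' : 1 ≤ α ∧ α ≤ N.K) :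
    ∃ t σ' l, Runs actP σ t σ' ∧ t ≤ 250 * N.K + 200 + 30 * l ∧ FlipLen N (lay σ) u h α l ∧
      Good N X C σ' ∧ Static N σ' ∧ pot N σ' + 1 ≤ pot N σ := by
  set σ1 := σ.setReg 9 α with hσ1
  have l1 : lay σ1 = lay σ := rfl
  have st1 : Static N σ1 := st.of_eq rfl rfl rfl (by simp [hσ1])
  obtain ⟨t, τ, r, ht, f, m, fresh, k1, k2⟩ := markP_spec (u := u) (h := h) σ1 st1 hN g.inv
    (by simpa [hσ1] using h7) (by simpa [hσ1] using h6) hMK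
  rw [l1] at m fresh k1 k2
  have q7 : τ.reg 7 = u := (f.reg 7 (by simp)).trans (by simpa [hσ1] using h7)
  have q6 : τ.reg 6 = h := (f.reg 6 (by simp)).trans (by simpa [hσ1] using h6)
  have q3 : τ.reg 3 = σ.reg 3 := (f.reg 3 (by simp)).trans (by simp [hσ1])
  have q9 : τ.reg 9 = α := (r.reg_eq 9 rfl).trans (by simp [hσ1])
  have good_of : ∀ {ρ : Mem}, Frame σ ρ → Good N X C ρ := fun {ρ} f => by
    refine ⟨(f.arr 4 (by simp) (by simp)).trans g.V, f.lay ▸ g.inv, ?_⟩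
    rw [f.lay, f.arr 10 (by simp) (by simp), f.arr 11 (by simp) (by simp), f.reg 3 (by simp)]
    exact g.list
  have f1 : Frame σ σ1 := framed_exec (9 ≔ .lit α) σ rfl
  have fτ := f1.trans f
  have lτ : lay τ = lay σ := fτ.lay
  have gτ : Good N X C τ := good_of fτ
  have start : ∀ t' σ', Runs (.branch (rg 11) fanP
      (searchP ⨾ .branch (rg 14) (.branch (eqE (rg 14) 1) finishP clashP) openP)) τ t' σ' →
      Runs actP σ (1 + (t + t' + 1) + 1) σ' := fun t' σ' h => by
    refine (Runs.assign _ _ _).seq (Runs.seq ?_ h)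
    convert r using 1
    simp [hσ1, hαr]
  have fin : ∀ t' σ', Runs actP σ t' σ' → Static N σ' := fun t' σ' r =>
    st.of_eq (r.arr_eq 4 rfl) (r.arr_eq 8 rfl) (r.arr_eq 9 rfl) (r.reg_eq 2 rfl)
  by_cases h11 : τ.reg 11 = 0
  · have hsing : (lay σ).single N u h := ⟨hh, fun d hd hdH => k1 h11 d hd hdH⟩
    obtain ⟨t', ρ, r', ht', f', b⟩ := searchP_spec (h := h) τ (st1.of_eq (r.arr_eq 4 rfl) (r.arr_eq 8 rfl)
      (r.arr_eq 9 rfl) (r.reg_eq 2 rfl)) hN gτ.inv q7 q6 (by rw [lτ]; exact m) (by rw [lτ]; exact fresh)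
    rw [lτ] at b
    have fρ := fτ.trans f'
    have lρ : lay ρ = lay σ := fρ.lay
    have gρ : Good N X C ρ := good_of fρ
    have p7 : ρ.reg 7 = u := (f'.reg 7 (by simp)).trans q7
    have p6 : ρ.reg 6 = h := (f'.reg 6 (by simp)).trans q6
    have p3 : ρ.reg 3 = σ.reg 3 := (f'.reg 3 (by simp)).trans q3
    have p9 : ρ.reg 9 = α := (r'.reg_eq 9 rfl).trans q9
    rcases b with ⟨b14, b⟩ | ⟨b14, b1, b2, s, n, b3, b4, b5⟩ | ⟨b14, b⟩
    · obtain ⟨s, n, T, ⟨w1, j, hj, w2⟩, w3⟩ := b h hsing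
      have hcl := (w3 rfl).trans w2
      obtain ⟨t2, σ', r2, ht2, g2, h3, hncl⟩ := openP_spec hN ρ gρ p7 p6 p9 hcl (by rw [lρ]; exact hh)
        (by rw [lρ]; exact hα) hα' (by rw [lρ]; exact T.walk) (by rw [lρ]; exact T.zero)
        (by rw [lρ]; exact w1) hj (by rw [lρ]; exact w2) rfl
      rw [lρ] at hncl ht2
      have R := start _ _ (.branch_neg h11 (r'.seq (.branch_neg (by simp [b14]) r2)))
      refine ⟨_, σ', _, R, by omega, Or.inr (Or.inr ⟨s j, ⟨hsing, ⟨j, T.orb j hj⟩, fun y hy ho => ?_⟩,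
        (T.mark j hj).2.1, (T.mark j hj).2.2, rfl⟩), g2, fin _ _ R, by unfold pot; omega⟩
      obtain ⟨s', n', T', k1, -⟩ := b y hy
      rw [← T'.mark_of_orb k1 ho, (T.mark j hj).1]
    · obtain ⟨t2, σ', r2, ht2, g2, h3, hncl⟩ := finishP_spec hN ρ gρ p7 rfl rfl
        (by rw [lρ]; exact b1.1) (by rw [lρ]; exact b2) (by rw [lρ]; exact b3) (by rw [lρ]; exact b4) b5
      rw [lρ] at hncl
      have R := start _ _ (.branch_neg h11 (r'.seq (.branch_pos (by simp [b14])
        (.branch_pos (by simp [b14]) r2))))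
      exact ⟨_, σ', 0, R, by omega, Or.inl rfl, g2, fin _ _ R, by unfold pot; omega⟩
    · obtain ⟨t2, σ', r2, ht2, g2, h3, hncl⟩ := clashP_spec hN ρ gρ p7 rfl rfl (by rw [lρ]; exact b)
      rw [lρ] at hncl
      have R := start _ _ (.branch_neg h11 (r'.seq (.branch_pos (by simp [b14])
        (.branch_neg (by simp [b14]) r2))))
      exact ⟨_, σ', 0, R, by omega, Or.inl rfl, g2, fin _ _ R, by unfold pot; omega⟩
  · obtain ⟨d1, d2, d3⟩ := k2 h11
    obtain ⟨t2, σ', r2, ht2, g2, h3, hncl⟩ := fanP_spec hN τ gτ q7 q6 q9 rfl (by rw [lτ]; exact hh)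
      (by rw [lτ]; exact d1) d2 (by rw [lτ]; exact d3) (by rw [lτ]; exact hα) hα'
    rw [lτ] at hncl ht2
    have R := start _ _ (.branch_pos h11 r2)
    exact ⟨_, σ', _, R, by omega, Or.inr (Or.inl rfl), g2, fin _ _ R, by unfold pot; omega⟩

end

/-! ### The main loop -/

section
variable {N : Net} {X C : ℕ → Prop}

/-- The total length of the flipped paths, over all random choices: the list position `r` determines the
token, and `s` its missing color. A path from a leaf determines the token through its starting point and
label, and a path from a center determines the token because only its walk contains the first color of
the path. So each of the two kinds of paths contributes at most the total length of all alternating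
paths, `Core.sum_plen_total`. -/
theorem sum_flipLen {L : Lay} (I : Core N X C L) {a : ℕ} {NM hd : ℕ → ℕ} {al l : ℕ → ℕ → ℕ}
    (h1 : ∀ r < a, L.tok N (hd r)) (h2 : ∀ r < a, ∀ r' < a, hd r = hd r' → r = r')
    (h3 : ∀ r < a, ∀ s < NM r, 1 ≤ al r s ∧ al r s ≤ N.K ∧ ¬ L.col (N.V (tw (hd r))) (al r s))
    (h4 : ∀ r < a, ∀ s < NM r, ∀ s' < NM r, al r s = al r s' → s = s')
    (h5 : ∀ r < a, ∀ s < NM r, FlipLen N L (N.V (tw (hd r))) (hd r) (al r s) (l r s)) :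
    ∑ r ∈ Finset.range a, ∑ s ∈ Finset.range (NM r), l r s ≤ 8 * N.m * N.K := by
  classical
  set S := (Finset.range a).sigma fun r => Finset.range (NM r) with hS
  have mem : ∀ p ∈ S, p.1 < a ∧ p.2 < NM p.1 := fun p hp => by simpa [hS] using hp
  rw [Finset.sum_sigma']
  set Q : (Σ _ : ℕ, ℕ) → Prop := fun p => ∃ c, L.loopAt N (N.V (tw (hd p.1))) (hd p.1) c ∧ 1 ≤ c ∧
    c ≤ N.K ∧ l p.1 p.2 = L.plen N (N.V (tw (hd p.1))) c (al p.1 p.2) with hQ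
  have hc : ∀ p, ∃ c, Q p → L.loopAt N (N.V (tw (hd p.1))) (hd p.1) c ∧ 1 ≤ c ∧
    c ≤ N.K ∧ l p.1 p.2 = L.plen N (N.V (tw (hd p.1))) c (al p.1 p.2) := fun p => by
    by_cases h : Q p
    · obtain ⟨c, hc⟩ := h; exact ⟨c, fun _ => hc⟩
    · exact ⟨0, fun h' => (h h').elim⟩
  choose c hc using hc
  let f : (Σ _ : ℕ, ℕ) → ℕ × ℕ × ℕ := fun p => (N.V (hd p.1), al p.1 p.2, L.H (hd p.1))
  let g : (Σ _ : ℕ, ℕ) → ℕ × ℕ × ℕ := fun p => (N.V (tw (hd p.1)), c p, al p.1 p.2)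
  have split : ∀ p ∈ S, l p.1 p.2 ≤ L.plen N (f p).1 (f p).2.1 (f p).2.2 +
      if Q p then L.plen N (g p).1 (g p).2.1 (g p).2.2 else 0 := fun p hp => by
    obtain ⟨k1, k2⟩ := mem p hp
    rcases h5 _ k1 _ k2 with h | h | h
    · omega
    · exact h.le.trans (Nat.le_add_right _ _)
    · have hq : Q p := h
      rw [if_pos hq]
      exact ((hc p hq).2.2.2).le.trans (Nat.le_add_left _ _)
  have inj : ∀ p ∈ S, ∀ p' ∈ S, hd p.1 = hd p'.1 → al p.1 p.2 = al p'.1 p'.2 → p = p' := by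
    rintro ⟨r, s⟩ hp ⟨r', s'⟩ hp' e e'
    obtain rfl := h2 _ (mem _ hp).1 _ (mem _ hp').1 e
    obtain rfl := h4 _ (mem _ hp).1 _ (mem _ hp).2 _ (mem _ hp').2 e'
    rfl
  have sf : ∑ p ∈ S, L.plen N (f p).1 (f p).2.1 (f p).2.2 ≤ 4 * N.m * N.K := by
    rw [← Finset.sum_image (f := fun t : ℕ × ℕ × ℕ => L.plen N t.1 t.2.1 t.2.2) (g := f)]
    · refine I.sum_plen_total _ fun t ht => ?_
      obtain ⟨p, hp, rfl⟩ := Finset.mem_image.1 ht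
      obtain ⟨k1, k2⟩ := mem p hp
      have := h3 _ k1 _ k2
      have t1 := I.H_pos (h1 _ k1)
      exact ⟨Finset.mem_Icc.2 ⟨this.1, this.2.1⟩, Finset.mem_Icc.2 t1, ((h1 _ k1).not_col I).1⟩
    · intro p hp p' hp' e
      simp only [f, Prod.mk.injEq] at e
      have t1 := h1 _ (mem p hp).1
      have t2 := h1 _ (mem p' hp').1
      exact inj p hp p' hp' (I.inj t1.1 t2.1 t1.2.1 e.1 e.2.2) e.2.1
  have sg : ∑ p ∈ S, (if Q p then L.plen N (g p).1 (g p).2.1 (g p).2.2 else 0) ≤ 4 * N.m * N.K := by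
    rw [← Finset.sum_filter,
      ← Finset.sum_image (f := fun t : ℕ × ℕ × ℕ => L.plen N t.1 t.2.1 t.2.2) (g := g)]
    · refine I.sum_plen_total _ fun t ht => ?_
      obtain ⟨p, hp, rfl⟩ := Finset.mem_image.1 ht
      obtain ⟨hp, hq⟩ := Finset.mem_filter.1 hp
      obtain ⟨k1, k2⟩ := mem p hp
      have := h3 _ k1 _ k2
      exact ⟨Finset.mem_Icc.2 ⟨(hc p hq).2.1, (hc p hq).2.2.1⟩, Finset.mem_Icc.2 ⟨this.1, this.2.1⟩,
        this.2.2⟩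
    · intro p hp p' hp' e
      obtain ⟨hp, hq⟩ := Finset.mem_filter.1 hp
      obtain ⟨hp', hq'⟩ := Finset.mem_filter.1 hp'
      simp only [g, Prod.mk.injEq] at e
      have q1 := (hc p hq).1
      have q2 := (hc p' hq').1
      rw [← e.2.1, ← e.1] at q2
      exact inj p hp p' hp' (q2.2.2 _ q1.1 q1.2.1) e.2.2
  calc _ ≤ ∑ p ∈ S, (L.plen N (f p).1 (f p).2.1 (f p).2.2 +
      if Q p then L.plen N (g p).1 (g p).2.1 (g p).2.2 else 0) := Finset.sum_le_sum split
    _ ≤ 4 * N.m * N.K + 4 * N.m * N.K := by rw [Finset.sum_add_distrib]; exact Nat.add_le_add sf sg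
    _ = _ := by ring

theorem FlipLen.le {L : Lay} (I : Core N X C L) {u h α l : ℕ} (hh : L.tok N h) (hα : ¬ L.col u α)
    (f : FlipLen N L u h α l) : l ≤ 2 * N.m := by
  rcases f with rfl | rfl | ⟨c, -, -, -, rfl⟩
  · omega
  · exact (I.plen_spec (hh.not_col I).1).2
  · exact (I.plen_spec hα).2

/-- The number of darts at `u` with edges that are not inert. -/
noncomputable def live (N : Net) (X : ℕ → Prop) (u : ℕ) : ℕ := by
  classical exact ((N.dartsAt u).filter fun d => ¬ X d).card

/-- At `u` all colors are missing except for those of edges that are not inert. -/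
theorem MissList.card_le {L : Lay} (I : Core N X C L) {u a : ℕ} {M : ℕ → ℕ}
    (l : MissList L u (N.K + 1) M a) : N.K ≤ a + live N X u := by
  classical
  have h1 : ((Finset.Icc 1 N.K).filter fun c => ¬ L.col u c).card ≤ a := by
    rw [← Finset.card_range a]
    refine Finset.card_le_card_of_surjOn M fun c hc => ?_
    simp only [Finset.coe_filter, Finset.mem_Icc, Set.mem_ofPred_eq] at hc
    obtain ⟨i, hi, e⟩ := l.surj c hc.1.1 (by omega) hc.2
    exact ⟨i, by simpa using hi, e⟩
  have h2 : ((Finset.Icc 1 N.K).filter fun c => L.col u c).card ≤ live N X u := by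
    refine Finset.card_le_card_of_injOn (L.T u) (fun c hc => ?_) (fun c hc c' hc' e => ?_)
    · have := I.col_dart (Finset.mem_filter.1 hc).2
      simp only [Finset.coe_filter, Set.mem_ofPred_eq, Net.mem_dartsAt]
      refine ⟨⟨this.1, this.2.1⟩, fun hX => ?_⟩
      have h0 := ((I.inert _ this.1).2 hX).1
      exact this.2.2.2.1 (this.2.2.1.symm.trans h0)
    · have k1 := I.col_dart (Finset.mem_filter.1 hc).2
      have k2 := I.col_dart (Finset.mem_filter.1 hc').2
      rw [← k1.2.2.1, e, k2.2.2.1]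
  have := Finset.card_filter_add_card_filter_not (s := Finset.Icc 1 N.K) (fun c => L.col u c)
  simp only [Nat.card_Icc, Nat.add_sub_cancel] at this
  omega

/-- Color tokens until there are none. -/
def mainP : Prog := .loop (rg 3) iterP

/-- The part of the state that an iteration preserves. -/
structure State (N : Net) (X C : ℕ → Prop) (σ : Mem) : Prop extends Good N X C σ where
  static : Static N σ
  m : σ.reg 1 = N.m

theorem State.pot_le {σ : Mem} (s : State N X C σ) : σ.reg 3 ≤ pot N σ ∧ pot N σ ≤ 8 * σ.reg 3 := by
  have h1 := s.list.card
  have h2 : (lay σ).ncls N ≤ ((lay σ).toks N).card := Finset.card_image_le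
  unfold pot; omega

/-- An upper bound for the number of steps of an iteration. -/
def iterSteps (N : Net) : ℕ := 262 * N.K + 60 * N.m + 300

/-- One iteration for given random choices `r` and `s`. -/
theorem iter_spec (hN : N.Good) (σ : Mem) (S : State N X C σ) (r : ℕ) (hr : r < σ.reg 3) :
    ∃ t τ, Runs centerP (σ.setReg 31 r) t τ ∧ t ≤ 12 * N.K + 20 ∧
      N.K ≤ τ.reg 8 + live N X (N.V (tw (σ.arr 10 r))) ∧
      MissList (lay σ) (N.V (tw (σ.arr 10 r))) (N.K + 1) (τ.arr 13) (τ.reg 8) ∧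
      ∀ s < τ.reg 8, ∃ t' σ' l, Runs actP (τ.setReg 31 s) t' σ' ∧ t' ≤ 250 * N.K + 200 + 30 * l ∧
        FlipLen N (lay σ) (N.V (tw (σ.arr 10 r))) (σ.arr 10 r) (τ.arr 13 s) l ∧ State N X C σ' ∧
        pot N σ' + 1 ≤ pot N σ := by
  obtain ⟨t, τ, run, ht, fa, fr, h6, h7, hMK, ml⟩ := centerP_spec (N := N) (σ.setReg 31 r)
    (by simpa using S.static.K)
  have l1 : lay (σ.setReg 31 r) = lay σ := rfl
  have lτ : lay τ = lay σ := by simp [lay, fa]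
  simp only [setReg_reg, setReg_arr, if_true] at h6 h7
  rw [h6, S.V] at h7
  rw [l1, h7] at ml
  obtain ⟨tk, -⟩ := S.list.tok r hr
  refine ⟨t, τ, run, ht, ml.card_le S.inv.toCore, ml, fun s hs => ?_⟩
  obtain ⟨m1, m2, m3⟩ := ml.mem s hs
  have e3 : τ.reg 3 = σ.reg 3 := (fr 3 (by simp)).trans (by simp)
  have g : Good N X C (τ.setReg 31 s) := by
    refine ⟨(fa 4 (by simp) (by simp)).trans S.V, ?_, ?_⟩
    · show Inv N X C (lay τ); rw [lτ]; exact S.inv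
    · show Listed N (lay τ) (τ.arr 10) (τ.arr 11) _
      rw [lτ, fa 10 (by simp) (by simp), fa 11 (by simp) (by simp)]
      simpa [e3] using S.list
  have st : Static N (τ.setReg 31 s) := S.static.of_eq (fa 4 (by simp) (by simp))
    (fa 8 (by simp) (by simp)) (fa 9 (by simp) (by simp)) (by
      simpa using (fr 2 (by simp)).trans (by simp))
  have lτ' : lay (τ.setReg 31 s) = lay σ := lτ
  obtain ⟨t', σ', l, R, ht', hl, g', st', hpot⟩ := actP_spec hN (τ.setReg 31 s) g st
    (u := N.V (tw (σ.arr 10 r))) (h := σ.arr 10 r) (α := τ.arr 13 s) (by simpa using h7)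
    (by simpa using h6) (by rw [lτ']; exact ⟨tk, rfl⟩) hMK (by simp) (by rw [lτ']; exact m3)
    ⟨m1, by omega⟩
  rw [lτ'] at hl
  refine ⟨t', σ', l, R, ht', hl, ⟨g', st', ?_⟩, ?_⟩
  · rw [R.reg_eq 1 rfl]; simpa using (fr 1 (by simp)).trans (by simpa using S.m)
  · have : pot N (τ.setReg 31 s) = pot N σ := by
      unfold pot; rw [lτ']; simp [e3]
    omega

/-- Whenever the main loop halts, all tokens are gone. The assumption on `live` provides a missing color
at every center, so that the random choice is among existing colors. -/
theorem mainP_ensures (hN : N.Good) (hlive : ∀ u, C u → live N X u < N.K) {k : List Prog}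
    {Q : Mem → Prop} (hQ : ∀ σ, State N X C σ → σ.reg 3 = 0 → Ensures (k, σ) Q) (n : ℕ) :
    ∀ σ, pot N σ = n → State N X C σ → Ensures (mainP :: k, σ) Q := by
  induction n using Nat.strong_induction_on with
  | _ n ih =>
    intro σ hn S
    by_cases h3 : σ.reg 3 = 0
    · exact (Runs.loop_neg (e := rg 3) (p := iterP) h3).ensures (hQ σ S h3)
    · refine .of_pure (c := (iterP :: mainP :: k, σ)) (by simp [mainP, step, h3]) ?_
      refine .of_pure (c := (_ :: _ :: mainP :: k, σ)) rfl ?_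
      refine .sample fun r hr => ?_
      have hr : r < σ.reg 3 := by simp at hr; omega
      obtain ⟨t, τ, run, -, hlv, ml, hs⟩ := iter_spec hN σ S r hr
      refine .of_pure (c := (_ :: _ :: mainP :: k, _)) rfl (run.ensures ?_)
      refine .of_pure (c := (_ :: _ :: mainP :: k, _)) rfl ?_
      refine .sample fun s hs' => ?_
      have := hlive _ (S.inv.ctr _ (S.list.tok r hr).1)
      have hs' : s < τ.reg 8 := by simp at hs'; omega
      obtain ⟨t', σ', l, R, -, -, S', hpot⟩ := hs s hs'
      exact R.ensures (ih _ (by omega) σ' rfl S')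

end

/-! ### The expected running time of the main loop -/

section
variable {N : Net} {X C : ℕ → Prop}

theorem expectedCost_le_of_pure {c c' : Config} (h : step c = PMF.pure c') {u : ℕ}
    (hu : stepCost c ≤ u) (n : ℕ) : expectedCost n c ≤ u + expectedCost n c' := by
  cases n with
  | zero => simp [expectedCost]
  | succ n =>
    rw [expectedCost_pure h]
    exact add_le_add (by exact_mod_cast hu) (expectedCost_mono_succ _ _)

theorem expectedCost_sample_le {x : ℕ} {e : Expr} {σ : Mem} {u : ℕ} (hu : 1 + e.cost σ ≤ u)
    (k : List Prog) (n : ℕ) : expectedCost n (.sample x e :: k, σ) ≤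
      u + ((e.eval σ + 1 : ℕ) : ENNReal)⁻¹ *
        ∑ r ∈ Finset.range (e.eval σ + 1), expectedCost n (k, σ.setReg x r) := by
  cases n with
  | zero => simp [expectedCost]
  | succ n =>
    rw [expectedCost_sample]
    gcongr
    · exact expectedCost_mono_succ _ _

/-- An average of bounds. -/
theorem average_le {n : ℕ} (hn : 0 < n) {f g : ℕ → ENNReal} {A c : ENNReal}
    (h : ∀ r < n, f r ≤ A + c * g r) :
    (n : ENNReal)⁻¹ * ∑ r ∈ Finset.range n, f r ≤
      A + c * ((n : ENNReal)⁻¹ * ∑ r ∈ Finset.range n, g r) := by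
  calc _ ≤ (n : ENNReal)⁻¹ * ∑ r ∈ Finset.range n, (A + c * g r) := by
        gcongr with r hr; exact h r (by simpa using hr)
    _ = (n : ENNReal)⁻¹ * n * A + c * ((n : ENNReal)⁻¹ * ∑ r ∈ Finset.range n, g r) := by
        rw [Finset.sum_add_distrib, ← Finset.mul_sum]
        simp only [Finset.sum_const, Finset.card_range, nsmul_eq_mul]
        ring
    _ = _ := by
        rw [ENNReal.inv_mul_cancel (by simp; omega) (by simp), one_mul]

theorem inv_le_mul_inv {a b c : ℕ} (hc : c ≠ 0) (h : b ≤ c * a) :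
    (a : ENNReal)⁻¹ ≤ c * (b : ENNReal)⁻¹ := by
  have h1 : ((c * a : ℕ) : ENNReal)⁻¹ ≤ (b : ENNReal)⁻¹ := by
    rw [ENNReal.inv_le_inv]; exact_mod_cast h
  calc (a : ENNReal)⁻¹ = c * ((c * a : ℕ) : ENNReal)⁻¹ := by
        rw [Nat.cast_mul, ENNReal.mul_inv (by simp [hc]) (by simp), ← mul_assoc,
          ENNReal.mul_inv_cancel (by simp [hc]) (by simp), one_mul]
    _ ≤ _ := by gcongr

/-- The bound for the expected cost of the main loop, for potential `φ`, if every step costs at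
most `U`. -/
noncomputable def mainCost (N : Net) (d U φ : ℕ) : ENNReal :=
  (U * (500 * (N.K + 1) * φ + 1) : ℕ) +
    (U * (3840 * (N.m * N.K)) : ℕ) * (d : ENNReal)⁻¹ *
      ∑ i ∈ Finset.range φ, ((i + 1 : ℕ) : ENNReal)⁻¹

theorem mainCost_mono (N : Net) (d U : ℕ) : Monotone (mainCost N d U) := by
  intro φ ψ h
  unfold mainCost
  gcongr

/-- By induction on the potential `φ`. There are at least `φ / 8` tokens, and every center has at least
`d / 2` missing colors, so that `sum_flipLen` bounds the expected length of the flipped path by `128 m K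
/ (φ d)`; the sum over all values of the potential is a harmonic sum. -/
theorem mainP_cost (hN : N.Good) {d : ℕ} (hd : 1 ≤ d) (hlive : ∀ u, C u → d + 2 * live N X u ≤ 2 * N.K)
    {B κ : ℕ} (hκ : mainP.weight ≤ κ) {k : List Prog} {R : ENNReal}
    (hR : ∀ n σ, State N X C σ → σ.reg 3 = 0 → σ.Bdd B → expectedCost n (k, σ) ≤ R) (φ : ℕ) :
    ∀ n b σ, pot N σ = φ → State N X C σ → 4 ≤ b → σ.Bdd b → b + 2 * iterSteps N * φ ≤ B →
      expectedCost n (mainP :: k, σ) ≤ mainCost N d (κ * (1 + B.size) ^ 2) φ + R := by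
  induction φ using Nat.strong_induction_on with
  | _ φ ih =>
  intro n b σ hφ S hb hB hbB
  have hBB : σ.Bdd B := hB.mono (by omega)
  set U := κ * (1 + B.size) ^ 2 with hU
  have sq : 1 ≤ (1 + B.size) ^ 2 := Nat.one_le_pow _ _ (by omega)
  have wt : iterP.weight + 2 ≤ κ ∧ centerP.weight ≤ κ ∧ actP.weight ≤ κ ∧ 4 ≤ κ := by
    simp only [mainP, iterP, Prog.weight, Expr.weight] at hκ ⊢
    omega
  have U1 : 1 ≤ U := by rw [hU]; nlinarith
  have costU : ∀ (e : Expr) (τ : Mem) (b' : ℕ), τ.Bdd b' → 4 ≤ b' → b' ≤ B → e.small = true →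
      1 + e.weight ≤ 4 → 1 + e.cost τ ≤ U := by
    intro e τ b' h1 h2 h3 h4 h5
    have := Expr.cost_le (by omega) (h1.mono h3) e h4
    rw [hU]; nlinarith
  by_cases h3 : σ.reg 3 = 0
  · refine (expectedCost_le_of_pure (c := (mainP :: k, σ)) (c' := (k, σ)) (u := U) (by simp [mainP, step, h3])
      (costU (rg 3) σ b hB hb (by omega) rfl (by decide)) n).trans ?_
    refine add_le_add ?_ (hR n σ S h3 hBB)
    unfold mainCost
    refine le_trans ?_ le_self_add
    norm_cast
    exact Nat.le_mul_of_pos_right _ (by omega)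
  obtain ⟨ψ, rfl⟩ : ∃ ψ, φ = ψ + 1 := ⟨φ - 1, by have := S.pot_le; omega⟩
  have hbB' : b + 2 * iterSteps N + 2 * iterSteps N * ψ ≤ B := by
    have : 2 * iterSteps N * (ψ + 1) = 2 * iterSteps N * ψ + 2 * iterSteps N := by ring
    omega
  have : Nonempty Mem := ⟨σ⟩
  choose! t τ run ht hlv ml hs using fun r hr => iter_spec hN σ S r hr
  choose! t' σ' l R' ht' hl S' hpot using hs
  have hctr : ∀ r < σ.reg 3, C (N.V (tw (σ.arr 10 r))) := fun r hr => S.inv.ctr _ (S.list.tok r hr).1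
  have hNM : ∀ r < σ.reg 3, d ≤ 2 * (τ r).reg 8 := fun r hr => by
    have := hlive _ (hctr r hr)
    have := hlv r hr
    omega
  have hsum : ∑ r ∈ Finset.range (σ.reg 3), ∑ s ∈ Finset.range ((τ r).reg 8), l r s ≤
      8 * N.m * N.K := by
    refine sum_flipLen (hd := σ.arr 10) (al := fun r s => (τ r).arr 13 s) S.inv.toCore
      (fun r hr => (S.list.tok r hr).1) (fun r hr r' hr' e => ?_) (fun r hr s hs => ?_)
      (fun r hr s hs s' hs' e => ?_) (fun r hr s hs => hl r hr s hs)
    · rw [← (S.list.tok r hr).2, ← (S.list.tok r' hr').2, e]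
    · have := (ml r hr).mem s hs; exact ⟨this.1, by omega, this.2.2⟩
    · rcases Nat.lt_trichotomy s s' with h | h | h
      · exact ((ml r hr).inj s s' h hs' e).elim
      · exact h
      · exact ((ml r hr).inj s' s h hs e.symm).elim
  -- the cost for given random choices
  have inner : ∀ r < σ.reg 3, ∀ s < (τ r).reg 8,
      expectedCost n (actP :: mainP :: k, (τ r).setReg 31 s) ≤
        ((U * (250 * N.K + 200) : ℕ) + (mainCost N d U ψ + R)) + (30 * U : ℕ) * (l r s : ENNReal) := by
    intro r hr s hs
    have hll : l r s ≤ 2 * N.m := (hl r hr s hs).le S.inv.toCore (S.list.tok r hr).1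
      ((ml r hr).mem s hs).2.2
    have b1 : (τ r).Bdd (b + 2 * t r) := (run r hr).bdd rfl hb (hB.setReg 31 (by have := hB.1 3; omega))
    have b2 : ((τ r).setReg 31 s).Bdd (b + 2 * t r) := b1.setReg 31 (by have := b1.1 8; omega)
    have e1 := ht r hr
    have e2 := ht' r hr s hs
    have e3 : t r + t' r s ≤ iterSteps N := by unfold iterSteps; omega
    have b3 := (R' r hr s hs).bdd rfl (by omega) b2
    have step1 := (R' r hr s hs).expectedCost_le (B := B) (κ := κ) rfl (by omega) b2
      (by omega) (by omega) n (mainP :: k)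
    have hp := hpot r hr s hs
    have step2 := ih (pot N (σ' r s)) (by omega) n _ (σ' r s) rfl (S' r hr s hs) (by omega) b3 (by
      have : 2 * iterSteps N * pot N (σ' r s) ≤ 2 * iterSteps N * ψ := by gcongr; omega
      omega)
    calc _ ≤ _ := step1
      _ ≤ ((U * (250 * N.K + 200) + 30 * U * l r s : ℕ) : ENNReal) + (mainCost N d U ψ + R) := by
        gcongr
        · rw [← hU]
          calc t' r s * U ≤ (250 * N.K + 200 + 30 * l r s) * U := Nat.mul_le_mul_right _ (ht' r hr s hs)
            _ = _ := by ring
        · exact step2.trans (by gcongr; exact mainCost_mono N d U (by omega))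
      _ = _ := by push_cast; ring
  have outer : ∀ r < σ.reg 3,
      expectedCost n ((centerP ⨾ .sample 31 (rg 8 - 1) ⨾ actP) :: mainP :: k, σ.setReg 31 r) ≤
        ((U * (262 * N.K + 224) : ℕ) + (mainCost N d U ψ + R)) + (30 * U : ℕ) *
          ((2 : ℕ) * (d : ENNReal)⁻¹ * ∑ s ∈ Finset.range ((τ r).reg 8), (l r s : ENNReal)) := by
    intro r hr
    have e1 := ht r hr
    have bσ : (σ.setReg 31 r).Bdd b := hB.setReg 31 (by have := hB.1 3; omega)
    have b1 : (τ r).Bdd (b + 2 * t r) := (run r hr).bdd rfl hb bσ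
    have hit : t r ≤ iterSteps N := by unfold iterSteps; omega
    have hpos : 0 < (τ r).reg 8 := by have := hNM r hr; omega
    have s1 := expectedCost_le_of_pure (c := ((centerP ⨾ .sample 31 (rg 8 - 1) ⨾ actP) :: mainP :: k,
      σ.setReg 31 r)) rfl (u := U) U1 n
    have s2 := (run r hr).expectedCost_le (B := B) (κ := κ) rfl hb bσ (by omega) (by omega) n
      ((.sample 31 (rg 8 - 1) ⨾ actP) :: mainP :: k)
    have s3 := expectedCost_le_of_pure (c := ((Prog.sample 31 (rg 8 - 1) ⨾ actP) :: mainP :: k,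
      τ r)) rfl (u := U) U1 n
    have s4 := expectedCost_sample_le (x := 31) (e := rg 8 - 1) (σ := τ r)
      (costU _ _ _ b1 (by omega) (by omega) rfl (by decide)) (actP :: mainP :: k) n
    have he : (rg 8 - 1 : Expr).eval (τ r) + 1 = (τ r).reg 8 := by simp; omega
    rw [he] at s4
    have s5 := average_le hpos (inner r hr)
    have s6 := inv_le_mul_inv (a := (τ r).reg 8) (b := d) (c := 2) (by omega) (hNM r hr)
    calc _ ≤ _ := s1
      _ ≤ U + (((t r * U : ℕ) : ENNReal) + (U + (U + (((U * (250 * N.K + 200) : ℕ) +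
          (mainCost N d U ψ + R)) + (30 * U : ℕ) * (((2 : ℕ) * (d : ENNReal)⁻¹) *
            ∑ s ∈ Finset.range ((τ r).reg 8), (l r s : ENNReal)))))) := by
        gcongr
        refine s2.trans ?_
        gcongr
        refine s3.trans ?_
        gcongr
        refine s4.trans ?_
        gcongr
        refine s5.trans ?_
        gcongr
      _ = ((U + (t r * U + (U + (U + U * (250 * N.K + 200)))) : ℕ) : ENNReal) +
          (mainCost N d U ψ + R) + (30 * U : ℕ) * (((2 : ℕ) * (d : ENNReal)⁻¹) *
            ∑ s ∈ Finset.range ((τ r).reg 8), (l r s : ENNReal)) := by push_cast; ring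
      _ ≤ _ := by
        gcongr
        calc U + (t r * U + (U + (U + U * (250 * N.K + 200)))) = U * (250 * N.K + 203 + t r) := by ring
          _ ≤ _ := Nat.mul_le_mul_left _ (by omega)
  have hpos : 0 < σ.reg 3 := by omega
  have s1 := expectedCost_le_of_pure (c := (mainP :: k, σ)) (c' := (iterP :: mainP :: k, σ)) (u := U)
    (by simp [mainP, step, h3]) (costU (rg 3) σ b hB hb (by omega) rfl (by decide)) n
  have s2 := expectedCost_le_of_pure (c := (iterP :: mainP :: k, σ)) rfl (u := U) U1 n
  have s4 := expectedCost_sample_le (x := 31) (e := rg 3 - 1) (σ := σ)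
    (costU _ _ _ hB (by omega) (by omega) rfl (by decide))
    ((centerP ⨾ .sample 31 (rg 8 - 1) ⨾ actP) :: mainP :: k) n
  have he : (rg 3 - 1 : Expr).eval σ + 1 = σ.reg 3 := by simp; omega
  rw [he] at s4
  have s5 := average_le hpos outer
  have s6 := inv_le_mul_inv (a := σ.reg 3) (b := ψ + 1) (c := 8) (by omega) (by have := S.pot_le; omega)
  have s7 : ∑ r ∈ Finset.range (σ.reg 3), ((2 : ℕ) * (d : ENNReal)⁻¹ *
      ∑ s ∈ Finset.range ((τ r).reg 8), (l r s : ENNReal)) ≤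
      (2 : ℕ) * (d : ENNReal)⁻¹ * (8 * N.m * N.K : ℕ) := by
    rw [← Finset.mul_sum]
    gcongr
    exact_mod_cast hsum
  calc _ ≤ _ := s1
    _ ≤ U + (U + (U + (((U * (262 * N.K + 224) : ℕ) + (mainCost N d U ψ + R)) + (30 * U : ℕ) *
        (((8 : ℕ) * ((ψ + 1 : ℕ) : ENNReal)⁻¹) * ((2 : ℕ) * (d : ENNReal)⁻¹ *
          (8 * N.m * N.K : ℕ)))))) := by
      gcongr
      refine s2.trans ?_
      gcongr
      refine s4.trans ?_
      gcongr
      refine s5.trans ?_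
      gcongr
    _ = ((U + (U + (U + U * (262 * N.K + 224))) : ℕ) : ENNReal) + (U * (3840 * (N.m * N.K)) : ℕ) *
          (d : ENNReal)⁻¹ * ((ψ + 1 : ℕ) : ENNReal)⁻¹ + (mainCost N d U ψ + R) := by push_cast; ring
    _ ≤ ((U * (500 * (N.K + 1)) : ℕ) : ENNReal) + (U * (3840 * (N.m * N.K)) : ℕ) *
          (d : ENNReal)⁻¹ * ((ψ + 1 : ℕ) : ENNReal)⁻¹ + (mainCost N d U ψ + R) := by
      gcongr
      calc U + (U + (U + U * (262 * N.K + 224))) = U * (262 * N.K + 227) := by ring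
        _ ≤ _ := Nat.mul_le_mul_left _ (by omega)
    _ = _ := by
      unfold mainCost
      rw [Finset.sum_range_succ]
      push_cast
      ring

end

/-! ### Building the data structures -/

/-- The number of the edge that contains the dart `d`. -/
def ed (d : ℕ) : ℕ := (d - 2) / 2

/-- The memory `σ` holds the edges of the net `N` in arrays `0` and `1`, and a proper partial coloring in
array `2`; everything apart from the input is `0`, and all vertices are less than `n`. -/
structure Input (N : Net) (n : ℕ) (σ : Mem) : Prop where
  m : σ.reg 1 = N.m
  reg : ∀ x, 2 ≤ x → σ.reg x = 0
  arr : ∀ a, 4 ≤ a → ∀ i, σ.arr a i = 0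
  V : ∀ d, N.V d = if N.dart d then (if d % 2 = 0 then σ.arr 0 (ed d) else σ.arr 1 (ed d)) else 0
  lt : ∀ d, N.dart d → N.V d < n
  le : ∀ d, N.dart d → σ.arr 2 (ed d) ≤ N.K
  proper : ∀ d e, N.dart d → N.dart e → N.V d = N.V e → σ.arr 2 (ed d) = σ.arr 2 (ed e) →
    σ.arr 2 (ed d) ≠ 0 → d = e
  max : ∃ v, (N.dartsAt v).card + 1 = N.K

/-- Register the dart in register `10`. -/
def buildStep : Prog :=
  25 ≔ .bin .div (rg 10 - 2) 2 ⨾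
  .branch (rg 10 % 2) (29 ≔ .get 1 (rg 25)) (29 ≔ .get 0 (rg 25)) ⨾
  26 ≔ .get 2 (rg 25) ⨾
  .store 4 (rg 10) (rg 29) ⨾ .store 5 (rg 10) (rg 26) ⨾
  .branch (rg 26) (.store 6 (ixE (rg 29) (rg 26)) (rg 10)) .skip ⨾
  .store 9 (ixE (rg 29) (.get 8 (rg 29))) (rg 10) ⨾
  .store 8 (rg 29) (.get 8 (rg 29) + 1) ⨾
  .store 7 (rg 29) 1 ⨾
  .branch (ltE (rg 2) (.get 8 (rg 29))) (2 ≔ .get 8 (rg 29)) .skip ⨾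
  10 ≔ rg 10 + 1

/-- Whether there are darts left. -/
abbrev moreDarts : Expr := ltE (rg 10) (rg 1 + rg 1 + 2)

/-- Build the arrays, and compute the number of colors. -/
def buildP : Prog := 10 ≔ 2 ⨾ .loop moreDarts buildStep ⨾ 2 ≔ rg 2 + 1

@[simp] theorem eval_div (σ : Mem) (e f : Expr) :
    (Expr.bin .div e f).eval σ = e.eval σ / f.eval σ := rfl

theorem buildStep_spec (σ : Mem) (v h : ℕ)
    (hv : v = if σ.reg 10 % 2 = 0 then σ.arr 0 (ed (σ.reg 10)) else σ.arr 1 (ed (σ.reg 10)))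
    (hh : h = σ.arr 2 (ed (σ.reg 10))) :
    (buildStep.exec σ).arr 4 = Function.update (σ.arr 4) (σ.reg 10) v ∧
    (buildStep.exec σ).arr 5 = Function.update (σ.arr 5) (σ.reg 10) h ∧
    (buildStep.exec σ).arr 6 =
      (if h = 0 then σ.arr 6 else Function.update (σ.arr 6) (ix v h) (σ.reg 10)) ∧
    (buildStep.exec σ).arr 7 = Function.update (σ.arr 7) v 1 ∧
    (buildStep.exec σ).arr 8 = Function.update (σ.arr 8) v (σ.arr 8 v + 1) ∧
    (buildStep.exec σ).arr 9 = Function.update (σ.arr 9) (ix v (σ.arr 8 v)) (σ.reg 10) ∧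
    (buildStep.exec σ).reg 10 = σ.reg 10 + 1 ∧
    (buildStep.exec σ).reg 2 = max (σ.reg 2) (σ.arr 8 v + 1) := by
  have hm : max (σ.reg 2) (σ.arr 8 v + 1) = if σ.reg 2 < σ.arr 8 v + 1 then σ.arr 8 v + 1 else σ.reg 2 := by
    split_ifs <;> omega
  rw [hm]
  unfold ed at hv hh
  by_cases h1 : σ.reg 10 % 2 = 0
  · rw [if_pos h1] at hv
    by_cases h2 : h = 0 <;> by_cases h3 : σ.reg 2 < σ.arr 8 v + 1 <;>
      simp [buildStep, Prog.exec, h1, ← hv, ← hh, h2, h3]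
  · rw [if_neg h1] at hv
    by_cases h2 : h = 0 <;> by_cases h3 : σ.reg 2 < σ.arr 8 v + 1 <;>
      simp [buildStep, Prog.exec, h1, ← hv, ← hh, h2, h3]

/-- The initial labels: all darts of an edge have its color. -/
def lab0 (N : Net) (σ : Mem) (d : ℕ) : ℕ := if N.dart d then σ.arr 2 (ed d) else 0

/-- The data structures contain the darts less than `D`. -/
structure Built (N : Net) (σ τ : Mem) (D : ℕ) : Prop where
  V : ∀ d, τ.arr 4 d = if d < D then N.V d else 0
  H : ∀ d, τ.arr 5 d = if d < D then lab0 N σ d else 0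
  T_of : ∀ d, d < D → lab0 N σ d ≠ 0 → τ.arr 6 (ix (N.V d) (lab0 N σ d)) = d
  of_T : ∀ v c, τ.arr 6 (ix v c) ≠ 0 → N.dart (τ.arr 6 (ix v c)) ∧ N.V (τ.arr 6 (ix v c)) = v ∧
    lab0 N σ (τ.arr 6 (ix v c)) = c ∧ c ≠ 0 ∧ τ.arr 6 (ix v c) < D
  M : ∀ d, N.dart d → d < D → τ.arr 7 (N.V d) = 1
  mem : ∀ v, ∀ k < τ.arr 8 v, N.dart (τ.arr 9 (ix v k)) ∧ N.V (τ.arr 9 (ix v k)) = v ∧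
    τ.arr 9 (ix v k) < D
  inj : ∀ v, ∀ k < τ.arr 8 v, ∀ l < τ.arr 8 v, τ.arr 9 (ix v k) = τ.arr 9 (ix v l) → k = l
  surj : ∀ d, N.dart d → d < D → ∃ k < τ.arr 8 (N.V d), τ.arr 9 (ix (N.V d) k) = d

theorem tw_ed {d : ℕ} (h : 2 ≤ d) : ed (tw d) = ed d := by unfold ed tw; omega

/-- Adding the dart `d` to the data structures. -/
theorem Built.step {N : Net} {n : ℕ} {σ τ : Mem} (inp : Input N n σ) {d : ℕ} (b : Built N σ τ d)
    (hd : N.dart d) {τ' : Mem}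
    (h4 : τ'.arr 4 = Function.update (τ.arr 4) d (N.V d))
    (h5 : τ'.arr 5 = Function.update (τ.arr 5) d (lab0 N σ d))
    (h6 : τ'.arr 6 = (if lab0 N σ d = 0 then τ.arr 6 else
      Function.update (τ.arr 6) (ix (N.V d) (lab0 N σ d)) d))
    (h7 : τ'.arr 7 = Function.update (τ.arr 7) (N.V d) 1)
    (h8 : τ'.arr 8 = Function.update (τ.arr 8) (N.V d) (τ.arr 8 (N.V d) + 1))
    (h9 : τ'.arr 9 = Function.update (τ.arr 9) (ix (N.V d) (τ.arr 8 (N.V d))) d) : Built N σ τ' (d + 1) := by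
  have hlab : ∀ e, N.dart e → lab0 N σ e = σ.arr 2 (ed e) := fun e he => by simp [lab0, he]
  have hdart : ∀ e, lab0 N σ e ≠ 0 → N.dart e := fun e he => by
    by_contra h; exact he (by simp [lab0, h])
  have hT : ∀ v c, τ'.arr 6 (ix v c) = if v = N.V d ∧ c = lab0 N σ d ∧ lab0 N σ d ≠ 0 then d else
      τ.arr 6 (ix v c) := fun v c => by
    rw [h6]
    by_cases h : lab0 N σ d = 0
    · simp [h]
    · simp [h, Function.update_apply, ix_inj]
  have hA : ∀ v k, τ'.arr 9 (ix v k) = if v = N.V d ∧ k = τ.arr 8 (N.V d) then d else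
      τ.arr 9 (ix v k) := fun v k => by
    rw [h9]; simp [Function.update_apply, ix_inj]
  have hD : ∀ v, τ'.arr 8 v = if v = N.V d then τ.arr 8 (N.V d) + 1 else τ.arr 8 v := fun v => by
    rw [h8, Function.update_apply]
  refine ⟨fun e => ?_, fun e => ?_, fun e he he0 => ?_, fun v c h => ?_, fun e he hlt => ?_,
    fun v k hk => ?_, fun v k hk l hl e => ?_, fun e he hlt => ?_⟩
  · rw [h4, Function.update_apply, b.V]
    split_ifs <;> first | omega | simp_all
  · rw [h5, Function.update_apply, b.H]
    split_ifs <;> first | omega | simp_all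
  · rw [hT]
    split_ifs with h
    · by_contra hne
      have hed := hdart e he0
      refine hne (inp.proper d e hd hed h.1.symm ?_ ?_)
      · rw [← hlab d hd, ← hlab e hed]; exact h.2.1.symm
      · rw [← hlab d hd]; exact h.2.2
    · have : e ≠ d := by
        rintro rfl
        exact h ⟨rfl, rfl, he0⟩
      exact b.T_of e (by omega) he0
  · rw [hT] at h ⊢
    split_ifs at h ⊢ with hif
    · exact ⟨hd, hif.1.symm, hif.2.1.symm, by rw [hif.2.1]; exact hif.2.2, by omega⟩
    · have := b.of_T v c h
      exact ⟨this.1, this.2.1, this.2.2.1, this.2.2.2.1, by omega⟩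
  · rw [h7, Function.update_apply]
    split_ifs with h
    · rfl
    · refine b.M e he ?_
      have : e ≠ d := by rintro rfl; exact h rfl
      omega
  · rw [hD] at hk
    rw [hA]
    split_ifs with hif
    · exact ⟨hd, hif.1.symm, by omega⟩
    · have := b.mem v k (by split_ifs at hk with hv <;> [(have : k ≠ τ.arr 8 (N.V d) := fun e => hif ⟨hv, e⟩; subst hv; omega); omega])
      exact ⟨this.1, this.2.1, by omega⟩
  · rw [hD] at hk hl
    rw [hA, hA] at e
    by_cases hv : v = N.V d
    · subst hv
      simp only [if_true, true_and] at hk hl e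
      split_ifs at e with h1 h2 h2
      · omega
      · have := b.mem (N.V d) l (by omega); omega
      · have := b.mem (N.V d) k (by omega); omega
      · exact b.inj _ k (by omega) l (by omega) e
    · simp only [hv, if_false, false_and] at hk hl e
      exact b.inj v k hk l hl e
  · rw [hD]
    by_cases hed : e = d
    · subst hed
      exact ⟨τ.arr 8 (N.V e), by simp, by rw [hA]; simp⟩
    · obtain ⟨k, hk, h⟩ := b.surj e he (by omega)
      refine ⟨k, by split_ifs with hv <;> [(rw [hv] at hk; omega); exact hk], ?_⟩
      rw [hA, if_neg]
      · exact h
      · rintro ⟨hv, hk'⟩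
        rw [hv, hk'] at hk; omega

/-- `buildP` builds the data structures of the whole graph. The number of colors, one more than the
maximum degree, is computed along the way. -/
theorem buildP_spec {N : Net} {n : ℕ} {σ : Mem} (inp : Input N n σ) (hN : N.Good) :
    ∃ t τ, Runs buildP σ t τ ∧ t ≤ 80 * N.m + 10 ∧ Built N σ τ (2 * N.m + 2) ∧ τ.reg 2 = N.K := by
  have hlen : buildStep.len ≤ 34 := by decide
  set σ1 := σ.setReg 10 2 with hσ1
  obtain ⟨t, τ, r, ht, ⟨hle, b, k0, k1, k2, k3, k4, k5⟩, hc⟩ := runs_loop (e := moreDarts) (p := buildStep)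
    (fun τ => τ.reg 10 ≤ 2 * N.m + 2 ∧ Built N σ τ (τ.reg 10) ∧ τ.reg 1 = N.m ∧ 2 ≤ τ.reg 10 ∧
      (τ.arr 0 = σ.arr 0 ∧ τ.arr 1 = σ.arr 1) ∧ τ.arr 2 = σ.arr 2 ∧
      (∀ v, τ.arr 8 v ≤ τ.reg 2) ∧ ∃ v, τ.arr 8 v = τ.reg 2)
    (fun τ => 35 * (2 * N.m + 2 - τ.reg 10))
    (by
      rintro τ ⟨hle, b, k0, k1, k2, k3, k4, k5⟩ hne
      have hlt : τ.reg 10 < 2 * N.m + 2 := by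
        by_contra h
        apply hne
        simp [k0]; omega
      have hd : N.dart (τ.reg 10) := ⟨k1, hlt⟩
      obtain ⟨t, ht, r⟩ := runs_exec buildStep τ rfl
      obtain ⟨s4, s5, s6, s7, s8, s9, s10, s2⟩ := buildStep_spec τ (N.V (τ.reg 10))
        (lab0 N σ (τ.reg 10)) (by rw [inp.V, if_pos hd, k2.1, k2.2]) (by
          rw [lab0, if_pos hd, k3])
      refine ⟨t, _, r, ⟨by omega, ?_, (r.reg_eq 1 rfl).trans k0, by omega,
        ⟨(r.arr_eq 0 rfl).trans k2.1, (r.arr_eq 1 rfl).trans k2.2⟩, (r.arr_eq 2 rfl).trans k3,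
        fun v => ?_, ?_⟩, by omega⟩
      · rw [s10]
        exact b.step inp hd s4 s5 s6 s7 s8 s9
      · have := k4 v
        rw [s8, s2, Function.update_apply]
        split_ifs <;> omega
      · obtain ⟨v, hv⟩ := k5
        rw [s2, s8]
        rcases Nat.lt_or_ge (τ.reg 2) (τ.arr 8 (N.V (τ.reg 10)) + 1) with h | h
        · exact ⟨N.V (τ.reg 10), by simp; omega⟩
        · refine ⟨v, ?_⟩
          rw [Function.update_of_ne]
          · omega
          · rintro rfl; omega)
    σ1 ⟨by simp [hσ1], by
      have z : ∀ a, 4 ≤ a → ∀ i, σ1.arr a i = 0 := inp.arr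
      have nd : ∀ d, d < 2 → ¬ N.dart d := fun d hd h => by have := h.1; omega
      have e10 : σ1.reg 10 = 2 := by simp [hσ1]
      rw [e10]
      refine ⟨fun d => ?_, fun d => ?_, fun d hd h => ?_, fun v c h => ?_, fun d hd h => ?_,
        fun v k hk => ?_, fun v k hk => ?_, fun d hd h => ?_⟩
      · rw [z 4 (by omega)]
        split_ifs with h
        · rw [inp.V, if_neg (nd d h)]
        · rfl
      · rw [z 5 (by omega)]
        split_ifs with h
        · rw [lab0, if_neg (nd d h)]
        · rfl
      · exact (h (by rw [lab0, if_neg (nd d hd)])).elim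
      · exact (h (z 6 (by omega) _)).elim
      · exact (nd d h hd).elim
      · rw [z 8 (by omega)] at hk; omega
      · rw [z 8 (by omega)] at hk; omega
      · exact (nd d h hd).elim, by simpa [hσ1] using inp.m, by simp [hσ1], ⟨rfl, rfl⟩, rfl,
      fun v => by rw [show σ1.arr 8 v = 0 from inp.arr 8 (by omega) v]; omega,
      0, by rw [show σ1.arr 8 0 = 0 from inp.arr 8 (by omega) 0]; simpa [hσ1] using (inp.reg 2 le_rfl).symm⟩
  have h10 : τ.reg 10 = 2 * N.m + 2 := by
    simp [k0] at hc; omega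
  rw [h10] at b
  have hdeg : ∀ v, τ.arr 8 v = (N.dartsAt v).card := by
    intro v
    rw [← Finset.card_range (τ.arr 8 v)]
    refine Finset.card_bij (fun k _ => τ.arr 9 (ix v k)) (fun k hk => ?_) (fun k hk l hl e => ?_)
      (fun d hd => ?_)
    · have := b.mem v k (by simpa using hk)
      simpa using ⟨this.1, this.2.1⟩
    · exact b.inj v k (by simpa using hk) l (by simpa using hl) e
    · rw [Net.mem_dartsAt] at hd
      obtain ⟨k, hk, e⟩ := b.surj d hd.1 hd.1.2
      rw [hd.2] at hk e
      exact ⟨k, by simpa using hk, e⟩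
  have hK : τ.reg 2 + 1 = N.K := by
    obtain ⟨v, hv⟩ := k5
    obtain ⟨w, hw⟩ := inp.max
    have h1 := hN.deg_lt v
    have h2 := k4 w
    rw [← hdeg] at h1 hw
    omega
  refine ⟨_, _, (Runs.assign _ _ _).seq (r.seq (.assign _ _ _)), ?_,
    ⟨b.V, b.H, b.T_of, b.of_T, b.M, b.mem, b.inj, b.surj⟩, by simpa using hK⟩
  have : σ1.reg 10 = 2 := by simp [hσ1]
  omega

/-! ### Free colors -/

/-- Go on to the next candidate for the free color at the end of the dart in register `10`, if the present
one is not free. -/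
def bumpStep : Prog :=
  29 ≔ vE (rg 10) ⨾ .branch (tE (rg 29) (mE (rg 29))) (.store 7 (rg 29) (mE (rg 29) + 1)) .skip ⨾
  10 ≔ rg 10 + 1

/-- Find a free color at every vertex: a vertex has as many chances as it has darts. -/
def bumpP : Prog := 10 ≔ 2 ⨾ .loop moreDarts bumpStep

/-- The number of darts at `v` that are less than `D`. -/
def seen (N : Net) (v D : ℕ) : ℕ := ((N.dartsAt v).filter fun d => d < D).card

theorem seen_succ_le {N : Net} (v D : ℕ) : seen N v (D + 1) ≤ seen N v D + 1 := by
  unfold seen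
  refine (Finset.card_le_card (t := insert D ((N.dartsAt v).filter fun d => d < D)) fun d hd => ?_).trans
    (Finset.card_insert_le _ _)
  simp only [Finset.mem_filter, Finset.mem_insert] at hd ⊢
  by_cases h : d = D
  · exact Or.inl h
  · exact Or.inr ⟨hd.1, by omega⟩

theorem seen_succ_of_ne {N : Net} {v D : ℕ} (h : N.V D ≠ v) : seen N v (D + 1) = seen N v D := by
  unfold seen
  congr 1
  ext d
  simp only [Finset.mem_filter, Net.mem_dartsAt]
  constructor
  · rintro ⟨h1, h2⟩
    refine ⟨h1, ?_⟩
    have : d ≠ D := by rintro rfl; exact h h1.2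
    omega
  · rintro ⟨h1, h2⟩; exact ⟨h1, by omega⟩

theorem seen_all (N : Net) (v : ℕ) : seen N v (2 * N.m + 2) = (N.dartsAt v).card := by
  unfold seen
  rw [Finset.filter_true_of_mem]
  intro d hd
  exact (Net.mem_dartsAt.1 hd).1.2

theorem bumpStep_spec (σ : Mem) (v : ℕ) (hv : v = σ.arr 4 (σ.reg 10)) :
    (bumpStep.exec σ).reg 10 = σ.reg 10 + 1 ∧
    (bumpStep.exec σ).arr 7 = if (lay σ).T v ((lay σ).M v) = 0 then σ.arr 7 else
      Function.update (σ.arr 7) v (σ.arr 7 v + 1) := by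
  have e : (lay σ).T v ((lay σ).M v) = σ.arr 6 (ix v (σ.arr 7 v)) := rfl
  rw [e]
  by_cases h : σ.arr 6 (ix v (σ.arr 7 v)) = 0 <;> simp [bumpStep, Prog.exec, ← hv, h]

/-- `bumpP` finds free colors in `O(m)` steps. When `k` darts at `v` have been seen, either the
candidate is free, or all of the first `k + 1` colors label darts at `v`, which is impossible for `k =
deg v`. -/
theorem bumpP_spec {N : Net} (hN : N.Good) (σ : Mem) (hV : ∀ d, N.dart d → σ.arr 4 d = N.V d)
    (hm : σ.reg 1 = N.m)
    (of_T : ∀ v c, (lay σ).T v c ≠ 0 → N.dart ((lay σ).T v c) ∧ N.V ((lay σ).T v c) = v)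
    (inj : ∀ v c c', (lay σ).T v c = (lay σ).T v c' → (lay σ).T v c ≠ 0 → c = c')
    (hM : ∀ d, N.dart d → σ.arr 7 (N.V d) = 1) :
    ∃ t τ, Runs bumpP σ t τ ∧ t ≤ 40 * N.m + 10 ∧ ∀ d, N.dart d → (lay τ).MOk N (N.V d) := by
  have hlen : bumpStep.len ≤ 15 := by decide
  obtain ⟨t, τ, r, ht, ⟨a1, a2, a3, a4, a5, a6⟩, hc⟩ := runs_loop (e := moreDarts) (p := bumpStep)
    (fun τ => 2 ≤ τ.reg 10 ∧ τ.reg 10 ≤ 2 * N.m + 2 ∧ τ.reg 1 = N.m ∧ τ.arr 4 = σ.arr 4 ∧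
      τ.arr 6 = σ.arr 6 ∧
      ∀ d, N.dart d → 1 ≤ τ.arr 7 (N.V d) ∧
        (∀ c, 1 ≤ c → c < τ.arr 7 (N.V d) → (lay σ).T (N.V d) c ≠ 0) ∧
        ((lay σ).T (N.V d) (τ.arr 7 (N.V d)) = 0 ∨ seen N (N.V d) (τ.reg 10) + 1 ≤ τ.arr 7 (N.V d)))
    (fun τ => 16 * (2 * N.m + 2 - τ.reg 10))
    (by
      rintro τ ⟨a1, a2, a3, a4, a5, a6⟩ hne
      have hlt : τ.reg 10 < 2 * N.m + 2 := by
        by_contra h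
        apply hne
        simp [a3]; omega
      have hd : N.dart (τ.reg 10) := ⟨a1, hlt⟩
      obtain ⟨t, ht, r⟩ := runs_exec bumpStep τ rfl
      obtain ⟨s10, s7⟩ := bumpStep_spec τ (N.V (τ.reg 10)) (by rw [a4, hV _ hd])
      have eT : (lay τ).T = (lay σ).T := by simp [lay, a5]
      rw [eT] at s7
      refine ⟨t, _, r, ⟨by omega, by omega, (r.reg_eq 1 rfl).trans a3, (r.arr_eq 4 rfl).trans a4,
        (r.arr_eq 6 rfl).trans a5, fun d hd => ?_⟩, by omega⟩
      obtain ⟨b1, b2, b3⟩ := a6 d hd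
      have hs := seen_succ_le (N := N) (N.V d) (τ.reg 10)
      have eM : (lay τ).M = τ.arr 7 := rfl
      rw [s7, s10, eM]
      by_cases hv : N.V (τ.reg 10) = N.V d
      · rw [hv]
        split_ifs with h
        · exact ⟨b1, b2, Or.inl h⟩
        · rw [Function.update_self]
          refine ⟨by omega, fun c h1 h2 => ?_, Or.inr ?_⟩
          · by_cases hc : c = τ.arr 7 (N.V d)
            · rw [hc]; exact h
            · exact b2 c h1 (by omega)
          · have := b3.resolve_left h
            omega
      · rw [seen_succ_of_ne hv]
        split_ifs
        · exact ⟨b1, b2, b3⟩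
        · rw [Function.update_of_ne (Ne.symm hv)]
          exact ⟨b1, b2, b3⟩)
    (σ.setReg 10 2) ⟨by simp, by simp, by simpa using hm, rfl, rfl, fun d hd => by
      have := hM d hd
      refine ⟨by simp [this], fun c h1 h2 => by simp [this] at h2; omega, Or.inr ?_⟩
      have h0 : seen N (N.V d) 2 = 0 := by
        unfold seen
        rw [Finset.card_eq_zero, Finset.filter_eq_empty_iff]
        intro e he
        have := (Net.mem_dartsAt.1 he).1.1
        omega
      simp [this, h0]⟩
  have h10 : τ.reg 10 = 2 * N.m + 2 := by
    simp [a3] at hc; omega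
  refine ⟨_, τ, (Runs.assign _ _ _).seq r, ?_, fun d hd => ?_⟩
  · have : (σ.setReg 10 2).reg 10 = 2 := by simp
    omega
  · obtain ⟨b1, b2, b3⟩ := a6 d hd
    obtain ⟨c, c1, c2, c3⟩ := exists_free (N := N) (lay σ).T (N.V d)
      (fun c hc => Net.mem_dartsAt.2 (of_T _ c hc)) (inj _)
    have hdeg := hN.deg_lt (N.V d)
    have hle : τ.arr 7 (N.V d) ≤ c := by
      by_contra h
      exact b2 c c1 (by omega) c3
    have eT : (lay τ).T = (lay σ).T := by simp [lay, a5]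
    have eM : (lay τ).M = τ.arr 7 := rfl
    unfold Lay.MOk
    rw [eT, eM]
    refine ⟨b1, by omega, ?_⟩
    rcases b3 with h | h
    · exact h
    · rw [h10, seen_all] at h
      have : τ.arr 7 (N.V d) = c := by omega
      rw [this]; exact c3

/-! ### Selecting the edges to be colored -/

section
variable {N : Net} {X C : ℕ → Prop}

/-- The edge of the dart `y`, whose two halves have no label, becomes a token. -/
theorem Inv.newToken {L : Lay} (I : Inv N X C L) {y : ℕ} (hy : N.dart y) (hX : X y)
    (hC : C (N.V (tw y))) {X' : ℕ → Prop} (hX' : ∀ d, N.dart d → (X' d ↔ X d ∧ d ≠ y ∧ d ≠ tw y))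
    {L' : Lay} (hL' : L' = ⟨Function.update L.H y (L.M (N.V y)), upd L.T (N.V y) (L.M (N.V y)) y, L.M⟩) :
    Core N X' C L' ∧ (∀ d, N.dart d → N.V d ≠ N.V y → L'.MOk N (N.V d)) ∧
      ∀ d, L'.tok N d ↔ L.tok N d ∨ d = y := by
  obtain ⟨m1, m2, m3⟩ := I.free y hy
  obtain ⟨h0, h0'⟩ := (I.inert y hy).2 hX
  generalize hw : N.V y = w at *
  generalize hk : L.M w = k at *
  have H' : ∀ d, L'.H d = if d = y then k else L.H d := fun d => by
    rw [hL']; exact Function.update_apply _ _ _ _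
  have T' : ∀ v c, L'.T v c = if v = w ∧ c = k then y else L.T v c := fun v c => by rw [hL']; rfl
  have M' : L'.M = L.M := by rw [hL']
  clear hL'
  have e1 := hy.tw_tw
  have n1 := tw_ne y
  have y2 := hy.1
  have twy : ∀ d, N.dart d → (tw d = y ↔ d = tw y) := fun d hd =>
    ⟨fun e => by rw [← e, hd.tw_tw], fun e => by rw [e, e1]⟩
  have toks : ∀ d, L'.tok N d ↔ L.tok N d ∨ d = y := by
    intro d
    by_cases hd : N.dart d
    · have := twy d hd
      simp only [Lay.tok, H']
      by_cases hdy : d = y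
      · subst hdy; simp [hd, n1, h0']; omega
      · by_cases hdt : d = tw y
        · subst hdt; simp [h0', hdy]
        · have : tw d ≠ y := fun e => hdt (this.1 e)
          simp [hdy, this]
    · simp only [Lay.tok, hd, false_and, false_or, false_iff]
      exact fun e => hd (e ▸ hy)
  refine ⟨⟨?_, ?_, ?_, ?_, ?_, ?_, ?_⟩, ?_, toks⟩
  · intro d hd
    have := I.le d hd
    rw [H']; split_ifs <;> omega
  · intro d hd hd0
    rw [H'] at hd0 ⊢
    rw [T']
    by_cases hdy : d = y
    · subst hdy; simp [hw]
    · rw [if_neg hdy] at hd0 ⊢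
      rw [if_neg]
      · exact I.T_of d hd hd0
      · rintro ⟨a, b⟩
        have := I.T_of d hd hd0
        rw [a, b, m3] at this
        have := hd.1; omega
  · intro v c h
    rw [T'] at h ⊢
    rw [H']
    split_ifs at h ⊢ with a b b
    · exact ⟨hy, by rw [hw, a.1], a.2.symm, by omega⟩
    · exact absurd rfl b
    · have := I.of_T v c h
      rw [b, h0] at this
      exact absurd this.2.2.1.symm this.2.2.2
    · exact I.of_T v c h
  · intro d hd
    have := I.edge d hd
    have := twy d hd
    rw [H', H']
    grind
  · rw [H', if_neg (by omega)]; exact I.one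
  · intro d hd
    rw [hX' d hd, ← I.inert d hd, H', H']
    have := twy d hd
    grind
  · intro d hd
    rcases (toks d).1 hd with h | rfl
    · exact I.ctr d h
    · exact hC
  · intro d hd hne
    obtain ⟨a1, a2, a3⟩ := I.free d hd
    unfold Lay.MOk
    rw [M', T', if_neg (fun h => hne h.1)]
    exact ⟨a1, a2, a3⟩

theorem Listed.add {Λ Λ' : Lay} {y a : ℕ} {L P : ℕ → ℕ} (l : Listed N Λ L P a)
    (hy : ¬ Λ.tok N y) (h : ∀ d, Λ'.tok N d ↔ Λ.tok N d ∨ d = y) :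
    Listed N Λ' (Function.update L a y) (Function.update P y a) (a + 1) := by
  refine ⟨fun t ht => ?_, fun d hd => ?_⟩
  · by_cases e : t = a
    · subst e; simp [h]
    · obtain ⟨q1, q2⟩ := l.tok t (by omega)
      have : L t ≠ y := fun e => hy (e ▸ q1)
      rw [Function.update_of_ne e, Function.update_of_ne this]
      exact ⟨(h _).2 (Or.inl q1), q2⟩
  · rcases (h d).1 hd with h1 | rfl
    · obtain ⟨q1, q2⟩ := l.pos d h1
      have : d ≠ y := fun e => hy (e ▸ h1)
      rw [Function.update_of_ne this, Function.update_of_ne (by omega)]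
      exact ⟨by omega, q2⟩
    · simp

/-- The part of `tokenP` before the search for a new free color. -/
def tokenHead : Prog :=
  29 ≔ vE (rg 12) ⨾ 25 ≔ mE (rg 29) ⨾ .store 5 (rg 12) (rg 25) ⨾
  .store 6 (ixE (rg 29) (rg 25)) (rg 12) ⨾
  .store 10 (rg 3) (rg 12) ⨾ .store 11 (rg 12) (rg 3) ⨾ 3 ≔ rg 3 + 1

/-- Make the edge of the dart in register `12` a token with this dart as its leaf. -/
def tokenP : Prog := tokenHead ⨾ freshP

theorem tokenHead_spec (σ : Mem) :
    lay (tokenHead.exec σ) =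
      ⟨Function.update (lay σ).H (σ.reg 12) ((lay σ).M (σ.arr 4 (σ.reg 12))),
        upd (lay σ).T (σ.arr 4 (σ.reg 12)) ((lay σ).M (σ.arr 4 (σ.reg 12))) (σ.reg 12), (lay σ).M⟩ ∧
    (tokenHead.exec σ).reg 3 = σ.reg 3 + 1 ∧
    (tokenHead.exec σ).reg 29 = σ.arr 4 (σ.reg 12) ∧
    (tokenHead.exec σ).arr 10 = Function.update (σ.arr 10) (σ.reg 3) (σ.reg 12) ∧
    (tokenHead.exec σ).arr 11 = Function.update (σ.arr 11) (σ.reg 12) (σ.reg 3) := by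
  simp [tokenHead, Prog.exec, lay, upd_ix]

/-- `tokenP` turns an edge without labels into a token in `O(K)` steps. -/
theorem tokenP_spec (hN : N.Good) (σ : Mem) (g : Good N X C σ) (hy : N.dart (σ.reg 12))
    (hX : X (σ.reg 12)) (hC : C (N.V (tw (σ.reg 12)))) {X' : ℕ → Prop}
    (hX' : ∀ d, N.dart d → (X' d ↔ X d ∧ d ≠ σ.reg 12 ∧ d ≠ tw (σ.reg 12))) :
    ∃ t σ', Runs tokenP σ t σ' ∧ t ≤ 2 * N.K + 30 ∧ Good N X' C σ' ∧ σ'.reg 3 = σ.reg 3 + 1 := by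
  obtain ⟨t, htl, r⟩ := runs_exec tokenHead σ rfl
  obtain ⟨a1, a2, a3, a4, a5⟩ := tokenHead_spec σ
  rw [g.V] at a1 a3
  obtain ⟨i1, i2, i3⟩ := g.inv.newToken hy hX hC hX' a1
  obtain ⟨c, c1, c2, c3⟩ := i1.exists_free (N.V (σ.reg 12))
  have hdeg := hN.deg_lt (N.V (σ.reg 12))
  obtain ⟨t', σ', c', r', ht', d1, d2, d3, d4⟩ := freshP_spec (tokenHead.exec σ) N.K
    ⟨c, c1, by omega, by rw [a3]; exact c3⟩
  rw [a3] at d3 d4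
  have s3 : σ'.reg 3 = σ.reg 3 + 1 := (r'.reg_eq 3 rfl).trans a2
  refine ⟨_, σ', r.seq r', ?_, ⟨?_, ?_, ?_⟩, s3⟩
  · have : tokenHead.len = 13 := rfl
    omega
  · rw [r'.arr_eq 4 rfl, r.arr_eq 4 rfl, g.V]
  · rw [d4]
    exact i1.setM (N.V (σ.reg 12)) c' i2 ⟨d1, d2, d3⟩
  · have hnt : ¬ (lay σ).tok N (σ.reg 12) := fun h => h.2.1 ((g.inv.inert _ hy).2 hX).1
    have := g.list.add (Λ' := lay σ') hnt fun d => (by rw [d4]; exact i3 d)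
    rw [r'.arr_eq 10 rfl, r'.arr_eq 11 rfl, a4, a5, s3]
    exact this

end

section
variable {N : Net} {C : ℕ → Prop}

/-- The edge `j` is uncolored and has an end in `C`; the array `A` contains the colors. -/
def Rel (N : Net) (A : ℕ → ℕ) (C : ℕ → Prop) (j : ℕ) : Prop :=
  A j = 0 ∧ (C (N.V (2 * j + 2)) ∨ C (N.V (2 * j + 3)))

/-- The edge of the dart `d` is uncolored, and not in the set `S` of edges to be colored. -/
def Idle (A : ℕ → ℕ) (S : Finset ℕ) (d : ℕ) : Prop := A (ed d) = 0 ∧ ed d ∉ S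

open Classical in
/-- The number of uncolored edges among the first `i` edges that have an end in `C`. -/
noncomputable def numRel (N : Net) (A : ℕ → ℕ) (C : ℕ → Prop) (i : ℕ) : ℕ :=
  ((Finset.range i).filter (Rel N A C)).card

/-- The set `S` of selected edges after the first `i` edges have been considered. The bit `x v` is set
when an edge at `v` is selected, and reset when an edge at `v` is dropped, which happens if it has an end
with bit `1`. So at most two edges are dropped for every selected edge, and at every vertex at most one
half of the uncolored edges, rounded up, is selected. -/
structure Sel (N : Net) (n : ℕ) (A : ℕ → ℕ) (C : ℕ → Prop) (S : Finset ℕ) (x : ℕ → ℕ) (i : ℕ) : Prop where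
  sub : ∀ j ∈ S, j < i ∧ Rel N A C j
  bit : ∀ v, x v ≤ 1
  count : numRel N A C i + ∑ v ∈ Finset.range n, x v ≤ 3 * S.card
  half : ∀ v, C v → 2 * ((N.dartsAt v).filter fun d => ed d ∈ S).card ≤
    ((N.dartsAt v).filter fun d => A (ed d) = 0 ∧ ed d < i).card + x v

theorem numRel_succ_of_rel {A : ℕ → ℕ} {i : ℕ} (h : Rel N A C i) :
    numRel N A C (i + 1) = numRel N A C i + 1 := by
  classical
  unfold numRel
  rw [Finset.range_add_one, Finset.filter_insert, if_pos h, Finset.card_insert_of_notMem (by simp)]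

theorem numRel_succ_of_not {A : ℕ → ℕ} {i : ℕ} (h : ¬ Rel N A C i) :
    numRel N A C (i + 1) = numRel N A C i := by
  classical
  unfold numRel
  rw [Finset.range_add_one, Finset.filter_insert, if_neg h]

theorem Net.ed_eq {d i : ℕ} (hd : N.dart d) : ed d = i ↔ d = 2 * i + 2 ∨ d = 2 * i + 3 := by
  have := hd.1
  unfold ed; omega

theorem Net.dart_pair {i : ℕ} (hi : i < N.m) : N.dart (2 * i + 2) ∧ N.dart (2 * i + 3) ∧
    tw (2 * i + 2) = 2 * i + 3 ∧ tw (2 * i + 3) = 2 * i + 2 := by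
  unfold Net.dart tw; omega

/-- Adding the edge `i` to a set of edges increases its degree at its two ends, which are different. -/
theorem card_filter_edge (hN : N.Good) (v : ℕ) {i : ℕ} (hi : i < N.m) {p q : ℕ → Prop} [DecidablePred p]
    [DecidablePred q] (hq : ∀ d, q d ↔ p d ∨ ed d = i) (hp : ∀ d, ed d = i → ¬ p d) :
    ((N.dartsAt v).filter q).card = ((N.dartsAt v).filter p).card +
      if v = N.V (2 * i + 2) ∨ v = N.V (2 * i + 3) then 1 else 0 := by
  classical
  obtain ⟨d1, d2, t1, t2⟩ := N.dart_pair hi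
  have hne := hN.ne _ d1
  rw [t1] at hne
  have : (N.dartsAt v).filter q = (N.dartsAt v).filter p ∪ (N.dartsAt v).filter fun d => ed d = i := by
    rw [← Finset.filter_or]; exact Finset.filter_congr fun d _ => hq d
  rw [this, Finset.card_union_of_disjoint]
  · congr 1
    split_ifs with h
    · rw [Finset.card_eq_one]
      rcases h with h | h
      · refine ⟨2 * i + 2, ?_⟩
        ext d
        simp only [Finset.mem_filter, Net.mem_dartsAt, Finset.mem_singleton]
        constructor
        · rintro ⟨⟨a, b⟩, c⟩
          rcases (N.ed_eq a).1 c with e | e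
          · exact e
          · rw [e] at b; exact absurd (h.symm.trans b.symm) hne
        · rintro rfl; exact ⟨⟨d1, h.symm⟩, (N.ed_eq d1).2 (Or.inl rfl)⟩
      · refine ⟨2 * i + 3, ?_⟩
        ext d
        simp only [Finset.mem_filter, Net.mem_dartsAt, Finset.mem_singleton]
        constructor
        · rintro ⟨⟨a, b⟩, c⟩
          rcases (N.ed_eq a).1 c with e | e
          · rw [e] at b; exact absurd (b.trans h) hne
          · exact e
        · rintro rfl; exact ⟨⟨d2, h.symm⟩, (N.ed_eq d2).2 (Or.inr rfl)⟩
    · rw [Finset.card_eq_zero, Finset.filter_eq_empty_iff]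
      intro d hd e
      rw [Net.mem_dartsAt] at hd
      rcases (N.ed_eq hd.1).1 e with e | e <;> rw [e] at hd <;> simp [hd.2] at h
  · rw [Finset.disjoint_filter]
    intro d _ h e
    exact hp d e h

theorem sum_update_range {n a : ℕ} (ha : a < n) (x : ℕ → ℕ) (p : ℕ) :
    ∑ v ∈ Finset.range n, Function.update x a p v + x a = ∑ v ∈ Finset.range n, x v + p := by
  rw [Finset.sum_update_of_mem (by simpa using ha), ← Finset.add_sum_erase _ x (Finset.mem_range.2 ha),
    Finset.sdiff_singleton_eq_erase]
  ring

section
variable {n : ℕ} {A : ℕ → ℕ} {S : Finset ℕ} {x : ℕ → ℕ} {i : ℕ}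

/-- The edge `i` is colored or has no end in `C`. -/
theorem Sel.pass (s : Sel N n A C S x i) (h : ¬ Rel N A C i) : Sel N n A C S x (i + 1) where
  sub j hj := ⟨by have := (s.sub j hj).1; omega, (s.sub j hj).2⟩
  bit := s.bit
  count := by rw [numRel_succ_of_not h]; exact s.count
  half v hv := (s.half v hv).trans (by
    gcongr
    omega)

/-- The uncolored degrees after one more uncolored edge. -/
theorem Sel.card_unc (hN : N.Good) (hi : i < N.m) (h : Rel N A C i) (v : ℕ) :
    ((N.dartsAt v).filter fun d => A (ed d) = 0 ∧ ed d < i + 1).card =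
      ((N.dartsAt v).filter fun d => A (ed d) = 0 ∧ ed d < i).card +
      if v = N.V (2 * i + 2) ∨ v = N.V (2 * i + 3) then 1 else 0 :=
  card_filter_edge hN v hi (fun d => by
    constructor
    · rintro ⟨a, b⟩
      by_cases e : ed d = i
      · exact Or.inr e
      · exact Or.inl ⟨a, by omega⟩
    · rintro (⟨a, b⟩ | e)
      · exact ⟨a, by omega⟩
      · exact ⟨by rw [e]; exact h.1, by omega⟩) (fun d e => by omega)

/-- The edge `i` has an end with bit `1`. Dropping it is paid for by that bit. -/
theorem Sel.drop (hN : N.Good) (s : Sel N n A C S x i) (hi : i < N.m) (h : Rel N A C i)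
    (hlt : ∀ d, N.dart d → N.V d < n) (hx : x (N.V (2 * i + 2)) + x (N.V (2 * i + 3)) ≠ 0) :
    Sel N n A C S (Function.update (Function.update x (N.V (2 * i + 2)) 0) (N.V (2 * i + 3)) 0)
      (i + 1) := by
  obtain ⟨d1, d2, t1, t2⟩ := N.dart_pair hi
  have hne := hN.ne _ d1
  rw [t1] at hne
  refine ⟨fun j hj => ⟨by have := (s.sub j hj).1; omega, (s.sub j hj).2⟩, fun v => ?_, ?_, fun v hv => ?_⟩
  · have := s.bit v
    simp only [Function.update_apply]; split_ifs <;> omega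
  · rw [numRel_succ_of_rel h]
    have e1 := sum_update_range (hlt _ d1) x 0
    have e2 := sum_update_range (hlt _ d2) (Function.update x (N.V (2 * i + 2)) 0) 0
    rw [Function.update_of_ne hne.symm] at e2
    have := s.count
    omega
  · rw [Sel.card_unc hN hi h]
    have := s.half v hv
    have := s.bit v
    simp only [Function.update_apply]
    split_ifs <;> omega

/-- The edge `i` has two ends with bit `0`. Selecting it pays for itself and for the two bits that are
set. -/
theorem Sel.pick (hN : N.Good) (s : Sel N n A C S x i) (hi : i < N.m) (h : Rel N A C i)
    (hlt : ∀ d, N.dart d → N.V d < n) (hx : x (N.V (2 * i + 2)) + x (N.V (2 * i + 3)) = 0) :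
    Sel N n A C (insert i S)
      (Function.update (Function.update x (N.V (2 * i + 2)) 1) (N.V (2 * i + 3)) 1) (i + 1) := by
  obtain ⟨d1, d2, t1, t2⟩ := N.dart_pair hi
  have hne := hN.ne _ d1
  rw [t1] at hne
  have hiS : i ∉ S := fun hi => by have := (s.sub i hi).1; omega
  refine ⟨fun j hj => ?_, fun v => ?_, ?_, fun v hv => ?_⟩
  · rcases Finset.mem_insert.1 hj with rfl | hj
    · exact ⟨by omega, h⟩
    · exact ⟨by have := (s.sub j hj).1; omega, (s.sub j hj).2⟩
  · have := s.bit v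
    simp only [Function.update_apply]; split_ifs <;> omega
  · rw [numRel_succ_of_rel h, Finset.card_insert_of_notMem hiS]
    have e1 := sum_update_range (hlt _ d1) x 1
    have e2 := sum_update_range (hlt _ d2) (Function.update x (N.V (2 * i + 2)) 1) 1
    rw [Function.update_of_ne hne.symm] at e2
    have := s.count
    omega
  · rw [Sel.card_unc hN hi h, card_filter_edge hN v hi (p := fun d => ed d ∈ S)
      (fun d => by rw [Finset.mem_insert, or_comm]) (fun d e => by rw [e]; exact hiS)]
    have := s.half v hv
    have := s.bit v
    simp only [Function.update_apply]
    have : v = N.V (2 * i + 2) → x v = 0 := by rintro rfl; omega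
    have : v = N.V (2 * i + 3) → x v = 0 := by rintro rfl; omega
    split_ifs <;> omega

end

end

section
variable {N : Net}

/-- Select the edge in register `4`; its darts are given by register `10`, its ends are in registers `5`
and `6`. -/
def pickP : Prog :=
  .store 14 (rg 5) 1 ⨾ .store 14 (rg 6) 1 ⨾
  .branch (.get 3 (rg 5)) (12 ≔ rg 10 + 1) (12 ≔ rg 10) ⨾ tokenP

/-- Consider the edge in register `4`. -/
def considerP : Prog :=
  .branch (.get 2 (rg 4)) .skip
    (.branch (.get 3 (rg 5) + .get 3 (rg 6))
      (.branch (.get 14 (rg 5) + .get 14 (rg 6))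
        (.store 14 (rg 5) 0 ⨾ .store 14 (rg 6) 0) pickP) .skip)

/-- Select the edges to be colored, and make them tokens. -/
def selectP : Prog :=
  4 ≔ 0 ⨾ 10 ≔ 2 ⨾ .loop (ltE (rg 4) (rg 1))
    (5 ≔ .get 0 (rg 4) ⨾ 6 ≔ .get 1 (rg 4) ⨾ considerP ⨾ 4 ≔ rg 4 + 1 ⨾ 10 ≔ rg 10 + 2)

theorem Good.congr {X X' C : ℕ → Prop} {σ τ : Mem} (g : Good N X C σ)
    (hX : ∀ d, N.dart d → (X' d ↔ X d))
    (h : ∀ a, a ≠ 14 → τ.arr a = σ.arr a) (h3 : τ.reg 3 = σ.reg 3) : Good N X' C τ := by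
  have hl : lay τ = lay σ := by simp [lay, h]
  refine ⟨by rw [h 4 (by omega), g.V], ?_, ?_⟩
  · rw [hl]
    exact { g.inv with inert := fun d hd => (g.inv.inert d hd).trans (hX d hd).symm }
  · rw [hl, h 10 (by omega), h 11 (by omega), h3]; exact g.list

/-- One iteration of the selection. -/
theorem considerP_spec (hN : N.Good) {n : ℕ} (τ : Mem) {i : ℕ} {S : Finset ℕ}
    (h4 : τ.reg 4 = i) (hi : i < N.m) (h10 : τ.reg 10 = 2 * i + 2)
    (h5 : τ.reg 5 = N.V (2 * i + 2)) (h6 : τ.reg 6 = N.V (2 * i + 3))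
    (hlt : ∀ d, N.dart d → N.V d < n)
    (g : Good N (Idle (τ.arr 2) S) (fun u => τ.arr 3 u ≠ 0) τ)
    (s : Sel N n (τ.arr 2) (fun u => τ.arr 3 u ≠ 0) S (τ.arr 14) i) (hc : τ.reg 3 = S.card) :
    ∃ t σ S', Runs considerP τ t σ ∧
      Good N (Idle (τ.arr 2) S') (fun u => τ.arr 3 u ≠ 0) σ ∧
      Sel N n (τ.arr 2) (fun u => τ.arr 3 u ≠ 0) S' (σ.arr 14) (i + 1) ∧ σ.reg 3 = S'.card ∧
      ((σ.reg 3 = τ.reg 3 ∧ t ≤ 10) ∨ (σ.reg 3 = τ.reg 3 + 1 ∧ t ≤ 2 * N.K + 50)) := by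
  obtain ⟨d1, d2, t1, t2⟩ := N.dart_pair hi
  have hne := hN.ne _ d1
  rw [t1] at hne
  by_cases c1 : τ.arr 2 i = 0
  swap
  · exact ⟨_, τ, S, .branch_pos (by simpa [h4] using c1) (.skip τ), g, s.pass fun h => c1 h.1, hc,
      Or.inl ⟨rfl, by omega⟩⟩
  by_cases c2 : τ.arr 3 (N.V (2 * i + 2)) + τ.arr 3 (N.V (2 * i + 3)) = 0
  · exact ⟨_, τ, S, .branch_neg (by simpa [h4] using c1) (.branch_neg (by simpa [h5, h6] using c2) (.skip τ)),
      g, s.pass fun h => by have := h.2; omega, hc, Or.inl ⟨rfl, by omega⟩⟩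
  have hr : Rel N (τ.arr 2) (fun u => τ.arr 3 u ≠ 0) i := ⟨c1, by omega⟩
  have c2' : (.get 3 (rg 5) + .get 3 (rg 6) : Expr).eval τ ≠ 0 := by
    simp only [eval_add, eval_get, eval_reg, h5, h6]; exact c2
  by_cases c3 : τ.arr 14 (N.V (2 * i + 2)) + τ.arr 14 (N.V (2 * i + 3)) = 0
  swap
  · have c3' : (.get 14 (rg 5) + .get 14 (rg 6) : Expr).eval τ ≠ 0 := by
      simp only [eval_add, eval_get, eval_reg, h5, h6]; exact c3
    refine ⟨_, _, S, .branch_neg (by simpa [h4] using c1) (.branch_pos c2' (.branch_pos c3'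
      ((Runs.store _ _ _ _).seq (.store _ _ _ _)))), g.congr (fun _ _ => Iff.rfl) ?_ rfl, ?_, hc,
      Or.inl ⟨rfl, by omega⟩⟩
    · intro a ha; simp [ha]
    · have := s.drop hN hi hr hlt c3
      simpa [h5, h6] using this
  · have c3' : (.get 14 (rg 5) + .get 14 (rg 6) : Expr).eval τ = 0 := by
      simp only [eval_add, eval_get, eval_reg, h5, h6]; exact c3
    set y := if τ.arr 3 (N.V (2 * i + 2)) = 0 then 2 * i + 2 else 2 * i + 3 with hy
    set τ1 := (τ.setArr 14 (τ.reg 5) 1).setArr 14 (τ.reg 6) 1 with hτ1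
    have r1 : Runs (.branch (.get 3 (rg 5)) (12 ≔ rg 10 + 1) (12 ≔ rg 10)) τ1 2 (τ1.setReg 12 y) := by
      by_cases hb : τ.arr 3 (N.V (2 * i + 2)) = 0
      · have := Runs.branch_neg (e := .get 3 (rg 5)) (p := 12 ≔ rg 10 + 1) (q := 12 ≔ rg 10) (σ := τ1)
          (by simp [hτ1, h5, hb]) (.assign _ _ _)
        simpa [hτ1, hy, h10, hb] using this
      · have := Runs.branch_pos (e := .get 3 (rg 5)) (p := 12 ≔ rg 10 + 1) (q := 12 ≔ rg 10) (σ := τ1)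
          (by simpa [hτ1, h5] using hb) (.assign _ _ _)
        simpa [hτ1, hy, h10, hb] using this
    have hyd : N.dart y := by rw [hy]; split_ifs <;> assumption
    have hye : ed y = i := by rw [N.ed_eq hyd, hy]; split_ifs <;> simp
    have hyt : tw y = if τ.arr 3 (N.V (2 * i + 2)) = 0 then 2 * i + 3 else 2 * i + 2 := by
      rw [hy]; split_ifs <;> assumption
    have hiS : i ∉ S := fun hi => by have := (s.sub i hi).1; omega
    have g1 : Good N (Idle (τ.arr 2) S) (fun u => τ.arr 3 u ≠ 0) (τ1.setReg 12 y) :=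
      g.congr (fun _ _ => Iff.rfl) (fun a ha => by simp [hτ1, ha]) (by simp [hτ1])
    obtain ⟨t, σ, r, ht, g2, h3⟩ := tokenP_spec hN (τ1.setReg 12 y) g1 (by simpa using hyd)
      (by simpa using ⟨hye ▸ c1, hye ▸ hiS⟩) (by
        simp only [setReg_reg, if_true, hyt]
        split_ifs with hb
        · omega
        · exact hb) (X' := Idle (τ.arr 2) (insert i S)) (fun d hd => by
        simp only [setReg_reg, if_true, Idle, Finset.mem_insert, not_or]
        have : ed d = i ↔ d = y ∨ d = tw y := by
          rw [N.ed_eq hd, hyt, hy]; split_ifs <;> omega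
        rw [this]; tauto)
    refine ⟨_, σ, insert i S, .branch_neg (by simpa [h4] using c1) (.branch_pos c2' (.branch_neg c3'
      ((Runs.store _ _ _ _).seq ((Runs.store _ _ _ _).seq (r1.seq r))))), g2, ?_, ?_,
      Or.inr ⟨by simpa [hτ1] using h3, by omega⟩⟩
    · have := s.pick hN hi hr hlt c3
      rw [r.arr_eq 14 rfl]
      simpa [hτ1, h5, h6] using this
    · rw [h3, Finset.card_insert_of_notMem hiS, ← hc]; simp [hτ1]

theorem Sel.card_le {n : ℕ} {A : ℕ → ℕ} {C : ℕ → Prop} {S : Finset ℕ} {x : ℕ → ℕ} {i j : ℕ}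
    (s : Sel N n A C S x i) (h : i ≤ j) : S.card ≤ numRel N A C j := by
  classical
  refine Finset.card_le_card fun k hk => ?_
  have := s.sub k hk
  simp only [Finset.mem_filter, Finset.mem_range]
  exact ⟨by omega, this.2⟩

/-- `selectP` selects the edges in `O(m + K λ)` steps, where `λ` is the number of uncolored edges with
an end in `C`. -/
theorem selectP_spec (hN : N.Good) {n : ℕ} {A : ℕ → ℕ} {C : ℕ → Prop} (τ : Mem) (hm : τ.reg 1 = N.m)
    (h0 : ∀ i < N.m, τ.arr 0 i = N.V (2 * i + 2)) (h1 : ∀ i < N.m, τ.arr 1 i = N.V (2 * i + 3))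
    (hA : τ.arr 2 = A) (hC : C = fun u => τ.arr 3 u ≠ 0)
    (hlt : ∀ d, N.dart d → N.V d < n) (g : Good N (Idle A ∅) C τ) (h3 : τ.reg 3 = 0)
    (h14 : ∀ v, τ.arr 14 v = 0) :
    ∃ t σ S, Runs selectP τ t σ ∧ t ≤ 25 * N.m + (2 * N.K + 65) * numRel N A C N.m + 10 ∧
      Good N (Idle A S) C σ ∧ Sel N n A C S (σ.arr 14) N.m ∧ σ.reg 3 = S.card := by
  obtain ⟨t, σ, r, ht, ⟨hle, e10, e1, ea, S, g', s, hc⟩, hcond⟩ := runs_loop (e := ltE (rg 4) (rg 1))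
    (p := 5 ≔ .get 0 (rg 4) ⨾ 6 ≔ .get 1 (rg 4) ⨾ considerP ⨾ 4 ≔ rg 4 + 1 ⨾ 10 ≔ rg 10 + 2)
    (fun ρ => ρ.reg 4 ≤ N.m ∧ ρ.reg 10 = 2 * ρ.reg 4 + 2 ∧ ρ.reg 1 = N.m ∧
      (ρ.arr 0 = τ.arr 0 ∧ ρ.arr 1 = τ.arr 1 ∧ ρ.arr 2 = τ.arr 2 ∧ ρ.arr 3 = τ.arr 3) ∧
      ∃ S, Good N (Idle A S) C ρ ∧ Sel N n A C S (ρ.arr 14) (ρ.reg 4) ∧ ρ.reg 3 = S.card)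
    (fun ρ => 25 * (N.m - ρ.reg 4) + (2 * N.K + 65) * (numRel N A C N.m - ρ.reg 3))
    (by
      rintro ρ ⟨hle, e10, e1, ⟨a0, a1, a2, a3⟩, S, g, s, hc⟩ hne
      have hi : ρ.reg 4 < N.m := by
        by_contra h
        apply hne
        simp [e1]; omega
      set ρ1 := (ρ.setReg 5 (ρ.arr 0 (ρ.reg 4))).setReg 6 (ρ.arr 1 (ρ.reg 4)) with hρ1
      have b2 : ρ1.arr 2 = A := by rw [← hA, ← a2]; rfl
      have b3 : (fun u => ρ1.arr 3 u ≠ 0) = C := by rw [hC, ← a3]; rfl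
      have g1 : Good N (Idle A S) C ρ1 := g.congr (fun _ _ => Iff.rfl) (fun _ _ => rfl) (by simp [hρ1])
      obtain ⟨t, σ, S', r, g', s', hc', hcase⟩ := considerP_spec hN (n := n) ρ1 (i := ρ.reg 4) (S := S)
        (by simp [hρ1]) hi (by simpa [hρ1] using e10) (by simp [hρ1, a0, h0 _ hi])
        (by simp [hρ1, a1, h1 _ hi]) hlt (by rw [b2, b3]; exact g1) (by rw [b2, b3]; exact s)
        (by simpa [hρ1] using hc)
      rw [b2, b3] at g' s'
      have q4 : σ.reg 4 = ρ.reg 4 := (r.reg_eq 4 rfl).trans (by simp [hρ1])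
      have q10 : σ.reg 10 = ρ.reg 10 := (r.reg_eq 10 rfl).trans (by simp [hρ1])
      have q3 : ρ1.reg 3 = ρ.reg 3 := by simp [hρ1]
      refine ⟨_, _, (Runs.assign _ _ _).seq ((Runs.assign _ _ _).seq (r.seq ((Runs.assign _ _ _).seq
        (.assign _ _ _)))), ⟨?_, ?_, ?_, ⟨?_, ?_, ?_, ?_⟩, S', g'.congr (fun _ _ => Iff.rfl) (fun _ _ => rfl) (by simp),
        ?_, by simpa using hc'⟩, ?_⟩
      · simp [q4]; omega
      · simp [q4, q10, e10]; omega
      · simpa [e1, hρ1] using r.reg_eq 1 rfl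
      · exact (r.arr_eq 0 rfl).trans a0
      · exact (r.arr_eq 1 rfl).trans a1
      · exact (r.arr_eq 2 rfl).trans a2
      · exact (r.arr_eq 3 rfl).trans a3
      · simpa [q4] using s'
      · have := s'.card_le (j := N.m) (by omega)
        rw [q3] at hcase
        have e3 : ∀ (σ : Mem), ((σ.setReg 4 (ρ.reg 4 + 1)).setReg 10 (ρ.reg 10 + 2)).reg 3 = σ.reg 3 := by simp
        simp only [setReg_reg, eval_add, eval_reg, eval_one, if_true, if_false, q4, show (4 : ℕ) ≠ 10 by omega,
          show (3 : ℕ) ≠ 10 by omega, show (3 : ℕ) ≠ 4 by omega]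
        rcases hcase with ⟨u1, u2⟩ | ⟨u1, u2⟩
        · rw [u1]; omega
        · have : numRel N A C N.m - ρ.reg 3 = (numRel N A C N.m - σ.reg 3) + 1 := by omega
          rw [this, Nat.mul_succ]; omega)
    ((τ.setReg 4 0).setReg 10 2) ⟨by simp, by simp, by simpa using hm, ⟨rfl, rfl, rfl, rfl⟩, ∅,
      g.congr (fun _ _ => Iff.rfl) (fun _ _ => rfl) (by simp), ⟨by simp, fun v => by simp [h14 v], by
        simp [h14, numRel], by simp⟩, by simpa using h3⟩
  refine ⟨_, σ, S, (Runs.assign _ _ _).seq ((Runs.assign _ _ _).seq r), ?_, g', ?_, hc⟩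
  · simp [h3] at ht; omega
  · have : σ.reg 4 = N.m := by simp [e1] at hcond; omega
    rw [← this]; exact s

end

/-! ### The whole algorithm -/

section
variable {N : Net}

/-- Preprocessing. -/
def prepP : Prog := buildP ⨾ bumpP ⨾ selectP

/-- Copy the labels to the output. -/
def outP : Prog :=
  4 ≔ 0 ⨾ 10 ≔ 2 ⨾ .loop (ltE (rg 4) (rg 1))
    (.store 2 (rg 4) (hE (rg 10)) ⨾ 4 ≔ rg 4 + 1 ⨾ 10 ≔ rg 10 + 2)

/-- The algorithm. -/
def solveP : Prog := prepP ⨾ mainP ⨾ outP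

theorem lab0_ne_zero {σ : Mem} {d : ℕ} (h : lab0 N σ d ≠ 0) : N.dart d := by
  by_contra hd
  exact h (by simp [lab0, hd])

/-- The initial labeling satisfies the invariant, and has no tokens. -/
theorem Built.inv {n : ℕ} {σ τ : Mem} (inp : Input N n σ) (b : Built N σ τ (2 * N.m + 2)) {Λ : Lay}
    {C : ℕ → Prop} (hH : Λ.H = τ.arr 5) (hT : Λ.T = fun v c => τ.arr 6 (ix v c))
    (hM : ∀ d, N.dart d → Λ.MOk N (N.V d)) :
    Inv N (Idle (σ.arr 2) ∅) C Λ ∧ ∀ d, ¬ Λ.tok N d := by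
  have H : ∀ d, Λ.H d = lab0 N σ d := fun d => by
    rw [hH, b.H]
    split_ifs with h
    · rfl
    · rw [lab0, if_neg]; exact fun hd => h hd.2
  have tw_lab : ∀ d, N.dart d → lab0 N σ (tw d) = lab0 N σ d := fun d hd => by
    simp [lab0, hd, Net.dart_tw hd, tw_ed hd.1]
  have tok : ∀ d, ¬ Λ.tok N d := by
    rintro d ⟨hd, h1, h2⟩
    rw [H] at h1 h2
    rw [tw_lab d hd] at h2
    exact h1 h2
  refine ⟨⟨⟨fun d hd => ?_, fun d hd h => ?_, fun v c h => ?_, fun d hd => ?_, ?_, fun d hd => ?_,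
    fun d hd => (tok d hd).elim⟩, hM⟩, tok⟩
  · rw [H, lab0, if_pos hd]; exact inp.le d hd
  · rw [H] at h
    rw [H, hT]; exact b.T_of d hd.2 h
  · rw [hT] at h ⊢
    have := b.of_T v c h
    exact ⟨this.1, this.2.1, by rw [H]; exact this.2.2.1, this.2.2.2.1⟩
  · rw [H, H, tw_lab d hd]; exact Or.inl rfl
  · rw [H]
    by_contra h
    have := (lab0_ne_zero h).1; omega
  · rw [H, H, tw_lab d hd]
    simp [Idle, lab0, hd]

/-- After the preprocessing, the invariant of the main loop holds. -/
theorem prepP_spec (hN : N.Good) {n : ℕ} {σ : Mem} (inp : Input N n σ) :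
    ∃ t τ S, Runs prepP σ t τ ∧
      t ≤ 145 * N.m + (2 * N.K + 65) * numRel N (σ.arr 2) (fun u => σ.arr 3 u ≠ 0) N.m + 40 ∧
      State N (Idle (σ.arr 2) S) (fun u => σ.arr 3 u ≠ 0) τ ∧
      Sel N n (σ.arr 2) (fun u => σ.arr 3 u ≠ 0) S (τ.arr 14) N.m ∧ τ.reg 3 = S.card := by
  obtain ⟨t1, τ1, r1, ht1, b, hK⟩ := buildP_spec inp hN
  have V1 : τ1.arr 4 = N.V := by
    funext d
    rw [b.V, inp.V]
    by_cases h : N.dart d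
    · simp [h, h.2]
    · simp [h]
  have m1 : τ1.reg 1 = N.m := (r1.reg_eq 1 rfl).trans inp.m
  obtain ⟨t2, τ2, r2, ht2, hM⟩ := bumpP_spec hN τ1 (fun d _ => by rw [V1]) m1
    (fun v c h => ⟨(b.of_T v c h).1, (b.of_T v c h).2.1⟩)
    (fun v c c' e h => by
      have h' : (lay τ1).T v c' ≠ 0 := e ▸ h
      have e' : τ1.arr 6 (ix v c) = τ1.arr 6 (ix v c') := e
      rw [← (b.of_T v c h).2.2.1, e', (b.of_T v c' h').2.2.1])
    (fun d hd => b.M d hd hd.2)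
  obtain ⟨inv, tok⟩ := b.inv inp (Λ := lay τ2) (C := fun u => σ.arr 3 u ≠ 0) (r2.arr_eq 5 rfl)
    (by rw [← r2.arr_eq 6 rfl]; rfl) hM
  have m2 : τ2.reg 1 = N.m := (r2.reg_eq 1 rfl).trans m1
  have z3 : τ2.reg 3 = 0 :=
    (r2.reg_eq 3 rfl).trans ((r1.reg_eq 3 rfl).trans (inp.reg 3 (by omega)))
  have V2 : τ2.arr 4 = N.V := (r2.arr_eq 4 rfl).trans V1
  have st2 : Static N τ2 := by
    refine ⟨V2, (r2.reg_eq 2 rfl).trans hK, ?_, ?_, ?_⟩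
    · rw [r2.arr_eq 8 rfl, r2.arr_eq 9 rfl]
      exact fun v k hk => ⟨(b.mem v k hk).1, (b.mem v k hk).2.1⟩
    · rw [r2.arr_eq 8 rfl, r2.arr_eq 9 rfl]; exact b.inj
    · rw [r2.arr_eq 8 rfl, r2.arr_eq 9 rfl]; exact fun d hd => b.surj d hd hd.2
  have keep : ∀ a, a < 4 → τ2.arr a = σ.arr a := fun a ha => by
    rw [r2.arr_eq a (by interval_cases a <;> rfl), r1.arr_eq a (by interval_cases a <;> rfl)]
  obtain ⟨t3, τ3, S, r3, ht3, g, s, hc⟩ := selectP_spec hN (n := n) (A := σ.arr 2)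
    (C := fun u => σ.arr 3 u ≠ 0) τ2 m2
    (fun i hi => by
      obtain ⟨d1, -, -, -⟩ := N.dart_pair hi
      rw [keep 0 (by omega), inp.V, if_pos d1, if_pos (by omega), (N.ed_eq d1).2 (Or.inl rfl)])
    (fun i hi => by
      obtain ⟨-, d1, -, -⟩ := N.dart_pair hi
      rw [keep 1 (by omega), inp.V, if_pos d1, if_neg (by omega), (N.ed_eq d1).2 (Or.inr rfl)])
    (keep 2 (by omega)) (by rw [keep 3 (by omega)]) inp.lt
    ⟨V2, inv, ⟨fun t ht => by omega, fun d hd => (tok d hd).elim⟩⟩ z3 (fun v => by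
      rw [r2.arr_eq 14 rfl, r1.arr_eq 14 rfl]; exact inp.arr 14 (by omega) v)
  refine ⟨_, τ3, S, r1.seq (r2.seq r3), by omega, ⟨g, ?_, (r3.reg_eq 1 rfl).trans m2⟩, s, hc⟩
  exact st2.of_eq (r3.arr_eq 4 rfl) (r3.arr_eq 8 rfl) (r3.arr_eq 9 rfl) (r3.reg_eq 2 rfl)

/-- At a vertex in `C` at least `d / 2` colors stay missing throughout, because only half of the
uncolored edges there, rounded up, are going to be colored. -/
theorem Sel.live_le (hN : N.Good) {n : ℕ} {A : ℕ → ℕ} {C : ℕ → Prop} {S : Finset ℕ} {x : ℕ → ℕ} {d : ℕ}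
    (s : Sel N n A C S x N.m) {u : ℕ} (hu : C u)
    (hd : d + ((N.dartsAt u).filter fun e => A (ed e) ≠ 0).card ≤ N.K) :
    d + 2 * live N (Idle A S) u ≤ 2 * N.K := by
  classical
  have h1 := s.half u hu
  have h2 := s.bit u
  have h3 := Finset.card_filter_add_card_filter_not (s := N.dartsAt u) (fun e => A (ed e) = 0)
  have h4 := hN.deg_lt u
  have h5 : ((N.dartsAt u).filter fun d => A (ed d) = 0 ∧ ed d < N.m).card ≤
      ((N.dartsAt u).filter fun d => A (ed d) = 0).card := by
    gcongr with d
    exact fun h => h.1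
  have h6 : live N (Idle A S) u ≤ ((N.dartsAt u).filter fun d => A (ed d) ≠ 0).card +
      ((N.dartsAt u).filter fun d => ed d ∈ S).card := by
    unfold live
    refine (Finset.card_le_card fun e he => ?_).trans (Finset.card_union_le _ _)
    obtain ⟨h1, h2⟩ := Finset.mem_filter.1 he
    simp only [Finset.mem_filter, Finset.mem_union]
    unfold Idle at h2
    tauto
  simp only [ne_eq] at *
  omega

/-- Array `2` of the memory `τ` contains a proper partial coloring that extends the coloring `A`, and
colors at least one third of the uncolored edges that have an end in `C`. -/
structure Solved (N : Net) (A : ℕ → ℕ) (C : ℕ → Prop) (τ : Mem) : Prop where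
  le : ∀ i < N.m, τ.arr 2 i ≤ N.K
  proper : ∀ d e, N.dart d → N.dart e → N.V d = N.V e → τ.arr 2 (ed d) = τ.arr 2 (ed e) →
    τ.arr 2 (ed d) ≠ 0 → d = e
  extend : ∀ i < N.m, A i ≠ 0 → τ.arr 2 i ≠ 0
  many : ∃ S : Finset ℕ, (∀ i ∈ S, i < N.m ∧ Rel N A C i ∧ τ.arr 2 i ≠ 0) ∧
    numRel N A C N.m ≤ 3 * S.card

/-- Without tokens, both halves of every edge have the same label. -/
theorem outP_spec {n : ℕ} {A : ℕ → ℕ} {C : ℕ → Prop} {S : Finset ℕ} {x : ℕ → ℕ}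
    (s : Sel N n A C S x N.m) {σ : Mem} (st : State N (Idle A S) C σ) (h3 : σ.reg 3 = 0) :
    ∃ t τ, Runs outP σ t τ ∧ t ≤ 8 * N.m + 10 ∧ Solved N A C τ := by
  obtain ⟨t, τ, r, ht, ⟨hle, e10, e1, e5, hout⟩, hcond⟩ := runs_loop (e := ltE (rg 4) (rg 1))
    (p := .store 2 (rg 4) (hE (rg 10)) ⨾ 4 ≔ rg 4 + 1 ⨾ 10 ≔ rg 10 + 2)
    (fun ρ => ρ.reg 4 ≤ N.m ∧ ρ.reg 10 = 2 * ρ.reg 4 + 2 ∧ ρ.reg 1 = N.m ∧ ρ.arr 5 = σ.arr 5 ∧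
      ∀ i < ρ.reg 4, ρ.arr 2 i = σ.arr 5 (2 * i + 2))
    (fun ρ => 6 * (N.m - ρ.reg 4))
    (by
      rintro ρ ⟨hle, e10, e1, e5, hout⟩ hne
      have hi : ρ.reg 4 < N.m := by
        by_contra h
        apply hne
        simp [e1]; omega
      refine ⟨_, _, (Runs.store _ _ _ _).seq ((Runs.assign _ _ _).seq (.assign _ _ _)),
        ⟨by simp; omega, by simp [e10]; omega, by simp [e1], by simp [e5], fun i hi => ?_⟩, by simp; omega⟩
      simp at hi
      by_cases e : i = ρ.reg 4
      · subst e; simp [e10, e5]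
      · simp [e]; exact hout i (by omega))
    ((σ.setReg 4 0).setReg 10 2) ⟨by simp, by simp, by simpa using st.m, rfl, by simp⟩
  have e4 : τ.reg 4 = N.m := by simp [e1] at hcond; omega
  rw [e4] at hout
  -- there are no tokens left
  have tok : ∀ d, N.dart d → σ.arr 5 (tw d) = σ.arr 5 d := by
    intro d hd
    have key : ∀ e, ¬ (lay σ).tok N e := fun e he => by
      have := (st.list.pos e he).1; omega
    have k1 := key d
    have k2 := key (tw d)
    have := st.inv.edge d hd
    simp only [Lay.tok, hd, Net.dart_tw hd, hd.tw_tw, true_and, lay] at k1 k2 this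
    omega
  have val : ∀ d, N.dart d → τ.arr 2 (ed d) = σ.arr 5 d := by
    intro d hd
    have hi : ed d < N.m := by unfold ed Net.dart at *; omega
    rw [hout _ hi]
    rcases (N.ed_eq hd).1 rfl with e | e
    · rw [← e]
    · have : 2 * ed d + 2 = tw d := by
        have := (N.dart_pair hi).2.2.2
        rw [← e] at this; exact this.symm
      rw [this, tok d hd]
  have nz : ∀ i < N.m, ¬ (A i = 0 ∧ i ∉ S) → τ.arr 2 i ≠ 0 := by
    intro i hi h h0
    obtain ⟨d1, -, -, -⟩ := N.dart_pair hi
    have e := (N.ed_eq d1).2 (Or.inl rfl)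
    have v := val _ d1
    rw [e, h0] at v
    have := (st.inv.inert _ d1).1 ⟨v.symm, (tok _ d1).trans v.symm⟩
    rw [Idle, e] at this
    exact h this
  refine ⟨_, τ, (Runs.assign _ _ _).seq ((Runs.assign _ _ _).seq r), ?_, fun i hi => ?_,
    fun d e hd he hV h h0 => ?_, fun i hi h => nz i hi (fun h' => h h'.1), S, fun i hi => ?_, ?_⟩
  · simp at ht; omega
  · rw [hout i hi]; exact st.inv.le _ (N.dart_pair hi).1
  · rw [val d hd] at h h0
    rw [val e he] at h
    exact st.inv.inj hd he h0 hV h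
  · obtain ⟨a, b⟩ := s.sub i hi
    exact ⟨a, b, nz i a fun h => h.2 hi⟩
  · have := s.count; omega

/-- At every vertex in `C` at least `d` colors are missing. -/
def Roomy (N : Net) (A : ℕ → ℕ) (C : ℕ → Prop) (d : ℕ) : Prop :=
  ∀ u, C u → d + ((N.dartsAt u).filter fun e => A (ed e) ≠ 0).card ≤ N.K

/-- The algorithm always outputs a correct coloring. -/
theorem solveP_ensures (hN : N.Good) {n d : ℕ} {σ : Mem} (inp : Input N n σ) (hd : 1 ≤ d)
    (hr : Roomy N (σ.arr 2) (fun u => σ.arr 3 u ≠ 0) d) :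
    Ensures ([solveP], σ) (Solved N (σ.arr 2) (fun u => σ.arr 3 u ≠ 0)) := by
  obtain ⟨t, τ, S, r, -, st, s, hc⟩ := prepP_spec hN inp
  refine .of_pure (c := ([prepP, mainP ⨾ outP], σ)) rfl (r.ensures ?_)
  refine .of_pure (c := ([mainP, outP], τ)) rfl ?_
  refine mainP_ensures hN (fun u hu => ?_) (fun ρ st' h3 => ?_) _ τ rfl st
  · have := s.live_le hN hu (hr u hu); omega
  · obtain ⟨t', τ', r', -, hs⟩ := outP_spec s st' h3
    exact r'.ensures (.halted hs)

theorem mainCost_mono_left (N : Net) (d φ : ℕ) {U U' : ℕ} (h : U ≤ U') :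
    mainCost N d U φ ≤ mainCost N d U' φ := by
  unfold mainCost
  gcongr

/-- The expected cost of the first `k` steps, if no number in memory ever exceeds `B`. -/
theorem solveP_cost (hN : N.Good) {n d : ℕ} {σ : Mem} (inp : Input N n σ) (hd : 1 ≤ d)
    (hr : Roomy N (σ.arr 2) (fun u => σ.arr 3 u ≠ 0) d) {a b B : ℕ} (hb : 4 ≤ b) (hσ : σ.Bdd b)
    (ha : a = numRel N (σ.arr 2) (fun u => σ.arr 3 u ≠ 0) N.m)
    (hB : b + 2 * (153 * N.m + 65 * (N.K + 1) * a + 52) + 2 * iterSteps N * (8 * a) ≤ B) (k : ℕ) :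
    expectedCost k ([solveP], σ) ≤
      ((solveP.weight * (1 + B.size) ^ 2 * (153 * N.m + 65 * (N.K + 1) * a + 52) : ℕ) : ENNReal) +
        mainCost N d (solveP.weight * (1 + B.size) ^ 2) (8 * a) := by
  obtain ⟨t, τ, S, r, ht, st, s, hc⟩ := prepP_spec hN inp
  rw [← ha] at ht
  set U := solveP.weight * (1 + B.size) ^ 2 with hU
  have hw : prepP.weight ≤ solveP.weight ∧ mainP.weight ≤ solveP.weight ∧ outP.weight ≤ solveP.weight ∧
      1 ≤ solveP.weight := by
    simp only [solveP, Prog.weight]; omega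
  have sq : 1 ≤ (1 + B.size) ^ 2 := Nat.one_le_pow _ _ (by omega)
  have U1 : 1 ≤ U := by rw [hU]; nlinarith
  have hta : t + 8 * N.m + 12 ≤ 153 * N.m + 65 * (N.K + 1) * a + 52 := by
    have : (2 * N.K + 65) * a ≤ 65 * (N.K + 1) * a := Nat.mul_le_mul_right _ (by omega)
    omega
  have hpot : pot N τ ≤ 8 * a := by
    have h1 := st.pot_le
    have h2 := s.card_le le_rfl
    omega
  have hiter : 2 * iterSteps N * pot N τ ≤ 2 * iterSteps N * (8 * a) := Nat.mul_le_mul_left _ hpot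
  have hτ : τ.Bdd (b + 2 * t) := r.bdd rfl hb hσ
  have s0 := expectedCost_le_of_pure (c := ([solveP], σ)) (c' := ([prepP, mainP ⨾ outP], σ)) rfl (u := U) U1 k
  have s1 := r.expectedCost_le (B := B) rfl hb hσ (by omega) hw.1 k [mainP ⨾ outP]
  have s2 := expectedCost_le_of_pure (c := ([mainP ⨾ outP], τ)) (c' := ([mainP, outP], τ)) rfl (u := U) U1 k
  have s3 := mainP_cost hN hd (fun u hu => s.live_le hN hu (hr u hu)) hw.2.1 (k := [outP])
    (R := (((8 * N.m + 10) * U : ℕ) : ENNReal)) (B := b + 2 * t + 2 * iterSteps N * pot N τ)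
    (fun k ρ st' h3 hρ => by
      obtain ⟨t', τ', r', ht', -⟩ := outP_spec s st' h3
      refine (r'.expectedCost_le (B := B) rfl (by omega) hρ (by omega) hw.2.2.1 k []).trans ?_
      rw [expectedCost_halted, add_zero]
      gcongr) (pot N τ) k (b + 2 * t) τ rfl st (by omega) hτ le_rfl
  calc _ ≤ _ := s0
    _ ≤ U + (((t * U : ℕ) : ENNReal) + (U + (mainCost N d U (8 * a) + (((8 * N.m + 10) * U : ℕ) : ENNReal)))) := by
      gcongr
      refine s1.trans ?_
      gcongr
      refine s2.trans ?_
      gcongr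
      refine s3.trans ?_
      gcongr
      refine (mainCost_mono_left N d _ ?_).trans (mainCost_mono N d U hpot)
      rw [hU]
      gcongr
      exact Nat.size_le_size (by omega)
    _ = ((U * (t + 8 * N.m + 12) : ℕ) : ENNReal) + mainCost N d U (8 * a) := by push_cast; ring
    _ ≤ _ := by gcongr

end

/-! ### Graphs as nets -/

section
variable {n : ℕ} {G : SimpleGraph (Fin n)} [DecidableRel G.Adj] (L : EdgeList G)

/-- The end vertices of the edges, as vertices of the graph. -/
def netV (d : ℕ) : ℕ :=
  if h : 2 ≤ d ∧ ed d < G.edgeFinset.card then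
    (if d % 2 = 0 then ((L.dart ⟨ed d, h.2⟩).fst : ℕ) else ((L.dart ⟨ed d, h.2⟩).snd : ℕ)) else 0

/-- The net of a graph that is given by a list of its edges. -/
def netOf : Net := ⟨G.edgeFinset.card, G.maxDegree + 1, netV L⟩

theorem netOf_V (i : Fin G.edgeFinset.card) : (netOf L).V (2 * i + 2) = (L.dart i).fst ∧
    (netOf L).V (2 * i + 3) = (L.dart i).snd := by
  have e1 : ed (2 * i + 2) = i := by unfold ed; omega
  have e2 : ed (2 * i + 3) = i := by unfold ed; omega
  have := i.2
  constructor <;> simp [netOf, netV, e1, e2, this, Nat.add_mod]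

theorem netOf_dart {d : ℕ} (hd : (netOf L).dart d) : ∃ i : Fin G.edgeFinset.card, ed d = i ∧
    (d = 2 * i + 2 ∧ tw d = 2 * i + 3 ∨ d = 2 * i + 3 ∧ tw d = 2 * i + 2) := by
  have h1 := hd.1
  have h2 : d < 2 * G.edgeFinset.card + 2 := hd.2
  refine ⟨⟨ed d, by unfold ed; omega⟩, rfl, ?_⟩
  simp only [ed, tw]; omega

theorem EdgeList.edge_inj {i j : Fin G.edgeFinset.card} (h : (L.dart i).edge = (L.dart j).edge) : i = j :=
  L.bijective.1 (Subtype.ext h)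

theorem mem_edge (i : Fin G.edgeFinset.card) (v : Fin n) :
    v ∈ (L.edge i).1 ↔ v = (L.dart i).fst ∨ v = (L.dart i).snd := by
  have : (L.edge i).1 = s((L.dart i).fst, (L.dart i).snd) := rfl
  rw [this, Sym2.mem_iff]

/-- Every dart at `v` belongs to an edge with the end `v`. -/
theorem mem_edge_of_dart {d : ℕ} (hd : (netOf L).dart d) :
    ∃ (i : Fin G.edgeFinset.card) (v : Fin n), ed d = i ∧ (netOf L).V d = v ∧ v ∈ (L.edge i).1 := by
  obtain ⟨i, hi, h⟩ := netOf_dart L hd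
  obtain ⟨v1, v2⟩ := netOf_V L i
  rcases h with ⟨rfl, -⟩ | ⟨rfl, -⟩
  · exact ⟨i, _, hi, v1, (mem_edge L i _).2 (Or.inl rfl)⟩
  · exact ⟨i, _, hi, v2, (mem_edge L i _).2 (Or.inr rfl)⟩

theorem exists_dart {i : Fin G.edgeFinset.card} {v : Fin n} (h : v ∈ (L.edge i).1) :
    ∃ d, (netOf L).dart d ∧ ed d = i ∧ (netOf L).V d = v := by
  obtain ⟨v1, v2⟩ := netOf_V L i
  obtain ⟨d1, d2, -, -⟩ := (netOf L).dart_pair i.2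
  rcases (mem_edge L i v).1 h with rfl | rfl
  · exact ⟨_, d1, ((netOf L).ed_eq d1).2 (Or.inl rfl), v1⟩
  · exact ⟨_, d2, ((netOf L).ed_eq d2).2 (Or.inr rfl), v2⟩

theorem netOf_ne {d : ℕ} (hd : (netOf L).dart d) : (netOf L).V d ≠ (netOf L).V (tw d) := by
  obtain ⟨i, -, h⟩ := netOf_dart L hd
  obtain ⟨v1, v2⟩ := netOf_V L i
  have hne := (L.dart i).adj.ne
  rcases h with ⟨e1, e2⟩ | ⟨e1, e2⟩ <;> rw [e2, e1, v1, v2]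
  · exact fun h => hne (Fin.ext h)
  · exact fun h => hne (Fin.ext h.symm)

theorem ed_eq_iff {d e : ℕ} (hd : (netOf L).dart d) (he : (netOf L).dart e) (h : ed d = ed e) :
    d = e ∨ e = tw d := by
  obtain ⟨i, hi, h1⟩ := netOf_dart L hd
  obtain ⟨j, hj, h2⟩ := netOf_dart L he
  omega

theorem netOf_simple {d e : ℕ} (hd : (netOf L).dart d) (he : (netOf L).dart e)
    (h1 : (netOf L).V d = (netOf L).V e) (h2 : (netOf L).V (tw d) = (netOf L).V (tw e)) : d = e := by
  obtain ⟨i, hi, hdi⟩ := netOf_dart L hd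
  obtain ⟨j, hj, hej⟩ := netOf_dart L he
  obtain ⟨v1, v2⟩ := netOf_V L i
  obtain ⟨w1, w2⟩ := netOf_V L j
  have key : (L.dart i).edge = (L.dart j).edge := by
    show s((L.dart i).fst, (L.dart i).snd) = s((L.dart j).fst, (L.dart j).snd)
    rw [Sym2.eq_iff]
    rcases hdi with ⟨a, b⟩ | ⟨a, b⟩ <;> rcases hej with ⟨a', b'⟩ | ⟨a', b'⟩ <;>
      rw [a, a'] at h1 <;> rw [b, b'] at h2 <;> simp only [v1, v2, w1, w2] at h1 h2
    · exact Or.inl ⟨Fin.ext h1, Fin.ext h2⟩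
    · exact Or.inr ⟨Fin.ext h1, Fin.ext h2⟩
    · exact Or.inr ⟨Fin.ext h2, Fin.ext h1⟩
    · exact Or.inl ⟨Fin.ext h2, Fin.ext h1⟩
  obtain rfl := EdgeList.edge_inj L key
  rcases ed_eq_iff L hd he (hi.trans hj.symm) with h | h
  · exact h
  · rw [h] at h1
    exact (netOf_ne L hd h1).elim

/-- The darts at `v` correspond to the neighbors of `v`. -/
theorem netOf_card (v : Fin n) : ((netOf L).dartsAt v).card ≤ G.degree v ∧
    G.degree v ≤ ((netOf L).dartsAt v).card := by
  classical
  rw [← G.card_neighborFinset_eq_degree]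
  constructor
  · have key : ∀ d ∈ (netOf L).dartsAt v, ∃ w : Fin n, (netOf L).V (tw d) = w ∧ G.Adj v w := by
      intro d hd
      obtain ⟨hd, hv⟩ := Net.mem_dartsAt.1 hd
      obtain ⟨i, -, h⟩ := netOf_dart L hd
      obtain ⟨v1, v2⟩ := netOf_V L i
      rcases h with ⟨a, b⟩ | ⟨a, b⟩
      · rw [a, v1] at hv
        rw [b, v2]
        exact ⟨_, rfl, by rw [← Fin.ext hv]; exact (L.dart i).adj⟩
      · rw [a, v2] at hv
        rw [b, v1]
        exact ⟨_, rfl, by rw [← Fin.ext hv]; exact (L.dart i).adj.symm⟩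
    refine (Finset.card_le_card_of_injOn (t := (G.neighborFinset v).image fun w : Fin n => (w : ℕ))
      (fun d => (netOf L).V (tw d)) (fun d hd => ?_) fun d hd e he h => ?_).trans Finset.card_image_le
    · obtain ⟨w, h1, h2⟩ := key d hd
      simp only [Finset.coe_image, Set.mem_image, Finset.mem_coe, SimpleGraph.mem_neighborFinset]
      exact ⟨w, h2, h1.symm⟩
    · have hd := Net.mem_dartsAt.1 hd
      have he := Net.mem_dartsAt.1 he
      exact netOf_simple L hd.1 he.1 (hd.2.trans he.2.symm) h
  · refine Finset.card_le_card_of_surjOn (t := G.neighborFinset v) (fun d =>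
      if h : (netOf L).V (tw d) < n then (⟨_, h⟩ : Fin n) else v) fun w hw => ?_
    rw [Finset.mem_coe, SimpleGraph.mem_neighborFinset] at hw
    obtain ⟨i, hi⟩ := L.bijective.2 ⟨s(v, w), hw⟩
    have hi : s((L.dart i).fst, (L.dart i).snd) = s(v, w) := congrArg Subtype.val hi
    obtain ⟨d1, d2, t1, t2⟩ := (netOf L).dart_pair i.2
    obtain ⟨v1, v2⟩ := netOf_V L i
    rcases Sym2.eq_iff.1 hi with ⟨a, b⟩ | ⟨a, b⟩
    · refine ⟨2 * i + 2, ?_, ?_⟩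
      · simp [d1, v1, a]
      · simp [t1, v2, b]
    · refine ⟨2 * i + 3, ?_, ?_⟩
      · simp [d2, v2, b]
      · simp [t2, v1, a]

theorem netOf_lt {d : ℕ} (hd : (netOf L).dart d) : (netOf L).V d < n := by
  obtain ⟨i, v, -, h, -⟩ := mem_edge_of_dart L hd
  omega

theorem netOf_empty {v : ℕ} (hv : n ≤ v) : ((netOf L).dartsAt v).card = 0 := by
  rw [Finset.card_eq_zero, Finset.eq_empty_iff_forall_notMem]
  intro d hd
  obtain ⟨hd, h⟩ := Net.mem_dartsAt.1 hd
  have := netOf_lt L hd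
  omega

theorem netOf_good : (netOf L).Good where
  ne d hd := netOf_ne L hd
  simple d e hd he := netOf_simple L hd he
  deg_lt v := by
    have hK : (netOf L).K = G.maxDegree + 1 := rfl
    by_cases hv : v < n
    · have h1 := (netOf_card L ⟨v, hv⟩).1
      have h2 := G.degree_le_maxDegree ⟨v, hv⟩
      dsimp only at h1
      omega
    · rw [netOf_empty L (by omega)]; omega

theorem netOf_max : ∃ v, ((netOf L).dartsAt v).card + 1 = (netOf L).K := by
  have hK : (netOf L).K = G.maxDegree + 1 := rfl
  rcases isEmpty_or_nonempty (Fin n) with h | h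
  · refine ⟨n, ?_⟩
    rw [netOf_empty L le_rfl, hK, G.maxDegree_of_subsingleton]
  · obtain ⟨v, hv⟩ := G.exists_maximal_degree_vertex
    have := netOf_card L v
    exact ⟨v, by omega⟩

end

theorem colorCode_inj {k : ℕ} {a b : Option (Fin k)} (h : colorCode a = colorCode b) : a = b := by
  cases a <;> cases b <;> simp [colorCode] at h ⊢
  exact Fin.ext h

theorem colorCode_eq_zero {k : ℕ} {a : Option (Fin k)} : colorCode a = 0 ↔ a = none := by
  cases a <;> simp [colorCode]

theorem colorCode_le {k : ℕ} (a : Option (Fin k)) : colorCode a ≤ k := by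
  cases a with
  | none => simp [colorCode]
  | some c => exact c.2

/-- The color for a number. -/
def decode (k x : ℕ) : Option (Fin k) :=
  if h : x ≠ 0 ∧ x ≤ k then some ⟨x - 1, by omega⟩ else none

theorem colorCode_decode {k x : ℕ} (h : x ≤ k) : colorCode (decode k x) = x := by
  unfold decode
  split_ifs with h'
  · simp only [colorCode]; omega
  · simp only [colorCode]; omega

section
variable {n : ℕ} {G : SimpleGraph (Fin n)} [DecidableRel G.Adj] (L : EdgeList G)
  (χ : PartialEdgeColoring G (G.maxDegree + 1)) (U : Set (Fin n))

theorem inputMem_color (i : Fin G.edgeFinset.card) :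
    (inputMem L χ U).arr 2 i = colorCode (χ.color (L.edge i)) := by
  simp [inputMem]

theorem inputMem_mem (v : ℕ) : (inputMem L χ U).arr 3 v ≠ 0 ↔ ∃ u : Fin n, u ∈ U ∧ v = u := by
  simp only [inputMem]
  by_cases h : v < n
  · simp only [h]
    constructor
    · intro h'
      exact ⟨⟨v, h⟩, by simpa using h', rfl⟩
    · rintro ⟨u, hu, rfl⟩
      simpa using hu
  · simp only [h]
    simp
    intro u _ e
    exact h (e ▸ u.2)

theorem inputMem_input : Input (netOf L) n (inputMem L χ U) where
  m := by simp [inputMem, netOf]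
  reg x hx := by
    simp only [inputMem]
    rw [if_neg (by omega), if_neg (by omega)]
  arr a ha i := by
    simp only [inputMem]
    rw [if_neg (by omega), if_neg (by omega), if_neg (by omega), if_neg (by omega)]
  V d := by
    have hm : (netOf L).m = G.edgeFinset.card := rfl
    split_ifs with h1 h2
    · obtain ⟨i, hi, h⟩ := netOf_dart L h1
      have e : d = 2 * i + 2 := by omega
      rw [hi, e, (netOf_V L i).1]
      simp [inputMem]
    · obtain ⟨i, hi, h⟩ := netOf_dart L h1
      have e : d = 2 * i + 3 := by omega
      rw [hi, e, (netOf_V L i).2]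
      simp [inputMem]
    · show netV L d = 0
      unfold netV
      rw [dif_neg]
      rintro ⟨a, b⟩
      refine h1 ⟨a, ?_⟩
      unfold ed at b
      omega
  lt d hd := netOf_lt L hd
  le d hd := by
    obtain ⟨i, hi, -⟩ := netOf_dart L hd
    rw [hi, inputMem_color]
    exact colorCode_le _
  proper d e hd he hV h h0 := by
    obtain ⟨i, v, hi, hv, mi⟩ := mem_edge_of_dart L hd
    obtain ⟨j, w, hj, hw, mj⟩ := mem_edge_of_dart L he
    rw [hv, hw] at hV
    obtain rfl := Fin.ext hV
    rw [hi, inputMem_color] at h h0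
    rw [hj, inputMem_color] at h
    by_cases hij : i = j
    · subst hij
      rcases ed_eq_iff L hd he (hi.trans hj.symm) with h | h
      · exact h
      · rw [h] at hw
        exact (netOf_ne L hd (hv.trans hw.symm)).elim
    · exact (χ.proper (L.edge i) (L.edge j) (fun e => hij (L.bijective.1 e)) ⟨v, mi, mj⟩
        (fun e => h0 (colorCode_eq_zero.2 e)) (colorCode_inj h)).elim
  max := netOf_max L

/-- The colors used at `u` are counted by the colored darts at `u`. -/
theorem roomy {d : ℕ} (hmiss : ∀ u ∈ U, d ≤ (χ.miss u).ncard) :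
    Roomy (netOf L) ((inputMem L χ U).arr 2) (fun u => (inputMem L χ U).arr 3 u ≠ 0) d := by
  classical
  intro u hu
  obtain ⟨u, hu', rfl⟩ := (inputMem_mem L χ U u).1 hu
  have inp := inputMem_input L χ U
  set A := (inputMem L χ U).arr 2 with hA
  set T := ((netOf L).dartsAt u).filter fun e => A (ed e) ≠ 0 with hT
  have h1 : T.card = (T.image fun e => A (ed e)).card := by
    rw [Finset.card_image_of_injOn]
    intro d hd e he h
    simp only [hT, Finset.coe_filter, Net.mem_dartsAt, Set.mem_ofPred_eq] at hd he
    exact inp.proper d e hd.1.1 he.1.1 (hd.1.2.trans he.1.2.symm) h hd.2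
  set M := (Finset.univ.filter fun c => c ∈ χ.miss u).image fun c : Fin (G.maxDegree + 1) => (c : ℕ) + 1 with hM
  have h2 : (χ.miss u).ncard = M.card := by
    rw [hM, Finset.card_image_of_injective _ (fun a b h => Fin.ext (by simpa using h)),
      ← Set.ncard_coe_finset]
    congr 1
    ext c; simp
  have h3 : Disjoint M (T.image fun e => A (ed e)) := by
    rw [Finset.disjoint_left]
    intro x hx hx'
    simp only [hM, Finset.mem_image, Finset.mem_filter, Finset.mem_univ, true_and] at hx
    simp only [Finset.mem_image, hT, Finset.mem_filter, Net.mem_dartsAt] at hx'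
    obtain ⟨c, hc, rfl⟩ := hx
    obtain ⟨e, ⟨⟨he, hv⟩, -⟩, h⟩ := hx'
    obtain ⟨i, v, hi, hv', mi⟩ := mem_edge_of_dart L he
    rw [hv'] at hv
    obtain rfl := Fin.ext hv
    rw [hi, hA, inputMem_color] at h
    exact hc (L.edge i) mi (colorCode_inj (h.trans rfl))
  have h4 : M ∪ (T.image fun e => A (ed e)) ⊆ Finset.Icc 1 (netOf L).K := by
    intro x hx
    rw [Finset.mem_Icc]
    rcases Finset.mem_union.1 hx with hx | hx
    · simp only [hM, Finset.mem_image] at hx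
      obtain ⟨c, -, rfl⟩ := hx
      have := c.2
      have hK : (netOf L).K = G.maxDegree + 1 := rfl
      omega
    · simp only [Finset.mem_image, hT, Finset.mem_filter, Net.mem_dartsAt] at hx
      obtain ⟨e, ⟨⟨he, -⟩, h0⟩, rfl⟩ := hx
      exact ⟨by omega, inp.le e he⟩
  have h5 := Finset.card_le_card h4
  rw [Finset.card_union_of_disjoint h3, Nat.card_Icc] at h5
  have := hmiss u hu'
  omega

theorem rel_iff (i : Fin G.edgeFinset.card) :
    Rel (netOf L) ((inputMem L χ U).arr 2) (fun u => (inputMem L χ U).arr 3 u ≠ 0) i ↔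
      L.edge i ∈ χ.uncoloredAt U := by
  obtain ⟨v1, v2⟩ := netOf_V L i
  unfold Rel
  beta_reduce
  rw [inputMem_color, colorCode_eq_zero, inputMem_mem, inputMem_mem, v1, v2]
  unfold PartialEdgeColoring.uncoloredAt
  simp only [Set.mem_ofPred_eq]
  refine and_congr_right fun _ => ?_
  constructor
  · rintro (⟨u, hu, e⟩ | ⟨u, hu, e⟩)
    · exact ⟨u, hu, (mem_edge L i u).2 (Or.inl (Fin.ext e.symm))⟩
    · exact ⟨u, hu, (mem_edge L i u).2 (Or.inr (Fin.ext e.symm))⟩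
  · rintro ⟨u, hu, h⟩
    rcases (mem_edge L i u).1 h with h | h
    · exact Or.inl ⟨u, hu, by rw [h]⟩
    · exact Or.inr ⟨u, hu, by rw [h]⟩

theorem numRel_eq : numRel (netOf L) ((inputMem L χ U).arr 2) (fun u => (inputMem L χ U).arr 3 u ≠ 0)
    (netOf L).m = (χ.uncoloredAt U).ncard := by
  classical
  have hm : (netOf L).m = G.edgeFinset.card := rfl
  unfold numRel
  rw [← Set.ncard_coe_finset]
  have mem : ∀ j, j ∈ ((Finset.range (netOf L).m).filter (Rel (netOf L) ((inputMem L χ U).arr 2)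
    (fun u => (inputMem L χ U).arr 3 u ≠ 0)) : Set ℕ) → ∃ h : j < G.edgeFinset.card,
      L.edge ⟨j, h⟩ ∈ χ.uncoloredAt U := by
    intro j hj
    simp only [Finset.coe_filter, Finset.mem_range, Set.mem_ofPred_eq] at hj
    exact ⟨hj.1, (rel_iff L χ U ⟨j, hj.1⟩).1 hj.2⟩
  refine Set.ncard_congr (fun j hj => L.edge ⟨j, (mem j hj).1⟩) (fun j hj => (mem j hj).2)
    (fun i j hi hj h => ?_) fun e he => ?_
  · simpa using L.bijective.1 h
  · obtain ⟨i, rfl⟩ := L.bijective.2 e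
    refine ⟨i, ?_, rfl⟩
    simp only [Finset.coe_filter, Finset.mem_range, Set.mem_ofPred_eq]
    exact ⟨i.2, (rel_iff L χ U i).2 he⟩

/-- The output as a coloring of the graph. -/
theorem Solved.coloring {τ : Mem} (s : Solved (netOf L) ((inputMem L χ U).arr 2)
    (fun u => (inputMem L χ U).arr 3 u ≠ 0) τ) :
    ∃ χ' : PartialEdgeColoring G (G.maxDegree + 1), HoldsColoring L τ χ' ∧ χ.ExtendedBy χ' ∧
      (χ.uncoloredAt U).ncard ≤ 3 * ({e ∈ χ.uncoloredAt U | χ'.color e ≠ none}).ncard := by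
  classical
  choose idx hidx using L.bijective.2
  have hidx' : ∀ e, L.edge (idx e) = e := hidx
  have idx_edge : ∀ i, idx (L.edge i) = i := fun i => L.bijective.1 (hidx (L.edge i))
  have code : ∀ i : Fin G.edgeFinset.card, colorCode (decode (G.maxDegree + 1) (τ.arr 2 i)) = τ.arr 2 i :=
    fun i => colorCode_decode (s.le i i.2)
  refine ⟨⟨fun e => decode _ (τ.arr 2 (idx e)), fun e f hne ⟨v, hv, hv'⟩ h0 h => ?_⟩, fun i => ?_,
    fun e he => ?_, ?_⟩
  · rw [← hidx' e] at hv
    rw [← hidx' f] at hv'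
    obtain ⟨d, hd, ed1, hdv⟩ := exists_dart L hv
    obtain ⟨d', hd', ed2, hdv'⟩ := exists_dart L hv'
    have h1 := congrArg colorCode h
    rw [code, code] at h1
    have h2 : τ.arr 2 (idx e) ≠ 0 := fun h => h0 (colorCode_eq_zero.1 ((code _).trans h))
    have := s.proper d d' hd hd' (hdv.trans hdv'.symm) (by rw [ed1, ed2]; exact h1) (by rw [ed1]; exact h2)
    rw [this, ed2] at ed1
    apply hne
    rw [← hidx' e, ← hidx' f, Fin.ext ed1]
  · show _ = colorCode (decode _ (τ.arr 2 (idx (L.edge i))))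
    rw [code, idx_edge]
  · have := s.extend (idx e) (idx e).2 (by
      rw [inputMem_color, hidx']; exact fun h => he (colorCode_eq_zero.1 h))
    intro h
    have h' : decode (G.maxDegree + 1) (τ.arr 2 (idx e)) = none := h
    rw [← colorCode_eq_zero, code] at h'
    exact this h'
  · obtain ⟨S, hS, h⟩ := s.many
    rw [numRel_eq] at h
    refine h.trans ?_
    gcongr
    rw [← Set.ncard_coe_finset]
    have lt : ∀ i ∈ S, i < G.edgeFinset.card := fun i hi => (hS i hi).1
    rw [Set.ncard_congr (s := (S : Set ℕ)) (t := {e | ∃ i, ∃ h : i ∈ S, L.edge ⟨i, lt i h⟩ = e})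
      (fun i hi => L.edge ⟨i, lt i hi⟩) (fun i hi => ⟨i, hi, rfl⟩)
      (fun i j hi hj h => by simpa using L.bijective.1 h) (fun e ⟨i, hi, h⟩ => ⟨i, hi, h⟩)]
    refine Set.ncard_le_ncard ?_ (Set.toFinite _)
    rintro e ⟨i, hi, rfl⟩
    obtain ⟨h1, h2, h3⟩ := hS i hi
    refine ⟨(rel_iff L χ U ⟨i, h1⟩).1 h2, fun h => h3 ?_⟩
    have h' : decode (G.maxDegree + 1) (τ.arr 2 (idx (L.edge ⟨i, h1⟩))) = none := h
    rw [idx_edge] at h'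
    rw [← code ⟨i, h1⟩, h']; rfl

end

/-! ### The time bound -/

theorem half_le_log {n : ℕ} : 1 / 2 ≤ Real.log ((n : ℝ) + 2) := by
  have h1 := Real.log_two_gt_d9
  have h2 : Real.log 2 ≤ Real.log ((n : ℝ) + 2) :=
    Real.log_le_log (by norm_num) (by have := n.cast_nonneg (α := ℝ); linarith)
  linarith

theorem size_le_log (n : ℕ) : (((n + 2).size : ℕ) : ℝ) ≤ 4 * Real.log ((n : ℝ) + 2) := by
  have h1 := Real.log_two_gt_d9
  have hl := half_le_log (n := n)
  obtain ⟨k, hk⟩ : ∃ k, (n + 2).size = k + 1 :=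
    ⟨(n + 2).size - 1, by have : 0 < (n + 2).size := Nat.size_pos.2 (by omega); omega⟩
  have h2 : 2 ^ k ≤ n + 2 := Nat.lt_size.1 (by omega)
  have h3 : (k : ℝ) * Real.log 2 ≤ Real.log ((n : ℝ) + 2) := by
    rw [← Real.log_pow]
    exact Real.log_le_log (by positivity) (by exact_mod_cast h2)
  rw [hk]
  push_cast
  have : (k : ℝ) * (2 / 3) ≤ Real.log ((n : ℝ) + 2) :=
    (mul_le_mul_of_nonneg_left (by linarith) k.cast_nonneg).trans h3
  linarith

theorem size_le_log_of_le_pow {n B : ℕ} (hB : B ≤ (n + 2) ^ 18) :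
    (((1 + B.size) ^ 2 : ℕ) : ℝ) ≤ 5476 * Real.log ((n : ℝ) + 2) ^ 2 := by
  have hl := half_le_log (n := n)
  have h1 := size_le_log n
  have h2 : B.size ≤ 18 * (n + 2).size := by
    rw [Nat.size_le, mul_comm, pow_mul]
    exact hB.trans_lt (Nat.pow_lt_pow_left (Nat.lt_size_self _) (by norm_num))
  clear hB
  generalize (n + 2).size = t at *
  generalize B.size = r at *
  have h3 : (r : ℝ) ≤ 18 * t := by exact_mod_cast h2
  have h4 : 1 + (r : ℝ) ≤ 74 * Real.log ((n : ℝ) + 2) := by linarith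
  calc (((1 + r) ^ 2 : ℕ) : ℝ) = (1 + (r : ℝ)) ^ 2 := by push_cast; ring
    _ ≤ (74 * Real.log ((n : ℝ) + 2)) ^ 2 := pow_le_pow_left₀ (by positivity) h4 2
    _ = _ := by ring

theorem harmonic_le_log {n φ : ℕ} (h : φ ≤ (n + 2) ^ 5) :
    ∑ i ∈ Finset.range φ, ((i + 1 : ℕ) : ℝ)⁻¹ ≤ 7 * Real.log ((n : ℝ) + 2) := by
  have hl := half_le_log (n := n)
  have h1 := harmonic_le_one_add_log φ
  have h2 : ((harmonic φ : ℚ) : ℝ) = ∑ i ∈ Finset.range φ, ((i + 1 : ℕ) : ℝ)⁻¹ := by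
    simp [harmonic]
  have h3 : Real.log φ ≤ 5 * Real.log ((n : ℝ) + 2) := by
    rcases Nat.eq_zero_or_pos φ with rfl | hpos
    · simp; linarith
    · calc Real.log φ ≤ Real.log (((n : ℝ) + 2) ^ 5) :=
            Real.log_le_log (by exact_mod_cast hpos) (by exact_mod_cast h)
        _ = _ := by rw [Real.log_pow]; norm_num
  rw [← h2]
  linarith

/-- The bound of `mainP_cost` as a real number. -/
theorem mainCost_eq (N : Net) {d : ℕ} (hd : 1 ≤ d) (U φ : ℕ) : mainCost N d U φ =
    ENNReal.ofReal ((U : ℝ) * (500 * ((N.K : ℝ) + 1) * φ + 1) +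
      (U : ℝ) * (3840 * ((N.m : ℝ) * N.K)) * (d : ℝ)⁻¹ *
        ∑ i ∈ Finset.range φ, ((i + 1 : ℕ) : ℝ)⁻¹) := by
  have inv : ∀ k : ℕ, 1 ≤ k → ENNReal.ofReal ((k : ℝ)⁻¹) = (k : ENNReal)⁻¹ := fun k hk => by
    rw [ENNReal.ofReal_inv_of_pos (by exact_mod_cast hk), ENNReal.ofReal_natCast]
  have e1 : (U : ℝ) * (500 * ((N.K : ℝ) + 1) * φ + 1) = ((U * (500 * (N.K + 1) * φ + 1) : ℕ) : ℝ) := by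
    push_cast; ring
  have e2 : (U : ℝ) * (3840 * ((N.m : ℝ) * N.K)) = ((U * (3840 * (N.m * N.K)) : ℕ) : ℝ) := by
    push_cast; ring
  rw [e1, e2, ENNReal.ofReal_add (by positivity) (by positivity), ENNReal.ofReal_mul (by positivity),
    ENNReal.ofReal_mul (by positivity), ENNReal.ofReal_natCast, ENNReal.ofReal_natCast, inv d hd,
    ENNReal.ofReal_sum_of_nonneg (fun i _ => by positivity), mainCost]
  congr 2
  exact Finset.sum_congr rfl fun i _ => (inv _ (by omega)).symm

/-- The arithmetic of the time bound, where `l` stands for the logarithm and `H` for the harmonic sum. -/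
theorem time_le {κ s l D m a d H : ℝ} (hκ : 0 ≤ κ) (hs : s ≤ 5476 * l ^ 2) (hl : 1 / 2 ≤ l)
    (hH : H ≤ 7 * l) (ha : 0 ≤ a) (hm : 0 ≤ m) (hd : 1 ≤ d) (hD0 : 0 ≤ D) (hdD : d ≤ D + 1)
    (hmD : 0 < m → 1 ≤ D) (ham : a ≤ m) (hs0 : 0 ≤ s) :
    κ * s * (153 * m + 65 * (D + 1 + 1) * a + 52) + (κ * s * (500 * (D + 1 + 1) * (8 * a) + 1) +
      κ * s * (3840 * (m * (D + 1))) * d⁻¹ * H) ≤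
      κ * 300000000 * l ^ 3 * (a * D + D * m / d + 1) := by
  have d0 : 0 < d := by linarith
  have hq0 : 0 ≤ D * m / d := by positivity
  have hp0 : 0 ≤ a * D := by positivity
  have h1 : (D + 1 + 1) * a ≤ 3 * (a * D) := by
    rcases hm.eq_or_lt with h | h
    · have : a = 0 := by linarith
      simp [this]
    · have := hmD h; nlinarith
  have h2 : m ≤ 2 * (D * m / d) := by
    rw [← mul_div_assoc, le_div_iff₀ d0]
    rcases hm.eq_or_lt with h | h
    · simp [← h]
    · have := hmD h; nlinarith
  have h3 : m * (D + 1) * d⁻¹ ≤ 2 * (D * m / d) := by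
    rw [← div_eq_mul_inv, ← mul_div_assoc]
    refine div_le_div_of_nonneg_right ?_ d0.le
    rcases hm.eq_or_lt with h | h
    · simp [← h]
    · have := hmD h; nlinarith
  have h4 : m * (D + 1) * d⁻¹ * H ≤ 2 * (D * m / d) * (7 * l) := by
    have : 0 ≤ m * (D + 1) * d⁻¹ := by positivity
    calc m * (D + 1) * d⁻¹ * H ≤ m * (D + 1) * d⁻¹ * (7 * l) := by gcongr
      _ ≤ _ := by gcongr
  generalize D * m / d = q at *
  generalize a * D = p at *
  have e : κ * s * (153 * m + 65 * (D + 1 + 1) * a + 52) + (κ * s * (500 * (D + 1 + 1) * (8 * a) + 1) +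
      κ * s * (3840 * (m * (D + 1))) * d⁻¹ * H) = κ * s * (153 * m + 4065 * ((D + 1 + 1) * a) + 53 +
        3840 * (m * (D + 1) * d⁻¹ * H)) := by ring
  rw [e]
  have key : 153 * m + 4065 * ((D + 1 + 1) * a) + 53 + 3840 * (m * (D + 1) * d⁻¹ * H) ≤
      54400 * l * (p + q + 1) := by
    nlinarith [mul_nonneg (by linarith : 0 ≤ l - 1 / 2) hq0, mul_nonneg (by linarith : 0 ≤ l - 1 / 2) hp0]
  calc _ ≤ κ * s * (54400 * l * (p + q + 1)) := by gcongr
    _ ≤ κ * (5476 * l ^ 2) * (54400 * l * (p + q + 1)) := by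
      have : 0 ≤ 54400 * l * (p + q + 1) := by
        have : 0 ≤ l := by linarith
        positivity
      gcongr
    _ = κ * 297894400 * l ^ 3 * (p + q + 1) := by ring
    _ ≤ _ := by
      have : 0 ≤ l := by linarith
      gcongr
      norm_num

section
variable {n : ℕ} {G : SimpleGraph (Fin n)} [DecidableRel G.Adj] (L : EdgeList G)
  (χ : PartialEdgeColoring G (G.maxDegree + 1)) (U : Set (Fin n))

theorem maxDegree_succ_le : G.maxDegree + 1 ≤ n + 1 := by
  rcases isEmpty_or_nonempty (Fin n) with h | h
  · rw [G.maxDegree_of_subsingleton]; omega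
  · have := G.maxDegree_lt_card_verts
    rw [Fintype.card_fin] at this
    omega

theorem card_edges_le : G.edgeFinset.card ≤ n ^ 2 := by
  have := G.card_edgeFinset_le_card_choose_two
  rw [Fintype.card_fin] at this
  exact this.trans (Nat.choose_le_pow n 2)

/-- All input numbers are polynomial in the number of vertices. -/
theorem inputMem_bdd : (inputMem L χ U).Bdd ((n + 2) ^ 2) := by
  have hm := card_edges_le (G := G)
  have hK := maxDegree_succ_le (G := G)
  have hn : n ^ 2 ≤ (n + 2) ^ 2 := Nat.pow_le_pow_left (by omega) 2
  have hn' : n + 1 ≤ (n + 2) ^ 2 := by nlinarith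
  refine ⟨fun x => ?_, fun a i => ?_⟩
  · simp only [inputMem]
    split_ifs <;> omega
  · simp only [inputMem]
    split_ifs with h1 h2 h2 h3 h3 h4 h4 h5
    all_goals try omega
    have := colorCode_le (χ.color (L.edge ⟨i, by assumption⟩))
    omega

/-- All numbers in memory are at most `(n + 2) ^ 18`, so every step costs `O(log² n)`; the third
logarithm is the harmonic sum. -/
theorem expectedTime_solveP_le {d : ℕ} (hd : 1 ≤ d) (hd' : d ≤ G.maxDegree + 1)
    (hmiss : ∀ u ∈ U, d ≤ (χ.miss u).ncard) :
    expectedTime solveP (inputMem L χ U) ≤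
      ENNReal.ofReal (solveP.weight * 300000000 * Real.log ((n : ℝ) + 2) ^ 3 *
        (((χ.uncoloredAt U).ncard : ℝ) * (G.maxDegree : ℝ) +
          (G.maxDegree : ℝ) * (G.edgeFinset.card : ℝ) / (d : ℝ) + 1)) := by
  set N := netOf L with hNN
  set a := (χ.uncoloredAt U).ncard with ha
  have hm : N.m = G.edgeFinset.card := rfl
  have hK : N.K = G.maxDegree + 1 := rfl
  have ha' := numRel_eq L χ U
  rw [← ha, ← hNN] at ha'
  have ham : a ≤ N.m := by
    classical
    rw [← ha']
    unfold numRel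
    exact (Finset.card_filter_le _ _).trans (by simp)
  have hmn : N.m ≤ (n + 2) ^ 2 := (card_edges_le (G := G)).trans (Nat.pow_le_pow_left (by omega) 2)
  have hKn : N.K + 1 ≤ n + 2 := by have := maxDegree_succ_le (G := G); omega
  have hφ : 8 * a ≤ (n + 2) ^ 5 := by
    have h8 : 8 ≤ (n + 2) ^ 3 := Nat.pow_le_pow_left (show 2 ≤ n + 2 by omega) 3
    calc 8 * a ≤ (n + 2) ^ 3 * (n + 2) ^ 2 := Nat.mul_le_mul h8 (ham.trans hmn)
      _ = _ := by ring
  obtain ⟨B, hBs⟩ : ∃ B, B = (n + 2) ^ 18 := ⟨_, rfl⟩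
  -- all numbers stay polynomial in `n`
  have hB : (n + 2) ^ 2 + 2 * (153 * N.m + 65 * (N.K + 1) * a + 52) + 2 * iterSteps N * (8 * a) ≤
      B := by
    rw [hBs]
    have hs : 2 ≤ n + 2 := by omega
    generalize n + 2 = s at *
    have s1 : 1 ≤ s ^ 2 := Nat.one_le_pow _ _ (by omega)
    have s2 : s ≤ s ^ 2 := Nat.le_self_pow (by norm_num) s
    have s4 : s ^ 2 ≤ s ^ 4 := Nat.pow_le_pow_right (by omega) (by norm_num)
    have hit : iterSteps N ≤ 622 * s ^ 2 := by unfold iterSteps; omega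
    have t1 : (N.K + 1) * a ≤ s ^ 4 := by
      calc (N.K + 1) * a ≤ s ^ 2 * s ^ 2 := Nat.mul_le_mul (by omega) (ham.trans hmn)
        _ = _ := by ring
    have t2 : iterSteps N * a ≤ 622 * s ^ 4 := by
      calc iterSteps N * a ≤ (622 * s ^ 2) * s ^ 2 := Nat.mul_le_mul hit (ham.trans hmn)
        _ = _ := by ring
    have t3 : 65 * (N.K + 1) * a = 65 * ((N.K + 1) * a) := by ring
    have t4 : 2 * iterSteps N * (8 * a) = 16 * (iterSteps N * a) := by ring
    rw [t3, t4]
    have t5 : 2 ^ 14 ≤ s ^ 14 := Nat.pow_le_pow_left hs 14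
    calc _ ≤ 2 ^ 14 * s ^ 4 := by omega
      _ ≤ s ^ 14 * s ^ 4 := Nat.mul_le_mul_right _ t5
      _ = s ^ 18 := by ring
  have hsz := size_le_log_of_le_pow hBs.le
  clear hBs
  refine iSup_le fun k => ?_
  refine (solveP_cost (netOf_good L) (inputMem_input L χ U) hd (roomy L χ U hmiss) (b := (n + 2) ^ 2)
    (by nlinarith) (inputMem_bdd L χ U) ha'.symm hB k).trans ?_
  generalize solveP.weight = κ
  rw [mainCost_eq _ hd, ← ENNReal.ofReal_natCast, ← ENNReal.ofReal_add (by positivity) (by positivity)]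
  refine ENNReal.ofReal_le_ofReal ?_
  have hmD : 0 < G.edgeFinset.card → 1 ≤ G.maxDegree := by
    intro h
    have h0 := (L.dart ⟨0, h⟩).adj
    have h1 := G.degree_le_maxDegree (L.dart ⟨0, h⟩).fst
    have h2 : 0 < G.degree (L.dart ⟨0, h⟩).fst := (G.degree_pos_iff_exists_adj _).2 ⟨_, h0⟩
    omega
  have := time_le (κ := κ) (s := ((1 + B.size) ^ 2 : ℕ))
    (l := Real.log ((n : ℝ) + 2)) (D := G.maxDegree) (m := G.edgeFinset.card) (a := a) (d := d)
    (by positivity) hsz half_le_log (harmonic_le_log hφ) (by positivity) (by positivity)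
    (by exact_mod_cast hd) (by positivity) (by exact_mod_cast hd') (fun h => by
      have := hmD (by exact_mod_cast h); exact_mod_cast this) (by exact_mod_cast ham) (by positivity)
  refine le_trans (le_of_eq ?_) this
  rw [← hNN, hm, hK]
  push_cast
  ring

end

end ColorExt

theorem lemma2p2 :
    ∃ (P : RandRAM.Prog) (c C : ℝ) (K : ℕ), 0 < c ∧
      ∀ (n : ℕ) (G : SimpleGraph (Fin n)) [DecidableRel G.Adj] (L : EdgeList G)
        (χ : PartialEdgeColoring G (G.maxDegree + 1)) (U : Set (Fin n)) (d : ℕ)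
        (_hd : 1 ≤ d) (_hd' : d ≤ G.maxDegree + 1)
        (_hmiss : ∀ u ∈ U, d ≤ (χ.miss u).ncard),
        (∀ σ, RandRAM.PossibleOutput P (inputMem L χ U) σ →
          ∃ χ' : PartialEdgeColoring G (G.maxDegree + 1),
            HoldsColoring L σ χ' ∧ χ.ExtendedBy χ' ∧
            c * ((χ.uncoloredAt U).ncard : ℝ) ≤
              (({e ∈ χ.uncoloredAt U | χ'.color e ≠ none}).ncard : ℝ)) ∧
        RandRAM.expectedTime P (inputMem L χ U) ≤
          ENNReal.ofReal (C * Real.log ((n : ℝ) + 2) ^ K *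
            (((χ.uncoloredAt U).ncard : ℝ) * (G.maxDegree : ℝ) +
              (G.maxDegree : ℝ) * (G.edgeFinset.card : ℝ) / (d : ℝ) + 1)) := by
  refine ⟨ColorExt.solveP, 1 / 3, ColorExt.solveP.weight * 300000000, 3, by norm_num,
    fun n G _ L χ U d hd hd' hmiss => ⟨fun σ hσ => ?_,
      ColorExt.expectedTime_solveP_le L χ U hd hd' hmiss⟩⟩
  obtain ⟨χ', h1, h2, h3⟩ := (ColorExt.solveP_ensures (ColorExt.netOf_good L)
    (ColorExt.inputMem_input L χ U) hd (ColorExt.roomy L χ U hmiss) σ hσ).coloring L χ U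
  refine ⟨χ', h1, h2, ?_⟩
  have : ((χ.uncoloredAt U).ncard : ℝ) ≤
    3 * (({e ∈ χ.uncoloredAt U | χ'.color e ≠ none}).ncard : ℝ) := by exact_mod_cast h3
  linarith
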